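/- Let $M$ be a connected closed oriented surface (for instance a sphere) with a Euclidean polyhedral metric, and let $V\subset M$ be a finite set containing all singular points of $M$ (for instance exactly the singular points). Consider geodesic triangulations $T$ of $M$ with vertex set $V$; loops, multiple edges and triangles with self-identifications are allowed. Let $\ell_{ij}$ be the length of the edge $ij$ of $T$. *Generalized convex polytopes.* Let $r=(r_i)_{i\in V}$ be positive numbers such that over each triangle $ijk$ of $T$ there is a non-degenerate Euclidean pyramid with side edges $r_i,r_j,r_k$. Glue these pyramids as prescribed by $T$, with common apex $a$. Let $\omega_i$ be the sum of the dihedral angles of the pyramids at the edge $ai$, let $\kappa_i=2\pi-\omega_i$, and let $\theta_{ij}$ be the sum of the dihedral angles at the boundary edge $ij$. The couple $(T,r)$ represents a generalized convex polytope with boundary $M$ if $\theta_{ij}\le\pi$ for all edges $ij$. Let $\mathcal P(M)\subset\mathbb R^V$ be the set of all $r$ such that $(T,r)$ represents a generalized convex polytope for some $T$. The curvatures $\kappa_i$ and the total scalar curvature $$H=\sum_i r_i\kappa_i+\sum_{ij}\ell_{ij}(\pi-\theta_{ij})$$ depend only on $r\in\mathcal P(M)$, not on the choice of $T$, and are considered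 as functions on $\mathcal P(M)$; their derivatives at $r$ are derivatives along $\mathcal P(M)$. *Generalized convex polyhedra.* A generalized simplicial fan $(T,\varphi)$ is a triangulation $T$ with a map $\varphi$ from its edges to $(0,\pi)$ such that for each triangle $ijk$ there is a spherical triangle with side lengths $\varphi_{ij},\varphi_{jk},\varphi_{ik}$; let $\omega_{ijk}$ be its angle at $i$. For $h\in\mathbb R^V$ put $$h_{ij}=\frac{h_j-h_i\cos\varphi_{ij}}{\sin\varphi_{ij}},\quad h_{ijk}=\frac{h_{ik}-h_{ij}\cos\omega_{ijk}}{\sin\omega_{ijk}},\quad \ell^*_{ij}=h_{ijk}+h_{ijl},$$ $$F_i=\frac12\sum_j h_{ij}\ell^*_{ij},\qquad \mathrm{vol}=\frac13\sum_i h_iF_i,$$ where $ijk$ and $ijl$ are the two triangles at the edge $ij$, and the sum over $j$ is over all oriented edges starting at $i$. The triple $(T,\varphi,h)$ is a generalized convex polyhedron if $\ell^*_{ij}\ge0$ for all edges. For fixed $(T,\varphi)$, $F_i$ and $\mathrm{vol}$ are polynomials in $h$. **Theorem.** Let $P=(T,r)$ be a generalized convex polytope with boundary $M$, and let $P^*=(T,\varphi,h)$,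 where $\varphi_{ij}$ is the angle at $a$ of the triangle $aij$ and $h_i=1/r_i$. Then $P^*$ is a generalized convex polyhedron, $H$ is twice differentiable at $P$ and the $\kappa_i$ are differentiable at $P$ (along $\mathcal P(M)$), and for all $i,j\in V$ $$\frac{\partial^2 H}{\partial r_i\,\partial r_j}(P)=\frac{\partial^2\mathrm{vol}}{\partial h_i\,\partial h_j}(P^*).$$ Equivalently, for all $i,j\in V$, $$\frac{\partial\kappa_i}{\partial r_j}(P)=\frac{\partial F_i}{\partial h_j}(P^*).$$ Both equalities hold, and all four matrices coincide. -/

import Mathlib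

open scoped ENNReal

namespace GenPolytope

noncomputable section

/-- The Euclidean plane. -/
abbrev E2 := EuclideanSpace ℝ (Fin 2)

/-- Euclidean 3-space. -/
abbrev E3 := EuclideanSpace ℝ (Fin 3)

/-! ## Angles of triangles with given side lengths -/

/-- The angle opposite to the side `a` in a Euclidean triangle with side lengths `a`, `b`, `c`. -/
def triAngle (a b c : ℝ) : ℝ :=
  Real.arccos ((b ^ 2 + c ^ 2 - a ^ 2) / (2 * b * c))

/-- The angle opposite to the side `a` in a spherical triangle with side lengths `a`, `b`, `c`. -/
def sphAngle (a b c : ℝ) : ℝ :=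
  Real.arccos ((Real.cos a - Real.cos b * Real.cos c) / (Real.sin b * Real.sin c))

/-! ## Triangulations of closed surfaces -/

/-- The next side of a triangle (sides are numbered cyclically). -/
def nextSide {F : Type} (d : F × Fin 3) : F × Fin 3 := (d.1, d.2 + 1)

/-- The previous side of a triangle. -/
def prevSide {F : Type} (d : F × Fin 3) : F × Fin 3 := (d.1, d.2 - 1)

/-- `prevSide` as a permutation of the set of all sides of all triangles. -/
def prevPerm (F : Type) : Equiv.Perm (F × Fin 3) where
  toFun := prevSide
  invFun := nextSide
  left_inv d := by simp [prevSide, nextSide]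
  right_inv d := by simp [prevSide, nextSide]

/-- A triangulation, with vertex set `V`, of a closed oriented surface, as a combinatorial map:
finitely many oriented triangles whose sides are glued in pairs.  The element `(f, k)` of
`Face × Fin 3` is the side of the triangle `f` that runs from its corner `k` to its corner
`k + 1`, and it also stands for the corner `k` itself.  Glued sides are identified with reversal
of direction, so an oriented edge of the triangulation is the same thing as an element of
`Face × Fin 3`, and `glue` reverses its orientation.  Loops, multiple edges and triangles with
self-identifications are allowed. -/
structure Triangulation (V : Type*) where
  /-- the triangles -/
  Face : Type
  [fintypeFace : Fintype Face]
  /-- the pairing of the sides -/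
  glue : Equiv.Perm (Face × Fin 3)
  glue_glue : ∀ d, glue (glue d) = d
  glue_ne : ∀ d, glue d ≠ d
  /-- the vertex at a corner; it is the initial vertex of the corresponding oriented edge -/
  vertex : Face × Fin 3 → V
  vertex_surjective : Function.Surjective vertex
  /-- two corners are at the same vertex iff one gets from one to the other by turning around
  the vertex, from each triangle to an adjacent one -/
  vertex_eq_iff : ∀ d d', vertex d = vertex d' ↔ (glue * prevPerm Face).SameCycle d d'

attribute [instance] Triangulation.fintypeFace

/-! ## Generalized simplicial fans and generalized convex polyhedra -/

namespace Triangulation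

variable {V : Type*} (T : Triangulation V)

/-- `(T, φ)` is a generalized simplicial fan: `φ` is a function on edges with values in `(0, π)`,
and each triangle of `T` is the combinatorial type of a (non-degenerate) spherical triangle with
side lengths given by `φ`. -/
def IsSimplicialFan (φ : T.Face × Fin 3 → ℝ) : Prop :=
  (∀ d, φ (T.glue d) = φ d) ∧ (∀ d, φ d ∈ Set.Ioo 0 Real.pi) ∧
    ∀ f, ∃ u : Fin 3 → E3, LinearIndependent ℝ u ∧ (∀ k, ‖u k‖ = 1) ∧
      ∀ k, InnerProductGeometry.angle (u k) (u (k + 1)) = φ (f, k)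

/-- The angle, at the corner `d`, of the spherical triangle of the fan that contains `d`. -/
def fanAngle (φ : T.Face × Fin 3 → ℝ) (d : T.Face × Fin 3) : ℝ :=
  sphAngle (φ (nextSide d)) (φ d) (φ (prevSide d))

/-- `h_{ij}`, for the oriented edge `d` from `i` to `j`. -/
def edgeAltitude (φ : T.Face × Fin 3 → ℝ) (h : V → ℝ) (d : T.Face × Fin 3) : ℝ :=
  (h (T.vertex (nextSide d)) - h (T.vertex d) * Real.cos (φ d)) / Real.sin (φ d)

/-- `h_{ji}`, for the oriented edge `d` from `i` to `j`. -/
def edgeAltitudeRev (φ : T.Face × Fin 3 → ℝ) (h : V → ℝ) (d : T.Face × Fin 3) : ℝ :=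
  (h (T.vertex d) - h (T.vertex (nextSide d)) * Real.cos (φ d)) / Real.sin (φ d)

/-- `h_{ijk} = (h_{ik} - h_{ij} cos ω_{ijk}) / sin ω_{ijk}`, where `d` is the oriented edge from
`i` to `j` and `ijk` is the triangle that contains the side `d`. -/
def leftAltitude (φ : T.Face × Fin 3 → ℝ) (h : V → ℝ) (d : T.Face × Fin 3) : ℝ :=
  (T.edgeAltitudeRev φ h (prevSide d) - T.edgeAltitude φ h d * Real.cos (T.fanAngle φ d)) /
    Real.sin (T.fanAngle φ d)

/-- `h_{ijl} = (h_{il} - h_{ij} cos ω_{ijl}) / sin ω_{ijl}`, where `d` is the oriented edge from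
`i` to `j` and `ijl` is the triangle on the other side of `d`.  In it, `T.glue d` runs from `j`
to `i`, and the next side runs from `i` to `l`. -/
def rightAltitude (φ : T.Face × Fin 3 → ℝ) (h : V → ℝ) (d : T.Face × Fin 3) : ℝ :=
  (T.edgeAltitude φ h (nextSide (T.glue d)) -
      T.edgeAltitude φ h d * Real.cos (T.fanAngle φ (nextSide (T.glue d)))) /
    Real.sin (T.fanAngle φ (nextSide (T.glue d)))

/-- The (signed) dual edge length `ℓ*_{ij} = h_{ijk} + h_{ijl}`. -/
def dualLength (φ : T.Face × Fin 3 → ℝ) (h : V → ℝ) (d : T.Face × Fin 3) : ℝ :=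
  T.leftAltitude φ h d + T.rightAltitude φ h d

/-- `(T, φ, h)` is a generalized convex polyhedron. -/
def IsConvexPolyhedron (φ : T.Face × Fin 3 → ℝ) (h : V → ℝ) : Prop :=
  T.IsSimplicialFan φ ∧ ∀ d, 0 ≤ T.dualLength φ h d

open Classical in
/-- The area `F_i = (1/2) ∑_j h_{ij} ℓ*_{ij}` of the `i`-th face of `(T, φ, h)`; the sum is over
all oriented edges with initial vertex `i`. -/
def faceArea (φ : T.Face × Fin 3 → ℝ) (h : V → ℝ) (i : V) : ℝ :=
  1 / 2 * ∑ d with T.vertex d = i, T.edgeAltitude φ h d * T.dualLength φ h d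

/-- The volume `(1/3) ∑_i h_i F_i` of `(T, φ, h)`. -/
def vol [Fintype V] (φ : T.Face × Fin 3 → ℝ) (h : V → ℝ) : ℝ :=
  1 / 3 * ∑ i, h i * T.faceArea φ h i

end Triangulation

/-! ## Geodesic triangulations of a polyhedral surface -/

/-- A geodesic triangulation, with vertex set `V`, of the metric space `M`.  It presents `M` as
the closed surface with a Euclidean polyhedral metric that is obtained by gluing Euclidean
triangles along sides of equal lengths, and `V` as the set of all vertices of these triangles
(so `V` contains all singular points of `M`). -/
structure GeodesicTriangulation (M : Type*) [MetricSpace M] (V : Finset M) extends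
    Triangulation V where
  /-- the corners of the triangles -/
  corner : Face → Fin 3 → E2
  affineIndependent_corner : ∀ f, AffineIndependent ℝ (corner f)
  /-- glued sides have equal lengths -/
  dist_glue : ∀ d, dist (corner (glue d).1 (glue d).2) (corner (glue d).1 ((glue d).2 + 1)) =
    dist (corner d.1 d.2) (corner d.1 (d.2 + 1))
  /-- the maps of the triangles to `M`; only the values on the triangles matter -/
  chart : Face → E2 → M
  chart_corner : ∀ d, chart d.1 (corner d.1 d.2) = vertex d
  /-- the triangles cover `M` -/
  chart_surjective : ∀ p, ∃ f, ∃ x ∈ convexHull ℝ (Set.range (corner f)), chart f x = p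
  /-- points of the triangles are identified in `M` exactly as prescribed by the gluing -/
  chart_eq_iff : ∀ f g, ∀ x ∈ convexHull ℝ (Set.range (corner f)),
    ∀ y ∈ convexHull ℝ (Set.range (corner g)),
      (chart f x = chart g y ↔
        Relation.EqvGen (fun p q : Face × E2 => ∃ k : Fin 3, ∃ t ∈ Set.Icc (0 : ℝ) 1,
          p = (p.1, AffineMap.lineMap (corner p.1 k) (corner p.1 (k + 1)) t) ∧
          q = ((glue (p.1, k)).1,
            AffineMap.lineMap (corner (glue (p.1, k)).1 ((glue (p.1, k)).2 + 1))
              (corner (glue (p.1, k)).1 (glue (p.1, k)).2) t)) (f, x) (g, y))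
  /-- the metric of `M` is the metric of the gluing: the infimum of the lengths of all chains
  of straight segments, each in one triangle -/
  edist_eq : ∀ p q, edist p q =
    ⨅ (n : ℕ) (c : ℕ → M) (_ : c 0 = p) (_ : c n = q), ∑ i ∈ Finset.range n,
      ⨅ (f : Face) (x ∈ convexHull ℝ (Set.range (corner f)))
        (y ∈ convexHull ℝ (Set.range (corner f))) (_ : chart f x = c i)
        (_ : chart f y = c (i + 1)), edist x y

/-! ## Generalized convex polytopes with a given boundary -/

namespace GeodesicTriangulation

variable {M : Type*} [MetricSpace M] {V : Finset M} (T : GeodesicTriangulation M V)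

/-- The length of an edge. -/
def length (d : T.Face × Fin 3) : ℝ :=
  dist (T.corner d.1 d.2) (T.corner d.1 (d.2 + 1))

/-- Over every triangle `ijk` of `T` there is a (non-degenerate) pyramid, with side edges of
lengths `r i`, `r j`, `r k`. -/
def HasPyramids (r : V → ℝ) : Prop :=
  ∀ f, ∃ (a : E3) (P : Fin 3 → E3),
    AffineIndependent ℝ (Fin.cons a P : Fin 4 → E3) ∧
    (∀ k, dist (P k) (P (k + 1)) = T.length (f, k)) ∧
    ∀ k, dist a (P k) = r (T.vertex (f, k))

/-- `φ_{ij}`: the angle at the apex `a` in the triangle `aij`, where `d` runs from `i` to `j`. -/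
def apexAngle (r : V → ℝ) (d : T.Face × Fin 3) : ℝ :=
  triAngle (T.length d) (r (T.vertex d)) (r (T.vertex (nextSide d)))

/-- `ρ_{ij}`: the angle at `i` in the triangle `aij`, where `d` runs from `i` to `j`. -/
def sideAngle (r : V → ℝ) (d : T.Face × Fin 3) : ℝ :=
  triAngle (r (T.vertex (nextSide d))) (r (T.vertex d)) (T.length d)

/-- `ρ_{ji}`: the angle at `j` in the triangle `aij`, where `d` runs from `i` to `j`. -/
def sideAngleRev (r : V → ℝ) (d : T.Face × Fin 3) : ℝ :=
  triAngle (r (T.vertex d)) (r (T.vertex (nextSide d))) (T.length d)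

/-- The angle of the base triangle at the corner `d`. -/
def baseAngle (d : T.Face × Fin 3) : ℝ :=
  triAngle (T.length (nextSide d)) (T.length d) (T.length (prevSide d))

/-- The dihedral angle of a pyramid at the side edge `ai`, where `i` is the corner `d` of its base
`ijk`.  It is the angle at `i` in the spherical section of the pyramid at the apex, which has side
lengths `φ_{ij}`, `φ_{jk}`, `φ_{ki}`. -/
def radialDihedral (r : V → ℝ) (d : T.Face × Fin 3) : ℝ :=
  sphAngle (T.apexAngle r (nextSide d)) (T.apexAngle r d) (T.apexAngle r (prevSide d))

/-- The dihedral angle of a pyramid at the side `ij = d` of its base `ijk`.  It is the angle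
opposite to the side `ρ_{ik}` in the spherical section of the pyramid at `i`, whose other sides are
`ρ_{ij}` and the angle of the base at `i`. -/
def baseDihedral (r : V → ℝ) (d : T.Face × Fin 3) : ℝ :=
  sphAngle (T.sideAngleRev r (prevSide d)) (T.sideAngle r d) (T.baseAngle d)

/-- `θ_{ij}`: the dihedral angle of the generalized polytope `(T, r)` at a boundary edge. -/
def boundaryDihedral (r : V → ℝ) (d : T.Face × Fin 3) : ℝ :=
  T.baseDihedral r d + T.baseDihedral r (T.glue d)

/-- The couple `(T, r)` represents a generalized convex polytope with boundary `M`. -/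
def IsConvexPolytope (r : V → ℝ) : Prop :=
  (∀ i, 0 < r i) ∧ T.HasPyramids r ∧ ∀ d, T.boundaryDihedral r d ≤ Real.pi

open Classical in
/-- The curvature `κ_i = 2π - ω_i` of `(T, r)` at the radial edge `ai`. -/
def curvature (r : V → ℝ) (i : V) : ℝ :=
  2 * Real.pi - ∑ d with T.vertex d = i, T.radialDihedral r d

/-- The total scalar curvature `∑_i r_i κ_i + ∑_{ij} ℓ_{ij} (π - θ_{ij})` of `(T, r)`.  The second
sum is over unoriented edges, hence is one half of the sum over oriented edges. -/
def totalScalarCurvature (r : V → ℝ) : ℝ :=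
  ∑ i, r i * T.curvature r i +
    1 / 2 * ∑ d, T.length d * (Real.pi - T.boundaryDihedral r d)

end GeodesicTriangulation

section Space

variable (M : Type*) [MetricSpace M] (V : Finset M)

/-- The space `𝒫(M)` of generalized convex polytopes with boundary `M`, in the coordinates given by
the radii: the union over all geodesic triangulations `T` with vertex set `V` of the sets of those
`r` such that `(T, r)` represents a generalized convex polytope. -/
def polytopeSpace : Set (V → ℝ) :=
  {r | ∃ T : GeodesicTriangulation M V, T.IsConvexPolytope r}

open Classical in
/-- The curvatures as functions on `𝒫(M)`: computed in any triangulation `T` such that `(T, r)`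
represents a generalized convex polytope (and zero outside of `𝒫(M)`). -/
def curvature (r : V → ℝ) (i : V) : ℝ :=
  if hr : r ∈ polytopeSpace M V then (Classical.choose hr).curvature r i else 0

open Classical in
/-- The total scalar curvature as a function on `𝒫(M)`. -/
def totalScalarCurvature (r : V → ℝ) : ℝ :=
  if hr : r ∈ polytopeSpace M V then (Classical.choose hr).totalScalarCurvature r else 0

end Space

/-! ## Jacobians and Hessians -/

section Calculus

variable {ι : Type*} [Fintype ι]

/-- `g`, as a function on `s`, has at `x` the Jacobian matrix `A`, that is
`A i j = ∂ g_i / ∂ x_j (x)`. -/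
def HasJacobianWithinAt (g : (ι → ℝ) → ι → ℝ) (A : Matrix ι ι ℝ) (s : Set (ι → ℝ)) (x : ι → ℝ) :
    Prop :=
  HasFDerivWithinAt g (LinearMap.toContinuousLinearMap A.mulVecLin) s x

/-- `f`, as a function on `s`, is differentiable and has at `x` the Hessian matrix `A`: the Jacobian
at `x` of its gradient `g` is `A`. -/
def HasHessianWithinAt (f : (ι → ℝ) → ℝ) (A : Matrix ι ι ℝ) (s : Set (ι → ℝ)) (x : ι → ℝ) : Prop :=
  ∃ g : (ι → ℝ) → ι → ℝ,
    (∀ y ∈ s, HasFDerivWithinAt f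
      (∑ i, g y i • (ContinuousLinearMap.proj i : (ι → ℝ) →L[ℝ] ℝ)) s y) ∧
    HasJacobianWithinAt g A s x

end Calculus

end

end GenPolytope

/-!
The proof has three parts: the functions `κ` and `H` on the space of polytopes reduce, together with
their derivatives, to those of a fixed triangulation; the derivatives for a fixed triangulation are
computed; and they are compared with those of the volume.

**Independence of the triangulation.**  For a couple `(T, r)`, the squared distance from the apex is
a function `power` on `M`.  On a triangle it is `‖x - foot‖² + height²`, so it is the squared
distance plus an affine function, and is determined by its values `r i ^ 2` at the corners.  The
couple represents a convex polytope if and only if all heights are positive and `power` is concave,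
up to the squared distance, across each edge (`isConvexPolytope_iff`).  Along a segment in a
triangle of another triangulation, the difference of `power` and the squared distance is then concave.
Therefore `power` is the largest among the functions that the triangulations define for the given
radii (`facePower_le_power`), and it depends on `r` only (`power_eq_power_of_mem_closure`).

It determines the quantities in question.  Near a vertex `i`, let a thin cylinder around the axis
`ai` cut out a region of the boundary.  Its area, weighted by the heights of the triangles, is a
multiple of the sum of the dihedral angles at `ai`, and can be computed from any triangulation with
the same function (`sum_height_mul_volume_eq`); this gives the curvatures
(`curvature_eq_of_power_eq`).  The edges across which `power` is not smooth belong to every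
triangulation with that function, and the other edges contribute nothing to `H` or to the matrix
`areaJacobian` (`sum_edges_eq`).

Up to relabeling of the triangles, there are only finitely many triangulations with edges of bounded
length (`exists_finite_shapes`), since a straight curve of bounded length passes through a bounded
number of triangles of a fixed triangulation (`exists_itinerary_bound`).  So near `r` the space of
polytopes is a finite union of the sets of the radii that represent a polytope with one of these
triangulations.  Each of these sets is relatively closed (`IsConvexPolytope.of_mem_closure`), and
hence a function on the space is differentiable at `r` as soon as its restrictions to the pieces
that contain `r` have a common derivative there (`IsConvexPolytope.hasFDerivWithinAt`).

**The derivatives for a fixed triangulation.**  The dihedral angles of a pyramid are arccosines of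
quotients of minors of a Gram matrix, and are differentiated by `hasFDerivAt_arccos_div_sqrt`.  The
result for the dihedral angle at `ai` shows that the Jacobian matrix of `κ` is the matrix
`areaJacobian` of the polyhedron with `h i = 1 / r i` (`hasFDerivAt_curvature`).  By
`schlafli_formula`, the terms of the derivative of `H` that contain derivatives of angles cancel, so
that the gradient of `H` is `κ` (`hasFDerivAt_totalScalarCurvature`).

**The dual polyhedron.**  The numbers `h_ij`, `h_ijk` and `ℓ*_ij` are linear in `h`, and up to
positive factors the `ℓ*_ij` express the concavity of `power` across the edges
(`isConvexPolyhedron_dual`).  The area `F i` is a quadratic form in `h` whose polarization is given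
by the matrix `A h`, the `areaJacobian` at `h`: one has `F = A h *ᵥ h / 2` and `A h *ᵥ v = A v *ᵥ h`
(`areaJacobian_mulVec_comm`), so that the Jacobian matrix of `F` is `A h`.  Moreover `A h` is
symmetric, which makes `F` the gradient of the volume (`hasFDerivAt_vol`).
-/

namespace GenPolytope

namespace GeodesicTriangulation

variable {M : Type*} [MetricSpace M] {V : Finset M} (T : GeodesicTriangulation M V)

/-! ### Triangles, barycentric coordinates and the gluing -/

/-- The corners of a triangle, as an affine basis of the plane. -/
noncomputable def basis (f : T.Face) : AffineBasis (Fin 3) ℝ E2 where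
  toFun := T.corner f
  ind' := T.affineIndependent_corner f
  tot' := by
    rw [(T.affineIndependent_corner f).affineSpan_eq_top_iff_card_eq_finrank_add_one]
    simp

/-- A (closed) triangle. -/
def face (f : T.Face) : Set E2 := convexHull ℝ (Set.range (T.corner f))

/-- The barycentric coordinates in the plane of a triangle. -/
noncomputable def bary (f : T.Face) (k : Fin 3) : E2 →ᵃ[ℝ] ℝ := (T.basis f).coord k

lemma mem_face_iff {f : T.Face} {x : E2} : x ∈ T.face f ↔ ∀ k, 0 ≤ T.bary f k x := by
  have := (T.basis f).convexHull_eq_nonneg_coord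
  change x ∈ convexHull ℝ (Set.range (T.basis f)) ↔ _
  rw [this]; rfl

lemma bary_corner (f : T.Face) (k l : Fin 3) :
    T.bary f k (T.corner f l) = if k = l then 1 else 0 :=
  (T.basis f).coord_apply k l

lemma corner_mem_face (f : T.Face) (k : Fin 3) : T.corner f k ∈ T.face f :=
  subset_convexHull _ _ ⟨k, rfl⟩

lemma sum_bary (f : T.Face) (x : E2) : ∑ k, T.bary f k x = 1 :=
  (T.basis f).sum_coord_apply_eq_one x

lemma sum_fin3_cyclic {α : Type*} [AddCommMonoid α] (g : Fin 3 → α) (k : Fin 3) :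
    ∑ i, g i = g k + g (k + 1) + g (k + 2) := by
  fin_cases k
  · exact Fin.sum_univ_three g
  · exact (Fin.sum_univ_three g).trans ((add_assoc _ _ _).trans (add_comm _ _))
  · exact (Fin.sum_univ_three g).trans ((add_comm _ _).trans (add_assoc _ _ _).symm)

lemma sum_bary_cyclic (f : T.Face) (k : Fin 3) (x : E2) :
    T.bary f k x + T.bary f (k + 1) x + T.bary f (k + 2) x = 1 := by
  rw [← sum_fin3_cyclic (fun i => T.bary f i x), T.sum_bary]

lemma sum_bary_smul (f : T.Face) (x : E2) : ∑ k, T.bary f k x • T.corner f k = x :=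
  (T.basis f).linear_combination_coord_eq_self x

lemma bary_ext {f : T.Face} {x y : E2} (h : ∀ k, T.bary f k x = T.bary f k y) : x = y :=
  (T.basis f).ext_elem h

lemma continuous_bary (f : T.Face) (k : Fin 3) : Continuous (T.bary f k) :=
  (T.bary f k).continuous_of_finiteDimensional

lemma affine_eq_sum_bary (f : T.Face) (g : E2 →ᵃ[ℝ] ℝ) (x : E2) :
    g x = ∑ k, T.bary f k x * g (T.corner f k) := by
  have h1 := (T.basis f).affineCombination_coord_eq_self x
  conv_lhs => rw [← h1]
  rw [Finset.map_affineCombination _ _ _ ((T.basis f).sum_coord_apply_eq_one x) g,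
    Finset.affineCombination_eq_linear_combination _ _ _ ((T.basis f).sum_coord_apply_eq_one x)]
  rfl

lemma fin3_cases (k l : Fin 3) : l = k ∨ l = k + 1 ∨ l = k + 2 := by
  revert k l; decide

lemma fin3_forall {p : Fin 3 → Prop} (k : Fin 3) : (∀ l, p l) ↔ p k ∧ p (k + 1) ∧ p (k + 2) := by
  constructor
  · exact fun h => ⟨h _, h _, h _⟩
  · rintro ⟨h0, h1, h2⟩ l
    rcases fin3_cases k l with rfl | rfl | rfl <;> assumption

lemma convex_face (f : T.Face) : Convex ℝ (T.face f) := convex_convexHull _ _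

lemma isCompact_face (f : T.Face) : IsCompact (T.face f) :=
  (Set.finite_range _).isCompact_convexHull _

/-- The point that divides a side in the ratio `t : 1 - t`. -/
noncomputable def sidePoint (d : T.Face × Fin 3) (t : ℝ) : E2 :=
  AffineMap.lineMap (T.corner d.1 d.2) (T.corner d.1 (d.2 + 1)) t

lemma bary_sidePoint (d : T.Face × Fin 3) (t : ℝ) (k : Fin 3) :
    T.bary d.1 k (T.sidePoint d t) =
      (1 - t) * (if k = d.2 then 1 else 0) + t * (if k = d.2 + 1 then 1 else 0) := by
  rw [sidePoint, AffineMap.apply_lineMap, T.bary_corner, T.bary_corner,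
    AffineMap.lineMap_apply_module]
  simp

lemma bary_sidePoint_zero (d : T.Face × Fin 3) (t : ℝ) :
    T.bary d.1 d.2 (T.sidePoint d t) = 1 - t := by
  rw [bary_sidePoint]; simp

lemma bary_sidePoint_one (d : T.Face × Fin 3) (t : ℝ) :
    T.bary d.1 (d.2 + 1) (T.sidePoint d t) = t := by
  rw [bary_sidePoint]; simp

lemma bary_sidePoint_two (d : T.Face × Fin 3) (t : ℝ) :
    T.bary d.1 (d.2 + 2) (T.sidePoint d t) = 0 := by
  rw [bary_sidePoint]
  have h : d.2 + 2 ≠ d.2 + 1 := by generalize d.2 = k; revert k; decide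
  simp [h]

lemma eq_sidePoint {d : T.Face × Fin 3} {x : E2} (h : T.bary d.1 (d.2 + 2) x = 0) :
    x = T.sidePoint d (T.bary d.1 (d.2 + 1) x) := by
  apply T.bary_ext (f := d.1)
  rw [fin3_forall d.2, bary_sidePoint_zero, bary_sidePoint_one, bary_sidePoint_two]
  have := T.sum_bary_cyclic d.1 d.2 x
  refine ⟨by linarith, rfl, h⟩

lemma sidePoint_mem_face (d : T.Face × Fin 3) {t : ℝ} (ht : t ∈ Set.Icc (0 : ℝ) 1) :
    T.sidePoint d t ∈ T.face d.1 := by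
  rw [mem_face_iff, fin3_forall d.2, bary_sidePoint_zero, bary_sidePoint_one, bary_sidePoint_two]
  exact ⟨by linarith [ht.2], ht.1, le_rfl⟩

@[simp] lemma sidePoint_zero (d : T.Face × Fin 3) : T.sidePoint d 0 = T.corner d.1 d.2 := by
  simp [sidePoint]

@[simp] lemma sidePoint_one (d : T.Face × Fin 3) : T.sidePoint d 1 = T.corner d.1 (d.2 + 1) := by
  simp [sidePoint]

/-- Points in the relative interiors of different sides are different. -/
lemma sidePoint_inj {d d' : T.Face × Fin 3} {t t' : ℝ} (ht : t ∈ Set.Ioo (0 : ℝ) 1)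
    (h1 : d'.1 = d.1) (h : T.sidePoint d' t' = T.sidePoint d t) :
    d' = d ∧ t' = t := by
  obtain ⟨f, k⟩ := d
  obtain ⟨f', k'⟩ := d'
  obtain rfl : f' = f := h1
  have h0 := T.bary_sidePoint_two (f', k') t'
  rw [h] at h0
  have a := T.bary_sidePoint_zero (f', k) t
  have b := T.bary_sidePoint_one (f', k) t
  simp only at h0 a b
  have hk : k' = k := by
    rcases fin3_cases k' k with rfl | rfl | rfl
    · rfl
    · rw [show k' + 1 + 1 = k' + 2 by rw [add_assoc]; rfl] at b
      rw [h0] at b; linarith [ht.1]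
    · rw [h0] at a; linarith [ht.2]
  subst hk
  refine ⟨rfl, ?_⟩
  have b' := T.bary_sidePoint_one (f', k') t'
  simp only at b'
  rw [h] at b'; linarith

lemma glue_sidePoint_zero (d : T.Face × Fin 3) (t : ℝ) :
    AffineMap.lineMap (T.corner (T.glue d).1 ((T.glue d).2 + 1))
      (T.corner (T.glue d).1 (T.glue d).2) t = T.sidePoint (T.glue d) (1 - t) := by
  rw [sidePoint, AffineMap.lineMap_apply_one_sub]

/-- A function on the disjoint union of the triangles that takes equal values at points that are
glued to each other. -/
def GluingInvariant {α : Type*} (F : T.Face → E2 → α) : Prop :=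
  ∀ d, ∀ t ∈ Set.Icc (0 : ℝ) 1,
    F d.1 (T.sidePoint d t) = F (T.glue d).1 (T.sidePoint (T.glue d) (1 - t))

variable {T} in
lemma GluingInvariant.eq_of_chart_eq {α : Type*} {F : T.Face → E2 → α} (hF : T.GluingInvariant F)
    {f g : T.Face} {x y : E2} (hx : x ∈ T.face f) (hy : y ∈ T.face g)
    (h : T.chart f x = T.chart g y) : F f x = F g y := by
  have h1 := (T.chart_eq_iff f g x hx y hy).1 h
  have key : ∀ p q : T.Face × E2, Relation.EqvGen (fun p q : T.Face × E2 => ∃ k : Fin 3,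
      ∃ t ∈ Set.Icc (0 : ℝ) 1,
          p = (p.1, AffineMap.lineMap (T.corner p.1 k) (T.corner p.1 (k + 1)) t) ∧
          q = ((T.glue (p.1, k)).1,
            AffineMap.lineMap (T.corner (T.glue (p.1, k)).1 ((T.glue (p.1, k)).2 + 1))
              (T.corner (T.glue (p.1, k)).1 (T.glue (p.1, k)).2) t)) p q →
      F p.1 p.2 = F q.1 q.2 := by
    intro p q hpq
    induction hpq with
    | rel p q hpq =>
      obtain ⟨k, t, ht, hp, hq⟩ := hpq
      have := hF (p.1, k) t ht
      rw [hp, hq, glue_sidePoint_zero]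
      exact this
    | refl => rfl
    | symm _ _ _ ih => exact ih.symm
    | trans _ _ _ _ _ ih1 ih2 => exact ih1.trans ih2
  exact key (f, x) (g, y) h1

lemma chart_sidePoint (d : T.Face × Fin 3) {t : ℝ} (ht : t ∈ Set.Icc (0 : ℝ) 1) :
    T.chart d.1 (T.sidePoint d t) =
      T.chart (T.glue d).1 (T.sidePoint (T.glue d) (1 - t)) := by
  rw [T.chart_eq_iff d.1 (T.glue d).1 _ (T.sidePoint_mem_face d ht) _
    (T.sidePoint_mem_face _ ⟨by linarith [ht.2], by linarith [ht.1]⟩)]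
  refine Relation.EqvGen.rel _ _ ⟨d.2, t, ht, rfl, ?_⟩
  rw [glue_sidePoint_zero]

lemma GluingInvariant.of_imp {F : T.Face → E2 → Prop}
    (h : ∀ d, ∀ t ∈ Set.Icc (0 : ℝ) 1,
      F d.1 (T.sidePoint d t) → F (T.glue d).1 (T.sidePoint (T.glue d) (1 - t))) :
    T.GluingInvariant F := by
  intro d t ht
  refine propext ⟨h d t ht, fun h' => ?_⟩
  have := h (T.glue d) (1 - t) ⟨by linarith [ht.2], by linarith [ht.1]⟩ h'
  rwa [T.glue_glue, sub_sub_cancel] at this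

/-- A point in the interior of a triangle is glued to no other point. -/
lemma eq_of_chart_eq_of_interior {f g : T.Face} {x y : E2} (hx : ∀ k, 0 < T.bary f k x)
    (hy : y ∈ T.face g) (h : T.chart f x = T.chart g y) : g = f ∧ y = x := by
  have hF : T.GluingInvariant (fun g y => g = f ∧ y = x) := by
    apply GluingInvariant.of_imp
    rintro d t ht ⟨h1, h2⟩
    exfalso
    have := T.bary_sidePoint_two d t
    rw [h2, h1] at this
    exact (hx _).ne' this
  have := hF.eq_of_chart_eq (T.mem_face_iff.2 fun k => (hx k).le) hy h
  simpa using this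

/-- A point in the relative interior of a side is glued only to its partner. -/
lemma eq_of_chart_eq_of_side {d : T.Face × Fin 3} {t : ℝ} (ht : t ∈ Set.Ioo (0 : ℝ) 1)
    {g : T.Face} {y : E2} (hy : y ∈ T.face g) (h : T.chart d.1 (T.sidePoint d t) = T.chart g y) :
    (g = d.1 ∧ y = T.sidePoint d t) ∨
      (g = (T.glue d).1 ∧ y = T.sidePoint (T.glue d) (1 - t)) := by
  have hF : T.GluingInvariant (fun g y => (g = d.1 ∧ y = T.sidePoint d t) ∨
      (g = (T.glue d).1 ∧ y = T.sidePoint (T.glue d) (1 - t))) := by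
    apply GluingInvariant.of_imp
    rintro d' t' ht' (⟨h1, h2⟩ | ⟨h1, h2⟩)
    · obtain ⟨rfl, rfl⟩ := T.sidePoint_inj ht h1 h2
      exact Or.inr ⟨rfl, rfl⟩
    · obtain ⟨rfl, rfl⟩ := T.sidePoint_inj (t := 1 - t) ⟨by linarith [ht.2], by linarith [ht.1]⟩
        h1 h2
      rw [T.glue_glue, sub_sub_cancel]
      exact Or.inl ⟨rfl, rfl⟩
  have := hF.eq_of_chart_eq (T.sidePoint_mem_face d ⟨ht.1.le, ht.2.le⟩) hy h
  simpa using this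

lemma vertex_glue (d : T.Face × Fin 3) : T.vertex (T.glue d) = T.vertex (nextSide d) := by
  symm
  rw [T.vertex_eq_iff]
  refine ⟨1, ?_⟩
  simp [prevPerm, prevSide, nextSide]

lemma vertex_nextSide_glue (d : T.Face × Fin 3) :
    T.vertex (nextSide (T.glue d)) = T.vertex d := by
  rw [← vertex_glue, T.glue_glue]

/-- A point of a triangle is at a vertex `i` of `M` iff it is a corner at `i`. -/
lemma chart_eq_vertex_iff {f : T.Face} {x : E2} (hx : x ∈ T.face f) (i : V) :
    T.chart f x = i ↔ ∃ k, T.vertex (f, k) = i ∧ x = T.corner f k := by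
  have hF : T.GluingInvariant (fun f x => ∃ k, T.vertex (f, k) = i ∧ x = T.corner f k) := by
    apply GluingInvariant.of_imp
    rintro d t ht ⟨k, h1, h2⟩
    have hb := T.bary_sidePoint_two d t
    have hb0 := T.bary_sidePoint_zero d t
    have hb1 := T.bary_sidePoint_one d t
    rw [h2, bary_corner] at hb hb0 hb1
    rcases fin3_cases d.2 k with rfl | rfl | rfl
    · simp only [if_true] at hb0
      have ht0 : t = 0 := by linarith
      subst ht0
      refine ⟨(T.glue d).2 + 1, ?_, by simp⟩
      rw [← h1]; exact T.vertex_nextSide_glue d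
    · simp only [if_true] at hb1
      subst hb1
      refine ⟨(T.glue d).2, ?_, by simp⟩
      rw [← h1]; exact T.vertex_glue d
    · simp at hb
  constructor
  · intro h
    obtain ⟨d, rfl⟩ := T.vertex_surjective i
    rw [← T.chart_corner d] at h
    have := hF.eq_of_chart_eq hx (T.corner_mem_face _ _) h
    rw [this]
    exact ⟨d.2, rfl, rfl⟩
  · rintro ⟨k, h1, rfl⟩
    rw [← h1]; exact T.chart_corner (f, k)

/-- Every point of `M` is represented by a point of a triangle. -/
lemma exists_rep (p : M) : ∃ f, ∃ x ∈ T.face f, T.chart f x = p := T.chart_surjective p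

/-- The function on `M` given by a gluing-invariant function on the triangles. -/
noncomputable def descend {α : Type*} (F : T.Face → E2 → α) (p : M) : α :=
  F (T.exists_rep p).choose (T.exists_rep p).choose_spec.choose

variable {T} in
lemma GluingInvariant.descend_chart {α : Type*} {F : T.Face → E2 → α} (hF : T.GluingInvariant F)
    {f : T.Face} {x : E2} (hx : x ∈ T.face f) : T.descend F (T.chart f x) = F f x := by
  have h := (T.exists_rep (T.chart f x)).choose_spec.choose_spec
  exact hF.eq_of_chart_eq h.1 hx h.2

/-- The charts do not increase distances. -/
lemma edist_chart_le {f : T.Face} {x y : E2} (hx : x ∈ T.face f) (hy : y ∈ T.face f) :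
    edist (T.chart f x) (T.chart f y) ≤ edist x y := by
  rw [T.edist_eq]
  refine (iInf_le _ 1).trans ((iInf_le _ (fun i => if i = 0 then T.chart f x else T.chart f y)).trans
    ((iInf_le _ (by simp)).trans ((iInf_le _ (by simp)).trans ?_)))
  simp only [Finset.range_one, Finset.sum_singleton]
  exact (iInf_le _ f).trans ((iInf₂_le x hx).trans ((iInf₂_le y hy).trans
    ((iInf_le _ (by simp)).trans ((iInf_le _ (by simp)).trans le_rfl))))

lemma dist_chart_le {f : T.Face} {x y : E2} (hx : x ∈ T.face f) (hy : y ∈ T.face f) :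
    dist (T.chart f x) (T.chart f y) ≤ dist x y := by
  have := T.edist_chart_le hx hy
  rwa [edist_dist, edist_dist, ENNReal.ofReal_le_ofReal_iff dist_nonneg] at this

variable {T} in
/-- The metric of `M` is the largest one for which the charts do not increase distances: a
gluing-invariant function that is Lipschitz on each triangle defines a Lipschitz function on `M`. -/
lemma GluingInvariant.lipschitz_descend {α : Type*} [PseudoEMetricSpace α] {F : T.Face → E2 → α}
    (hF : T.GluingInvariant F) {K : ℝ≥0∞} (hL : ∀ f, ∀ x ∈ T.face f, ∀ y ∈ T.face f,
      edist (F f x) (F f y) ≤ K * edist x y) (hK0 : K ≠ 0) (hK : K ≠ ⊤) (p q : M) :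
    edist (T.descend F p) (T.descend F q) ≤ K * edist p q := by
  rw [T.edist_eq p q]
  simp only [ENNReal.mul_iInf_of_ne hK0 hK, le_iInf_iff]
  rintro n c rfl rfl
  refine (edist_le_range_sum_edist (fun i => T.descend F (c i)) n).trans ?_
  rw [Finset.mul_sum]
  refine Finset.sum_le_sum fun i _ => ?_
  simp only [ENNReal.mul_iInf_of_ne hK0 hK, le_iInf_iff]
  intro f x hx y hy h1 h2
  rw [← h1, ← h2, hF.descend_chart hx, hF.descend_chart hy]
  exact hL f x hx y hy

end GeodesicTriangulation
lemma exists_affineIsometryEquiv (R : E2 ≃ₗᵢ[ℝ] E2) (p q : E2) :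
    ∃ τ : E2 ≃ᵃⁱ[ℝ] E2, ∀ z, τ z = R (z - p) + q := by
  refine ⟨AffineIsometryEquiv.mk' (fun z => R (z - p) + q) R p fun z => ?_, fun z => rfl⟩
  simp

namespace GeodesicTriangulation

variable {M : Type*} [MetricSpace M] {V : Finset M} (T : GeodesicTriangulation M V)

/-! ### Unfolding adjacent triangles -/

lemma sidePoint_eq (d : T.Face × Fin 3) (t : ℝ) :
    T.sidePoint d t = T.corner d.1 d.2 + t • (T.corner d.1 (d.2 + 1) - T.corner d.1 d.2) := by
  rw [sidePoint, AffineMap.lineMap_apply_module']; abel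

/-- The plane of the triangle across a side can be placed isometrically in the plane of the given
triangle in such a way that the two triangles share the side and are on different sides of it. -/
lemma exists_unfolding (d : T.Face × Fin 3) : ∃ τ : E2 ≃ᵃⁱ[ℝ] E2,
    (∀ s, τ (T.sidePoint (T.glue d) (1 - s)) = T.sidePoint d s) ∧
    ∃ κ : ℝ, 0 < κ ∧ ∀ z, T.bary d.1 (d.2 + 2) (τ z) =
      - κ * T.bary (T.glue d).1 ((T.glue d).2 + 2) z := by
  set a := T.corner d.1 d.2 with ha
  set b := T.corner d.1 (d.2 + 1) with hb
  set a' := T.corner (T.glue d).1 (T.glue d).2 with ha'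
  set b' := T.corner (T.glue d).1 ((T.glue d).2 + 1) with hb'
  have hnorm : ‖b' - a'‖ = ‖a - b‖ := by
    have := T.dist_glue d
    rw [← ha, ← hb, ← ha', ← hb', dist_eq_norm, dist_eq_norm] at this
    rw [norm_sub_rev, this]
  set R := (ℝ ∙ ((b' - a') - (a - b)))ᗮ.reflection with hR
  have hRv : R (b' - a') = a - b := Submodule.reflection_sub hnorm
  obtain ⟨τ, hτ⟩ := exists_affineIsometryEquiv R a' b
  obtain ⟨σ, hσ⟩ := exists_affineIsometryEquiv (ℝ ∙ (a - b)).reflection b b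
  have hside : ∀ s, τ (T.sidePoint (T.glue d) (1 - s)) = T.sidePoint d s := by
    intro s
    rw [hτ, sidePoint_eq, sidePoint_eq, ← ha, ← hb, ← ha', ← hb', add_sub_cancel_left, map_smul,
      hRv]
    module
  have hσside : ∀ s, σ (T.sidePoint d s) = T.sidePoint d s := by
    intro s
    rw [hσ, sidePoint_eq, ← ha, ← hb]
    have h1 : a + s • (b - a) - b = (1 - s) • (a - b) := by module
    rw [h1, map_smul, Submodule.reflection_mem_subspace_eq_self
      (Submodule.mem_span_singleton_self _)]
    module
  set L := T.bary d.1 (d.2 + 2) with hL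
  have hLb : L b = 0 := by
    have := T.bary_sidePoint_two d 1; rwa [sidePoint_one] at this
  have hLa : L a = 0 := by
    have := T.bary_sidePoint_two d 0; rwa [sidePoint_zero] at this
  have hLlin : ∀ w, L (w + b) = L.linear w := by
    intro w
    have := L.map_vadd b w
    rw [vadd_eq_add, vadd_eq_add, hLb, add_zero] at this
    exact this
  have hLab : L.linear (a - b) = 0 := by
    rw [← hLlin, sub_add_cancel, hLa]
  have hσL : ∀ y, L (σ y) = - L y := by
    intro y
    have h2 : L y = L.linear (y - b) := by rw [← hLlin, sub_add_cancel]
    rw [hσ, hLlin, h2, Submodule.reflection_apply, map_sub, map_nsmul]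
    have h3 : (ℝ ∙ (a - b)).starProjection (y - b) ∈ ℝ ∙ (a - b) :=
      Submodule.starProjection_apply_mem _ _
    obtain ⟨c, hc⟩ := Submodule.mem_span_singleton.1 h3
    rw [← hc, map_smul, hLab]
    simp
  have hτL : ∀ z, L (τ z) = L (τ (T.corner (T.glue d).1 ((T.glue d).2 + 2))) *
      T.bary (T.glue d).1 ((T.glue d).2 + 2) z := by
    intro z
    have h1 := T.affine_eq_sum_bary (T.glue d).1 (L.comp τ.toAffineEquiv.toAffineMap) z
    rw [sum_fin3_cyclic _ (T.glue d).2] at h1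
    have e0 : L (τ a') = 0 := by rw [hτ, sub_self, map_zero, zero_add, hLb]
    have e1 : L (τ b') = 0 := by rw [hτ, hRv, sub_add_cancel, hLa]
    change L (τ z) = _ * L (τ a') + _ * L (τ b') + _ * L (τ _) at h1
    rw [h1, e0, e1]; ring
  set m := L (τ (T.corner (T.glue d).1 ((T.glue d).2 + 2))) with hm
  have hm0 : m ≠ 0 := by
    intro h0
    have := hτL (τ.symm (T.corner d.1 (d.2 + 2)))
    rw [h0, AffineIsometryEquiv.apply_symm_apply, hL, bary_corner] at this
    simp at this
  rcases lt_or_gt_of_ne hm0 with h | h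
  · exact ⟨τ, hside, -m, by linarith, fun z => by rw [hτL z, neg_neg]⟩
  · refine ⟨τ.trans σ, fun s => ?_, m, h, fun z => ?_⟩
    · rw [AffineIsometryEquiv.coe_trans, Function.comp_apply, hside, hσside]
    · rw [AffineIsometryEquiv.coe_trans, Function.comp_apply, hσL, hτL]; ring

/-- The placement of the plane of the triangle across the side `d` in the plane of the triangle
of `d`. -/
noncomputable def unfold (d : T.Face × Fin 3) : E2 ≃ᵃⁱ[ℝ] E2 := (T.exists_unfolding d).choose

lemma unfold_sidePoint (d : T.Face × Fin 3) (s : ℝ) :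
    T.unfold d (T.sidePoint (T.glue d) (1 - s)) = T.sidePoint d s :=
  (T.exists_unfolding d).choose_spec.1 s

lemma unfold_symm_sidePoint (d : T.Face × Fin 3) (s : ℝ) :
    (T.unfold d).symm (T.sidePoint d s) = T.sidePoint (T.glue d) (1 - s) := by
  rw [← unfold_sidePoint, AffineIsometryEquiv.symm_apply_apply]

lemma exists_bary_unfold (d : T.Face × Fin 3) : ∃ κ : ℝ, 0 < κ ∧ ∀ z,
    T.bary (T.glue d).1 ((T.glue d).2 + 2) ((T.unfold d).symm z) =
      - κ * T.bary d.1 (d.2 + 2) z := by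
  obtain ⟨κ, h0, h⟩ := (T.exists_unfolding d).choose_spec.2
  refine ⟨κ⁻¹, inv_pos.2 h0, fun z => ?_⟩
  have := h ((T.unfold d).symm z)
  change T.bary d.1 (d.2 + 2) (T.unfold d ((T.unfold d).symm z)) = _ at this
  rw [AffineIsometryEquiv.apply_symm_apply] at this
  rw [this]; field_simp

end GeodesicTriangulation

/-! ### Flat discs -/

/-- The distance from `y` to `P`, truncated at `ρ`. -/
noncomputable def truncDist (ρ : ℝ) (P : Set E2) (y : E2) : ℝ :=
  sInf (insert ρ ((fun z => dist y z) '' P))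

lemma bddBelow_truncDist {ρ : ℝ} (P : Set E2) (y : E2) :
    BddBelow (insert ρ ((fun z => dist y z) '' P)) := by
  refine ⟨min ρ 0, ?_⟩
  rintro _ (rfl | ⟨z, _, rfl⟩)
  · exact min_le_left _ _
  · exact (min_le_right _ _).trans dist_nonneg

lemma le_truncDist_iff {ρ : ℝ} {P : Set E2} {y : E2} {c : ℝ} :
    c ≤ truncDist ρ P y ↔ c ≤ ρ ∧ ∀ z ∈ P, c ≤ dist y z := by
  rw [truncDist, le_csInf_iff (bddBelow_truncDist P y) (Set.insert_nonempty _ _)]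
  simp

lemma truncDist_le {ρ : ℝ} (P : Set E2) (y : E2) : truncDist ρ P y ≤ ρ :=
  (le_truncDist_iff.1 le_rfl).1

lemma truncDist_le_dist {ρ : ℝ} {P : Set E2} {y z : E2} (hz : z ∈ P) :
    truncDist ρ P y ≤ dist y z :=
  (le_truncDist_iff.1 le_rfl).2 z hz

lemma exists_of_truncDist_lt {ρ : ℝ} {P : Set E2} {y : E2} (h : truncDist ρ P y < ρ) :
    ∃ z ∈ P, dist y z < ρ := by
  by_contra! h'
  exact h.not_ge (le_truncDist_iff.2 ⟨le_rfl, h'⟩)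

lemma edist_truncDist_le {ρ : ℝ} (P : Set E2) (x y : E2) :
    edist (truncDist ρ P x) (truncDist ρ P y) ≤ 1 * edist x y := by
  have key : ∀ x y : E2, truncDist ρ P x - dist x y ≤ truncDist ρ P y := by
    intro x y
    rw [le_truncDist_iff]
    constructor
    · linarith [truncDist_le (ρ := ρ) P x, dist_nonneg (x := x) (y := y)]
    · intro z hz
      linarith [truncDist_le_dist (ρ := ρ) (y := x) hz, dist_triangle x y z]
  rw [one_mul, edist_dist, edist_dist]
  apply ENNReal.ofReal_le_ofReal
  rw [Real.dist_eq, abs_le]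
  have h1 := key x y
  have h2 := key y x
  rw [dist_comm] at h2
  constructor <;> linarith

lemma truncDist_le_truncDist {ρ : ℝ} {P P' : Set E2} {y y' : E2}
    (h : ∀ z' ∈ P', dist y' z' < ρ → ∃ z ∈ P, dist y z = dist y' z') :
    truncDist ρ P y ≤ truncDist ρ P' y' := by
  rw [le_truncDist_iff]
  refine ⟨truncDist_le _ _, fun z' hz' => ?_⟩
  by_cases h1 : dist y' z' < ρ
  · obtain ⟨z, hz, h2⟩ := h z' hz' h1
    rw [← h2]; exact truncDist_le_dist hz
  · exact (truncDist_le _ _).trans (not_lt.1 h1)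

/-- `Φ` maps the disc of radius `ρ` around the origin isometrically onto the ball of radius `ρ`
around `p`. -/
structure IsFlatDisc {M : Type*} [MetricSpace M] (p : M) (ρ : ℝ) (Φ : E2 → M) : Prop where
  pos : 0 < ρ
  map_zero : Φ 0 = p
  dist_eq : ∀ u v, ‖u‖ < ρ → ‖v‖ < ρ → dist (Φ u) (Φ v) = dist u v
  surj : ∀ q, dist p q < ρ → ∃ u, ‖u‖ < ρ ∧ Φ u = q

namespace GeodesicTriangulation

variable {M : Type*} [MetricSpace M] {V : Finset M} (T : GeodesicTriangulation M V)

/-- Finitely many placements of triangles in the plane that fit together near the origin, in the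
same way as the triangles are glued, give a flat disc in `M`.  The truncated distance from a point
of the disc extends to a function on `M` with Lipschitz constant one, and therefore no path that
leaves the disc is shorter than the segment between its ends. -/
lemma exists_flatDisc_of_placements {ι : Type} [Nonempty ι] (f : ι → T.Face)
    (D : ι → E2 ≃ᵃⁱ[ℝ] E2) {ρ : ℝ} (hρ : 0 < ρ)
    (cover : ∀ u, ‖u‖ < 2 * ρ → ∃ k, D k u ∈ T.face (f k))
    (compat : ∀ k l u, ‖u‖ < 2 * ρ → D k u ∈ T.face (f k) → D l u ∈ T.face (f l) →
      T.chart (f k) (D k u) = T.chart (f l) (D l u))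
    (glue : ∀ k d, d.1 = f k → ∀ t ∈ Set.Icc (0 : ℝ) 1, ∀ u, ‖u‖ < 2 * ρ →
      D k u = T.sidePoint d t → ∃ l, f l = (T.glue d).1 ∧
        D l u = T.sidePoint (T.glue d) (1 - t))
    (sep : ∀ k l u v, f k = f l → ‖u‖ < 2 * ρ → ‖v‖ < 2 * ρ → D k u = D l v → k = l)
    (conv : ∀ k l u w, ‖u‖ < 2 * ρ → ‖w‖ < 2 * ρ → D k u ∈ T.face (f k) → D l w ∈ T.face (f l) →
      ∃ m, ‖m‖ < 2 * ρ ∧ dist u m + dist m w = dist u w ∧ D k m ∈ T.face (f k) ∧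
        D l m ∈ T.face (f l)) :
    ∃ p, ∃ Φ : E2 → M, IsFlatDisc p (ρ / 2) Φ ∧
      (∀ k u, ‖u‖ < ρ / 2 → D k u ∈ T.face (f k) → Φ u = T.chart (f k) (D k u)) ∧
      (∀ g, ∀ y ∈ T.face g, dist p (T.chart g y) < ρ / 2 →
        ∃ k u, ‖u‖ < ρ / 2 ∧ g = f k ∧ y = D k u) := by
  classical
  -- the comparison functions: distances to the point `w` of the disc
  set G : E2 → T.Face → E2 → ℝ :=
    fun w g y => truncDist ρ {z | ∃ k, f k = g ∧ z = D k w} y with hG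
  have hinv : ∀ w, ‖w‖ < ρ → T.GluingInvariant (G w) := by
    intro w hw
    have key : ∀ d, ∀ t ∈ Set.Icc (0 : ℝ) 1,
        G w (T.glue d).1 (T.sidePoint (T.glue d) (1 - t)) ≤ G w d.1 (T.sidePoint d t) := by
      intro d t ht
      apply truncDist_le_truncDist
      rintro _ ⟨k, hk, rfl⟩ hlt
      set u := (D k).symm (T.sidePoint d t) with hu
      have hDu : D k u = T.sidePoint d t := by rw [hu, AffineIsometryEquiv.apply_symm_apply]
      rw [← hDu, AffineIsometryEquiv.dist_map] at hlt
      have hu2 : ‖u‖ < 2 * ρ := by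
        have := norm_sub_norm_le u w
        rw [dist_eq_norm] at hlt
        linarith
      obtain ⟨l, hl, hDl⟩ := glue k d hk.symm t ht u hu2 hDu
      refine ⟨D l w, ⟨l, hl, rfl⟩, ?_⟩
      rw [← hDl, ← hDu, AffineIsometryEquiv.dist_map, AffineIsometryEquiv.dist_map]
    intro d t ht
    refine le_antisymm ?_ (key d t ht)
    have := key (T.glue d) (1 - t) ⟨by linarith [ht.2], by linarith [ht.1]⟩
    rwa [T.glue_glue, sub_sub_cancel] at this
  have hlip : ∀ w, ‖w‖ < ρ → ∀ p q, dist (T.descend (G w) p) (T.descend (G w) q) ≤ dist p q := by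
    intro w hw p q
    have := (hinv w hw).lipschitz_descend (K := 1) (fun f x _ y _ => edist_truncDist_le _ x y)
      one_ne_zero ENNReal.one_ne_top p q
    rw [one_mul, edist_dist, edist_dist, ENNReal.ofReal_le_ofReal_iff dist_nonneg] at this
    exact this
  have hGval : ∀ w k u, ‖w‖ < ρ → ‖u‖ < 2 * ρ → G w (f k) (D k u) = min ρ (dist u w) := by
    intro w k u hw hu
    apply le_antisymm
    · refine le_min (truncDist_le _ _) ?_
      rw [← (D k).dist_map u w]
      exact truncDist_le_dist ⟨k, rfl, rfl⟩
    · rw [hG, le_truncDist_iff]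
      refine ⟨min_le_left _ _, ?_⟩
      rintro _ ⟨l, hl, rfl⟩
      by_contra! hlt
      set v := (D l).symm (D k u) with hv
      have hDv : D l v = D k u := by rw [hv, AffineIsometryEquiv.apply_symm_apply]
      rw [← hDv, AffineIsometryEquiv.dist_map] at hlt
      have hv2 : ‖v‖ < 2 * ρ := by
        have := norm_sub_norm_le v w
        have h3 := hlt.trans_le (min_le_left _ _)
        rw [dist_eq_norm] at h3
        linarith
      have hlk : l = k := sep l k v u hl hv2 hu hDv
      subst hlk
      have : v = u := (D l).injective hDv
      rw [this] at hlt
      exact absurd hlt (not_lt.2 (min_le_right _ _))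
  set Φ : E2 → M := fun u => if h : ∃ k, D k u ∈ T.face (f k) then
    T.chart (f h.choose) (D h.choose u) else T.chart (f (Classical.arbitrary ι)) 0 with hΦ
  have hΦval : ∀ k u, ‖u‖ < 2 * ρ → D k u ∈ T.face (f k) → Φ u = T.chart (f k) (D k u) := by
    intro k u hu hk
    have h : ∃ k, D k u ∈ T.face (f k) := ⟨k, hk⟩
    simp only [hΦ, dif_pos h]
    exact compat _ _ u hu h.choose_spec hk
  have hrep : ∀ g, ∀ y ∈ T.face g, dist (Φ 0) (T.chart g y) < ρ / 2 →
        ∃ k u, ‖u‖ < ρ / 2 ∧ g = f k ∧ y = D k u := by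
    intro g y hy hlt
    have h0 : ‖(0 : E2)‖ < ρ := by simpa using hρ
    obtain ⟨k0, hk0⟩ := cover 0 (by simpa using hρ)
    have h1 := hlip 0 h0 (Φ 0) (T.chart g y)
    rw [hΦval k0 0 (by simpa using hρ) hk0, (hinv 0 h0).descend_chart hk0,
      (hinv 0 h0).descend_chart hy, hGval 0 k0 0 h0 (by simpa using hρ), dist_self,
      min_eq_right hρ.le, ← hΦval k0 0 (by simpa using hρ) hk0] at h1
    have h2' : G 0 g y < ρ / 2 := by
      rw [Real.dist_eq, zero_sub, abs_neg] at h1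
      exact (le_abs_self _).trans_lt (h1.trans_lt hlt)
    have h2 : G 0 g y < ρ := by linarith
    obtain ⟨_, ⟨k, hk, rfl⟩, hz⟩ := exists_of_truncDist_lt h2
    refine ⟨k, (D k).symm y, ?_, hk.symm, by rw [AffineIsometryEquiv.apply_symm_apply]⟩
    rw [← (D k).apply_symm_apply y, AffineIsometryEquiv.dist_map, dist_zero_right] at hz
    have h3 := hGval 0 k ((D k).symm y) h0 (by linarith)
    rw [AffineIsometryEquiv.apply_symm_apply, hk, dist_zero_right, min_eq_right hz.le] at h3
    linarith
  refine ⟨Φ 0, Φ, ⟨by linarith, rfl, ?_, ?_⟩, fun k u hu hk => hΦval k u (by linarith) hk, hrep⟩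
  · have hle : ∀ u v, ‖u‖ < ρ / 2 → ‖v‖ < ρ / 2 → dist (Φ u) (Φ v) ≤ dist u v := by
      intro u v hu hv
      obtain ⟨k, hk⟩ := cover u (by linarith)
      obtain ⟨l, hl⟩ := cover v (by linarith)
      obtain ⟨m, hm, hd, hkm, hlm⟩ := conv k l u v (by linarith) (by linarith) hk hl
      calc dist (Φ u) (Φ v) ≤ dist (Φ u) (Φ m) + dist (Φ m) (Φ v) := dist_triangle _ _ _
        _ ≤ dist u m + dist m v := by
          apply add_le_add
          · rw [hΦval k u (by linarith) hk, hΦval k m hm hkm, ← (D k).dist_map u m]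
            exact T.dist_chart_le hk hkm
          · rw [hΦval l v (by linarith) hl, hΦval l m hm hlm, ← (D l).dist_map m v]
            exact T.dist_chart_le hlm hl
        _ = dist u v := hd
    intro u v hu hv
    refine le_antisymm (hle u v hu hv) ?_
    obtain ⟨k, hk⟩ := cover u (by linarith)
    obtain ⟨l, hl⟩ := cover v (by linarith)
    have hv' : ‖v‖ < ρ := by linarith
    have h1 := hlip v hv' (Φ u) (Φ v)
    rw [hΦval k u (by linarith) hk, hΦval l v (by linarith) hl, (hinv v hv').descend_chart hk,
      (hinv v hv').descend_chart hl, hGval v k u hv' (by linarith),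
      hGval v l v hv' (by linarith), dist_self, min_eq_right hρ.le, min_eq_right,
      dist_zero_right, Real.norm_of_nonneg dist_nonneg] at h1
    · rw [hΦval k u (by linarith) hk, hΦval l v (by linarith) hl]
      exact h1
    · rw [dist_eq_norm]
      linarith [norm_sub_le u v]
  · intro q hq
    obtain ⟨g, y, hy, rfl⟩ := T.exists_rep q
    obtain ⟨k, u, hu, rfl, rfl⟩ := hrep g y hy hq
    exact ⟨u, hu, hΦval k u (by linarith) hy⟩

end GeodesicTriangulation
/-- Two flat discs with the same center differ by a linear isometry. -/
lemma IsFlatDisc.exists_linearIsometry {M : Type*} [MetricSpace M] {p : M} {ρ ρ' : ℝ}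
    {Φ Φ' : E2 → M} (h : IsFlatDisc p ρ Φ) (h' : IsFlatDisc p ρ' Φ') :
    ∃ L : E2 ≃ₗᵢ[ℝ] E2, ∀ u, ‖u‖ < ρ → ‖u‖ < ρ' → Φ' u = Φ (L u) := by
  set R := min ρ ρ' with hR
  have hRpos : 0 < R := lt_min h.pos h'.pos
  have hnorm : ∀ u, ‖u‖ < R → ∃ v, ‖v‖ = ‖u‖ ∧ Φ v = Φ' u := by
    intro u hu
    have hd : dist p (Φ' u) = ‖u‖ := by
      rw [← h'.map_zero, h'.dist_eq 0 u (by simpa using h'.pos) (hu.trans_le (min_le_right _ _)),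
        dist_zero_left]
    obtain ⟨v, hv, hv'⟩ := h.surj (Φ' u) (by rw [hd]; exact hu.trans_le (min_le_left _ _))
    refine ⟨v, ?_, hv'⟩
    rw [← hd, ← hv', ← h.map_zero, h.dist_eq 0 v (by simpa using h.pos) hv, dist_zero_left]
  choose! F hF1 hF2 using hnorm
  have hFd : ∀ u v, ‖u‖ < R → ‖v‖ < R → dist (F u) (F v) = dist u v := by
    intro u v hu hv
    rw [← h.dist_eq (F u) (F v) (by rw [hF1 u hu]; exact hu.trans_le (min_le_left _ _))
      (by rw [hF1 v hv]; exact hv.trans_le (min_le_left _ _)), hF2 u hu, hF2 v hv,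
      h'.dist_eq u v (hu.trans_le (min_le_right _ _)) (hv.trans_le (min_le_right _ _))]
  have hFi : ∀ u v, ‖u‖ < R → ‖v‖ < R → inner ℝ (F u) (F v) = inner ℝ u v := by
    intro u v hu hv
    have h1 := hFd u v hu hv
    rw [dist_eq_norm, dist_eq_norm] at h1
    have h2 := norm_sub_sq_real (F u) (F v)
    have h3 := norm_sub_sq_real u v
    rw [h1, hF1 u hu, hF1 v hv] at h2
    linarith
  -- the images of two short orthogonal vectors determine the linear isometry
  set e := EuclideanSpace.basisFun (Fin 2) ℝ with he
  set ε := R / 2 with hε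
  have hεpos : 0 < ε := by positivity
  have hεe : ∀ i, ‖ε • e i‖ < R := by
    intro i
    rw [norm_smul, e.norm_eq_one, Real.norm_of_nonneg hεpos.le]; linarith
  have hon : Orthonormal ℝ (fun i => ε⁻¹ • F (ε • e i)) := by
    rw [orthonormal_iff_ite]
    intro i j
    rw [inner_smul_left, inner_smul_right, hFi _ _ (hεe i) (hεe j), inner_smul_left,
      inner_smul_right, orthonormal_iff_ite.1 e.orthonormal i j]
    simp only [conj_trivial]
    split_ifs <;> field_simp
  set b := (basisOfOrthonormalOfCardEqFinrank hon (by simp)).toOrthonormalBasis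
    (by rw [coe_basisOfOrthonormalOfCardEqFinrank]; exact hon) with hb
  have hbi : ∀ i, b i = ε⁻¹ • F (ε • e i) := by
    intro i
    rw [hb, Module.Basis.coe_toOrthonormalBasis, coe_basisOfOrthonormalOfCardEqFinrank]
  refine ⟨e.equiv b (Equiv.refl _), fun u hu hu' => ?_⟩
  have huR : ‖u‖ < R := lt_min hu hu'
  rw [← hF2 u huR]
  congr 1
  apply b.repr.injective
  ext i
  rw [b.repr_apply_apply, b.repr_apply_apply, hbi, inner_smul_left, hFi _ _ (hεe i) huR,
    inner_smul_left]
  have h5 : inner ℝ (b i) ((e.equiv b (Equiv.refl _)) u) = inner ℝ (e i) u := by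
    rw [← (e.equiv b (Equiv.refl _)).inner_map_map (e i) u]
    simp
  rw [← hbi, h5]
  simp only [conj_trivial]
  field_simp

namespace GeodesicTriangulation

variable {M : Type*} [MetricSpace M] {V : Finset M} (T : GeodesicTriangulation M V)

lemma exists_ball_bary_pos (f : T.Face) (k : Fin 3) {x : E2} (hx : 0 < T.bary f k x) :
    ∃ ρ > 0, ∀ u, ‖u‖ < ρ → 0 < T.bary f k (x + u) := by
  have h1 : Filter.Tendsto (fun u : E2 => T.bary f k (x + u)) (nhds 0) (nhds (T.bary f k x)) := by
    have : Continuous (fun u : E2 => T.bary f k (x + u)) :=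
      (T.continuous_bary f k).comp (continuous_const.add continuous_id)
    simpa using this.tendsto 0
  obtain ⟨ρ, hρ, h⟩ := Metric.eventually_nhds_iff.1 (h1.eventually (lt_mem_nhds hx))
  exact ⟨ρ, hρ, fun u hu => h (by simpa using hu)⟩

/-- The flat disc around a point in the interior of a triangle. -/
lemma exists_flatDisc_interior {f : T.Face} {x : E2} (hx : ∀ k, 0 < T.bary f k x) :
    ∃ ρ, ∃ Φ : E2 → M, IsFlatDisc (T.chart f x) ρ Φ ∧
      ∀ u, ‖u‖ < ρ → (∀ k, 0 < T.bary f k (x + u)) ∧ Φ u = T.chart f (x + u) := by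
  choose r hr0 hr using fun k => T.exists_ball_bary_pos f k (hx k)
  set R := min (r 0) (min (r 1) (r 2)) with hR
  have hR0 : 0 < R := lt_min (hr0 0) (lt_min (hr0 1) (hr0 2))
  have hRb : ∀ u, ‖u‖ < R → ∀ k, 0 < T.bary f k (x + u) := by
    intro u hu k
    rw [hR, lt_min_iff, lt_min_iff] at hu
    fin_cases k
    · exact hr 0 u hu.1
    · exact hr 1 u hu.2.1
    · exact hr 2 u hu.2.2
  set D := AffineIsometryEquiv.constVAdd ℝ E2 x
  have hD : ∀ u, D u = x + u := fun u => rfl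
  have hface : ∀ u, ‖u‖ < 2 * (R / 2) → D u ∈ T.face f := by
    intro u hu
    rw [mem_face_iff]
    exact fun k => (hRb u (by linarith) k).le
  obtain ⟨p, Φ, h1, h2, -⟩ := T.exists_flatDisc_of_placements (ι := Unit) (fun _ => f)
    (fun _ => D) (ρ := R / 2) (by positivity) (fun u hu => ⟨(), hface u hu⟩)
    (fun _ _ _ _ _ _ => rfl)
    (fun _ d hd t _ u hu hs => by
      exfalso
      have := hRb u (by linarith) (d.2 + 2)
      obtain ⟨f', k⟩ := d
      obtain rfl : f' = f := hd
      rw [← hD, hs] at this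
      exact this.ne' (T.bary_sidePoint_two (f', k) t))
    (fun _ _ _ _ _ _ _ _ => rfl)
    (fun _ _ u w hu _ hku _ => ⟨u, hu, by simp, hku, hku⟩)
  have hp : p = T.chart f x := by
    rw [← h1.map_zero, h2 () 0 (by simpa using hR0) (hface 0 (by simpa using hR0)), hD, add_zero]
  subst hp
  refine ⟨_, Φ, h1, fun u hu => ⟨hRb u (by linarith), ?_⟩⟩
  rw [h2 () u hu (hface u (by linarith)), hD]

/-- The flat disc around a point in the relative interior of a side. -/
lemma exists_flatDisc_side (d : T.Face × Fin 3) {t : ℝ} (ht : t ∈ Set.Ioo (0 : ℝ) 1) :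
    ∃ ρ, ∃ Φ : E2 → M, IsFlatDisc (T.chart d.1 (T.sidePoint d t)) ρ Φ ∧
      ∀ u, ‖u‖ < ρ →
        (0 ≤ T.bary d.1 (d.2 + 2) (T.sidePoint d t + u) → T.sidePoint d t + u ∈ T.face d.1 ∧
          Φ u = T.chart d.1 (T.sidePoint d t + u)) ∧
        (T.bary d.1 (d.2 + 2) (T.sidePoint d t + u) ≤ 0 →
          (T.unfold d).symm (T.sidePoint d t + u) ∈ T.face (T.glue d).1 ∧
          Φ u = T.chart (T.glue d).1 ((T.unfold d).symm (T.sidePoint d t + u))) := by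
  set x := T.sidePoint d t with hx
  set x2 := T.sidePoint (T.glue d) (1 - t) with hx2
  set τ := T.unfold d with hτ
  have hτx : τ.symm x = x2 := T.unfold_symm_sidePoint d t
  have hsub : ∀ u, τ.symm (x + u) = x2 + τ.symm.linearIsometryEquiv u := by
    intro u
    have := τ.symm.map_vadd x u
    rw [vadd_eq_add, vadd_eq_add, hτx, add_comm] at this
    rw [this, add_comm x2]
  obtain ⟨κ, hκ, hb⟩ := T.exists_bary_unfold d
  obtain ⟨r1, hr1, h1⟩ := T.exists_ball_bary_pos d.1 d.2 (x := x)
    (by rw [hx, bary_sidePoint_zero]; linarith [ht.2])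
  obtain ⟨r2, hr2, h2⟩ := T.exists_ball_bary_pos d.1 (d.2 + 1) (x := x)
    (by rw [hx, bary_sidePoint_one]; linarith [ht.1])
  obtain ⟨r3, hr3, h3⟩ := T.exists_ball_bary_pos (T.glue d).1 (T.glue d).2 (x := x2)
    (by rw [hx2, bary_sidePoint_zero]; linarith [ht.1])
  obtain ⟨r4, hr4, h4⟩ := T.exists_ball_bary_pos (T.glue d).1 ((T.glue d).2 + 1) (x := x2)
    (by rw [hx2, bary_sidePoint_one]; linarith [ht.2])
  obtain ⟨r5, hr5, h5⟩ : ∃ r5 > 0, d.1 = (T.glue d).1 → r5 ≤ dist x x2 := by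
    by_cases h : d.1 = (T.glue d).1
    · refine ⟨dist x x2, dist_pos.2 fun he => ?_, fun _ => le_rfl⟩
      exact T.glue_ne d (T.sidePoint_inj ht h.symm he.symm).1
    · exact ⟨1, one_pos, fun h' => absurd h' h⟩
  obtain ⟨R, hR0, hR1, hR2, hR3, hR4, hR5⟩ : ∃ R > 0, R ≤ r1 ∧ R ≤ r2 ∧ R ≤ r3 ∧ R ≤ r4 ∧
      2 * R ≤ r5 := by
    refine ⟨min (min r1 r2) (min (min r3 r4) (r5 / 2)), by positivity, ?_, ?_, ?_, ?_, ?_⟩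
    · simp
    · simp
    · simp
    · simp
    · have : min (min r1 r2) (min (min r3 r4) (r5 / 2)) ≤ r5 / 2 := by simp
      linarith
  -- the plane of the disc, placed in the plane of the triangle of `d` and in that of its neighbor
  set D0 := AffineIsometryEquiv.constVAdd ℝ E2 x with hD0
  set D1 := D0.trans τ.symm with hD1
  have e0 : ∀ u, D0 u = x + u := fun u => rfl
  have e1 : ∀ u, D1 u = τ.symm (x + u) := fun u => rfl
  have a1 : ∀ u, ‖u‖ < R → 0 < T.bary d.1 d.2 (D0 u) := fun u hu => h1 u (by linarith)
  have a2 : ∀ u, ‖u‖ < R → 0 < T.bary d.1 (d.2 + 1) (D0 u) := fun u hu => h2 u (by linarith)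
  have a3 : ∀ u, ‖u‖ < R → 0 < T.bary (T.glue d).1 (T.glue d).2 (D1 u) := fun u hu => by
    rw [e1, hsub]; exact h3 _ (by rw [LinearIsometryEquiv.norm_map]; linarith)
  have a4 : ∀ u, ‖u‖ < R → 0 < T.bary (T.glue d).1 ((T.glue d).2 + 1) (D1 u) := fun u hu => by
    rw [e1, hsub]; exact h4 _ (by rw [LinearIsometryEquiv.norm_map]; linarith)
  have f0 : ∀ u, ‖u‖ < R → (D0 u ∈ T.face d.1 ↔ 0 ≤ T.bary d.1 (d.2 + 2) (x + u)) := by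
    intro u hu
    rw [mem_face_iff, fin3_forall d.2]
    exact ⟨fun h => h.2.2, fun h => ⟨(a1 u hu).le, (a2 u hu).le, h⟩⟩
  have f1 : ∀ u, ‖u‖ < R → (D1 u ∈ T.face (T.glue d).1 ↔ T.bary d.1 (d.2 + 2) (x + u) ≤ 0) := by
    intro u hu
    rw [mem_face_iff, fin3_forall (T.glue d).2, e1, hb]
    constructor
    · intro h
      have := h.2.2
      nlinarith
    · intro h
      refine ⟨(a3 u hu).le, (a4 u hu).le, ?_⟩
      nlinarith
  have hcomp : ∀ u, ‖u‖ < R → D0 u ∈ T.face d.1 → D1 u ∈ T.face (T.glue d).1 →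
      T.chart d.1 (D0 u) = T.chart (T.glue d).1 (D1 u) := by
    intro u hu hu0 hu1
    have hz : T.bary d.1 (d.2 + 2) (D0 u) = 0 := le_antisymm ((f1 u hu).1 hu1) ((f0 u hu).1 hu0)
    have hs := T.eq_sidePoint hz
    have hsum := T.sum_bary_cyclic d.1 d.2 (D0 u)
    rw [e1, ← e0, hs, T.unfold_symm_sidePoint]
    exact T.chart_sidePoint d ⟨(a2 u hu).le, by linarith [a1 u hu]⟩
  have hconv : ∀ u w, ‖u‖ < R → ‖w‖ < R → D0 u ∈ T.face d.1 → D1 w ∈ T.face (T.glue d).1 →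
      ∃ m, ‖m‖ < R ∧ dist u m + dist m w = dist u w ∧ D0 m ∈ T.face d.1 ∧
        D1 m ∈ T.face (T.glue d).1 := by
    intro u w hu hw hu0 hw1
    have hbu := (f0 u hu).1 hu0
    have hbw := (f1 w hw).1 hw1
    obtain ⟨s, hs, hs0⟩ : ∃ s ∈ Set.Icc (0 : ℝ) 1,
        T.bary d.1 (d.2 + 2) (x + AffineMap.lineMap u w s) = 0 := by
      have hc : ContinuousOn (fun s : ℝ => T.bary d.1 (d.2 + 2) (x + AffineMap.lineMap u w s))
          (Set.Icc 0 1) := by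
        apply Continuous.continuousOn
        exact (T.continuous_bary _ _).comp
          (continuous_const.add AffineMap.lineMap_continuous)
      have := intermediate_value_Icc' zero_le_one hc
      exact this ⟨by simpa using hbw, by simpa using hbu⟩
    have hm : ‖(AffineMap.lineMap u w s : E2)‖ < R := by
      have : AffineMap.lineMap u w s ∈ Metric.ball (0 : E2) R :=
        (convex_ball (0 : E2) R).lineMap_mem (by simpa using hu) (by simpa using hw) hs
      simpa using this
    refine ⟨_, hm, ?_, (f0 _ hm).2 hs0.ge, (f1 _ hm).2 hs0.le⟩
    rw [dist_left_lineMap, dist_lineMap_right, Real.norm_of_nonneg hs.1,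
      Real.norm_of_nonneg (by linarith [hs.2])]
    ring
  obtain ⟨p, Φ, hd1, hd2, -⟩ := T.exists_flatDisc_of_placements (ι := Bool)
    (fun b => if b then d.1 else (T.glue d).1) (fun b => if b then D0 else D1)
    (ρ := R / 2) (by positivity)
    (by
      intro u hu
      rcases le_total 0 (T.bary d.1 (d.2 + 2) (x + u)) with h | h
      · exact ⟨true, (f0 u (by linarith)).2 h⟩
      · exact ⟨false, (f1 u (by linarith)).2 h⟩)
    (by
      rintro (_ | _) (_ | _) u hu hk hl
      · rfl
      · exact (hcomp u (by linarith) hl hk).symm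
      · exact hcomp u (by linarith) hk hl
      · rfl)
    (by
      rintro (_ | _) d' hd' s hs u hu hsu
      · refine ⟨true, ?_⟩
        have hu' : ‖u‖ < R := by linarith
        have hsu' : D1 u = T.sidePoint d' s := hsu
        have hd'' : d'.1 = (T.glue d).1 := hd'
        have hde : d' = T.glue d := by
          have hz := T.bary_sidePoint_two d' s
          rw [← hsu', hd''] at hz
          refine Prod.ext hd'' ?_
          rcases fin3_cases (T.glue d).2 (d'.2 + 2) with h | h | h
          · rw [h] at hz; exact absurd hz (a3 u hu').ne'
          · rw [h] at hz; exact absurd hz (a4 u hu').ne'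
          · exact add_right_cancel h
        subst hde
        rw [T.glue_glue]
        refine ⟨rfl, ?_⟩
        change D0 u = _
        have := T.unfold_sidePoint d (1 - s)
        rw [sub_sub_cancel, ← hsu', e1, AffineIsometryEquiv.apply_symm_apply] at this
        rw [e0, this]
      · refine ⟨false, ?_⟩
        have hu' : ‖u‖ < R := by linarith
        have hsu' : D0 u = T.sidePoint d' s := hsu
        have hd'' : d'.1 = d.1 := hd'
        have hde : d' = d := by
          have hz := T.bary_sidePoint_two d' s
          rw [← hsu', hd''] at hz
          refine Prod.ext hd'' ?_
          rcases fin3_cases d.2 (d'.2 + 2) with h | h | h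
          · rw [h] at hz; exact absurd hz (a1 u hu').ne'
          · rw [h] at hz; exact absurd hz (a2 u hu').ne'
          · exact add_right_cancel h
        subst hde
        refine ⟨rfl, ?_⟩
        change D1 u = _
        rw [e1, ← e0, hsu', T.unfold_symm_sidePoint])
    (by
      have hne : ∀ u v, ‖u‖ < R → ‖v‖ < R → d.1 = (T.glue d).1 → D0 u ≠ D1 v := by
        intro u v hu hv hf he
        have h6 := h5 hf
        rw [e0, e1, hsub] at he
        have h7 : x - x2 = τ.symm.linearIsometryEquiv v - u := by
          rw [sub_eq_sub_iff_add_eq_add, he, add_comm]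
        have h8 : dist x x2 ≤ ‖v‖ + ‖u‖ := by
          rw [dist_eq_norm, h7, ← τ.symm.linearIsometryEquiv.norm_map v]
          exact norm_sub_le _ _
        linarith
      rintro (_ | _) (_ | _) u v hf hu hv he
      · rfl
      · exact absurd he.symm (hne v u (by linarith) (by linarith) hf.symm)
      · exact absurd he (hne u v (by linarith) (by linarith) hf)
      · rfl)
    (by
      rintro (_ | _) (_ | _) u w hu hw hk hl
      · exact ⟨u, hu, by simp, hk, hk⟩
      · obtain ⟨m, m1, m2, m3, m4⟩ := hconv w u (by linarith) (by linarith) hl hk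
        refine ⟨m, by linarith, ?_, m4, m3⟩
        rw [dist_comm u m, dist_comm m w, dist_comm u w]; linarith
      · obtain ⟨m, m1, m2, m3, m4⟩ := hconv u w (by linarith) (by linarith) hk hl
        exact ⟨m, by linarith, m2, m3, m4⟩
      · exact ⟨u, hu, by simp, hk, hk⟩)
  have hx0 : D0 0 = x := by rw [e0, add_zero]
  have hp : p = T.chart d.1 x := by
    have h00 : D0 0 ∈ T.face d.1 := by
      rw [hx0]; exact T.sidePoint_mem_face d ⟨ht.1.le, ht.2.le⟩
    rw [← hd1.map_zero, hd2 true 0 (by simpa using hR0) h00]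
    exact congrArg (T.chart d.1) hx0
  subst hp
  refine ⟨_, Φ, hd1, fun u hu => ⟨fun h => ?_, fun h => ?_⟩⟩
  · have := (f0 u (by linarith)).2 h
    exact ⟨this, hd2 true u hu this⟩
  · have := (f1 u (by linarith)).2 h
    exact ⟨this, hd2 false u hu this⟩

end GeodesicTriangulation
lemma exists_pos_forall_le {α : Type*} [Finite α] (g : α → ℝ) (hg : ∀ a, 0 < g a) :
    ∃ c > 0, ∀ a, c ≤ g a := by
  cases isEmpty_or_nonempty α
  · exact ⟨1, one_pos, fun a => isEmptyElim a⟩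
  · obtain ⟨a, ha⟩ := Finite.exists_min g
    exact ⟨g a, hg a, ha⟩

/-! ### Straight curves -/

section Straight

variable {M : Type*} [MetricSpace M]

/-- Near the parameter `t`, the curve `γ` is a straight line, traversed with constant speed, in a
flat disc around `γ t`. -/
def StraightAt (γ : ℝ → M) (t : ℝ) : Prop :=
  ∃ ρ Φ w, IsFlatDisc (γ t) ρ Φ ∧ ∃ δ > 0, ∀ s, |s| < δ → γ (t + s) = Φ (s • w)

lemma StraightAt.exists_velocity {γ : ℝ → M} {t : ℝ} (h : StraightAt γ t) {ρ : ℝ} {Φ : E2 → M}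
    (hΦ : IsFlatDisc (γ t) ρ Φ) :
    ∃ w : E2, ∃ δ > 0, ∀ s, |s| < δ → ‖s • w‖ < ρ ∧ γ (t + s) = Φ (s • w) := by
  obtain ⟨ρ', Φ', w, hd, δ, hδ, hs⟩ := h
  obtain ⟨L, hL⟩ := hΦ.exists_linearIsometry hd
  have h1 : ∀ R > 0, ∃ δ' > 0, ∀ s : ℝ, |s| < δ' → ‖s • w‖ < R := by
    intro R hR
    refine ⟨R / (‖w‖ + 1), by positivity, fun s hs => ?_⟩
    rw [norm_smul, Real.norm_eq_abs]
    have : |s| * (‖w‖ + 1) < R := (lt_div_iff₀ (by positivity)).1 hs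
    nlinarith [abs_nonneg s]
  obtain ⟨δ1, hδ1, h2⟩ := h1 ρ hΦ.pos
  obtain ⟨δ2, hδ2, h3⟩ := h1 ρ' hd.pos
  refine ⟨L w, min δ (min δ1 δ2), lt_min hδ (lt_min hδ1 hδ2), fun s hs' => ?_⟩
  rw [lt_min_iff, lt_min_iff] at hs'
  rw [← map_smul, L.norm_map]
  exact ⟨h2 s hs'.2.1, by rw [hs s hs'.1, hL _ (h2 s hs'.2.1) (h3 s hs'.2.2)]⟩

lemma StraightAt.continuousAt {γ : ℝ → M} {t : ℝ} (h : StraightAt γ t) : ContinuousAt γ t := by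
  have h0 := h
  obtain ⟨ρ, Φ, w', hd, -⟩ := h0
  obtain ⟨w, δ, hδ, hs⟩ := h.exists_velocity hd
  rw [Metric.continuousAt_iff]
  intro ε hε
  refine ⟨min δ (ε / (‖w‖ + 1)), lt_min hδ (by positivity), fun x hx => ?_⟩
  rw [lt_min_iff, Real.dist_eq] at hx
  have h1 := hs (x - t) hx.1
  have h2 := hs 0 (by simpa using hδ)
  rw [add_sub_cancel] at h1
  rw [add_zero] at h2
  rw [h1.2, h2.2, hd.dist_eq _ _ h1.1 h2.1, zero_smul, dist_zero_right, norm_smul,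
    Real.norm_eq_abs]
  have : |x - t| * (‖w‖ + 1) < ε := (lt_div_iff₀ (by positivity)).1 hx.2
  nlinarith [abs_nonneg (x - t)]

/-- Unique continuation of straight curves. -/
lemma eq_of_straightAt {γ₁ γ₂ : ℝ → M} {a b : ℝ} (h1 : ∀ t ∈ Set.Ioo a b, StraightAt γ₁ t)
    (h2 : ∀ t ∈ Set.Ioo a b, StraightAt γ₂ t) {t₀ : ℝ} (ht₀ : t₀ ∈ Set.Ioo a b)
    (h : γ₁ =ᶠ[nhds t₀] γ₂) : ∀ t ∈ Set.Ioo a b, γ₁ t = γ₂ t := by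
  set Z : Set ℝ := {t | γ₁ =ᶠ[nhds t] γ₂} with hZ
  have hZo : IsOpen Z := isOpen_setOfPred_eventually_nhds
  have hsub : Set.Ioo a b ⊆ Z := by
    refine isPreconnected_Ioo.subset_of_closure_inter_subset hZo ⟨t₀, ht₀, h⟩ ?_
    rintro t ⟨htc, ht⟩
    have hfr : ∃ᶠ s in nhds t, s ∈ Z := mem_closure_iff_frequently.1 htc
    have heq : γ₁ t = γ₂ t := by
      by_contra hne
      have hc : ContinuousAt (fun s => dist (γ₁ s) (γ₂ s)) t :=
        (h1 t ht).continuousAt.dist (h2 t ht).continuousAt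
      have := hc.eventually (lt_mem_nhds (dist_pos.2 hne))
      obtain ⟨s, hs, hs'⟩ := (hfr.and_eventually this).exists
      have hs0 : γ₁ s = γ₂ s := Filter.EventuallyEq.eq_of_nhds hs
      rw [hs0, dist_self] at hs'
      exact lt_irrefl _ hs'
    have h1t := h1 t ht
    obtain ⟨ρ, Φ, w', hd, -⟩ := h1t
    obtain ⟨w1, δ1, hδ1, hs1⟩ := (h1 t ht).exists_velocity hd
    have hd2 := hd
    rw [heq] at hd2
    obtain ⟨w2, δ2, hδ2, hs2⟩ := (h2 t ht).exists_velocity hd2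
    by_cases htZ : t ∈ Z
    · exact htZ
    have hev : ∀ᶠ s in nhds t, |s - t| < min δ1 δ2 := by
      have := Metric.ball_mem_nhds t (lt_min hδ1 hδ2)
      filter_upwards [this] with s hs
      simpa [Real.dist_eq] using hs
    obtain ⟨s, hsZ, hs⟩ := (hfr.and_eventually hev).exists
    rw [lt_min_iff] at hs
    have hne : s - t ≠ 0 := fun h0 => htZ (by rwa [sub_eq_zero.1 h0] at hsZ)
    have e1 := hs1 _ hs.1
    have e2 := hs2 _ hs.2
    rw [add_sub_cancel] at e1 e2
    -- in the disc, the curves are lines through the center, and share the point with parameter `s`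
    have hw : w1 = w2 := by
      have h5 := hd.dist_eq _ _ e1.1 e2.1
      rw [← e1.2, ← e2.2, Filter.EventuallyEq.eq_of_nhds hsZ, dist_self] at h5
      have := dist_eq_zero.1 h5.symm
      exact smul_right_injective _ hne this
    subst hw
    filter_upwards [hev] with s hs
    rw [lt_min_iff] at hs
    have e1 := hs1 _ hs.1
    have e2 := hs2 _ hs.2
    rw [add_sub_cancel] at e1 e2
    rw [e1.2, e2.2]
  exact fun t ht => Filter.EventuallyEq.eq_of_nhds (hsub ht)

lemma StraightAt.comp_affine {γ : ℝ → M} {c b t : ℝ} (h : StraightAt γ (c * t + b)) :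
    StraightAt (fun s => γ (c * s + b)) t := by
  obtain ⟨ρ, Φ, w, hd, δ, hδ, hs⟩ := h
  refine ⟨ρ, Φ, c • w, hd, δ / (|c| + 1), by positivity, fun s hs' => ?_⟩
  have : |s| * (|c| + 1) < δ := (lt_div_iff₀ (by positivity)).1 hs'
  have h2 : |c * s| < δ := by rw [abs_mul]; nlinarith [abs_nonneg s]
  rw [smul_smul, mul_comm s c, ← hs _ h2]
  change γ (c * (t + s) + b) = _
  congr 1; ring

end Straight

namespace GeodesicTriangulation

variable {M : Type*} [MetricSpace M] {V : Finset M} (T : GeodesicTriangulation M V)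

/-! ### Points of `M` that are not vertices -/

lemma chart_mem_iff {f : T.Face} {x : E2} (hx : x ∈ T.face f) :
    T.chart f x ∈ V ↔ ∃ k, x = T.corner f k := by
  constructor
  · intro h
    obtain ⟨k, -, hk⟩ := (T.chart_eq_vertex_iff hx ⟨_, h⟩).1 rfl
    exact ⟨k, hk⟩
  · rintro ⟨k, rfl⟩
    rw [T.chart_corner (f, k)]
    exact (T.vertex (f, k)).2

lemma exists_sidePoint_of_bary_eq_zero {f : T.Face} {x : E2} (hx : x ∈ T.face f) {k : Fin 3}
    (hk : T.bary f k x = 0) : ∃ t ∈ Set.Icc (0 : ℝ) 1, x = T.sidePoint (f, k + 1) t := by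
  have h3 : k + 1 + 2 = k := by clear hk; revert k; decide
  have hz : T.bary (f, k + 1).1 ((f, k + 1).2 + 2) x = 0 := by
    simp only [h3, hk]
  have hs := T.sum_bary_cyclic f (k + 1) x
  rw [T.mem_face_iff] at hx
  refine ⟨_, ⟨hx _, ?_⟩, T.eq_sidePoint hz⟩
  have := hx (k + 1)
  have := hx (k + 1 + 2)
  simp only
  linarith

lemma interior_or_side {f : T.Face} {x : E2} (hx : x ∈ T.face f) (hv : T.chart f x ∉ V) :
    (∀ k, 0 < T.bary f k x) ∨ ∃ k, ∃ t ∈ Set.Ioo (0 : ℝ) 1, x = T.sidePoint (f, k) t := by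
  by_cases h : ∀ k, 0 < T.bary f k x
  · exact Or.inl h
  right
  push Not at h
  obtain ⟨k, hk⟩ := h
  have hk0 : T.bary f k x = 0 := le_antisymm hk (T.mem_face_iff.1 hx k)
  obtain ⟨t, ht, rfl⟩ := T.exists_sidePoint_of_bary_eq_zero hx hk0
  rw [T.chart_mem_iff hx] at hv
  refine ⟨k + 1, t, ⟨lt_of_le_of_ne ht.1 ?_, lt_of_le_of_ne ht.2 ?_⟩, rfl⟩
  · rintro rfl
    exact hv ⟨_, T.sidePoint_zero _⟩
  · rintro rfl
    exact hv ⟨_, T.sidePoint_one _⟩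

lemma chart_sidePoint_notMem (d : T.Face × Fin 3) {t : ℝ} (ht : t ∈ Set.Ioo (0 : ℝ) 1) :
    T.chart d.1 (T.sidePoint d t) ∉ V := by
  rw [T.chart_mem_iff (T.sidePoint_mem_face d ⟨ht.1.le, ht.2.le⟩)]
  rintro ⟨k, hk⟩
  have h0 := T.bary_sidePoint_zero d t
  have h1 := T.bary_sidePoint_one d t
  rw [hk, bary_corner] at h0 h1
  split_ifs at h0 h1 <;> linarith [ht.1, ht.2]

lemma chart_interior_notMem {f : T.Face} {x : E2} (hx : ∀ k, 0 < T.bary f k x) :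
    T.chart f x ∉ V := by
  rw [T.chart_mem_iff (T.mem_face_iff.2 fun k => (hx k).le)]
  rintro ⟨k, rfl⟩
  have := hx (k + 1)
  rw [bary_corner] at this
  simp at this

/-- Near a point that is not a vertex, the chart of a triangle is the restriction of a flat
disc. -/
lemma exists_flatDisc_chart {f : T.Face} {x : E2} (hx : x ∈ T.face f) (hv : T.chart f x ∉ V) :
    ∃ ρ, ∃ Φ : E2 → M, IsFlatDisc (T.chart f x) ρ Φ ∧
      ∀ u, ‖u‖ < ρ → x + u ∈ T.face f → Φ u = T.chart f (x + u) := by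
  rcases T.interior_or_side hx hv with h | ⟨k, t, ht, rfl⟩
  · obtain ⟨ρ, Φ, h1, h2⟩ := T.exists_flatDisc_interior h
    exact ⟨ρ, Φ, h1, fun u hu _ => (h2 u hu).2⟩
  · obtain ⟨ρ, Φ, h1, h2⟩ := T.exists_flatDisc_side (f, k) ht
    exact ⟨ρ, Φ, h1, fun u hu hf => ((h2 u hu).1 (T.mem_face_iff.1 hf _)).2⟩

lemma exists_flatDisc (T : GeodesicTriangulation M V) {p : M} (hp : p ∉ V) :
    ∃ ρ Φ, IsFlatDisc p ρ Φ := by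
  obtain ⟨f, x, hx, rfl⟩ := T.exists_rep p
  obtain ⟨ρ, Φ, h, -⟩ := T.exists_flatDisc_chart hx hp
  exact ⟨ρ, Φ, h⟩

/-- In a flat disc, the chart of a triangle is a linear isometry. -/
lemma exists_linearIsometry_chart {f : T.Face} {x : E2} (hx : x ∈ T.face f)
    (hv : T.chart f x ∉ V) {ρ : ℝ} {Φ : E2 → M} (hΦ : IsFlatDisc (T.chart f x) ρ Φ) :
    ∃ L : E2 ≃ₗᵢ[ℝ] E2, ∃ ε > 0, ε ≤ ρ ∧ ∀ u, ‖u‖ < ε → x + u ∈ T.face f →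
      T.chart f (x + u) = Φ (L u) := by
  obtain ⟨ρ', Φ', h, h'⟩ := T.exists_flatDisc_chart hx hv
  obtain ⟨L, hL⟩ := hΦ.exists_linearIsometry h
  refine ⟨L, min ρ ρ', lt_min hΦ.pos h.pos, min_le_left _ _, fun u hu hf => ?_⟩
  rw [lt_min_iff] at hu
  rw [← h' u hu.2 hf, hL u hu.1 hu.2]

/-- A segment in a triangle is straight in `M`. -/
lemma straightAt_chart {f : T.Face} {x v : E2} {t δ : ℝ} (hδ : 0 < δ)
    (h : ∀ s, |s| < δ → x + (t + s) • v ∈ T.face f) (hv : T.chart f (x + t • v) ∉ V) :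
    StraightAt (fun s => T.chart f (x + s • v)) t := by
  have hx : x + t • v ∈ T.face f := by simpa using h 0 (by simpa using hδ)
  obtain ⟨ρ, Φ, h1, h2⟩ := T.exists_flatDisc_chart hx hv
  refine ⟨ρ, Φ, v, h1, min δ (ρ / (‖v‖ + 1)), lt_min hδ (by have := h1.pos; positivity),
    fun s hs => ?_⟩
  rw [lt_min_iff] at hs
  have h3 : x + (t + s) • v = x + t • v + s • v := by module
  have h4 : ‖s • v‖ < ρ := by
    rw [norm_smul, Real.norm_eq_abs]
    have : |s| * (‖v‖ + 1) < ρ := (lt_div_iff₀ (by positivity)).1 hs.2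
    nlinarith [abs_nonneg s]
  rw [h2 _ h4 (h3 ▸ h s hs.1), ← h3]

/-- The edge with the orientation given by `d`, as a curve in `M` with parameter in `[0, 1]`. -/
noncomputable def edgeCurve (d : T.Face × Fin 3) (t : ℝ) : M := T.chart d.1 (T.sidePoint d t)

lemma straightAt_edgeCurve (d : T.Face × Fin 3) {t : ℝ} (ht : t ∈ Set.Ioo (0 : ℝ) 1) :
    StraightAt (T.edgeCurve d) t := by
  have h1 : T.edgeCurve d = fun s => T.chart d.1
      (T.corner d.1 d.2 + s • (T.corner d.1 (d.2 + 1) - T.corner d.1 d.2)) := by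
    funext s; rw [edgeCurve, sidePoint_eq]
  rw [h1]
  refine T.straightAt_chart (δ := min t (1 - t)) (lt_min ht.1 (by linarith [ht.2])) ?_ ?_
  · intro s hs
    rw [← sidePoint_eq]
    rw [lt_min_iff, abs_lt, abs_lt] at hs
    exact T.sidePoint_mem_face d ⟨by linarith, by linarith⟩
  · rw [← sidePoint_eq]; exact T.chart_sidePoint_notMem d ht

/-! ### Neighborhoods of the vertices -/

/-- Near a corner of a triangle, the distance from the corner is the distance in `M` from the
vertex. -/
lemma exists_vertex_nhd : ∃ ρ > 0,
    (∀ f k l x, dist x (T.corner f k) < ρ → dist x (T.corner f l) < ρ → k = l) ∧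
    (∀ f k x, x ∈ T.face f → dist x (T.corner f k) < ρ →
      dist (T.vertex (f, k) : M) (T.chart f x) = dist x (T.corner f k)) ∧
    (∀ (i : V) f x, x ∈ T.face f → dist (i : M) (T.chart f x) < ρ →
      ∃ k, T.vertex (f, k) = i ∧ dist x (T.corner f k) = dist (i : M) (T.chart f x)) := by
  have h0 : ∀ d : T.Face × Fin 3, ∃ r > 0, ∀ y, dist y (T.corner d.1 d.2) < r →
      0 < T.bary d.1 d.2 y := by
    intro d
    obtain ⟨r, hr, h⟩ := T.exists_ball_bary_pos d.1 d.2 (x := T.corner d.1 d.2)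
      (by rw [bary_corner]; simp)
    refine ⟨r, hr, fun y hy => ?_⟩
    have := h (y - T.corner d.1 d.2) (by rwa [← dist_eq_norm])
    rwa [add_sub_cancel] at this
  choose r hr0 hr using h0
  obtain ⟨R, hR, hRr⟩ := exists_pos_forall_le r hr0
  have hb : ∀ f k y, dist y (T.corner f k) < R → 0 < T.bary f k y :=
    fun f k y hy => hr (f, k) y (hy.trans_le (hRr _))
  have hsep : ∀ f k l, k ≠ l → R ≤ dist (T.corner f k) (T.corner f l) := by
    intro f k l hkl
    by_contra! hlt
    have := hb f l _ hlt
    rw [bary_corner, if_neg (Ne.symm hkl)] at this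
    exact lt_irrefl _ this
  set ρ := R / 2 with hρ
  have hρ0 : 0 < ρ := by positivity
  have huniq : ∀ f k l x, dist x (T.corner f k) < ρ → dist x (T.corner f l) < ρ → k = l := by
    intro f k l x h1 h2
    by_contra hkl
    have := hsep f k l hkl
    have := dist_triangle_left (T.corner f k) (T.corner f l) x
    linarith
  -- The truncated distance from the corners at the vertex `i` has Lipschitz constant one on `M`,
  -- and therefore bounds the distance from `i` in `M` from below.
  set G : V → T.Face → E2 → ℝ :=
    fun i f y => truncDist ρ {z | ∃ k, T.vertex (f, k) = i ∧ z = T.corner f k} y with hG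
  have hinv : ∀ i, T.GluingInvariant (G i) := by
    intro i
    have key : ∀ d, ∀ t ∈ Set.Icc (0 : ℝ) 1,
        G i (T.glue d).1 (T.sidePoint (T.glue d) (1 - t)) ≤ G i d.1 (T.sidePoint d t) := by
      intro d t ht
      apply truncDist_le_truncDist
      rintro _ ⟨k, hk, rfl⟩ hlt
      have hpos := hb _ _ _ (hlt.trans (by linarith))
      rcases fin3_cases d.2 k with rfl | rfl | rfl
      · refine ⟨_, ⟨(T.glue d).2 + 1, ?_, rfl⟩, ?_⟩
        · rw [← hk]; exact T.vertex_nextSide_glue d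
        · rw [← unfold_symm_sidePoint, ← sidePoint_one, ← sidePoint_zero]
          have := T.unfold_symm_sidePoint d 0
          rw [sub_zero] at this
          rw [← this, AffineIsometryEquiv.dist_map]
      · refine ⟨_, ⟨(T.glue d).2, ?_, rfl⟩, ?_⟩
        · rw [← hk]; exact T.vertex_glue d
        · rw [← unfold_symm_sidePoint, ← sidePoint_one, ← sidePoint_zero]
          have := T.unfold_symm_sidePoint d 1
          rw [sub_self] at this
          rw [← this, AffineIsometryEquiv.dist_map]
      · rw [bary_sidePoint_two] at hpos
        exact absurd hpos (lt_irrefl _)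
    intro d t ht
    refine le_antisymm ?_ (key d t ht)
    have := key (T.glue d) (1 - t) ⟨by linarith [ht.2], by linarith [ht.1]⟩
    rwa [T.glue_glue, sub_sub_cancel] at this
  have hlip : ∀ i p q, dist (T.descend (G i) p) (T.descend (G i) q) ≤ dist p q := by
    intro i p q
    have := (hinv i).lipschitz_descend (K := 1) (fun f x _ y _ => edist_truncDist_le _ x y)
      one_ne_zero ENNReal.one_ne_top p q
    rw [one_mul, edist_dist, edist_dist, ENNReal.ofReal_le_ofReal_iff dist_nonneg] at this
    exact this
  have hGval : ∀ f k x, dist x (T.corner f k) < ρ →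
      G (T.vertex (f, k)) f x = dist x (T.corner f k) := by
    intro f k x hx
    apply le_antisymm
    · exact truncDist_le_dist ⟨k, rfl, rfl⟩
    · rw [hG, le_truncDist_iff]
      refine ⟨hx.le, ?_⟩
      rintro _ ⟨l, -, rfl⟩
      by_contra! hlt
      have := huniq f k l x hx (hlt.trans hx)
      subst this
      exact lt_irrefl _ hlt
  have hA : ∀ f k x, x ∈ T.face f → dist x (T.corner f k) < ρ →
      dist (T.vertex (f, k) : M) (T.chart f x) = dist x (T.corner f k) := by
    intro f k x hx hd
    rw [← T.chart_corner (f, k)]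
    apply le_antisymm
    · rw [dist_comm x]; exact T.dist_chart_le (T.corner_mem_face _ _) hx
    · have := hlip (T.vertex (f, k)) (T.chart f (T.corner f k)) (T.chart f x)
      rw [(hinv _).descend_chart hx, (hinv _).descend_chart (T.corner_mem_face _ _),
        hGval f k x hd, hGval f k _ (by simpa using hρ0), dist_self, dist_zero_left,
        Real.norm_of_nonneg dist_nonneg] at this
      exact this
  refine ⟨ρ, hρ0, huniq, hA, ?_⟩
  intro i f x hx hlt
  obtain ⟨⟨g, k⟩, rfl⟩ := T.vertex_surjective i
  have h1 := hlip (T.vertex (g, k)) (T.vertex (g, k)) (T.chart f x)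
  have h2 : T.descend (G (T.vertex (g, k))) (T.vertex (g, k) : M) = 0 := by
    rw [← T.chart_corner (g, k), (hinv _).descend_chart (T.corner_mem_face _ _),
      hGval g k _ (by simpa using hρ0), dist_self]
  rw [h2, (hinv _).descend_chart hx, Real.dist_eq, zero_sub, abs_neg] at h1
  obtain ⟨_, ⟨l, hl, rfl⟩, hz⟩ := exists_of_truncDist_lt
    ((le_abs_self _).trans_lt (h1.trans_lt hlt))
  refine ⟨l, hl, ?_⟩
  rw [← hA f l x hx hz, hl]

/-! ### The squared distance from the apex -/

/-- The squared distance from the apex, at the points of a triangle.  The formula makes sense for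
all radii, whether or not there is a pyramid over the triangle. -/
noncomputable def facePower (r : V → ℝ) (f : T.Face) (x : E2) : ℝ :=
  ∑ k, T.bary f k x * (r (T.vertex (f, k)) ^ 2 - dist x (T.corner f k) ^ 2)

lemma facePower_corner (r : V → ℝ) (f : T.Face) (k : Fin 3) :
    T.facePower r f (T.corner f k) = r (T.vertex (f, k)) ^ 2 := by
  simp [facePower, bary_corner]

lemma facePower_eq (r : V → ℝ) (f : T.Face) (x : E2) :
    T.facePower r f x =
      ‖x‖ ^ 2 + ∑ k, T.bary f k x * (r (T.vertex (f, k)) ^ 2 - ‖T.corner f k‖ ^ 2) := by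
  have h1 : ∑ k, T.bary f k x * inner ℝ x (T.corner f k) = ‖x‖ ^ 2 := by
    simp only [← inner_smul_right, ← inner_sum, sum_bary_smul, real_inner_self_eq_norm_sq]
  have h2 : ∀ k, T.bary f k x * (r (T.vertex (f, k)) ^ 2 - dist x (T.corner f k) ^ 2) =
      T.bary f k x * (r (T.vertex (f, k)) ^ 2 - ‖T.corner f k‖ ^ 2) +
      2 * (T.bary f k x * inner ℝ x (T.corner f k)) - T.bary f k x * ‖x‖ ^ 2 := by
    intro k
    rw [dist_eq_norm, norm_sub_sq_real]; ring
  rw [facePower, Finset.sum_congr rfl fun k _ => h2 k, Finset.sum_sub_distrib,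
    Finset.sum_add_distrib, ← Finset.mul_sum, h1, ← Finset.sum_mul, sum_bary]
  ring

/-- The gradient of a barycentric coordinate. -/
noncomputable def baryGrad (f : T.Face) (k : Fin 3) : E2 :=
  (InnerProductSpace.toDual ℝ E2).symm (LinearMap.toContinuousLinearMap (T.bary f k).linear)

lemma bary_sub (f : T.Face) (k : Fin 3) (x y : E2) :
    T.bary f k x - T.bary f k y = inner ℝ (T.baryGrad f k) (x - y) := by
  rw [baryGrad, InnerProductSpace.toDual_symm_apply]
  have := (T.bary f k).linearMap_vsub x y
  simpa using this.symm

lemma bary_add (f : T.Face) (k : Fin 3) (x u : E2) :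
    T.bary f k (x + u) = T.bary f k x + inner ℝ (T.baryGrad f k) u := by
  have := T.bary_sub f k (x + u) x
  rw [add_sub_cancel_left] at this
  linarith

lemma baryGrad_ne_zero (f : T.Face) (k : Fin 3) : T.baryGrad f k ≠ 0 := by
  intro h
  have := T.bary_sub f k (T.corner f k) (T.corner f (k + 1))
  rw [h, bary_corner, bary_corner, inner_zero_left] at this
  simp at this

lemma exists_foot (r : V → ℝ) (f : T.Face) : ∃ p : E2, ∃ c : ℝ, ∀ x,
    T.facePower r f x = dist x p ^ 2 + c := by
  set a : E2 := ∑ k, (r (T.vertex (f, k)) ^ 2 - ‖T.corner f k‖ ^ 2) • T.baryGrad f k with ha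
  set g : E2 → ℝ := fun x =>
    ∑ k, T.bary f k x * (r (T.vertex (f, k)) ^ 2 - ‖T.corner f k‖ ^ 2) with hg
  have hg1 : ∀ x, g x = g 0 + inner ℝ a x := by
    intro x
    simp only [hg, ha, sum_inner, inner_smul_left, conj_trivial, ← Finset.sum_add_distrib]
    refine Finset.sum_congr rfl fun k _ => ?_
    have := T.bary_add f k 0 x
    rw [zero_add] at this
    rw [this]; ring
  refine ⟨-(1 / 2 : ℝ) • a, g 0 - ‖(1 / 2 : ℝ) • a‖ ^ 2, fun x => ?_⟩
  rw [facePower_eq]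
  change ‖x‖ ^ 2 + g x = _
  rw [hg1, dist_eq_norm, neg_smul, sub_neg_eq_add, norm_add_sq_real, inner_smul_right,
    real_inner_comm]
  ring

/-- The foot, in the plane of the triangle, of the altitude of the pyramid from the apex. -/
noncomputable def foot (r : V → ℝ) (f : T.Face) : E2 := (T.exists_foot r f).choose

/-- The squared height of the pyramid over a triangle.  It is positive iff the pyramid exists. -/
noncomputable def heightSq (r : V → ℝ) (f : T.Face) : ℝ := (T.exists_foot r f).choose_spec.choose

lemma facePower_eq_foot (r : V → ℝ) (f : T.Face) (x : E2) :
    T.facePower r f x = dist x (T.foot r f) ^ 2 + T.heightSq r f :=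
  (T.exists_foot r f).choose_spec.choose_spec x

lemma dist_sidePoint_left (d : T.Face × Fin 3) (t : ℝ) :
    dist (T.sidePoint d t) (T.corner d.1 d.2) ^ 2 = t ^ 2 * T.length d ^ 2 := by
  rw [sidePoint, dist_lineMap_left, mul_pow, Real.norm_eq_abs, sq_abs, length]

lemma dist_sidePoint_right (d : T.Face × Fin 3) (t : ℝ) :
    dist (T.sidePoint d t) (T.corner d.1 (d.2 + 1)) ^ 2 = (1 - t) ^ 2 * T.length d ^ 2 := by
  rw [sidePoint, dist_lineMap_right, mul_pow, Real.norm_eq_abs, sq_abs, length]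

lemma length_glue (d : T.Face × Fin 3) : T.length (T.glue d) = T.length d := T.dist_glue d

lemma facePower_sidePoint (r : V → ℝ) (d : T.Face × Fin 3) (t : ℝ) :
    T.facePower r d.1 (T.sidePoint d t) =
      (1 - t) * (r (T.vertex d) ^ 2 - t ^ 2 * T.length d ^ 2) +
        t * (r (T.vertex (nextSide d)) ^ 2 - (1 - t) ^ 2 * T.length d ^ 2) := by
  rw [facePower, sum_fin3_cyclic _ d.2, bary_sidePoint_zero, bary_sidePoint_one,
    bary_sidePoint_two, dist_sidePoint_left, dist_sidePoint_right, zero_mul, add_zero]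
  rfl

lemma facePower_sidePoint_glue (r : V → ℝ) (d : T.Face × Fin 3) (t : ℝ) :
    T.facePower r d.1 (T.sidePoint d t) =
      T.facePower r (T.glue d).1 (T.sidePoint (T.glue d) (1 - t)) := by
  rw [facePower_sidePoint, facePower_sidePoint, length_glue, vertex_glue, vertex_nextSide_glue]
  ring

lemma gluingInvariant_facePower (r : V → ℝ) : T.GluingInvariant (T.facePower r) :=
  fun d t _ => T.facePower_sidePoint_glue r d t

/-- The squared distance from the apex, as a function on `M`. -/
noncomputable def power (r : V → ℝ) : M → ℝ := T.descend (T.facePower r)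

lemma power_chart (r : V → ℝ) {f : T.Face} {x : E2} (hx : x ∈ T.face f) :
    T.power r (T.chart f x) = T.facePower r f x :=
  (T.gluingInvariant_facePower r).descend_chart hx

lemma power_vertex (r : V → ℝ) (i : V) : T.power r i = r i ^ 2 := by
  obtain ⟨d, rfl⟩ := T.vertex_surjective i
  rw [← T.chart_corner d, power_chart _ _ (T.corner_mem_face _ _), facePower_corner]

lemma continuous_power (r : V → ℝ) : Continuous (T.power r) := by
  have h1 : ∀ f, ∃ D > 0, ∀ x ∈ T.face f, dist x (T.foot r f) ≤ D := by
    intro f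
    obtain ⟨D, hD⟩ := (T.isCompact_face f).isBounded.subset_closedBall (T.foot r f)
    refine ⟨max D 1, lt_max_of_lt_right one_pos, fun x hx => ?_⟩
    exact (Metric.mem_closedBall.1 (hD hx)).trans (le_max_left _ _)
  choose D hD0 hD using h1
  obtain ⟨c, hc, hcD⟩ := exists_pos_forall_le (fun f => (D f)⁻¹) (fun f => inv_pos.2 (hD0 f))
  have hle : ∀ f, D f ≤ c⁻¹ := fun f => by
    rw [le_inv_comm₀ (hD0 f) hc]; exact hcD f
  set K : NNReal := ⟨2 * c⁻¹, by positivity⟩ with hK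
  have hK0 : (K : ℝ≥0∞) ≠ 0 := by
    rw [ENNReal.coe_ne_zero]
    intro h
    have : (2 * c⁻¹ : ℝ) = 0 := congrArg NNReal.toReal h
    have : 0 < 2 * c⁻¹ := by positivity
    linarith
  have hlip := (T.gluingInvariant_facePower r).lipschitz_descend (K := K) (fun f x hx y hy => by
    rw [facePower_eq_foot, facePower_eq_foot, edist_dist, edist_dist, ← ENNReal.ofReal_coe_nnreal,
      ← ENNReal.ofReal_mul (show (0 : ℝ) ≤ (K : ℝ) from K.2)]
    apply ENNReal.ofReal_le_ofReal
    change _ ≤ 2 * c⁻¹ * dist x y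
    rw [Real.dist_eq]
    set a := dist x (T.foot r f)
    set b := dist y (T.foot r f)
    have ha : a ≤ c⁻¹ := (hD f x hx).trans (hle f)
    have hb : b ≤ c⁻¹ := (hD f y hy).trans (hle f)
    have hab : |a - b| ≤ dist x y := abs_dist_sub_le _ _ _
    have ha0 : 0 ≤ a := dist_nonneg
    have hb0 : 0 ≤ b := dist_nonneg
    have : a ^ 2 + T.heightSq r f - (b ^ 2 + T.heightSq r f) = (a + b) * (a - b) := by ring
    rw [this, abs_mul, abs_of_nonneg (by linarith)]
    have hcpos : 0 < c⁻¹ := by positivity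
    exact mul_le_mul (by linarith) hab (abs_nonneg _) (by linarith)) hK0 ENNReal.coe_ne_top
  exact (LipschitzWith.continuous (K := K) hlip)

/-- The signed distance of the foot of the altitude from a side of the base triangle; it is
positive if the foot is on the same side as the triangle. -/
noncomputable def footDist (r : V → ℝ) (d : T.Face × Fin 3) : ℝ :=
  T.bary d.1 (d.2 + 2) (T.foot r d.1) / ‖T.baryGrad d.1 (d.2 + 2)‖

lemma dist_sq_sub_dist_sq (x y p q : E2) :
    (dist x p ^ 2 - dist x q ^ 2) - (dist y p ^ 2 - dist y q ^ 2) =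
      2 * inner ℝ (q - p) (x - y) := by
  simp only [dist_eq_norm, norm_sub_sq_real, inner_sub_left, inner_sub_right,
    real_inner_comm p x, real_inner_comm p y, real_inner_comm q x, real_inner_comm q y]
  ring

/-- The two functions of adjacent triangles, in the unfolded plane, differ by an affine function
that vanishes along the common side, and the sign of which is given by the position of the feet. -/
lemma facePower_sub_unfold (r : V → ℝ) (d : T.Face × Fin 3) (y : E2) :
    T.facePower r d.1 y - T.facePower r (T.glue d).1 ((T.unfold d).symm y) =
      -2 * (T.footDist r d + T.footDist r (T.glue d)) / ‖T.baryGrad d.1 (d.2 + 2)‖ *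
        T.bary d.1 (d.2 + 2) y := by
  set τ := T.unfold d with hτ
  set g := T.baryGrad d.1 (d.2 + 2) with hg
  set g' := T.baryGrad (T.glue d).1 ((T.glue d).2 + 2) with hg'
  set p1 := T.foot r d.1 with hp1
  set p2 := T.foot r (T.glue d).1 with hp2
  obtain ⟨κ, hκ, hb⟩ := T.exists_bary_unfold d
  have hgpos : 0 < ‖g‖ := norm_pos_iff.2 (T.baryGrad_ne_zero _ _)
  have hg'pos : 0 < ‖g'‖ := norm_pos_iff.2 (T.baryGrad_ne_zero _ _)
  set F : E2 → ℝ := fun y => T.facePower r d.1 y - T.facePower r (T.glue d).1 (τ.symm y) with hF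
  have hFe : ∀ y, F y = (dist y p1 ^ 2 - dist y (τ p2) ^ 2) +
      (T.heightSq r d.1 - T.heightSq r (T.glue d).1) := by
    intro y
    have h1 : dist (τ.symm y) p2 = dist y (τ p2) := by
      rw [← τ.dist_map, AffineIsometryEquiv.apply_symm_apply]
    simp only [hF, facePower_eq_foot, ← hp1, ← hp2, h1]; ring
  have hFsub : ∀ x y, F x - F y = 2 * inner ℝ (τ p2 - p1) (x - y) := by
    intro x y
    rw [hFe, hFe, ← dist_sq_sub_dist_sq]; ring
  have hFside : ∀ t, F (T.sidePoint d t) = 0 := by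
    intro t
    simp only [hF]
    rw [T.unfold_symm_sidePoint, facePower_sidePoint_glue, sub_self]
  set m := F (T.corner d.1 (d.2 + 2)) with hm
  -- an affine function that vanishes on the side is a multiple of the barycentric coordinate
  have hFm : ∀ y, F y = m * T.bary d.1 (d.2 + 2) y := by
    intro y
    have h0 := hFside 0
    have h1 := hFside 1
    rw [sidePoint_zero] at h0
    rw [sidePoint_one] at h1
    have hs := T.sum_bary_smul d.1 y
    have hs1 := T.sum_bary_cyclic d.1 d.2 y
    rw [sum_fin3_cyclic _ d.2] at hs
    set A := T.bary d.1 d.2 y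
    set B := T.bary d.1 (d.2 + 1) y
    set C := T.bary d.1 (d.2 + 2) y
    set c0 := T.corner d.1 d.2
    set c1 := T.corner d.1 (d.2 + 1)
    set c2 := T.corner d.1 (d.2 + 2)
    have e1 := hFsub y c0
    have e2 := hFsub c1 c0
    have e3 := hFsub c2 c0
    have hA : A = 1 - B - C := by linarith
    have hy : y - c0 = B • (c1 - c0) + C • (c2 - c0) := by
      rw [← hs, hA]; module
    rw [hy, inner_add_right, inner_smul_right, inner_smul_right] at e1
    rw [h1, h0] at e2
    rw [h0, ← hm] at e3
    rw [h0] at e1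
    have hX : inner ℝ (τ p2 - p1) (c1 - c0) = (0 : ℝ) := by linarith
    have hY : m = 2 * inner ℝ (τ p2 - p1) (c2 - c0) := by linarith
    rw [hX] at e1
    rw [hY]
    linarith
  have hgrad : (2 : ℝ) • (τ p2 - p1) = m • g := by
    apply ext_inner_right ℝ
    intro v
    have h1 := hFsub (0 + v) 0
    rw [hFm, hFm, ← mul_sub, T.bary_sub, add_sub_cancel_left] at h1
    rw [inner_smul_left, inner_smul_left]
    simpa using h1.symm
  have hgg' : κ * ‖g‖ = ‖g'‖ := by
    -- the differential of the barycentric coordinate in the unfolded plane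
    have h1 : τ.linearIsometryEquiv g' = -κ • g := by
      apply ext_inner_right ℝ
      intro v
      have h2 : inner ℝ (τ.linearIsometryEquiv g') v = inner ℝ g' (τ.linearIsometryEquiv.symm v) := by
        rw [← τ.linearIsometryEquiv.symm.inner_map_map,
          LinearIsometryEquiv.symm_apply_apply]
      have h3 : τ.symm (0 + v) - τ.symm 0 = τ.linearIsometryEquiv.symm v := by
        have h4 := τ.symm.map_vsub (0 + v) 0
        have h5 : τ.symm (0 + v) - τ.symm 0 = τ.symm.linearIsometryEquiv v := by
          simpa using h4.symm
        exact h5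
      rw [h2, ← h3, ← T.bary_sub, hb, hb, ← mul_sub, T.bary_sub, add_sub_cancel_left,
        inner_smul_left]
      simp
      exact Or.inl rfl
    have := congrArg norm h1
    rw [LinearIsometryEquiv.norm_map, norm_smul, norm_neg, Real.norm_of_nonneg hκ.le] at this
    exact this.symm
  have hb2 := hb (τ p2)
  rw [hτ, AffineIsometryEquiv.symm_apply_apply, ← hτ] at hb2
  have hs1 : T.footDist r d = T.bary d.1 (d.2 + 2) p1 / ‖g‖ := rfl
  have hs2 : T.footDist r (T.glue d) = T.bary (T.glue d).1 ((T.glue d).2 + 2) p2 / ‖g'‖ := rfl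
  have hdiff : 2 * (T.bary d.1 (d.2 + 2) (τ p2) - T.bary d.1 (d.2 + 2) p1) = m * ‖g‖ ^ 2 := by
    rw [T.bary_sub, ← hg, ← real_inner_self_eq_norm_sq, ← inner_smul_right,
      ← inner_smul_right, hgrad]
  change F y = _
  rw [hFm, hs1, hs2, hb2, ← hgg']
  have : m = 2 * (T.bary d.1 (d.2 + 2) (τ p2) - T.bary d.1 (d.2 + 2) p1) / ‖g‖ ^ 2 := by
    rw [hdiff]; field_simp
  rw [this]
  field_simp
  ring

end GeodesicTriangulation
/-- A continuous function on an interval that is midpoint concave near each interior point lies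
above its chord. -/
lemma chord_le_of_locally_midpoint_concave {φ : ℝ → ℝ} (hc : ContinuousOn φ (Set.Icc 0 1))
    (h : ∀ s ∈ Set.Ioo (0 : ℝ) 1, ∃ δ > 0, ∀ η, 0 < η → η < δ → φ (s - η) + φ (s + η) ≤ 2 * φ s)
    {s : ℝ} (hs : s ∈ Set.Icc (0 : ℝ) 1) : (1 - s) * φ 0 + s * φ 1 ≤ φ s := by
  set ψ : ℝ → ℝ := fun s => φ s - ((1 - s) * φ 0 + s * φ 1) with hψ
  have hψc : ContinuousOn ψ (Set.Icc 0 1) := hc.sub (by fun_prop)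
  obtain ⟨m, hm, hmin⟩ := isCompact_Icc.exists_isMinOn ⟨0, by simp⟩ hψc
  by_contra! hlt
  have hneg : ψ m < 0 := by
    have : ψ m ≤ ψ s := hmin hs
    have : ψ s < 0 := by simp only [hψ]; linarith
    linarith
  -- the last minimum point of the difference cannot be an interior point
  set Z : Set ℝ := {t ∈ Set.Icc (0 : ℝ) 1 | ψ t = ψ m} with hZ
  have hZc : IsCompact Z := by
    have h1 : IsClosed Z := by
      have := hψc.preimage_isClosed_of_isClosed isClosed_Icc (isClosed_singleton (x := ψ m))
      exact this
    exact isCompact_Icc.of_isClosed_subset h1 (fun t ht => ht.1)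
  have hZn : Z.Nonempty := ⟨m, hm, rfl⟩
  set t := sSup Z with ht
  have htZ : t ∈ Z := hZc.sSup_mem hZn
  have h0 : ψ 0 = 0 := by simp [hψ]
  have h1 : ψ 1 = 0 := by simp [hψ]
  have ht0 : t ≠ 0 := by
    intro h; have := htZ.2; rw [h, h0] at this; linarith
  have ht1 : t ≠ 1 := by
    intro h; have := htZ.2; rw [h, h1] at this; linarith
  have htI : t ∈ Set.Ioo (0 : ℝ) 1 :=
    ⟨lt_of_le_of_ne htZ.1.1 (Ne.symm ht0), lt_of_le_of_ne htZ.1.2 ht1⟩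
  obtain ⟨δ, hδ, hη⟩ := h t htI
  obtain ⟨η, hη0, hη1⟩ := exists_between (show 0 < min δ (min t (1 - t)) from
    lt_min hδ (lt_min htI.1 (by linarith [htI.2])))
  rw [lt_min_iff, lt_min_iff] at hη1
  have e1 := hη η hη0 hη1.1
  have e2 : ψ m ≤ ψ (t - η) := hmin ⟨by linarith, by linarith⟩
  have e3 : ψ m < ψ (t + η) := by
    have hI : t + η ∈ Set.Icc (0 : ℝ) 1 := ⟨by linarith, by linarith⟩
    refine lt_of_le_of_ne (hmin hI) fun he => ?_
    have : t + η ≤ t := le_csSup hZc.bddAbove ⟨hI, he.symm⟩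
    linarith
  have e4 : ψ t = ψ m := htZ.2
  simp only [hψ] at e2 e3 e4
  nlinarith

namespace GeodesicTriangulation

variable {M : Type*} [MetricSpace M] {V : Finset M} (T : GeodesicTriangulation M V)

/-! ### Comparison of triangulations -/

/-- The function `power` is concave, up to the squared distance, across all edges. -/
def PowerConcave (r : V → ℝ) : Prop := ∀ d, 0 ≤ T.footDist r d + T.footDist r (T.glue d)

lemma exists_flatDisc_interior_power (r : V → ℝ) {f : T.Face} {x : E2}
    (hx : ∀ k, 0 < T.bary f k x) :
    ∃ ρ, ∃ Φ : E2 → M, IsFlatDisc (T.chart f x) ρ Φ ∧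
      ∀ u, ‖u‖ < ρ → T.power r (Φ u) = T.facePower r f (x + u) := by
  obtain ⟨ρ, Φ, h1, h2⟩ := T.exists_flatDisc_interior hx
  refine ⟨ρ, Φ, h1, fun u hu => ?_⟩
  rw [(h2 u hu).2, T.power_chart r (T.mem_face_iff.2 fun k => ((h2 u hu).1 k).le)]

/-- Near a point of an edge, the function `power` is the minimum of the functions of the two
adjacent triangles. -/
lemma exists_flatDisc_side_power {r : V → ℝ} (hr : T.PowerConcave r) (d : T.Face × Fin 3) {t : ℝ}
    (ht : t ∈ Set.Ioo (0 : ℝ) 1) :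
    ∃ ρ, ∃ Φ : E2 → M, IsFlatDisc (T.chart d.1 (T.sidePoint d t)) ρ Φ ∧
      ∀ u, ‖u‖ < ρ →
        (0 ≤ T.bary d.1 (d.2 + 2) (T.sidePoint d t + u) →
          Φ u = T.chart d.1 (T.sidePoint d t + u)) ∧
        T.power r (Φ u) = min (T.facePower r d.1 (T.sidePoint d t + u))
          (T.facePower r (T.glue d).1 ((T.unfold d).symm (T.sidePoint d t + u))) := by
  obtain ⟨ρ, Φ, h1, h2⟩ := T.exists_flatDisc_side d ht
  refine ⟨ρ, Φ, h1, fun u hu => ⟨fun h => ((h2 u hu).1 h).2, ?_⟩⟩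
  have hF := T.facePower_sub_unfold r d (T.sidePoint d t + u)
  have hg : 0 < ‖T.baryGrad d.1 (d.2 + 2)‖ := norm_pos_iff.2 (T.baryGrad_ne_zero _ _)
  have hc : -2 * (T.footDist r d + T.footDist r (T.glue d)) / ‖T.baryGrad d.1 (d.2 + 2)‖ ≤ 0 :=
    div_nonpos_of_nonpos_of_nonneg (by linarith [hr d]) hg.le
  rcases le_total 0 (T.bary d.1 (d.2 + 2) (T.sidePoint d t + u)) with h | h
  · obtain ⟨e1, e2⟩ := (h2 u hu).1 h
    rw [e2, T.power_chart r e1, min_eq_left]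
    have := mul_nonpos_of_nonpos_of_nonneg hc h
    linarith
  · obtain ⟨e1, e2⟩ := (h2 u hu).2 h
    rw [e2, T.power_chart r e1, min_eq_right]
    have := mul_nonneg_of_nonpos_of_nonpos hc h
    linarith

lemma facePower_unfold (r : V → ℝ) (d : T.Face × Fin 3) (y : E2) :
    T.facePower r (T.glue d).1 ((T.unfold d).symm y) =
      dist y (T.unfold d (T.foot r (T.glue d).1)) ^ 2 + T.heightSq r (T.glue d).1 := by
  rw [facePower_eq_foot, ← (T.unfold d).dist_map, AffineIsometryEquiv.apply_symm_apply]

/-- In a flat disc, the function `power` is the minimum of two squared distances from points in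
space. -/
lemma exists_power_eq_min {r : V → ℝ} (hr : T.PowerConcave r) {p : M} (hp : p ∉ V) {ρ : ℝ}
    {Φ : E2 → M} (hΦ : IsFlatDisc p ρ Φ) :
    ∃ ε > 0, ε ≤ ρ ∧ ∃ p₁ p₂ : E2, ∃ c₁ c₂ : ℝ, ∀ u, ‖u‖ < ε →
      T.power r (Φ u) = min (dist u p₁ ^ 2 + c₁) (dist u p₂ ^ 2 + c₂) := by
  have key : ∃ ρ' Φ', IsFlatDisc p ρ' Φ' ∧ ∃ p₁ p₂ : E2, ∃ c₁ c₂ : ℝ, ∀ u, ‖u‖ < ρ' →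
      T.power r (Φ' u) = min (dist u p₁ ^ 2 + c₁) (dist u p₂ ^ 2 + c₂) := by
    have hsub : ∀ x u q : E2, dist (x + u) q = dist u (q - x) := by
      intro x u q; rw [dist_eq_norm, dist_eq_norm]; congr 1; abel
    obtain ⟨f, x, hx, rfl⟩ := T.exists_rep p
    rcases T.interior_or_side hx hp with h | ⟨k, t, ht, rfl⟩
    · obtain ⟨ρ', Φ', h1, h2⟩ := T.exists_flatDisc_interior_power r h
      refine ⟨ρ', Φ', h1, T.foot r f - x, T.foot r f - x, T.heightSq r f, T.heightSq r f,
        fun u hu => ?_⟩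
      rw [h2 u hu, facePower_eq_foot, min_self, hsub]
    · obtain ⟨ρ', Φ', h1, h2⟩ := T.exists_flatDisc_side_power hr (f, k) ht
      refine ⟨ρ', Φ', h1, T.foot r f - T.sidePoint (f, k) t,
        T.unfold (f, k) (T.foot r (T.glue (f, k)).1) - T.sidePoint (f, k) t, T.heightSq r f,
        T.heightSq r (T.glue (f, k)).1, fun u hu => ?_⟩
      rw [(h2 u hu).2, facePower_unfold, facePower_eq_foot, ← hsub, ← hsub]
  obtain ⟨ρ', Φ', h1, p₁, p₂, c₁, c₂, h2⟩ := key
  obtain ⟨L, hL⟩ := h1.exists_linearIsometry hΦ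
  refine ⟨min ρ ρ', lt_min hΦ.pos h1.pos, min_le_left _ _, L.symm p₁, L.symm p₂, c₁, c₂,
    fun u hu => ?_⟩
  rw [lt_min_iff] at hu
  have hd : ∀ q, dist (L u) q = dist u (L.symm q) := by
    intro q
    rw [← L.dist_map u, LinearIsometryEquiv.apply_symm_apply]
  rw [hL u hu.2 hu.1, h2 _ (by rw [L.norm_map]; exact hu.2), hd, hd]

lemma power_midpoint_concave {r : V → ℝ} (hr : T.PowerConcave r) {p : M} (hp : p ∉ V) {ρ : ℝ}
    {Φ : E2 → M} (hΦ : IsFlatDisc p ρ Φ) :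
    ∃ ε > 0, ∀ u, ‖u‖ < ε →
      T.power r (Φ u) + T.power r (Φ (-u)) ≤ 2 * T.power r (Φ 0) + 2 * ‖u‖ ^ 2 := by
  obtain ⟨ε, hε, -, p₁, p₂, c₁, c₂, h⟩ := T.exists_power_eq_min hr hp hΦ
  refine ⟨ε, hε, fun u hu => ?_⟩
  have hsum : ∀ q : E2, dist u q ^ 2 + dist (-u) q ^ 2 = 2 * dist 0 q ^ 2 + 2 * ‖u‖ ^ 2 := by
    intro q
    rw [dist_eq_norm, dist_eq_norm, dist_eq_norm, norm_sub_sq_real, norm_sub_sq_real,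
      inner_neg_left, norm_neg, zero_sub, norm_neg]
    ring
  rw [h u hu, h (-u) (by rwa [norm_neg]), h 0 (by simpa using hε)]
  have h1 := hsum p₁
  have h2 := hsum p₂
  rcases min_cases (dist (0 : E2) p₁ ^ 2 + c₁) (dist (0 : E2) p₂ ^ 2 + c₂) with ⟨h3, -⟩ | ⟨h3, -⟩
  · rw [h3]
    have := min_le_left (dist u p₁ ^ 2 + c₁) (dist u p₂ ^ 2 + c₂)
    have := min_le_left (dist (-u) p₁ ^ 2 + c₁) (dist (-u) p₂ ^ 2 + c₂)
    linarith
  · rw [h3]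
    have := min_le_right (dist u p₁ ^ 2 + c₁) (dist u p₂ ^ 2 + c₂)
    have := min_le_right (dist (-u) p₁ ^ 2 + c₁) (dist (-u) p₂ ^ 2 + c₂)
    linarith

lemma lineMap_ne_corner {f : T.Face} {x y : E2} (hx : x ∈ T.face f) (hy : y ∈ T.face f)
    (hxy : x ≠ y) {s : ℝ} (hs : s ∈ Set.Ioo (0 : ℝ) 1) (k : Fin 3) :
    (AffineMap.lineMap x y s : E2) ≠ T.corner f k := by
  intro h
  have hb : ∀ l, (1 - s) * T.bary f l x + s * T.bary f l y = if l = k then 1 else 0 := by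
    intro l
    rw [← T.bary_corner, ← h, AffineMap.apply_lineMap, AffineMap.lineMap_apply_module]
    simp
  rw [mem_face_iff] at hx hy
  have hz : ∀ l, l ≠ k → T.bary f l x = 0 ∧ T.bary f l y = 0 := by
    intro l hl
    have := hb l
    rw [if_neg hl] at this
    have h1 := mul_nonneg (by linarith [hs.2] : 0 ≤ 1 - s) (hx l)
    have h2 := mul_nonneg hs.1.le (hy l)
    have h3 : (1 - s) * T.bary f l x = 0 := by linarith
    have h4 : s * T.bary f l y = 0 := by linarith
    rcases mul_eq_zero.1 h3 with h5 | h5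
    · linarith [hs.2]
    rcases mul_eq_zero.1 h4 with h6 | h6
    · linarith [hs.1]
    exact ⟨h5, h6⟩
  apply hxy
  refine T.bary_ext (f := f) ((fin3_forall k).2 ?_)
  have n1 : k + 1 ≠ k := by clear h hb hz; revert k; decide
  have n2 : k + 2 ≠ k := by clear h hb hz; revert k; decide
  have z1 := hz _ n1
  have z2 := hz _ n2
  have s1 := T.sum_bary_cyclic f k x
  have s2 := T.sum_bary_cyclic f k y
  refine ⟨by linarith [z1.1, z1.2, z2.1, z2.2], by rw [z1.1, z1.2], by rw [z2.1, z2.2]⟩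

lemma chart_lineMap_notMem {f : T.Face} {x y : E2} (hx : x ∈ T.face f) (hy : y ∈ T.face f)
    (hxy : x ≠ y) {s : ℝ} (hs : s ∈ Set.Ioo (0 : ℝ) 1) :
    T.chart f (AffineMap.lineMap x y s) ∉ V := by
  rw [T.chart_mem_iff ((T.convex_face f).lineMap_mem hx hy ⟨hs.1.le, hs.2.le⟩)]
  rintro ⟨k, hk⟩
  exact T.lineMap_ne_corner hx hy hxy hs k hk

lemma continuousOn_chart (f : T.Face) : ContinuousOn (T.chart f) (T.face f) := by
  have : LipschitzOnWith 1 (T.chart f) (T.face f) := by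
    intro x hx y hy
    simpa using T.edist_chart_le hx hy
  exact this.continuousOn

/-- The function of a convex polytope is the largest one: it is at least the function of any other
triangulation with the same radii.  On a triangle of the other triangulation, the function of the
polytope minus the squared distance from the origin of the plane is concave, the other function
minus the same quantity is affine, and the two agree at the corners. -/
lemma facePower_le_power {r : V → ℝ} (hr : T.PowerConcave r) (T' : GeodesicTriangulation M V)
    {f : T'.Face} {x : E2} (hx : x ∈ T'.face f) :
    T'.facePower r f x ≤ T.power r (T'.chart f x) := by
  set g : E2 → ℝ := fun x => T.power r (T'.chart f x) - ‖x‖ ^ 2 with hg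
  have hgc : ContinuousOn g (T'.face f) :=
    ((T.continuous_power r).comp_continuousOn (T'.continuousOn_chart f)).sub (by fun_prop)
  have hconc : ConcaveOn ℝ (T'.face f) g := by
    refine ⟨T'.convex_face f, fun x hx y hy a b ha hb hab => ?_⟩
    have hmem : ∀ s ∈ Set.Icc (0 : ℝ) 1, (AffineMap.lineMap x y s : E2) ∈ T'.face f :=
      fun s hs => (T'.convex_face f).lineMap_mem hx hy hs
    have key := chord_le_of_locally_midpoint_concave
      (φ := fun s => g (AffineMap.lineMap x y s)) ?_ ?_ (s := b) ⟨hb, by linarith⟩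
    · simp only [AffineMap.lineMap_apply_zero, AffineMap.lineMap_apply_one] at key
      have ha' : a = 1 - b := by linarith
      rw [AffineMap.lineMap_apply_module] at key
      rw [ha', smul_eq_mul, smul_eq_mul]
      exact key
    · exact hgc.comp AffineMap.lineMap_continuous.continuousOn hmem
    · intro s hs
      by_cases hxy : x = y
      · subst hxy
        refine ⟨1, one_pos, fun η _ _ => ?_⟩
        simp only [AffineMap.lineMap_same, AffineMap.const_apply]
        linarith
      set z : E2 := AffineMap.lineMap x y s with hz
      have hzV := T'.chart_lineMap_notMem hx hy hxy hs
      rw [← hz] at hzV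
      have hzf : z ∈ T'.face f := hmem s ⟨hs.1.le, hs.2.le⟩
      obtain ⟨ρ, Φ, hΦ⟩ := T.exists_flatDisc hzV
      obtain ⟨L, ε1, hε1, hερ, hL⟩ := T'.exists_linearIsometry_chart hzf hzV hΦ
      obtain ⟨ε2, hε2, hmid⟩ := T.power_midpoint_concave hr hzV hΦ
      have hv : 0 < ‖y - x‖ := norm_pos_iff.2 (sub_ne_zero.2 (Ne.symm hxy))
      refine ⟨min (min s (1 - s)) (min ε1 ε2 / ‖y - x‖), lt_min (lt_min hs.1 (by linarith [hs.2]))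
        (div_pos (lt_min hε1 hε2) hv), fun η hη0 hη => ?_⟩
      rw [lt_min_iff, lt_min_iff, lt_div_iff₀ hv, lt_min_iff] at hη
      set u := η • (y - x) with hu
      have hun : ‖u‖ = η * ‖y - x‖ := by rw [hu, norm_smul, Real.norm_of_nonneg hη0.le]
      have e1 : (AffineMap.lineMap x y (s + η) : E2) = z + u := by
        rw [hz, hu, AffineMap.lineMap_apply_module', AffineMap.lineMap_apply_module']; module
      have e2 : (AffineMap.lineMap x y (s - η) : E2) = z + -u := by
        rw [hz, hu, AffineMap.lineMap_apply_module', AffineMap.lineMap_apply_module']; module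
      have m1 : z + u ∈ T'.face f := e1 ▸ hmem _ ⟨by linarith, by linarith⟩
      have m2 : z + -u ∈ T'.face f := e2 ▸ hmem _ ⟨by linarith, by linarith⟩
      have h0 := hL 0 (by simpa using hε1) (by simpa using hzf)
      have h1 := hL u (by rw [hun]; exact hη.2.1) m1
      have h2 := hL (-u) (by rw [norm_neg, hun]; exact hη.2.1) m2
      rw [map_zero, add_zero] at h0
      rw [map_neg] at h2
      have h3 := hmid (L u) (by rw [L.norm_map, hun]; exact hη.2.2)
      rw [L.norm_map] at h3
      simp only [hg, e1, e2, h1, h2]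
      rw [h0]
      have h4 := norm_add_sq_real z u
      have h5 := norm_add_sq_real z (-u)
      rw [inner_neg_right, norm_neg] at h5
      linarith
  have hJ := hconc.le_map_sum (t := Finset.univ) (w := fun k => T'.bary f k x)
    (p := fun k => T'.corner f k) (fun k _ => T'.mem_face_iff.1 hx k) (T'.sum_bary f x)
    (fun k _ => T'.corner_mem_face f k)
  rw [T'.sum_bary_smul] at hJ
  have hgcorner : ∀ k, g (T'.corner f k) = r (T'.vertex (f, k)) ^ 2 - ‖T'.corner f k‖ ^ 2 := by
    intro k
    simp only [hg]
    rw [T'.chart_corner (f, k), power_vertex]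
  simp only [hgcorner, smul_eq_mul] at hJ
  rw [facePower_eq]
  simp only [hg] at hJ
  linarith

lemma power_le_power {r : V → ℝ} (hr : T.PowerConcave r) (T' : GeodesicTriangulation M V) (p : M) :
    T'.power r p ≤ T.power r p := by
  obtain ⟨f, x, hx, rfl⟩ := T'.exists_rep p
  rw [T'.power_chart r hx]
  exact T.facePower_le_power hr T' hx

lemma continuous_facePower (f : T.Face) (x : E2) : Continuous fun r => T.facePower r f x := by
  unfold facePower
  fun_prop

/-- Two triangulations define the same function on `M` if both functions are concave up to the
squared distance; for one of them, it suffices that this holds for radii close to the given ones,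
since the comparison of the two functions passes to limits. -/
lemma power_eq_power_of_mem_closure {r : V → ℝ} (hr : T.PowerConcave r)
    (T' : GeodesicTriangulation M V) (hr' : r ∈ closure {r' | T'.PowerConcave r'}) :
    T'.power r = T.power r := by
  funext p
  refine le_antisymm (T.power_le_power hr T' p) ?_
  obtain ⟨f, x, hx, hp⟩ := T.exists_rep p
  obtain ⟨f', x', hx', hp'⟩ := T'.exists_rep p
  have hcl : IsClosed {r' : V → ℝ | T.facePower r' f x ≤ T'.facePower r' f' x'} :=
    isClosed_le (T.continuous_facePower f x) (T'.continuous_facePower f' x')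
  have hsub : {r' | T'.PowerConcave r'} ⊆
      {r' : V → ℝ | T.facePower r' f x ≤ T'.facePower r' f' x'} := by
    intro r' h
    have := T'.facePower_le_power h T hx
    rw [hp, ← hp', T'.power_chart r' hx'] at this
    exact this
  have := hcl.closure_subset_iff.2 hsub hr'
  rw [← hp, T.power_chart r hx]
  rw [hp, ← hp', T'.power_chart r hx']
  exact this

/-! ### The itinerary of a straight curve through the triangles -/

/-- From the parameter `a` on, for a while, the curve `γ` is the straight line in the triangle `f`
with initial point `x` and velocity `v`. -/
def Follows (γ : ℝ → M) (f : T.Face) (x v : E2) (a : ℝ) : Prop :=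
  ∃ δ > 0, ∀ s ∈ Set.Ioo (0 : ℝ) δ, x + s • v ∈ T.face f ∧ γ (a + s) = T.chart f (x + s • v)

/-- A curve with parameter in `[0, 1]` that is straight in the complement of the vertices and ends
at a vertex. -/
structure IsStraightCurve (V : Finset M) (γ : ℝ → M) : Prop where
  straightAt : ∀ t ∈ Set.Ioo (0 : ℝ) 1, StraightAt γ t
  notMem : ∀ t ∈ Set.Ioo (0 : ℝ) 1, γ t ∉ V
  continuousOn : ContinuousOn γ (Set.Icc 0 1)
  end_mem : γ 1 ∈ V

lemma isStraightCurve_edgeCurve (d : T.Face × Fin 3) : IsStraightCurve V (T.edgeCurve d) where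
  straightAt t ht := T.straightAt_edgeCurve d ht
  notMem t ht := T.chart_sidePoint_notMem d ht
  continuousOn := by
    refine (T.continuousOn_chart d.1).comp ?_ fun t ht => T.sidePoint_mem_face d ht
    exact (AffineMap.lineMap_continuous).continuousOn
  end_mem := by
    rw [edgeCurve, sidePoint_one]
    have := T.chart_corner (nextSide d)
    change T.chart d.1 (T.corner d.1 (d.2 + 1)) = _ at this
    rw [this]
    exact (T.vertex _).2

lemma add_smul_mem_face {f : T.Face} {x v : E2} {s₁ s₂ s : ℝ} (h1 : x + s₁ • v ∈ T.face f)
    (h2 : x + s₂ • v ∈ T.face f) (hs : s ∈ Set.Icc s₁ s₂) : x + s • v ∈ T.face f := by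
  rw [mem_face_iff] at *
  intro k
  have e1 := h1 k
  have e2 := h2 k
  rw [bary_add, inner_smul_right] at *
  rcases le_total 0 (inner ℝ (T.baryGrad f k) v) with h | h
  · have := mul_le_mul_of_nonneg_right hs.1 h; linarith
  · have := mul_le_mul_of_nonpos_right hs.2 h; linarith

lemma chart_add_smul_notMem {f : T.Face} {x v : E2} (hv : v ≠ 0) {s₁ s₂ s : ℝ}
    (h1 : x + s₁ • v ∈ T.face f) (h2 : x + s₂ • v ∈ T.face f) (hs : s ∈ Set.Ioo s₁ s₂) :
    T.chart f (x + s • v) ∉ V := by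
  have h12 : 0 < s₂ - s₁ := by linarith [hs.1, hs.2]
  have hne : x + s₁ • v ≠ x + s₂ • v := by
    intro h
    have h3 : (s₂ - s₁) • v = 0 := by
      rw [sub_smul, sub_eq_zero]; exact (add_left_cancel h).symm
    rcases smul_eq_zero.1 h3 with h4 | h4
    · linarith
    · exact hv h4
  have := T.chart_lineMap_notMem h1 h2 hne (s := (s - s₁) / (s₂ - s₁))
    ⟨div_pos (by linarith [hs.1]) h12, by rw [div_lt_one h12]; linarith [hs.2]⟩
  have he : (AffineMap.lineMap (x + s₁ • v) (x + s₂ • v) ((s - s₁) / (s₂ - s₁)) : E2) =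
      x + s • v := by
    rw [AffineMap.lineMap_apply_module', add_sub_add_left_eq_sub, ← sub_smul, smul_smul,
      div_mul_cancel₀ _ h12.ne']
    module
  rwa [he] at this

lemma straightAt_chart_of_mem {f : T.Face} {x v : E2} (hv : v ≠ 0) {s₁ s₂ s : ℝ}
    (h1 : x + s₁ • v ∈ T.face f) (h2 : x + s₂ • v ∈ T.face f) (hs : s ∈ Set.Ioo s₁ s₂) :
    StraightAt (fun s => T.chart f (x + s • v)) s := by
  refine T.straightAt_chart (δ := min (s - s₁) (s₂ - s))
    (lt_min (by linarith [hs.1]) (by linarith [hs.2])) (fun u hu => ?_)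
    (T.chart_add_smul_notMem hv h1 h2 hs)
  rw [lt_min_iff, abs_lt, abs_lt] at hu
  exact T.add_smul_mem_face h1 h2 ⟨by linarith, by linarith⟩

/-- A straight curve follows a line in a triangle as long as the line stays in the triangle. -/
lemma Follows.eq_chart {T : GeodesicTriangulation M V} {γ : ℝ → M} (hγ : IsStraightCurve V γ)
    {f : T.Face} {x v : E2} {a : ℝ} (h : T.Follows γ f x v a) (hv : v ≠ 0) (ha : 0 ≤ a)
    (hx : x ∈ T.face f) {σ : ℝ} (hσ0 : 0 < σ) (hσ : x + σ • v ∈ T.face f) (hσ1 : a + σ ≤ 1) :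
    ∀ s ∈ Set.Icc (0 : ℝ) σ, γ (a + s) = T.chart f (x + s • v) := by
  have hx0 : x + (0 : ℝ) • v ∈ T.face f := by simpa using hx
  have hopen : ∀ s ∈ Set.Ioo (0 : ℝ) σ, γ (1 * s + a) = T.chart f (x + s • v) := by
    obtain ⟨δ, hδ, hs⟩ := h
    obtain ⟨t₀, ht0, ht1⟩ := exists_between (lt_min hδ hσ0)
    rw [lt_min_iff] at ht1
    refine eq_of_straightAt (γ₁ := fun s => γ (1 * s + a))
      (fun s hs => (hγ.straightAt _ ⟨?_, ?_⟩).comp_affine)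
      (fun s hs => T.straightAt_chart_of_mem hv hx0 hσ hs) (t₀ := t₀) ⟨ht0, ht1.2⟩ ?_
    · linarith [hs.1]
    · linarith [hs.2]
    · filter_upwards [Ioo_mem_nhds ht0 ht1.1] with s hs'
      rw [one_mul, add_comm, (hs s hs').2]
  have hc1 : ContinuousOn (fun s => γ (a + s)) (Set.Icc 0 σ) := by
    refine hγ.continuousOn.comp (by fun_prop) fun s hs => ⟨?_, ?_⟩
    · linarith [hs.1]
    · linarith [hs.2]
  have hc2 : ContinuousOn (fun s : ℝ => T.chart f (x + s • v)) (Set.Icc 0 σ) :=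
    (T.continuousOn_chart f).comp (by fun_prop) fun s hs => T.add_smul_mem_face hx0 hσ hs
  have heq : Set.EqOn (fun s => γ (a + s)) (fun s => T.chart f (x + s • v)) (Set.Ioo 0 σ) := by
    intro s hs
    have := hopen s hs
    rw [one_mul, add_comm] at this
    exact this
  have := heq.of_subset_closure hc1 hc2 Set.Ioo_subset_Icc_self
    (by rw [closure_Ioo hσ0.ne])
  exact fun s hs => this hs

/-- A straight curve that follows a line in a triangle either ends at a corner of the triangle, or
leaves the triangle transversally through a side and follows a line in the next triangle, which is
the same line in the unfolded plane. -/
lemma Follows.exit {T : GeodesicTriangulation M V} {γ : ℝ → M} (hγ : IsStraightCurve V γ)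
    {f : T.Face} {x v : E2} {a : ℝ} (h : T.Follows γ f x v a) (hv : v ≠ 0) (ha : 0 ≤ a)
    (ha1 : a < 1) (hx : x ∈ T.face f) :
    (∃ k, x + (1 - a) • v = T.corner f k) ∨
    ∃ k t σ, t ∈ Set.Ioo (0 : ℝ) 1 ∧ 0 < σ ∧ a + σ < 1 ∧
      x + σ • v = T.sidePoint (f, k) t ∧ inner ℝ (T.baryGrad f (k + 2)) v < 0 ∧
      T.Follows γ (T.glue (f, k)).1 (T.sidePoint (T.glue (f, k)) (1 - t))
        ((T.unfold (f, k)).symm.linearIsometryEquiv v) (a + σ) := by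
  have hx0 : x + (0 : ℝ) • v ∈ T.face f := by simpa using hx
  -- the last point of the line in the triangle
  set S : Set ℝ := {s | 0 ≤ s ∧ x + s • v ∈ T.face f} with hS
  have hSc : IsCompact S := by
    refine Metric.isCompact_of_isClosed_isBounded ?_ ?_
    · exact isClosed_Ici.inter ((T.isCompact_face f).isClosed.preimage (by fun_prop))
    · obtain ⟨R, hR⟩ := (T.isCompact_face f).isBounded.subset_closedBall x
      refine (Metric.isBounded_closedBall (x := (0 : ℝ)) (r := R / ‖v‖)).subset ?_
      rintro s ⟨-, hs⟩
      have := hR hs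
      rw [Metric.mem_closedBall, dist_eq_norm, add_sub_cancel_left, norm_smul] at this
      rw [Metric.mem_closedBall, dist_zero_right, le_div_iff₀ (norm_pos_iff.2 hv)]
      exact this
  set σ := sSup S with hσ
  have hσS : σ ∈ S := hSc.sSup_mem ⟨0, le_rfl, hx0⟩
  have hσmax : ∀ s, 0 ≤ s → x + s • v ∈ T.face f → s ≤ σ :=
    fun s h0 hs => le_csSup hSc.bddAbove ⟨h0, hs⟩
  have hσ0 : 0 < σ := by
    obtain ⟨δ, hδ, hs⟩ := h
    have := hσmax (δ / 2) (by linarith) (hs (δ / 2) ⟨by linarith, by linarith⟩).1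
    linarith
  rcases lt_trichotomy (a + σ) 1 with h1 | h1 | h1
  · right
    have heq := h.eq_chart hγ hv ha hx hσ0 hσS.2 h1.le
    have hzV : T.chart f (x + σ • v) ∉ V := by
      rw [← heq σ ⟨hσ0.le, le_rfl⟩]
      exact hγ.notMem _ ⟨by linarith, h1⟩
    rcases T.interior_or_side hσS.2 hzV with hint | ⟨k, t, ht, hz⟩
    · exfalso
      -- the line could be prolonged in the interior of the triangle
      obtain ⟨ρ, Φ, h2, h3⟩ := T.exists_flatDisc_interior hint
      have hvp := norm_pos_iff.2 hv
      obtain ⟨s, hs0, hs1⟩ := exists_between (div_pos h2.pos hvp)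
      rw [lt_div_iff₀ hvp] at hs1
      have := (h3 (s • v) (by rwa [norm_smul, Real.norm_of_nonneg hs0.le])).1
      have h4 := hσmax (σ + s) (by linarith) (by
        rw [mem_face_iff]
        intro k
        have := (this k).le
        rwa [add_assoc, ← add_smul] at this)
      linarith
    obtain ⟨ρ, Φ, hΦ, hΦ2⟩ := T.exists_flatDisc_side (f, k) ht
    simp only at hΦ hΦ2
    rw [← hz] at hΦ hΦ2
    have hb0 : T.bary f (k + 2) (x + σ • v) = 0 := by
      rw [hz]; exact T.bary_sidePoint_two (f, k) t
    have hneg : inner ℝ (T.baryGrad f (k + 2)) v < 0 := by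
      by_contra! hge
      have hvp := norm_pos_iff.2 hv
      obtain ⟨s, hs0, hs1⟩ := exists_between (div_pos hΦ.pos hvp)
      rw [lt_div_iff₀ hvp] at hs1
      have h3 := ((hΦ2 (s • v) (by rwa [norm_smul, Real.norm_of_nonneg hs0.le])).1 (by
        rw [bary_add, hb0, inner_smul_right, zero_add]
        exact mul_nonneg hs0.le hge)).1
      rw [add_assoc, ← add_smul] at h3
      have h4 := hσmax (σ + s) (by linarith) h3
      linarith
    refine ⟨k, t, σ, ht, hσ0, h1, hz, hneg, ?_⟩
    -- in the flat disc around the exit point, the curve has the same velocity before and after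
    have hst := hγ.straightAt (a + σ) ⟨by linarith, h1⟩
    have hγσ := heq σ ⟨hσ0.le, le_rfl⟩
    rw [← hγσ] at hΦ
    obtain ⟨w, δ, hδ, hw⟩ := hst.exists_velocity hΦ
    have hvp : 0 < ‖v‖ := norm_pos_iff.2 hv
    have hwv : w = v := by
      obtain ⟨s, hs0, hs1⟩ := exists_between (lt_min hδ (lt_min hσ0 (div_pos hΦ.pos hvp)))
      rw [lt_min_iff, lt_min_iff, lt_div_iff₀ hvp] at hs1
      have e1 := hw (-s) (by rw [abs_neg, abs_of_pos hs0]; exact hs1.1)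
      have hn : ‖(-s) • v‖ < ρ := by
        rw [norm_smul, norm_neg, Real.norm_of_nonneg hs0.le]; exact hs1.2.2
      have e2 := ((hΦ2 ((-s) • v) hn).1 (by
        rw [bary_add, hb0, inner_smul_right, zero_add]
        nlinarith)).2
      have e3 := heq (σ - s) ⟨by linarith, by linarith⟩
      have e4 : x + σ • v + -s • v = x + (σ - s) • v := by module
      rw [e4, ← e3] at e2
      have e5 := hΦ.dist_eq _ _ e1.1 hn
      rw [← e1.2, e2, show a + σ + -s = a + (σ - s) by ring, dist_self] at e5
      exact smul_right_injective _ (neg_ne_zero.2 hs0.ne') (dist_eq_zero.1 e5.symm)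
    subst hwv
    have hsub : ∀ s : ℝ, (T.unfold (f, k)).symm (x + σ • w + s • w) =
        T.sidePoint (T.glue (f, k)) (1 - t) +
          s • (T.unfold (f, k)).symm.linearIsometryEquiv w := by
      intro s
      have := (T.unfold (f, k)).symm.map_vadd (x + σ • w) (s • w)
      rw [vadd_eq_add, vadd_eq_add, hz, T.unfold_symm_sidePoint, map_smul] at this
      rw [hz, add_comm _ (s • w), this, add_comm]
    refine ⟨min δ (ρ / ‖w‖), lt_min hδ (div_pos hΦ.pos hvp), fun s hs => ?_⟩
    have hs2 := hs.2
    rw [lt_min_iff, lt_div_iff₀ hvp] at hs2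
    have e1 := hw s (by rw [abs_of_pos hs.1]; exact hs2.1)
    have e2 := (hΦ2 (s • w) e1.1).2 (by
      rw [bary_add, hb0, inner_smul_right, zero_add]
      nlinarith [hs.1])
    rw [hsub] at e2
    exact ⟨e2.1, by rw [e1.2, e2.2]⟩
  · left
    have heq := h.eq_chart hγ hv ha hx hσ0 hσS.2 h1.le
    have h2 := heq σ ⟨hσ0.le, le_rfl⟩
    rw [h1] at h2
    have h3 := hγ.end_mem
    rw [h2, T.chart_mem_iff hσS.2] at h3
    rwa [show 1 - a = σ by linarith]
  · exfalso
    have hm : x + (1 - a) • v ∈ T.face f :=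
      T.add_smul_mem_face hx0 hσS.2 ⟨by linarith, by linarith⟩
    have heq := h.eq_chart hγ hv ha hx (by linarith : 0 < 1 - a) hm (by linarith)
    have h2 := heq (1 - a) ⟨by linarith, le_rfl⟩
    have h3 := hγ.end_mem
    rw [add_sub_cancel] at h2
    rw [h2] at h3
    exact T.chart_add_smul_notMem hv hx0 hσS.2 (s := 1 - a) ⟨by linarith, by linarith⟩ h3

end GeodesicTriangulation
open InnerProductGeometry EuclideanGeometry in
/-- A line that cuts a corner `w` with angle `∠ x w z`, from `x` to `z`: the angle with the
direction to `w` increases by the angle at `w`, and the distance from `x` to `z` is bounded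
below. -/
lemma angle_turn {w x z v : E2} {σ : ℝ} (hzw : z ≠ w) (hσ : 0 < σ)
    (hz : z = x + σ • v) :
    InnerProductGeometry.angle v (w - z) =
      InnerProductGeometry.angle v (w - x) + EuclideanGeometry.angle x w z ∧
    dist x w * Real.sin (EuclideanGeometry.angle x w z) ≤ σ * ‖v‖ ∧
    dist z w * Real.sin (EuclideanGeometry.angle x w z) ≤ σ * ‖v‖ := by
  have hsum := EuclideanGeometry.angle_add_angle_add_angle_eq_pi x hzw
  have hxz : dist x z = σ * ‖v‖ := by
    rw [hz, dist_self_add_right, norm_smul, Real.norm_of_nonneg hσ.le]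
  have e1 : EuclideanGeometry.angle z x w = InnerProductGeometry.angle v (w - x) := by
    unfold EuclideanGeometry.angle
    simp only [vsub_eq_sub, hz, add_sub_cancel_left]
    exact InnerProductGeometry.angle_smul_left_of_pos _ _ hσ
  have e2 : EuclideanGeometry.angle w z x = Real.pi - InnerProductGeometry.angle v (w - z) := by
    unfold EuclideanGeometry.angle
    have : x - z = σ • (-v) := by rw [hz]; module
    simp only [vsub_eq_sub]
    rw [this, InnerProductGeometry.angle_smul_right_of_pos _ _ hσ,
      InnerProductGeometry.angle_neg_right, InnerProductGeometry.angle_comm]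
  refine ⟨?_, ?_, ?_⟩
  · linarith
  · have h := EuclideanGeometry.law_sin z w x
    have h1 := Real.sin_le_one (EuclideanGeometry.angle x z w)
    rw [← hxz, EuclideanGeometry.angle_comm, mul_comm, dist_comm x w, h]
    exact mul_le_of_le_one_left dist_nonneg h1
  · have h := EuclideanGeometry.law_sin x w z
    have h1 := Real.sin_le_one (EuclideanGeometry.angle z x w)
    rw [← hxz, mul_comm, dist_comm z w, h, dist_comm z x]
    exact mul_le_of_le_one_left dist_nonneg h1

namespace GeodesicTriangulation

variable {M : Type*} [MetricSpace M] {V : Finset M} (T : GeodesicTriangulation M V)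

/-! ### Finiteness of the set of edges of bounded length -/

lemma corner_ne (f : T.Face) {k l : Fin 3} (h : k ≠ l) : T.corner f k ≠ T.corner f l :=
  fun he => h ((T.affineIndependent_corner f).injective he)

lemma length_pos (d : T.Face × Fin 3) : 0 < T.length d :=
  dist_pos.2 (T.corner_ne _ (by simp))

/-- The angle of a triangle at a corner. -/
noncomputable def cornerAngle (d : T.Face × Fin 3) : ℝ :=
  EuclideanGeometry.angle (T.corner d.1 (d.2 + 1)) (T.corner d.1 d.2) (T.corner d.1 (d.2 + 2))

lemma sin_cornerAngle_pos (d : T.Face × Fin 3) : 0 < Real.sin (T.cornerAngle d) := by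
  apply EuclideanGeometry.sin_pos_of_not_collinear
  rw [← affineIndependent_iff_not_collinear_set]
  have h := (T.affineIndependent_corner d.1).comp_embedding
    (⟨![d.2 + 1, d.2, d.2 + 2], by
      generalize d.2 = k; revert k; decide⟩ : Fin 3 ↪ Fin 3)
  convert! h using 1
  ext i
  fin_cases i <;> rfl

lemma cornerAngle_pos (d : T.Face × Fin 3) : 0 < T.cornerAngle d := by
  have h := T.sin_cornerAngle_pos d
  have h0 : 0 ≤ T.cornerAngle d := EuclideanGeometry.angle_nonneg _ _ _
  rcases h0.eq_or_lt with h1 | h1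
  · rw [← h1, Real.sin_zero] at h; exact absurd h (lt_irrefl _)
  · exact h1

lemma unfold_linear_sub (d : T.Face × Fin 3) (s t : ℝ) :
    (T.unfold d).symm.linearIsometryEquiv (T.sidePoint d s - T.sidePoint d t) =
      T.sidePoint (T.glue d) (1 - s) - T.sidePoint (T.glue d) (1 - t) := by
  have := (T.unfold d).symm.map_vsub (T.sidePoint d s) (T.sidePoint d t)
  rw [T.unfold_symm_sidePoint, T.unfold_symm_sidePoint] at this
  exact this

lemma inner_baryGrad_unfold (d : T.Face × Fin 3) : ∃ κ : ℝ, 0 < κ ∧ ∀ v,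
    inner ℝ (T.baryGrad (T.glue d).1 ((T.glue d).2 + 2))
      ((T.unfold d).symm.linearIsometryEquiv v) =
      - κ * inner ℝ (T.baryGrad d.1 (d.2 + 2)) v := by
  obtain ⟨κ, hκ, h⟩ := T.exists_bary_unfold d
  refine ⟨κ, hκ, fun v => ?_⟩
  have h1 := (T.unfold d).symm.map_vsub v 0
  have h2 : (T.unfold d).symm v - (T.unfold d).symm 0 =
      (T.unfold d).symm.linearIsometryEquiv v := by simpa using h1.symm
  rw [← h2, ← T.bary_sub, h, h, ← mul_sub, T.bary_sub, sub_zero]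

lemma dist_sidePoint (d : T.Face × Fin 3) (s t : ℝ) :
    dist (T.sidePoint d s) (T.sidePoint d t) = |s - t| * T.length d := by
  rw [sidePoint, sidePoint, dist_lineMap_lineMap, Real.dist_eq, length]

lemma sidePoint_sub (d : T.Face × Fin 3) (s t : ℝ) :
    T.sidePoint d s - T.sidePoint d t =
      (s - t) • (T.corner d.1 (d.2 + 1) - T.corner d.1 d.2) := by
  rw [sidePoint_eq, sidePoint_eq]; module

/-- A line that enters a triangle through the side `e` and leaves it through a different side cuts
one corner of the triangle.  The common end of the two sides is `sidePoint e β` with `β = 0` or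
`β = 1`. -/
lemma exists_turn {e : T.Face × Fin 3} {t : ℝ} (ht : t ∈ Set.Ioo (0 : ℝ) 1) {v : E2}
    {k : Fin 3} (hk : k ≠ e.2) {t' σ : ℝ} (ht' : t' ∈ Set.Ioo (0 : ℝ) 1) (hσ : 0 < σ)
    (hz : T.sidePoint e t + σ • v = T.sidePoint (e.1, k) t') {α₀ s₀ : ℝ}
    (hα₀ : ∀ d, α₀ ≤ T.cornerAngle d) (hs₀ : ∀ d, s₀ ≤ Real.sin (T.cornerAngle d)) :
    ∃ β : ℝ, (β = 0 ∨ β = 1) ∧ T.sidePoint (e.1, k) (1 - β) = T.sidePoint e β ∧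
      InnerProductGeometry.angle v (T.sidePoint e β - T.sidePoint e t) + α₀ ≤
        InnerProductGeometry.angle v (T.sidePoint e β - T.sidePoint (e.1, k) t') ∧
      dist (T.sidePoint e t) (T.sidePoint e β) * s₀ ≤ σ * ‖v‖ ∧
      dist (T.sidePoint (e.1, k) t') (T.sidePoint e β) * s₀ ≤ σ * ‖v‖ := by
  obtain ⟨f, l⟩ := e
  simp only at hk hz ⊢
  have hl := T.length_pos (f, l)
  have hl' := T.length_pos (f, k)
  have main : ∀ β : ℝ, (β = 0 ∨ β = 1) → T.sidePoint (f, k) (1 - β) = T.sidePoint (f, l) β →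
      (∃ d, EuclideanGeometry.angle (T.sidePoint (f, l) t) (T.sidePoint (f, l) β)
        (T.sidePoint (f, k) t') = T.cornerAngle d) →
      ∃ β : ℝ, (β = 0 ∨ β = 1) ∧ T.sidePoint (f, k) (1 - β) = T.sidePoint (f, l) β ∧
      InnerProductGeometry.angle v (T.sidePoint (f, l) β - T.sidePoint (f, l) t) + α₀ ≤
        InnerProductGeometry.angle v (T.sidePoint (f, l) β - T.sidePoint (f, k) t') ∧
      dist (T.sidePoint (f, l) t) (T.sidePoint (f, l) β) * s₀ ≤ σ * ‖v‖ ∧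
      dist (T.sidePoint (f, k) t') (T.sidePoint (f, l) β) * s₀ ≤ σ * ‖v‖ := by
    rintro β hβ hc ⟨d, hd⟩
    have hne2 : T.sidePoint (f, k) t' ≠ T.sidePoint (f, l) β := by
      rw [← hc, ← dist_pos, dist_sidePoint]
      refine mul_pos (abs_pos.2 ?_) hl'
      rcases hβ with rfl | rfl
      · linarith [ht'.2]
      · linarith [ht'.1]
    obtain ⟨a1, a2, a3⟩ := angle_turn hne2 hσ hz.symm
    rw [hd] at a1 a2 a3
    refine ⟨β, hβ, hc, by linarith [hα₀ d], ?_, ?_⟩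
    · exact (mul_le_mul_of_nonneg_left (hs₀ d) dist_nonneg).trans a2
    · exact (mul_le_mul_of_nonneg_left (hs₀ d) dist_nonneg).trans a3
  rcases fin3_cases l k with rfl | rfl | rfl
  · exact absurd rfl hk
  · -- the sides have the terminal corner of `e` in common
    refine main 1 (Or.inr rfl) (by rw [sub_self, sidePoint_zero, sidePoint_one])
      ⟨(f, l + 1), ?_⟩
    have h3 : l + 1 + 2 = l := by clear hz hk hl' hl main; revert l; decide
    unfold cornerAngle EuclideanGeometry.angle
    simp only [vsub_eq_sub, h3]
    have e1 : T.sidePoint (f, l) t - T.sidePoint (f, l) 1 =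
        (1 - t) • (T.corner f l - T.corner f (l + 1)) := by rw [sidePoint_sub]; module
    have e2 : T.sidePoint (f, l + 1) t' - T.sidePoint (f, l) 1 =
        t' • (T.corner f (l + 1 + 1) - T.corner f (l + 1)) := by
      have h4 : T.sidePoint (f, l) 1 = T.sidePoint (f, l + 1) 0 := by
        rw [sidePoint_zero, sidePoint_one]
      rw [h4, sidePoint_sub]; module
    rw [e1, e2, InnerProductGeometry.angle_smul_left_of_pos _ _ (by linarith [ht.2]),
      InnerProductGeometry.angle_smul_right_of_pos _ _ ht'.1, InnerProductGeometry.angle_comm]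
  · -- the sides have the initial corner of `e` in common
    have h3 : l + 2 + 1 = l := by clear hz hk hl' hl main; revert l; decide
    refine main 0 (Or.inl rfl) (by rw [sub_zero, sidePoint_zero, sidePoint_one]; simp only [h3])
      ⟨(f, l), ?_⟩
    unfold cornerAngle EuclideanGeometry.angle
    simp only [vsub_eq_sub]
    have e1 : T.sidePoint (f, l) t - T.sidePoint (f, l) 0 =
        t • (T.corner f (l + 1) - T.corner f l) := by rw [sidePoint_sub]; module
    have e2 : T.sidePoint (f, l + 2) t' - T.sidePoint (f, l) 0 =
        (1 - t') • (T.corner f (l + 2) - T.corner f l) := by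
      have h4 : T.sidePoint (f, l) 0 = T.sidePoint (f, l + 2) 1 := by
        rw [sidePoint_zero, sidePoint_one]; simp only [h3]
      rw [h4, sidePoint_sub]
      simp only [h3]; module
    rw [e1, e2, InnerProductGeometry.angle_smul_left_of_pos _ _ ht.1,
      InnerProductGeometry.angle_smul_right_of_pos _ _ (by linarith [ht'.2])]

/-- The position of a corner in the plane of the first triangle, when a sequence of triangles is
unfolded successively across the sides in the list. -/
noncomputable def develop : List (T.Face × Fin 3) → T.Face × Fin 3 → E2
  | [], c => T.corner c.1 c.2
  | d :: L, c => T.unfold d (develop L c)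

lemma develop_exit {d : T.Face × Fin 3} {x v q : E2} {t σ a : ℝ}
    (hz : x + σ • v = T.sidePoint d t)
    (h : T.sidePoint (T.glue d) (1 - t) + (1 - (a + σ)) •
      (T.unfold d).symm.linearIsometryEquiv v = q) : x + (1 - a) • v = T.unfold d q := by
  rw [← h, ← T.unfold_symm_sidePoint]
  have h1 := (T.unfold d).symm.map_vadd (T.sidePoint d t) ((1 - (a + σ)) • v)
  rw [vadd_eq_add, vadd_eq_add, map_smul] at h1
  rw [add_comm ((T.unfold d).symm _), ← h1, AffineIsometryEquiv.apply_symm_apply, ← hz]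
  module

/-- A straight curve of bounded length passes through a bounded number of triangles.  In a sequence
of triangles around the same vertex, the angle between the curve and the direction to the vertex
increases in each step by an angle of a triangle; when the vertex changes, the curve has passed a
definite distance in the last two triangles. -/
lemma exists_itinerary_bound (ℓ₀ : ℝ) : ∃ N : ℕ, ∀ γ : ℝ → M, IsStraightCurve V γ →
    ∀ f k v, v ≠ 0 → ‖v‖ ≤ ℓ₀ → T.Follows γ f (T.corner f k) v 0 →
      ∃ L c, L.length ≤ N ∧ T.corner f k + v = T.develop L c := by
  obtain ⟨α₀, hα0, hα⟩ := exists_pos_forall_le T.cornerAngle T.cornerAngle_pos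
  obtain ⟨s₀, hs0, hs⟩ := exists_pos_forall_le _ T.sin_cornerAngle_pos
  obtain ⟨l₀, hl0, hl⟩ := exists_pos_forall_le _ T.length_pos
  obtain ⟨K, hK⟩ : ∃ K, ∀ d, T.length d * s₀ ≤ K := by
    obtain ⟨K, hK⟩ := (Set.finite_range fun d => T.length d * s₀).bddAbove
    exact ⟨K, fun d => hK ⟨d, rfl⟩⟩
  set c₀ := l₀ * s₀ with hc₀
  have hc0 : 0 < c₀ := mul_pos hl0 hs0
  -- When the vertex changes, the angle may drop by `π = C * c₀`, and the curve has passed a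
  -- distance of at least `c₀`.
  set C := Real.pi / c₀ with hC
  have hC0 : 0 < C := div_pos Real.pi_pos hc0
  obtain ⟨N, hN⟩ := exists_nat_gt ((Real.pi + C * (2 * ℓ₀ + K)) / α₀)
  rw [div_lt_iff₀ hα0] at hN
  refine ⟨N + 2, fun γ hγ f k v hv hvl hfol => ?_⟩
  -- `Inv n e t v a`: the curve enters a triangle through `e` at time `a`, and `n` steps are
  -- accounted for.  The curve turned last around the corner `sidePoint e β`.  After the first
  -- triangle, `S` is the distance that was passed in the last one.
  set Inv : ℕ → T.Face × Fin 3 → ℝ → E2 → ℝ → Prop := fun n e t v a =>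
    t ∈ Set.Ioo (0 : ℝ) 1 ∧ 0 ≤ a ∧ a < 1 ∧ v ≠ 0 ∧ ‖v‖ ≤ ℓ₀ ∧
      T.Follows γ e.1 (T.sidePoint e t) v a ∧ 0 < inner ℝ (T.baryGrad e.1 (e.2 + 2)) v ∧
      ∃ β : ℝ, (β = 0 ∨ β = 1) ∧ ∃ S : ℝ, dist (T.sidePoint e t) (T.sidePoint e β) * s₀ ≤ S ∧
        n * α₀ ≤ InnerProductGeometry.angle v (T.sidePoint e β - T.sidePoint e t) +
          C * (2 * (a * ‖v‖) - S + K) with hInv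
  have hnext : ∀ d : T.Face × Fin 3, ∀ v, inner ℝ (T.baryGrad d.1 (d.2 + 2)) v < 0 →
      0 < inner ℝ (T.baryGrad (T.glue d).1 ((T.glue d).2 + 2))
        ((T.unfold d).symm.linearIsometryEquiv v) := by
    intro d v hdv
    obtain ⟨κ, hκ, h⟩ := T.inner_baryGrad_unfold d
    rw [h]; nlinarith
  have hstep : ∀ m n e t v a, Inv n e t v a → N < n + m →
      ∃ L c, L.length ≤ m ∧ T.sidePoint e t + (1 - a) • v = T.develop L c := by
    intro m
    induction m with
    | zero =>
      rintro n e t v a ⟨ht, ha0, ha1, hv, hvl, -, -, β, -, S, hS, hn⟩ hNn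
      exfalso
      have h1 : (N : ℝ) * α₀ ≤ n * α₀ := by
        apply mul_le_mul_of_nonneg_right _ hα0.le
        exact_mod_cast (by omega : N ≤ n)
      have h2 := InnerProductGeometry.angle_le_pi v (T.sidePoint e β - T.sidePoint e t)
      have h3 : 0 ≤ S := (mul_nonneg dist_nonneg hs0.le).trans hS
      have h4 : a * ‖v‖ ≤ ℓ₀ := by nlinarith [norm_nonneg v]
      have h5 : C * (2 * (a * ‖v‖) - S + K) ≤ C * (2 * ℓ₀ + K) :=
        mul_le_mul_of_nonneg_left (by linarith) hC0.le
      linarith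
    | succ m ih =>
      rintro n e t v a ⟨ht, ha0, ha1, hv, hvl, hF, hin, β, hβ, S, hS, hn⟩ hNn
      have hx := T.sidePoint_mem_face e ⟨ht.1.le, ht.2.le⟩
      rcases hF.exit hγ hv ha0 ha1 hx with ⟨k, hk⟩ | ⟨k, t', σ, ht', hσ, haσ, hz, hout, hF'⟩
      · exact ⟨[], (e.1, k), by simp, by simpa [develop] using hk⟩
      have hke : k ≠ e.2 := by
        rintro rfl
        linarith
      obtain ⟨β', hβ', hc, hang, hd1, hd2⟩ := T.exists_turn ht hke ht' hσ hz hα hs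
      set d : T.Face × Fin 3 := (e.1, k) with hd
      have hLang : ∀ s, InnerProductGeometry.angle ((T.unfold d).symm.linearIsometryEquiv v)
          (T.sidePoint (T.glue d) (1 - s) - T.sidePoint (T.glue d) (1 - t')) =
          InnerProductGeometry.angle v (T.sidePoint d s - T.sidePoint d t') := by
        intro s
        rw [← T.unfold_linear_sub]
        exact LinearIsometry.angle_map
          ((T.unfold d).symm.linearIsometryEquiv).toLinearIsometry _ _
      have hLang' := hLang (1 - β')
      rw [sub_sub_cancel, hc] at hLang'
      have hdist : dist (T.sidePoint (T.glue d) (1 - t')) (T.sidePoint (T.glue d) β') =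
          dist (T.sidePoint d t') (T.sidePoint e β') := by
        rw [← hc, dist_sidePoint, dist_sidePoint, length_glue]
        congr 1
        rw [← abs_neg]; congr 1; ring
      obtain ⟨L, c, hL, hLc⟩ := ih (n + 1) (T.glue d) (1 - t')
        ((T.unfold d).symm.linearIsometryEquiv v) (a + σ)
        ⟨⟨by linarith [ht'.2], by linarith [ht'.1]⟩, by linarith, haσ,
          fun h0 => hv (by simpa using h0), by rwa [LinearIsometryEquiv.norm_map], hF',
          hnext d v hout, β', hβ', σ * ‖v‖, by rwa [hdist], by
            rw [hLang', LinearIsometryEquiv.norm_map]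
            push_cast
            have hsv : 0 < σ * ‖v‖ := mul_pos hσ (norm_pos_iff.2 hv)
            have hS0 : 0 ≤ S := (mul_nonneg dist_nonneg hs0.le).trans hS
            by_cases hbb : β' = β
            · -- the line turns around the same vertex as before
              subst hbb
              have : C * (2 * (a * ‖v‖) - S + K) ≤
                  C * (2 * ((a + σ) * ‖v‖) - σ * ‖v‖ + K) :=
                mul_le_mul_of_nonneg_left (by nlinarith) hC0.le
              linarith
            · -- the vertex changes
              have hlen : c₀ ≤ S + σ * ‖v‖ := by
                have h1 : dist (T.sidePoint e t) (T.sidePoint e β) +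
                    dist (T.sidePoint e t) (T.sidePoint e β') = T.length e := by
                  rw [dist_sidePoint, dist_sidePoint]
                  rcases hβ with rfl | rfl <;> rcases hβ' with rfl | rfl
                  · exact absurd rfl hbb
                  · rw [sub_zero, abs_of_pos ht.1, abs_of_neg (by linarith [ht.2])]; ring
                  · rw [sub_zero, abs_of_pos ht.1, abs_of_neg (by linarith [ht.2])]; ring
                  · exact absurd rfl hbb
                have h2 : l₀ * s₀ ≤ T.length e * s₀ :=
                  mul_le_mul_of_nonneg_right (hl e) hs0.le
                rw [← h1] at h2
                linarith
              have hC1 : Real.pi ≤ C * (S + σ * ‖v‖) := by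
                rw [hC, div_mul_eq_mul_div, le_div_iff₀ hc0]
                exact mul_le_mul_of_nonneg_left hlen Real.pi_pos.le
              have hπ : InnerProductGeometry.angle v (T.sidePoint e β - T.sidePoint e t) =
                  Real.pi - InnerProductGeometry.angle v
                    (T.sidePoint e β' - T.sidePoint e t) := by
                rw [T.sidePoint_sub, T.sidePoint_sub]
                rcases hβ with rfl | rfl <;> rcases hβ' with rfl | rfl
                · exact absurd rfl hbb
                · rw [InnerProductGeometry.angle_smul_right_of_neg _ _ (by linarith [ht.1]),
                    InnerProductGeometry.angle_smul_right_of_pos _ _ (by linarith [ht.2]),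
                    InnerProductGeometry.angle_neg_right]
                · rw [InnerProductGeometry.angle_smul_right_of_pos _ _ (by linarith [ht.2]),
                    InnerProductGeometry.angle_smul_right_of_neg _ _ (by linarith [ht.1]),
                    InnerProductGeometry.angle_neg_right]
                  ring
                · exact absurd rfl hbb
              have h0 := InnerProductGeometry.angle_nonneg v
                (T.sidePoint e β' - T.sidePoint e t)
              have h6 : C * (2 * ((a + σ) * ‖v‖) - σ * ‖v‖ + K) =
                  C * (2 * (a * ‖v‖) - S + K) + C * (S + σ * ‖v‖) := by ring
              rw [h6]
              linarith⟩ (by omega)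
      refine ⟨d :: L, c, by simpa using hL, ?_⟩
      exact T.develop_exit hz hLc
  rcases hfol.exit hγ hv le_rfl one_pos (T.corner_mem_face f k) with
    ⟨l, hl'⟩ | ⟨l, t, σ, ht, hσ, haσ, hz, hout, hF'⟩
  · exact ⟨[], (f, l), by simp, by simpa [develop] using hl'⟩
  · set d : T.Face × Fin 3 := (f, l) with hd
    obtain ⟨L, c, hL, hLc⟩ := hstep (N + 1) 0 (T.glue d) (1 - t)
      ((T.unfold d).symm.linearIsometryEquiv v) (0 + σ)
      ⟨⟨by linarith [ht.2], by linarith [ht.1]⟩, by linarith, haσ,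
          fun h0 => hv (by simpa using h0), by rwa [LinearIsometryEquiv.norm_map], hF',
          hnext d v hout, 0, Or.inl rfl, _, le_rfl, by
            have h1 : dist (T.sidePoint (T.glue d) (1 - t)) (T.sidePoint (T.glue d) 0) * s₀ ≤
                K := by
              refine le_trans ?_ (hK (T.glue d))
              apply mul_le_mul_of_nonneg_right _ hs0.le
              rw [dist_sidePoint, sub_zero, abs_of_pos (by linarith [ht.2])]
              exact mul_le_of_le_one_left (T.length_pos _).le (by linarith [ht.1])
            have h2 : 0 ≤ (0 + σ) * ‖(T.unfold d).symm.linearIsometryEquiv v‖ :=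
              mul_nonneg (by linarith) (norm_nonneg _)
            have h3 := mul_nonneg hC0.le (show 0 ≤ 2 * ((0 + σ) *
              ‖(T.unfold d).symm.linearIsometryEquiv v‖) -
              dist (T.sidePoint (T.glue d) (1 - t)) (T.sidePoint (T.glue d) 0) * s₀ + K by linarith)
            have h4 := InnerProductGeometry.angle_nonneg
              ((T.unfold d).symm.linearIsometryEquiv v)
              (T.sidePoint (T.glue d) 0 - T.sidePoint (T.glue d) (1 - t))
            push_cast
            linarith⟩ (by omega)
    refine ⟨d :: L, c, ?_, ?_⟩
    · rw [List.length_cons]; omega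
    · have := T.develop_exit (a := 0) hz hLc
      simpa [develop] using this

/-- An edge of any other triangulation starts along a straight segment in a triangle of `T`: a
radial segment of `T` and the edge, which have a common point near the vertex, have the same
direction there, since otherwise the edge would have a shortcut. -/
lemma exists_follows_edgeCurve (T' : GeodesicTriangulation M V) (d' : T'.Face × Fin 3) :
    ∃ f k v, ‖v‖ = T'.length d' ∧ T.Follows (T'.edgeCurve d') f (T.corner f k) v 0 := by
  obtain ⟨ρ, hρ, h1, h2, h3⟩ := T.exists_vertex_nhd
  obtain ⟨ρ', hρ', h1', h2', h3'⟩ := T'.exists_vertex_nhd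
  set l := T'.length d' with hl
  have hl0 : 0 < l := T'.length_pos d'
  set γ := T'.edgeCurve d' with hγ
  set i := T'.vertex d' with hi
  have hγd : ∀ s, 0 ≤ s → s ≤ 1 → s * l < ρ' → dist (i : M) (γ s) = s * l := by
    intro s hs0 hs1 hs
    have e : dist (T'.sidePoint d' s) (T'.corner d'.1 d'.2) = s * l := by
      rw [← T'.sidePoint_zero d', dist_sidePoint, sub_zero, abs_of_nonneg hs0]
    rw [← e]
    exact h2' d'.1 d'.2 _ (T'.sidePoint_mem_face d' ⟨hs0, hs1⟩) (by rwa [e])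
  obtain ⟨s₀, hs0, hs1, hsρ, hsρ'⟩ : ∃ s₀ : ℝ, 0 < s₀ ∧ s₀ < 1 ∧ s₀ * l < ρ ∧ s₀ * l < ρ' := by
    refine ⟨min (1 / 2) (min (ρ / (2 * l)) (ρ' / (2 * l))), by positivity, ?_, ?_, ?_⟩
    · exact lt_of_le_of_lt (min_le_left _ _) (by norm_num)
    · have : min (1 / 2) (min (ρ / (2 * l)) (ρ' / (2 * l))) ≤ ρ / (2 * l) :=
        (min_le_right _ _).trans (min_le_left _ _)
      calc _ ≤ ρ / (2 * l) * l := mul_le_mul_of_nonneg_right this hl0.le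
        _ = ρ / 2 := by field_simp
        _ < ρ := by linarith
    · have : min (1 / 2) (min (ρ / (2 * l)) (ρ' / (2 * l))) ≤ ρ' / (2 * l) :=
        (min_le_right _ _).trans (min_le_right _ _)
      calc _ ≤ ρ' / (2 * l) * l := mul_le_mul_of_nonneg_right this hl0.le
        _ = ρ' / 2 := by field_simp
        _ < ρ' := by linarith
  have hγ0 : dist (i : M) (γ s₀) = s₀ * l := hγd s₀ hs0.le hs1.le hsρ'
  obtain ⟨f, x, hx, hxp⟩ := T.exists_rep (γ s₀)
  obtain ⟨k, hk, hxc⟩ := h3 i f x hx (by rw [hxp, hγ0]; exact hsρ)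
  rw [hxp, hγ0, dist_eq_norm] at hxc
  set c := T.corner f k with hc
  set v : E2 := s₀⁻¹ • (x - c) with hv
  have hxv : c + s₀ • v = x := by rw [hv, smul_inv_smul₀ hs0.ne']; abel
  have hvl : ‖v‖ = l := by
    rw [hv, norm_smul, hxc, Real.norm_of_nonneg (inv_nonneg.2 hs0.le)]
    field_simp
  have hv0 : v ≠ 0 := by rw [← norm_pos_iff, hvl]; exact hl0
  have hc0 : c + (0 : ℝ) • v ∈ T.face f := by
    rw [zero_smul, add_zero]; exact T.corner_mem_face f k
  have hcs : c + s₀ • v ∈ T.face f := by rw [hxv]; exact hx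
  have hmem : ∀ s ∈ Set.Icc 0 s₀, c + s • v ∈ T.face f := fun s hs =>
    T.add_smul_mem_face hc0 hcs hs
  have hβd : ∀ s ∈ Set.Icc 0 s₀, dist (i : M) (T.chart f (c + s • v)) = s * l := by
    intro s hs
    have e : dist (c + s • v) c = s * l := by
      rw [dist_self_add_left, norm_smul, hvl, Real.norm_of_nonneg hs.1]
    rw [← e, ← hk]
    refine h2 f k _ (hmem s hs) ?_
    rw [e]
    exact lt_of_le_of_lt (mul_le_mul_of_nonneg_right hs.2 hl0.le) hsρ
  have hγV : γ s₀ ∉ V := T'.chart_sidePoint_notMem d' ⟨hs0, hs1⟩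
  obtain ⟨ρ₁, Φ, hΦ⟩ := T.exists_flatDisc hγV
  obtain ⟨w, δ, hδ, hw⟩ := (T'.straightAt_edgeCurve d' ⟨hs0, hs1⟩).exists_velocity hΦ
  have hΦ' := hΦ
  rw [← hγ] at hw
  rw [← hxp] at hΦ' hγV
  obtain ⟨L, ε, hε, hερ, hL⟩ := T.exists_linearIsometry_chart hx hγV hΦ'
  -- the radial segment near its end, in the flat disc
  have hβ : ∀ u, 0 ≤ u → u ≤ s₀ → u * l < ε →
      T.chart f (c + (s₀ - u) • v) = Φ (-(u • L v)) := by
    intro u hu0 hu1 hu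
    have e : c + (s₀ - u) • v = x + (-u) • v := by rw [← hxv]; module
    have h4 := hL ((-u) • v) (by rw [norm_smul, norm_neg, Real.norm_of_nonneg hu0, hvl]; exact hu)
      (by rw [← e]; exact hmem _ ⟨by linarith, by linarith⟩)
    rw [e, h4, map_smul, neg_smul]
  obtain ⟨η, hη, hηδ, hηs, hη1, hηε, hηρ⟩ : ∃ η : ℝ, 0 < η ∧ η ≤ δ ∧ η ≤ s₀ ∧ s₀ + η ≤ 1 ∧
      η * l ≤ ε ∧ (s₀ + η) * l ≤ ρ' := by
    refine ⟨min δ (min s₀ (min (1 - s₀) (min (ε / l) (ρ' / l - s₀)))), ?_, ?_, ?_, ?_, ?_, ?_⟩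
    · have : s₀ < ρ' / l := by rwa [lt_div_iff₀ hl0]
      simp only [lt_min_iff, sub_pos]
      exact ⟨hδ, hs0, hs1, by positivity, this⟩
    · exact min_le_left _ _
    · exact (min_le_right _ _).trans (min_le_left _ _)
    · have : min δ (min s₀ (min (1 - s₀) (min (ε / l) (ρ' / l - s₀)))) ≤ 1 - s₀ :=
        (min_le_right _ _).trans ((min_le_right _ _).trans (min_le_left _ _))
      linarith
    · rw [← le_div_iff₀ hl0]
      exact (min_le_right _ _).trans ((min_le_right _ _).trans ((min_le_right _ _).trans
        (min_le_left _ _)))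
    · rw [← le_div_iff₀ hl0]
      have : min δ (min s₀ (min (1 - s₀) (min (ε / l) (ρ' / l - s₀)))) ≤ ρ' / l - s₀ :=
        (min_le_right _ _).trans ((min_le_right _ _).trans ((min_le_right _ _).trans
        (min_le_right _ _)))
      linarith
  have hwL : w = L v := by
    set u := η / 2 with hu
    have hu0 : 0 < u := by positivity
    have huη : u < η := by rw [hu]; linarith
    have hul : u * l < ε := lt_of_lt_of_le (mul_lt_mul_of_pos_right huη hl0) hηε
    obtain ⟨hw1, hw2⟩ := hw u (by rw [abs_of_pos hu0]; linarith)
    have hLn : ‖u • L v‖ = u * l := by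
      rw [norm_smul, LinearIsometryEquiv.norm_map, hvl, Real.norm_of_nonneg hu0.le]
    have hd1 : dist (T.chart f (c + (s₀ - u) • v)) (γ (s₀ + u)) = u * ‖w + L v‖ := by
      rw [hβ u hu0.le (by linarith) hul, hw2, hΦ.dist_eq _ _ _ hw1, dist_comm, dist_eq_norm,
        sub_neg_eq_add, ← smul_add, norm_smul, Real.norm_of_nonneg hu0.le]
      rw [norm_neg, hLn]; linarith
    have hd2 := dist_triangle (i : M) (T.chart f (c + (s₀ - u) • v)) (γ (s₀ + u))
    have hul' : (s₀ + u) * l < ρ' :=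
      lt_of_lt_of_le (mul_lt_mul_of_pos_right (by linarith) hl0) hηρ
    rw [hd1, hβd _ ⟨by linarith, by linarith⟩, hγd _ (by linarith) (by linarith) hul'] at hd2
    have hsum : 2 * l ≤ ‖w + L v‖ := by
      by_contra! hlt
      have := mul_lt_mul_of_pos_left hlt hu0
      linarith
    have hwl : ‖w‖ ≤ l := by
      have h5 : dist (γ (s₀ + 0)) (γ (s₀ + u)) ≤ u * l := by
        refine (T'.dist_chart_le (T'.sidePoint_mem_face d' ⟨by linarith, by linarith⟩)
          (T'.sidePoint_mem_face d' ⟨by linarith, by linarith⟩)).trans ?_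
        rw [dist_sidePoint, ← hl, add_zero, abs_sub_comm, add_sub_cancel_left, abs_of_pos hu0]
      rw [add_zero, hw2, ← hΦ.map_zero, hΦ.dist_eq _ _ (by simpa using hΦ.pos) hw1, dist_zero_left,
        norm_smul, Real.norm_of_nonneg hu0.le] at h5
      exact le_of_mul_le_mul_left h5 hu0
    have hpar := parallelogram_law_with_norm ℝ w (L v)
    rw [LinearIsometryEquiv.norm_map, hvl] at hpar
    have : ‖w - L v‖ * ‖w - L v‖ ≤ 0 := by nlinarith [norm_nonneg w]
    have h6 : ‖w - L v‖ = 0 := by nlinarith [norm_nonneg (w - L v)]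
    exact sub_eq_zero.1 (norm_eq_zero.1 h6)
  have hev : γ =ᶠ[nhds (s₀ - η / 2)] fun s => T.chart f (c + s • v) := by
    filter_upwards [Ioo_mem_nhds (show s₀ - η < s₀ - η / 2 by linarith)
      (show s₀ - η / 2 < s₀ by linarith)] with s hs
    have h7 := hβ (s₀ - s) (by linarith [hs.2]) (by linarith [hs.1])
      (lt_of_lt_of_le (mul_lt_mul_of_pos_right (by linarith [hs.1]) hl0) hηε)
    rw [sub_sub_cancel] at h7
    rw [h7, ← hwL, ← neg_smul, neg_sub]
    have h8 := (hw (s - s₀) (by rw [abs_lt]; constructor <;> linarith [hs.1, hs.2])).2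
    rwa [add_sub_cancel] at h8
  have heq := eq_of_straightAt (a := 0) (b := s₀)
    (fun t ht => T'.straightAt_edgeCurve d' ⟨ht.1, ht.2.trans hs1⟩)
    (fun t ht => T.straightAt_chart_of_mem hv0 hc0 hcs ht)
    ⟨by linarith, by linarith⟩ hev
  refine ⟨f, k, v, hvl, s₀, hs0, fun s hs => ⟨hmem s ⟨hs.1.le, hs.2.le⟩, ?_⟩⟩
  rw [zero_add]
  exact heq s hs

/-- Oriented edges whose curves agree near one point of the open edges coincide. -/
lemma eq_of_edgeCurve_eventuallyEq {d₁ d₂ : T.Face × Fin 3} {t : ℝ} (ht : t ∈ Set.Ioo (0 : ℝ) 1)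
    (h : T.edgeCurve d₁ =ᶠ[nhds t] T.edgeCurve d₂) : d₁ = d₂ := by
  have h1 := eq_of_straightAt (fun t ht => T.straightAt_edgeCurve d₁ ht)
    (fun t ht => T.straightAt_edgeCurve d₂ ht) ht h (1 / 4) ⟨by norm_num, by norm_num⟩
  have hm : (1 / 4 : ℝ) ∈ Set.Ioo (0 : ℝ) 1 := ⟨by norm_num, by norm_num⟩
  rcases T.eq_of_chart_eq_of_side hm (T.sidePoint_mem_face d₂ ⟨hm.1.le, hm.2.le⟩) h1 with
    ⟨h2, h3⟩ | ⟨h2, h3⟩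
  · exact (T.sidePoint_inj hm h2 h3).1.symm
  · have := (T.sidePoint_inj (t := 1 - 1 / 4) ⟨by norm_num, by norm_num⟩ h2 h3).2
    norm_num at this

/-- The edges of bounded length of all triangulations have only finitely many initial directions
and lengths in the triangles of `T`. -/
lemma exists_finite_edge_germs (ℓ₀ : ℝ) : ∃ C : Set ((T.Face × Fin 3) × E2), C.Finite ∧
    ∀ (T' : GeodesicTriangulation M V) (d' : T'.Face × Fin 3), T'.length d' ≤ ℓ₀ →
      ∃ e v, (e, v) ∈ C ∧ ‖v‖ = T'.length d' ∧
        T.Follows (T'.edgeCurve d') e.1 (T.corner e.1 e.2) v 0 := by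
  obtain ⟨N, hN⟩ := T.exists_itinerary_bound ℓ₀
  refine ⟨(fun q : (T.Face × Fin 3) × List (T.Face × Fin 3) × (T.Face × Fin 3) =>
    (q.1, T.develop q.2.1 q.2.2 - T.corner q.1.1 q.1.2)) ''
      (Set.univ ×ˢ {L | L.length ≤ N} ×ˢ Set.univ), ?_, ?_⟩
  · exact (Set.finite_univ.prod ((List.finite_length_le _ N).prod Set.finite_univ)).image _
  · intro T' d' hd'
    obtain ⟨f, k, v, hv, hF⟩ := T.exists_follows_edgeCurve T' d'
    obtain ⟨L, c, hL, hc⟩ := hN _ (T'.isStraightCurve_edgeCurve d') f k v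
      (by rw [← norm_pos_iff, hv]; exact T'.length_pos d') (by rwa [hv]) hF
    exact ⟨(f, k), v, ⟨((f, k), L, c), ⟨trivial, hL, trivial⟩, by simp [← hc]⟩, hv, hF⟩

/-- Two geodesic triangulations have the same shape if there is a bijection of the triangles that
preserves the gluing, the vertices and the lengths. -/
def SameShape (T₁ T₂ : GeodesicTriangulation M V) : Prop :=
  ∃ e : T₁.Face ≃ T₂.Face, (∀ d, T₂.glue (Prod.map e id d) = Prod.map e id (T₁.glue d)) ∧
    (∀ d, T₂.vertex (Prod.map e id d) = T₁.vertex d) ∧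
    ∀ d, T₂.length (Prod.map e id d) = T₁.length d

/-- Up to shape, there are only finitely many geodesic triangulations with a given bound on the
lengths of the edges. -/
lemma exists_finite_shapes (T : GeodesicTriangulation M V) (ℓ₀ : ℝ) :
    ∃ (ι : Type) (_ : Finite ι) (S : ι → GeodesicTriangulation M V),
      ∀ T' : GeodesicTriangulation M V, (∀ d, T'.length d ≤ ℓ₀) → ∃ i, (S i).SameShape T' := by
  obtain ⟨C, hC, hCT⟩ := T.exists_finite_edge_germs ℓ₀
  have := hC.to_subtype
  let A := Σ n : Fin (Nat.card C + 1), Equiv.Perm (Fin n × Fin 3) × (Fin n × Fin 3 → V) ×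
    (Fin n × Fin 3 → C)
  -- the shape of `T'` is given by the data `D`
  let R : GeodesicTriangulation M V → A → Prop := fun T' D => ∃ e : T'.Face ≃ Fin D.1,
    (∀ d, D.2.1 (Prod.map e id d) = Prod.map e id (T'.glue d)) ∧
    (∀ d, D.2.2.1 (Prod.map e id d) = T'.vertex d) ∧
    ∀ d, ‖(D.2.2.2 (Prod.map e id d) : (T.Face × Fin 3) × E2).2‖ = T'.length d
  have hR : ∀ T₁ T₂ D, R T₁ D → R T₂ D → T₁.SameShape T₂ := by
    rintro T₁ T₂ D ⟨e₁, h1, h2, h3⟩ ⟨e₂, h1', h2', h3'⟩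
    have hcomp : ∀ d : T₁.Face × Fin 3, Prod.map e₂ id (Prod.map (e₁.trans e₂.symm) id d) =
        Prod.map e₁ id d := by
      intro d; simp [Prod.map]
    refine ⟨e₁.trans e₂.symm, fun d => ?_, fun d => ?_, fun d => ?_⟩
    · have hinj : Function.Injective (Prod.map e₂ (id : Fin 3 → Fin 3)) :=
        e₂.injective.prodMap Function.injective_id
      apply hinj
      rw [← h1', hcomp, h1, hcomp]
    · rw [← h2', hcomp, h2]
    · rw [← h3', hcomp, h3]
  obtain ⟨B, hB⟩ : ∃ B : Set A, B = {D | ∃ T', R T' D} := ⟨_, rfl⟩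
  have hB' : ∀ D : B, ∃ T', R T' D := fun D => hB.subset D.2
  choose S hS using hB'
  let E := Finite.equivFin B
  refine ⟨Fin (Nat.card B), inferInstance, fun i => S (E.symm i), fun T' hT' => ?_⟩
  choose e v hmem hv hF using fun d => hCT T' d (hT' d)
  have hinj : Function.Injective fun d : T'.Face × Fin 3 => (⟨(e d, v d), hmem d⟩ : C) := by
    intro d₁ d₂ h
    simp only [Subtype.mk.injEq, Prod.mk.injEq] at h
    obtain ⟨δ₁, hδ₁, h1⟩ := hF d₁
    obtain ⟨δ₂, hδ₂, h2⟩ := hF d₂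
    rw [h.1, h.2] at h1
    have hm : 0 < min δ₁ (min δ₂ 1) := by positivity
    apply T'.eq_of_edgeCurve_eventuallyEq (t := min δ₁ (min δ₂ 1) / 2)
    · exact ⟨by positivity, by
        have : min δ₁ (min δ₂ 1) ≤ 1 := (min_le_right _ _).trans (min_le_right _ _)
        linarith⟩
    · filter_upwards [Ioo_mem_nhds (show 0 < min δ₁ (min δ₂ 1) / 2 by positivity)
        (show min δ₁ (min δ₂ 1) / 2 < min δ₁ (min δ₂ 1) by linarith)] with s hs
      have e1 := (h1 s ⟨hs.1, hs.2.trans_le (min_le_left _ _)⟩).2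
      have e2 := (h2 s ⟨hs.1, hs.2.trans_le ((min_le_right _ _).trans (min_le_left _ _))⟩).2
      rw [zero_add] at e1 e2
      rw [e1, e2]
  have hcard : Fintype.card T'.Face < Nat.card C + 1 := by
    have h1 := Nat.card_le_card_of_injective _ hinj
    rw [Nat.card_eq_fintype_card (α := T'.Face × Fin 3), Fintype.card_prod, Fintype.card_fin] at h1
    change _ ≤ Nat.card C at h1
    omega
  let E' := Fintype.equivFin T'.Face
  let P : T'.Face × Fin 3 ≃ Fin (Fintype.card T'.Face) × Fin 3 := Equiv.prodCongr E' (Equiv.refl _)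
  have hP : ∀ d, Prod.map E' id d = P d := fun d => rfl
  have hD : R T' ⟨⟨_, hcard⟩, (P.symm.trans T'.glue).trans P, T'.vertex ∘ P.symm,
      fun d => ⟨(e (P.symm d), v (P.symm d)), hmem _⟩⟩ := by
    refine ⟨E', fun d => ?_, fun d => ?_, fun d => ?_⟩
    · simp only [hP]
      simp
    · simp only [hP]
      simp
    · simp only [hP]
      simp [hv]
  refine ⟨E ⟨_, by rw [hB]; exact ⟨T', hD⟩⟩, ?_⟩
  simp only [Equiv.symm_apply_apply]
  exact hR _ _ _ (hS _) hD

lemma baseDihedral_map {T₁ T₂ : GeodesicTriangulation M V} {e : T₁.Face → T₂.Face}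
    (hv : ∀ d, T₂.vertex (Prod.map e id d) = T₁.vertex d)
    (hl : ∀ d, T₂.length (Prod.map e id d) = T₁.length d) (r : V → ℝ) (d : T₁.Face × Fin 3) :
    T₂.baseDihedral r (Prod.map e id d) = T₁.baseDihedral r d := by
  have hn : ∀ d : T₁.Face × Fin 3, nextSide (Prod.map e id d) = Prod.map e id (nextSide d) :=
    fun _ => rfl
  have hp : ∀ d : T₁.Face × Fin 3, prevSide (Prod.map e id d) = Prod.map e id (prevSide d) :=
    fun _ => rfl
  simp only [baseDihedral, sideAngle, sideAngleRev, baseAngle, hn, hp, hv, hl]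

lemma SameShape.isConvexPolytope {T₁ T₂ : GeodesicTriangulation M V} (h : T₁.SameShape T₂)
    {r : V → ℝ} (hr : T₂.IsConvexPolytope r) : T₁.IsConvexPolytope r := by
  obtain ⟨e, h1, h2, h3⟩ := h
  obtain ⟨hr1, hr2, hr3⟩ := hr
  refine ⟨hr1, fun f => ?_, fun d => ?_⟩
  · obtain ⟨a, P, hP, hl, ha⟩ := hr2 (e f)
    exact ⟨a, P, hP, fun k => (hl k).trans (h3 (f, k)), fun k =>
      (ha k).trans (congrArg r (h2 (f, k)))⟩
  · have h4 := hr3 (Prod.map e id d)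
    rw [boundaryDihedral, h1, baseDihedral_map h2 h3, baseDihedral_map h2 h3] at h4
    exact h4

end GeodesicTriangulation
/-! ### The Gram matrix of a pyramid -/

/-! In this part, `x`, `y`, `z` are the lengths of the side edges of a pyramid over a triangle `ijk`,
and `c`, `a`, `b` are the lengths of the sides `ij`, `jk`, `ki` of the base. -/

/-- The inner product of the vectors from the apex of a triangle to the ends of its base, for side
lengths `x`, `y` and base `c`. -/
noncomputable def gramEntry (x y c : ℝ) : ℝ := (x ^ 2 + y ^ 2 - c ^ 2) / 2

/-- A principal minor of order two of the Gram matrix of a pyramid. -/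
noncomputable def gramMinor (x y c : ℝ) : ℝ := x ^ 2 * y ^ 2 - gramEntry x y c ^ 2

/-- The negative of the cofactor, at the place `jk`, of the Gram matrix of a pyramid. -/
noncomputable def gramCofactor (x y z c a b : ℝ) : ℝ :=
  gramEntry y z a * x ^ 2 - gramEntry x y c * gramEntry z x b

/-- The determinant of the Gram matrix of a pyramid. -/
noncomputable def gramDet (x y z c a b : ℝ) : ℝ :=
  x ^ 2 * y ^ 2 * z ^ 2 + 2 * gramEntry x y c * gramEntry y z a * gramEntry z x b -
    x ^ 2 * gramEntry y z a ^ 2 - y ^ 2 * gramEntry z x b ^ 2 - z ^ 2 * gramEntry x y c ^ 2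

/-- The square of twice the area of a triangle with side lengths `c`, `a`, `b`. -/
noncomputable def areaSq (c a b : ℝ) : ℝ := c ^ 2 * b ^ 2 - ((c ^ 2 + b ^ 2 - a ^ 2) / 2) ^ 2

/-- The product of twice the area of the base of a pyramid with twice the signed area of the
triangle that is spanned by the side `ij` of the base and the foot of the altitude. -/
noncomputable def footArea (x y z c a b : ℝ) : ℝ :=
  gramMinor x y c - gramCofactor x y z c a b - gramCofactor y z x a b c

section Identities

variable (x y z c a b : ℝ)

lemma gramMinor_mul_sub_sq : gramMinor x y c * gramMinor z x b - gramCofactor x y z c a b ^ 2 =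
    x ^ 2 * gramDet x y z c a b := by
  unfold gramMinor gramCofactor gramDet; ring

lemma areaSq_mul_sub_sq : areaSq c a b * gramMinor x y c - footArea x y z c a b ^ 2 =
    c ^ 2 * gramDet x y z c a b := by
  unfold footArea areaSq gramMinor gramCofactor gramDet gramEntry; ring

lemma gramDet_cyclic : gramDet y z x a b c = gramDet x y z c a b := by
  unfold gramDet; ring

lemma gramEntry_comm : gramEntry x y c = gramEntry y x c := by
  unfold gramEntry; ring

lemma gramMinor_comm : gramMinor x y c = gramMinor y x c := by
  unfold gramMinor; rw [gramEntry_comm]; ring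

lemma triAngle_comm : triAngle c x y = triAngle c y x := by
  unfold triAngle; congr 1; ring

end Identities

/-- The angle of a spherical triangle whose sides are the angles between three vectors, in terms of
the norms `u`, `v`, `w` of the vectors and their inner products `p`, `q`, `s`. -/
lemma sphAngle_arccos {u v w p q s : ℝ} (hu : 0 < u) (hv : 0 < v) (hw : 0 < w)
    (h1 : 0 < u ^ 2 * v ^ 2 - p ^ 2) (h2 : 0 < v ^ 2 * w ^ 2 - q ^ 2)
    (h3 : 0 < w ^ 2 * u ^ 2 - s ^ 2) :
    sphAngle (Real.arccos (q / (v * w))) (Real.arccos (p / (u * v))) (Real.arccos (s / (w * u))) =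
      Real.arccos ((q * u ^ 2 - p * s) /
        Real.sqrt ((u ^ 2 * v ^ 2 - p ^ 2) * (w ^ 2 * u ^ 2 - s ^ 2))) := by
  have key : ∀ {u v p : ℝ}, 0 < u → 0 < v → 0 < u ^ 2 * v ^ 2 - p ^ 2 →
      Real.cos (Real.arccos (p / (u * v))) = p / (u * v) ∧
      Real.sin (Real.arccos (p / (u * v))) = Real.sqrt (u ^ 2 * v ^ 2 - p ^ 2) / (u * v) := by
    intro u v p hu hv h
    have huv : 0 < u * v := mul_pos hu hv
    have h4 : |p / (u * v)| ≤ 1 := by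
      rw [abs_div, abs_of_pos huv, div_le_one huv]
      exact abs_le_of_sq_le_sq (by nlinarith) huv.le
    refine ⟨Real.cos_arccos (abs_le.1 h4).1 (abs_le.1 h4).2, ?_⟩
    rw [Real.sin_arccos, eq_div_iff huv.ne', ← Real.sqrt_sq huv.le, ← Real.sqrt_mul']
    · congr 1
      rw [Real.sqrt_sq huv.le]; field_simp
    · positivity
  obtain ⟨c1, s1⟩ := key hu hv h1
  obtain ⟨c2, -⟩ := key hv hw h2
  obtain ⟨c3, s3⟩ := key hw hu h3
  unfold sphAngle
  rw [c1, c2, c3, s1, s3, Real.sqrt_mul h1.le]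
  congr 1
  have := Real.sqrt_pos.2 h1
  have := Real.sqrt_pos.2 h3
  field_simp

lemma triAngle_eq_arccos (c x y : ℝ) :
    triAngle c x y = Real.arccos (gramEntry x y c / (x * y)) := by
  unfold triAngle gramEntry
  congr 1
  rw [div_div, mul_assoc]

section Angles

variable {x y z c a b : ℝ}

lemma cos_triAngle (hx : 0 < x) (hy : 0 < y) (h : 0 < gramMinor x y c) :
    Real.cos (triAngle c x y) = gramEntry x y c / (x * y) := by
  have hxy : 0 < x * y := mul_pos hx hy
  have h4 : |gramEntry x y c / (x * y)| ≤ 1 := by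
    rw [abs_div, abs_of_pos hxy, div_le_one hxy]
    unfold gramMinor at h
    exact abs_le_of_sq_le_sq (by nlinarith) hxy.le
  rw [triAngle_eq_arccos, Real.cos_arccos (abs_le.1 h4).1 (abs_le.1 h4).2]

lemma sin_triAngle (hx : 0 < x) (hy : 0 < y) :
    Real.sin (triAngle c x y) = Real.sqrt (gramMinor x y c) / (x * y) := by
  have hxy : 0 < x * y := mul_pos hx hy
  have h5 : gramMinor x y c = (1 - (gramEntry x y c / (x * y)) ^ 2) * (x * y) ^ 2 := by
    unfold gramMinor; field_simp
  rw [triAngle_eq_arccos, Real.sin_arccos, eq_div_iff hxy.ne', h5, Real.sqrt_mul' _ (sq_nonneg _),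
    Real.sqrt_sq hxy.le]

/-- The dihedral angle of a pyramid at a side edge. -/
lemma sphAngle_radial (hx : 0 < x) (hy : 0 < y) (hz : 0 < z) (h1 : 0 < gramMinor x y c)
    (h2 : 0 < gramMinor y z a) (h3 : 0 < gramMinor z x b) :
    sphAngle (triAngle a y z) (triAngle c x y) (triAngle b z x) =
      Real.arccos (gramCofactor x y z c a b /
        Real.sqrt (gramMinor x y c * gramMinor z x b)) := by
  simp only [triAngle_eq_arccos]
  exact sphAngle_arccos hx hy hz h1 h2 h3

/-- The dihedral angle of a pyramid at a side of its base. -/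
lemma sphAngle_base (hx : 0 < x) (hc : 0 < c) (hb : 0 < b) (h1 : 0 < gramMinor x y c)
    (h2 : 0 < gramMinor z x b) (h3 : 0 < areaSq c a b) :
    sphAngle (triAngle z x b) (triAngle y x c) (triAngle a c b) =
      Real.arccos (footArea x y z c a b / Real.sqrt (gramMinor x y c * areaSq c a b)) := by
  have e1 : c ^ 2 * x ^ 2 - gramEntry x c y ^ 2 = gramMinor x y c := by
    unfold gramMinor gramEntry; ring
  have e2 : x ^ 2 * b ^ 2 - gramEntry x b z ^ 2 = gramMinor z x b := by
    unfold gramMinor gramEntry; ring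
  have e3 : b ^ 2 * c ^ 2 - gramEntry c b a ^ 2 = areaSq c a b := by
    unfold areaSq gramEntry; ring
  have e4 : gramEntry x b z * c ^ 2 - gramEntry x c y * gramEntry c b a =
      footArea x y z c a b := by
    unfold footArea gramMinor gramCofactor gramEntry; ring
  have h := sphAngle_arccos (p := gramEntry x c y) (q := gramEntry x b z) (s := gramEntry c b a)
    hc hx hb (by rwa [e1]) (by rwa [e2]) (by rwa [e3])
  rw [e1, e3, e4] at h
  rw [← h]
  simp only [triAngle_eq_arccos]
  rw [mul_comm c x, mul_comm b c]

end Angles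

/-! ### Altitudes in a spherical fan -/

/-- The angle of a spherical triangle and its sine, in terms of the Gram determinant. -/
lemma cos_sphAngle {A B C G : ℝ} (hB : 0 < Real.sin B) (hC : 0 < Real.sin C)
    (hG : G = 1 + 2 * Real.cos A * Real.cos B * Real.cos C - Real.cos A ^ 2 - Real.cos B ^ 2 -
      Real.cos C ^ 2) (h : 0 < G) :
    Real.cos (sphAngle A B C) =
      (Real.cos A - Real.cos B * Real.cos C) / (Real.sin B * Real.sin C) ∧
    Real.sin (sphAngle A B C) = Real.sqrt G / (Real.sin B * Real.sin C) := by
  have hBC : 0 < Real.sin B * Real.sin C := mul_pos hB hC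
  have key : (Real.sin B * Real.sin C) ^ 2 - (Real.cos A - Real.cos B * Real.cos C) ^ 2 = G := by
    rw [hG, mul_pow, Real.sin_sq, Real.sin_sq]; ring
  have h4 : |(Real.cos A - Real.cos B * Real.cos C) / (Real.sin B * Real.sin C)| ≤ 1 := by
    rw [abs_div, abs_of_pos hBC, div_le_one hBC]
    exact abs_le_of_sq_le_sq (by linarith) hBC.le
  refine ⟨Real.cos_arccos (abs_le.1 h4).1 (abs_le.1 h4).2, ?_⟩
  have h5 : G = (1 - ((Real.cos A - Real.cos B * Real.cos C) / (Real.sin B * Real.sin C)) ^ 2) *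
      (Real.sin B * Real.sin C) ^ 2 := by
    rw [← key]; field_simp
  rw [sphAngle, Real.sin_arccos, eq_div_iff hBC.ne', h5, Real.sqrt_mul' _ (sq_nonneg _),
    Real.sqrt_sq hBC.le]

/-- The altitude of a face of a generalized polyhedron over one of its edges, in a form that is
symmetric in the two faces at the edge. -/
lemma altitude_eq {A B C G hi hj hk : ℝ} (hB : 0 < Real.sin B) (hC : 0 < Real.sin C)
    (hG : G = 1 + 2 * Real.cos A * Real.cos B * Real.cos C - Real.cos A ^ 2 - Real.cos B ^ 2 -
      Real.cos C ^ 2) (h : 0 < G) :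
    ((hk - hi * Real.cos B) / Real.sin B -
        (hj - hi * Real.cos C) / Real.sin C * Real.cos (sphAngle A B C)) /
      Real.sin (sphAngle A B C) =
    (hk * Real.sin C ^ 2 - hi * (Real.cos B - Real.cos A * Real.cos C) -
      hj * (Real.cos A - Real.cos B * Real.cos C)) / (Real.sqrt G * Real.sin C) := by
  obtain ⟨h1, h2⟩ := cos_sphAngle hB hC hG h
  rw [h1, h2]
  have := Real.sqrt_pos.2 h
  field_simp
  rw [Real.sin_sq]
  ring

lemma nextSide_nextSide {F : Type} (d : F × Fin 3) : nextSide (nextSide d) = prevSide d := by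
  obtain ⟨f, k⟩ := d
  simp only [nextSide, prevSide, Prod.mk.injEq, true_and]
  revert k; decide

lemma prevSide_prevSide {F : Type} (d : F × Fin 3) : prevSide (prevSide d) = nextSide d := by
  obtain ⟨f, k⟩ := d
  simp only [nextSide, prevSide, Prod.mk.injEq, true_and]
  revert k; decide

lemma nextSide_prevSide {F : Type} (d : F × Fin 3) : nextSide (prevSide d) = d := by
  simp [nextSide, prevSide]

lemma prevSide_nextSide {F : Type} (d : F × Fin 3) : prevSide (nextSide d) = d := by
  simp [nextSide, prevSide]

/-- Plane geometry of a vector `g` that is orthogonal to one side `e` of a triangle and normalized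
by its value on another side. -/
lemma plane_normal {e e₂ w g : E2} (he : e ≠ 0) (h0 : inner ℝ g e = 0) (h1 : inner ℝ g e₂ = 1) :
    0 < ‖e‖ ^ 2 * ‖e₂‖ ^ 2 - inner ℝ e e₂ ^ 2 ∧
    inner ℝ g w / ‖g‖ * Real.sqrt (‖e‖ ^ 2 * ‖e₂‖ ^ 2 - inner ℝ e e₂ ^ 2) * ‖e‖ =
      inner ℝ w e₂ * ‖e‖ ^ 2 - inner ℝ w e * inner ℝ e e₂ ∧
    (inner ℝ g w / ‖g‖) ^ 2 * ‖e‖ ^ 2 = ‖e‖ ^ 2 * ‖w‖ ^ 2 - inner ℝ w e ^ 2 := by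
  have hen : 0 < ‖e‖ := norm_pos_iff.2 he
  set D : ℝ := e 0 * e₂ 1 - e 1 * e₂ 0 with hD
  have e1 : ‖e‖ ^ 2 = e 0 ^ 2 + e 1 ^ 2 := by
    rw [EuclideanSpace.norm_sq_eq, Fin.sum_univ_two]; simp
  have e2 : ‖e₂‖ ^ 2 = e₂ 0 ^ 2 + e₂ 1 ^ 2 := by
    rw [EuclideanSpace.norm_sq_eq, Fin.sum_univ_two]; simp
  have e3 : ‖w‖ ^ 2 = w 0 ^ 2 + w 1 ^ 2 := by
    rw [EuclideanSpace.norm_sq_eq, Fin.sum_univ_two]; simp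
  have e4 : ‖g‖ ^ 2 = g 0 ^ 2 + g 1 ^ 2 := by
    rw [EuclideanSpace.norm_sq_eq, Fin.sum_univ_two]; simp
  have hi : ∀ u v : E2, inner ℝ u v = u 0 * v 0 + u 1 * v 1 := by
    intro u v
    simp [PiLp.inner_apply, Fin.sum_univ_two, mul_comm]
  rw [hi] at h0 h1
  have hg1 : D * g 1 = e 0 := by rw [hD]; linear_combination e 0 * h1 - e₂ 0 * h0
  have hg0 : D * g 0 = - e 1 := by rw [hD]; linear_combination e₂ 1 * h0 - e 1 * h1
  have hD0 : D ≠ 0 := by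
    intro h
    rw [h, zero_mul] at hg0 hg1
    have : ‖e‖ ^ 2 = 0 := by rw [e1, ← hg1, neg_eq_zero.1 hg0.symm]; ring
    exact hen.ne' (by simpa using this)
  have hΔ : ‖e‖ ^ 2 * ‖e₂‖ ^ 2 - inner ℝ e e₂ ^ 2 = D ^ 2 := by rw [e1, e2, hi, hD]; ring
  have hgn : |D| * ‖g‖ = ‖e‖ := by
    rw [← abs_of_nonneg (norm_nonneg g), ← abs_mul, ← abs_of_nonneg (norm_nonneg e),
      ← sq_eq_sq_iff_abs_eq_abs, mul_pow, e4, e1, ← hg1, ← neg_sq (e 1), ← hg0]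
    ring
  have hg : 0 < ‖g‖ := by
    rcases (norm_nonneg g).eq_or_lt with h | h
    · rw [← h, mul_zero] at hgn; exact absurd hgn hen.ne
    · exact h
  have hw : inner ℝ g w * D = e 0 * w 1 - e 1 * w 0 := by
    rw [hi]; linear_combination w 1 * hg1 + w 0 * hg0
  refine ⟨by rw [hΔ]; positivity, ?_, ?_⟩
  · rw [hΔ, Real.sqrt_sq_eq_abs, ← hgn]
    have : inner ℝ g w / ‖g‖ * |D| * (|D| * ‖g‖) = inner ℝ g w * D * D := by
      field_simp; rw [sq_abs]
    rw [this, hw, hgn, e1, hi, hi, hi, hD]; ring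
  · have : (inner ℝ g w / ‖g‖) ^ 2 * ‖e‖ ^ 2 = (inner ℝ g w * D) ^ 2 := by
      rw [← hgn, mul_pow, sq_abs]; field_simp
    rw [this, hw, e1, e3, hi]; ring

namespace GeodesicTriangulation

variable {M : Type*} [MetricSpace M] {V : Finset M} (T : GeodesicTriangulation M V)

/-! ### Pyramids over the triangles -/

/-- The minor of the Gram matrix of a pyramid that belongs to a side of its base. -/
noncomputable def edgeMinor (r : V → ℝ) (d : T.Face × Fin 3) : ℝ :=
  gramMinor (r (T.vertex d)) (r (T.vertex (nextSide d))) (T.length d)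

/-- The cofactor of the Gram matrix of a pyramid that belongs to a corner of its base. -/
noncomputable def cornerCofactor (r : V → ℝ) (d : T.Face × Fin 3) : ℝ :=
  gramCofactor (r (T.vertex d)) (r (T.vertex (nextSide d))) (r (T.vertex (prevSide d)))
    (T.length d) (T.length (nextSide d)) (T.length (prevSide d))

/-- The Gram determinant of the pyramid over the triangle of `d`. -/
noncomputable def pyramidDet (r : V → ℝ) (d : T.Face × Fin 3) : ℝ :=
  gramDet (r (T.vertex d)) (r (T.vertex (nextSide d))) (r (T.vertex (prevSide d)))
    (T.length d) (T.length (nextSide d)) (T.length (prevSide d))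

/-- The square of twice the area of the triangle of `d`. -/
noncomputable def baseAreaSq (d : T.Face × Fin 3) : ℝ :=
  areaSq (T.length d) (T.length (nextSide d)) (T.length (prevSide d))

/-- The multiple `footArea` of the signed distance of the foot from a side of the base. -/
noncomputable def sideFootArea (r : V → ℝ) (d : T.Face × Fin 3) : ℝ :=
  footArea (r (T.vertex d)) (r (T.vertex (nextSide d))) (r (T.vertex (prevSide d)))
    (T.length d) (T.length (nextSide d)) (T.length (prevSide d))

lemma pyramidDet_nextSide (r : V → ℝ) (d : T.Face × Fin 3) :
    T.pyramidDet r (nextSide d) = T.pyramidDet r d := by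
  unfold pyramidDet
  rw [nextSide_nextSide, prevSide_nextSide, gramDet_cyclic]

lemma pyramidDet_prevSide (r : V → ℝ) (d : T.Face × Fin 3) :
    T.pyramidDet r (prevSide d) = T.pyramidDet r d := by
  rw [← T.pyramidDet_nextSide r (prevSide d), nextSide_prevSide]

lemma dist_corner_foot (r : V → ℝ) (d : T.Face × Fin 3) :
    ‖T.foot r d.1 - T.corner d.1 d.2‖ ^ 2 + T.heightSq r d.1 = r (T.vertex d) ^ 2 := by
  rw [← dist_eq_norm, dist_comm, ← facePower_eq_foot, facePower_corner]

/-- The dictionary between the position of the foot of the altitude of a pyramid and the lengths of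
its edges. -/
lemma pyramid_formulas (r : V → ℝ) (d : T.Face × Fin 3) :
    0 < T.baseAreaSq d ∧
    T.sideFootArea r d = T.footDist r d * Real.sqrt (T.baseAreaSq d) * T.length d ∧
    T.edgeMinor r d = T.length d ^ 2 * (T.footDist r d ^ 2 + T.heightSq r d.1) := by
  obtain ⟨f, k⟩ := d
  have hk2 : k - 1 = k + 2 := by revert k; decide
  have hk3 : k + 2 + 1 = k := by revert k; decide
  have hk4 : k + 1 + 1 = k + 2 := by revert k; decide
  have hne1 : ¬ (k + 2 = k + 1) := by revert k; decide
  have hne2 : ¬ (k + 2 = k) := by revert k; decide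
  set e := T.corner f (k + 1) - T.corner f k with he
  set e₂ := T.corner f (k + 2) - T.corner f k with he₂
  set w := T.foot r f - T.corner f k with hw
  set g := T.baryGrad f (k + 2) with hg
  have he0 : e ≠ 0 := sub_ne_zero.2 (T.corner_ne f (by simp))
  have hg0 : inner ℝ g e = 0 := by
    rw [hg, he, ← bary_sub, bary_corner, bary_corner, if_neg hne1, if_neg hne2, sub_zero]
  have hg1 : inner ℝ g e₂ = 1 := by
    rw [hg, he₂, ← bary_sub, bary_corner, bary_corner, if_pos rfl, if_neg hne2, sub_zero]
  have hgw : T.footDist r (f, k) = inner ℝ g w / ‖g‖ := by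
    rw [hg, hw, ← bary_sub, bary_corner, if_neg hne2, sub_zero]; rfl
  have hc : T.length (f, k) = ‖e‖ := by rw [length, dist_comm, dist_eq_norm]
  have hb : T.length (prevSide (f, k)) = ‖e₂‖ := by
    simp only [length, prevSide, hk2, hk3]; rw [dist_eq_norm]
  have ha : T.length (nextSide (f, k)) = ‖e₂ - e‖ := by
    simp only [length, nextSide, hk4]; rw [dist_comm, dist_eq_norm, he, he₂]; congr 1; abel
  have hx := T.dist_corner_foot r (f, k)
  have hy := T.dist_corner_foot r (nextSide (f, k))
  have hz := T.dist_corner_foot r (prevSide (f, k))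
  have hy' : T.foot r (nextSide (f, k)).1 - T.corner (nextSide (f, k)).1 (nextSide (f, k)).2 =
      w - e := by simp only [nextSide, hw, he]; abel
  have hz' : T.foot r (prevSide (f, k)).1 - T.corner (prevSide (f, k)).1 (prevSide (f, k)).2 =
      w - e₂ := by simp only [prevSide, hk2, hw, he₂]; abel
  rw [hy', norm_sub_sq_real] at hy
  rw [hz', norm_sub_sq_real] at hz
  change ‖w‖ ^ 2 + T.heightSq r f = _ at hx
  change _ + T.heightSq r f = _ at hy
  change _ + T.heightSq r f = _ at hz
  have ha2 : T.length (nextSide (f, k)) ^ 2 = ‖e₂‖ ^ 2 - 2 * inner ℝ e e₂ + ‖e‖ ^ 2 := by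
    rw [ha, norm_sub_sq_real, real_inner_comm]
  obtain ⟨h1, h2, h3⟩ := plane_normal (w := w) he0 hg0 hg1
  have hΔ : T.baseAreaSq (f, k) = ‖e‖ ^ 2 * ‖e₂‖ ^ 2 - inner ℝ e e₂ ^ 2 := by
    rw [baseAreaSq, areaSq, ha2, hc, hb]; ring
  refine ⟨by rwa [hΔ], ?_, ?_⟩
  · rw [hgw, hΔ, hc, h2]
    unfold sideFootArea footArea gramMinor gramCofactor gramEntry
    rw [ha2, hc, hb, ← hx, ← hy, ← hz]
    ring
  · rw [hgw, hc, mul_add, mul_comm (‖e‖ ^ 2), h3]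
    unfold edgeMinor gramMinor gramEntry
    rw [hc, ← hx, ← hy]
    ring

lemma baseAreaSq_pos (d : T.Face × Fin 3) : 0 < T.baseAreaSq d := (T.pyramid_formulas 0 d).1

lemma pyramidDet_eq (r : V → ℝ) (d : T.Face × Fin 3) :
    T.pyramidDet r d = T.heightSq r d.1 * T.baseAreaSq d := by
  obtain ⟨h1, h2, h3⟩ := T.pyramid_formulas r d
  have h4 : T.baseAreaSq d * T.edgeMinor r d - T.sideFootArea r d ^ 2 =
    T.length d ^ 2 * T.pyramidDet r d := areaSq_mul_sub_sq _ _ _ _ _ _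
  rw [h2, h3, mul_pow, mul_pow, Real.sq_sqrt h1.le] at h4
  have h5 : T.length d ^ 2 ≠ 0 := (pow_pos (T.length_pos d) 2).ne'
  apply mul_left_cancel₀ h5
  rw [← h4]; ring

lemma pyramidDet_pos {r : V → ℝ} {d : T.Face × Fin 3} (h : 0 < T.heightSq r d.1) :
    0 < T.pyramidDet r d := by
  rw [pyramidDet_eq]; exact mul_pos h (T.baseAreaSq_pos d)

lemma edgeMinor_pos {r : V → ℝ} {d : T.Face × Fin 3} (h : 0 < T.heightSq r d.1) :
    0 < T.edgeMinor r d := by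
  rw [(T.pyramid_formulas r d).2.2]
  have := T.length_pos d
  positivity

lemma edgeMinor_glue (r : V → ℝ) (d : T.Face × Fin 3) :
    T.edgeMinor r (T.glue d) = T.edgeMinor r d := by
  unfold edgeMinor
  rw [T.vertex_glue, T.vertex_nextSide_glue, T.length_glue, gramMinor_comm]

lemma edgeMinor_mul_sub_sq (r : V → ℝ) (d : T.Face × Fin 3) :
    T.edgeMinor r d * T.edgeMinor r (prevSide d) - T.cornerCofactor r d ^ 2 =
      r (T.vertex d) ^ 2 * T.pyramidDet r d := by
  have := gramMinor_mul_sub_sq (r (T.vertex d)) (r (T.vertex (nextSide d)))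
    (r (T.vertex (prevSide d))) (T.length d) (T.length (nextSide d)) (T.length (prevSide d))
  unfold edgeMinor
  rw [nextSide_prevSide]
  exact this

lemma radialDihedral_eq {r : V → ℝ} (hr : ∀ i, 0 < r i) {d : T.Face × Fin 3}
    (h : 0 < T.heightSq r d.1) :
    T.radialDihedral r d = Real.arccos (T.cornerCofactor r d /
      Real.sqrt (T.edgeMinor r d * T.edgeMinor r (prevSide d))) := by
  have h1 : 0 < T.edgeMinor r d := T.edgeMinor_pos h
  have h2 : 0 < T.edgeMinor r (nextSide d) := T.edgeMinor_pos (d := nextSide d) h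
  have h3 : 0 < T.edgeMinor r (prevSide d) := T.edgeMinor_pos (d := prevSide d) h
  unfold edgeMinor at h1 h2 h3 ⊢
  rw [nextSide_nextSide] at h2
  rw [nextSide_prevSide] at h3 ⊢
  unfold radialDihedral apexAngle cornerCofactor
  rw [nextSide_nextSide, nextSide_prevSide]
  exact sphAngle_radial (hr _) (hr _) (hr _) h1 h2 h3

lemma baseDihedral_eq {r : V → ℝ} (hr : ∀ i, 0 < r i) {d : T.Face × Fin 3}
    (h : 0 < T.heightSq r d.1) :
    T.baseDihedral r d = Real.arccos (T.sideFootArea r d /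
      Real.sqrt (T.edgeMinor r d * T.baseAreaSq d)) := by
  have h1 : 0 < T.edgeMinor r d := T.edgeMinor_pos h
  have h3 : 0 < T.edgeMinor r (prevSide d) := T.edgeMinor_pos (d := prevSide d) h
  unfold edgeMinor at h1 h3 ⊢
  rw [nextSide_prevSide] at h3
  unfold baseDihedral sideAngle sideAngleRev baseAngle sideFootArea baseAreaSq
  rw [nextSide_prevSide]
  exact sphAngle_base (hr _) (T.length_pos _) (T.length_pos _) h1 h3 (T.baseAreaSq_pos d)

lemma baseDihedral_eq_footDist {r : V → ℝ} (hr : ∀ i, 0 < r i) {d : T.Face × Fin 3}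
    (h : 0 < T.heightSq r d.1) :
    T.baseDihedral r d = Real.arccos (T.footDist r d * T.length d /
      Real.sqrt (T.edgeMinor r d)) := by
  rw [T.baseDihedral_eq hr h, (T.pyramid_formulas r d).2.1, Real.sqrt_mul (T.edgeMinor_pos h).le]
  congr 1
  have h1 := Real.sqrt_pos.2 (T.baseAreaSq_pos d)
  have h2 := Real.sqrt_pos.2 (T.edgeMinor_pos h)
  field_simp

lemma abs_footDist_mul_lt {r : V → ℝ} {d : T.Face × Fin 3} (h : 0 < T.heightSq r d.1) :
    |T.footDist r d * T.length d| < Real.sqrt (T.edgeMinor r d) := by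
  rw [Real.lt_sqrt (abs_nonneg _), sq_abs, (T.pyramid_formulas r d).2.2]
  have := pow_pos (T.length_pos d) 2
  nlinarith

/-- The convexity condition at an edge, in terms of dihedral angles and in terms of the feet of the
altitudes of the two pyramids. -/
lemma boundaryDihedral_le_pi_iff {r : V → ℝ} (hr : ∀ i, 0 < r i) (h : ∀ f, 0 < T.heightSq r f)
    (d : T.Face × Fin 3) :
    T.boundaryDihedral r d ≤ Real.pi ↔ 0 ≤ T.footDist r d + T.footDist r (T.glue d) := by
  have h0 := Real.sqrt_pos.2 (T.edgeMinor_pos (r := r) (d := d) (h _))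
  have a1 := abs_lt.1 (T.abs_footDist_mul_lt (r := r) (d := d) (h _))
  have a2 := abs_lt.1 (T.abs_footDist_mul_lt (r := r) (d := T.glue d) (h _))
  have hl := T.length_pos d
  rw [edgeMinor_glue, length_glue] at a2
  rw [boundaryDihedral, T.baseDihedral_eq_footDist hr (h _), T.baseDihedral_eq_footDist hr (h _),
    edgeMinor_glue, length_glue, ← le_sub_iff_add_le', ← Real.arccos_neg,
    Real.strictAntiOn_arccos.le_iff_ge]
  · rw [← neg_div, div_le_div_iff_of_pos_right h0]
    constructor
    · intro h'
      by_contra! hlt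
      nlinarith
    · intro h'
      nlinarith
  · constructor
    · rw [le_div_iff₀ h0]; linarith
    · rw [div_le_iff₀ h0]; linarith
  · rw [← neg_div]
    constructor
    · rw [le_div_iff₀ h0]; linarith
    · rw [div_le_iff₀ h0]; linarith

lemma linearIndependent_of_affineIndependent_cons {a : E3} {P : Fin 3 → E3}
    (h : AffineIndependent ℝ (Fin.cons a P : Fin 4 → E3)) :
    LinearIndependent ℝ fun k => P k - a := by
  rw [affineIndependent_iff_linearIndependent_vsub ℝ _ (0 : Fin 4)] at h
  have h1 := h.comp (fun k : Fin 3 => (⟨k.succ, Fin.succ_ne_zero k⟩ : {x : Fin 4 // x ≠ 0}))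
    (fun k l hkl => by simpa using hkl)
  exact h1

/-- A pyramid in space with the given edge lengths has the distance from its apex to the image of
the foot as its height. -/
lemma heightSq_pos_of_hasPyramids {r : V → ℝ} (h : T.HasPyramids r) (f : T.Face) :
    0 < T.heightSq r f := by
  obtain ⟨a, P, hP, hl, ha⟩ := h f
  have hu := linearIndependent_of_affineIndependent_cons hP
  set u : Fin 3 → E3 := fun k => P k - a with hu'
  set w : Fin 3 → E2 := fun k => T.corner f k - T.foot r f with hw
  set b : Fin 3 → ℝ := fun k => T.bary f k (T.foot r f) with hb
  have hun : ∀ k, ‖u k‖ ^ 2 = r (T.vertex (f, k)) ^ 2 := by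
    intro k
    rw [← ha k, dist_comm, dist_eq_norm]
  have hwn : ∀ k, ‖w k‖ ^ 2 = r (T.vertex (f, k)) ^ 2 - T.heightSq r f := by
    intro k
    rw [← T.dist_corner_foot r (f, k), norm_sub_rev]; ring
  have hnext : ∀ k, inner ℝ (w k) (w (k + 1)) = inner ℝ (u k) (u (k + 1)) - T.heightSq r f := by
    intro k
    have h1 := norm_sub_sq_real (w k) (w (k + 1))
    have h2 := norm_sub_sq_real (u k) (u (k + 1))
    have h3 : ‖w k - w (k + 1)‖ = ‖u k - u (k + 1)‖ := by
      have := hl k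
      rw [length, dist_eq_norm, dist_eq_norm] at this
      simp only [hw, hu', sub_sub_sub_cancel_right]
      exact this.symm
    rw [h3, h2, hwn, hwn, hun, hun] at h1
    linarith
  have hin : ∀ k l, inner ℝ (w k) (w l) = inner ℝ (u k) (u l) - T.heightSq r f := by
    intro k l
    rcases fin3_cases k l with rfl | rfl | rfl
    · rw [real_inner_self_eq_norm_sq, real_inner_self_eq_norm_sq, hwn, hun]
    · exact hnext k
    · have h1 := hnext (k + 2)
      have h2 : k + 2 + 1 = k := by clear h1; revert k; decide
      rw [h2] at h1
      rw [real_inner_comm, h1, real_inner_comm]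
  have hb1 : ∑ k, b k = 1 := T.sum_bary f _
  have hbw : ∑ k, b k • w k = 0 := by
    simp only [hw, smul_sub, Finset.sum_sub_distrib, ← Finset.sum_smul, hb1, one_smul]
    rw [T.sum_bary_smul, sub_self]
  have hsum : inner ℝ (∑ k, b k • w k) (∑ l, b l • w l) =
      inner ℝ (∑ k, b k • u k) (∑ l, b l • u l) - T.heightSq r f := by
    have h5 : T.heightSq r f = ∑ k, ∑ l, b k * (b l * T.heightSq r f) := by
      simp_rw [← Finset.mul_sum, ← Finset.sum_mul, hb1]; simp
    rw [h5]
    simp only [sum_inner, inner_sum, real_inner_smul_left, real_inner_smul_right]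
    rw [← Finset.sum_sub_distrib]
    refine Finset.sum_congr rfl fun k _ => ?_
    rw [← Finset.sum_sub_distrib]
    refine Finset.sum_congr rfl fun l _ => ?_
    rw [hin]
    ring
  rw [hbw, inner_zero_left, real_inner_self_eq_norm_sq] at hsum
  have hne : ∑ k, b k • u k ≠ 0 := by
    intro h0
    have := Fintype.linearIndependent_iff.1 hu b h0
    simp [this] at hb1
  have := norm_pos_iff.2 hne
  nlinarith

lemma hasPyramids_of_heightSq_pos {r : V → ℝ} (hr : ∀ i, 0 < r i) (h : ∀ f, 0 < T.heightSq r f) :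
    T.HasPyramids r := by
  intro f
  set a : E3 := !₂[T.foot r f 0, T.foot r f 1, Real.sqrt (T.heightSq r f)] with ha
  set P : Fin 3 → E3 := fun k => !₂[T.corner f k 0, T.corner f k 1, 0] with hP
  have hh := Real.sqrt_pos.2 (h f)
  refine ⟨a, P, ?_, fun k => ?_, fun k => ?_⟩
  · rw [affineIndependent_iff_of_fintype]
    intro w hw h1
    rw [Finset.univ.weightedVSub_eq_linear_combination hw] at h1
    have hc : ∀ i : Fin 3, ∑ j, w j * (Fin.cons a P : Fin 4 → E3) j i = 0 := by
      intro i
      have := congrArg (fun v : E3 => v i) h1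
      simpa using this
    have h2 := hc 2
    have h3 := hc 0
    have h4 := hc 1
    rw [Fin.sum_univ_succ] at h2 h3 h4 hw
    simp only [Fin.cons_zero, Fin.cons_succ] at h2 h3 h4
    simp [ha, hP] at h2 h3 h4
    have hw0 : w 0 = 0 := by
      rcases h2 with h2 | h2
      · exact h2
      · exact absurd h2 hh.ne'
    rw [hw0, zero_mul, zero_add] at h3 h4
    rw [hw0, zero_add] at hw
    have h5 := (affineIndependent_iff_of_fintype ℝ _).1 (T.affineIndependent_corner f)
      (fun k => w k.succ) hw (by
        rw [Finset.univ.weightedVSub_eq_linear_combination hw]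
        ext i
        fin_cases i
        · simpa using h3
        · simpa using h4)
    intro i
    induction i using Fin.cases with
    | zero => exact hw0
    | succ k => exact h5 k
  · rw [length, EuclideanSpace.dist_eq, EuclideanSpace.dist_eq, Fin.sum_univ_three,
      Fin.sum_univ_two]
    simp [hP]
  · have h2 := T.dist_corner_foot r (f, k)
    rw [← dist_eq_norm, EuclideanSpace.dist_eq, Real.sq_sqrt (by positivity),
      Fin.sum_univ_two] at h2
    rw [EuclideanSpace.dist_eq, Fin.sum_univ_three, ← Real.sqrt_sq (hr _).le, ← h2]
    congr 1
    simp [ha, hP, Real.dist_eq, Real.sq_sqrt (h f).le]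

/-- Convexity in terms of the power function. -/
lemma isConvexPolytope_iff {r : V → ℝ} : T.IsConvexPolytope r ↔
    (∀ i, 0 < r i) ∧ (∀ f, 0 < T.heightSq r f) ∧ T.PowerConcave r := by
  constructor
  · rintro ⟨h1, h2, h3⟩
    have h4 := T.heightSq_pos_of_hasPyramids h2
    exact ⟨h1, h4, fun d => (T.boundaryDihedral_le_pi_iff h1 h4 d).1 (h3 d)⟩
  · rintro ⟨h1, h2, h3⟩
    exact ⟨h1, T.hasPyramids_of_heightSq_pos h1 h2,
      fun d => (T.boundaryDihedral_le_pi_iff h1 h2 d).2 (h3 d)⟩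

/-! ### The dual polyhedron -/

lemma isSimplicialFan_apexAngle {r : V → ℝ} (hr : ∀ i, 0 < r i) (h : T.HasPyramids r) :
    T.IsSimplicialFan (T.apexAngle r) := by
  have h0 := T.heightSq_pos_of_hasPyramids h
  refine ⟨fun d => ?_, fun d => ?_, fun f => ?_⟩
  · unfold apexAngle
    rw [T.vertex_glue, T.vertex_nextSide_glue, T.length_glue, triAngle_comm]
  · have h1 := T.edgeMinor_pos (r := r) (d := d) (h0 _)
    have h2 : 0 < Real.sin (T.apexAngle r d) := by
      unfold apexAngle
      rw [sin_triAngle (hr _) (hr _)]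
      have := hr (T.vertex d)
      have := hr (T.vertex (nextSide d))
      have := Real.sqrt_pos.2 h1
      unfold edgeMinor at this
      positivity
    refine ⟨lt_of_le_of_ne (Real.arccos_nonneg _) ?_, lt_of_le_of_ne (Real.arccos_le_pi _) ?_⟩
    · intro h3
      change 0 = T.apexAngle r d at h3
      rw [← h3, Real.sin_zero] at h2; exact lt_irrefl _ h2
    · intro h3
      change T.apexAngle r d = Real.pi at h3
      rw [h3, Real.sin_pi] at h2; exact lt_irrefl _ h2
  · obtain ⟨a, P, hP, hl, ha⟩ := h f
    have hu := linearIndependent_of_affineIndependent_cons hP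
    have hn : ∀ k, ‖P k - a‖ = r (T.vertex (f, k)) := by
      intro k; rw [← ha k, dist_comm, dist_eq_norm]
    refine ⟨fun k => (r (T.vertex (f, k)))⁻¹ • (P k - a), ?_, fun k => ?_, fun k => ?_⟩
    · exact hu.units_smul fun k => Units.mk0 _ (inv_ne_zero (hr (T.vertex (f, k))).ne')
    · rw [norm_smul, hn, Real.norm_of_nonneg (inv_nonneg.2 (hr _).le), inv_mul_cancel₀ (hr _).ne']
    · rw [InnerProductGeometry.angle_smul_left_of_pos _ _ (inv_pos.2 (hr _)),
        InnerProductGeometry.angle_smul_right_of_pos _ _ (inv_pos.2 (hr _))]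
      have h1 := norm_sub_sq_real (P k - a) (P (k + 1) - a)
      rw [sub_sub_sub_cancel_right, ← dist_eq_norm, hl, hn, hn] at h1
      unfold InnerProductGeometry.angle apexAngle
      rw [hn, hn, triAngle_eq_arccos]
      congr 2
      unfold gramEntry
      simp only [nextSide]
      linarith

/-- The Gram determinant of the three unit vectors of a triangle of a fan. -/
noncomputable def fanDet (φ : T.Face × Fin 3 → ℝ) (d : T.Face × Fin 3) : ℝ :=
  1 + 2 * Real.cos (φ (nextSide d)) * Real.cos (φ d) * Real.cos (φ (prevSide d)) -
    Real.cos (φ (nextSide d)) ^ 2 - Real.cos (φ d) ^ 2 - Real.cos (φ (prevSide d)) ^ 2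

lemma leftAltitude_eq {φ : T.Face × Fin 3 → ℝ} (h : V → ℝ) {d : T.Face × Fin 3}
    (hs : ∀ d, 0 < Real.sin (φ d)) (hG : 0 < T.fanDet φ d) :
    T.leftAltitude φ h d = (h (T.vertex (prevSide d)) * Real.sin (φ d) ^ 2 -
      h (T.vertex d) * (Real.cos (φ (prevSide d)) - Real.cos (φ (nextSide d)) * Real.cos (φ d)) -
      h (T.vertex (nextSide d)) *
        (Real.cos (φ (nextSide d)) - Real.cos (φ (prevSide d)) * Real.cos (φ d))) /
      (Real.sqrt (T.fanDet φ d) * Real.sin (φ d)) := by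
  have h1 := altitude_eq (A := φ (nextSide d)) (B := φ (prevSide d)) (C := φ d)
    (hi := h (T.vertex d)) (hj := h (T.vertex (nextSide d))) (hk := h (T.vertex (prevSide d)))
    (hs _) (hs _) (G := T.fanDet φ d) (by unfold fanDet; ring) hG
  have hcomm : ∀ A B C, sphAngle A B C = sphAngle A C B := by
    intro A B C; unfold sphAngle; rw [mul_comm (Real.cos B), mul_comm (Real.sin B)]
  rw [← h1]
  unfold Triangulation.leftAltitude Triangulation.edgeAltitudeRev Triangulation.edgeAltitude
    Triangulation.fanAngle
  rw [nextSide_prevSide, hcomm]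

lemma rightAltitude_eq {φ : T.Face × Fin 3 → ℝ} (h : V → ℝ) {d : T.Face × Fin 3}
    (hφ : ∀ d, φ (T.glue d) = φ d)
    (hs : ∀ d, 0 < Real.sin (φ d)) (hG : 0 < T.fanDet φ (T.glue d)) :
    T.rightAltitude φ h d = T.leftAltitude φ h (T.glue d) := by
  rw [T.leftAltitude_eq h hs hG, T.vertex_glue, T.vertex_nextSide_glue]
  set e := T.glue d with he
  have h1 := altitude_eq (A := φ (prevSide e)) (B := φ (nextSide e)) (C := φ e)
    (hi := h (T.vertex d)) (hj := h (T.vertex (nextSide d))) (hk := h (T.vertex (prevSide e)))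
    (hs _) (hs _) (G := T.fanDet φ e) (by unfold fanDet; ring) hG
  have hd : φ d = φ e := (hφ d).symm
  have h2 : (h (T.vertex (prevSide e)) * Real.sin (φ e) ^ 2 -
      h (T.vertex (nextSide d)) *
        (Real.cos (φ (prevSide e)) - Real.cos (φ (nextSide e)) * Real.cos (φ e)) -
      h (T.vertex d) *
        (Real.cos (φ (nextSide e)) - Real.cos (φ (prevSide e)) * Real.cos (φ e))) =
      (h (T.vertex (prevSide e)) * Real.sin (φ e) ^ 2 - h (T.vertex d) *
        (Real.cos (φ (nextSide e)) - Real.cos (φ (prevSide e)) * Real.cos (φ e)) -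
      h (T.vertex (nextSide d)) *
        (Real.cos (φ (prevSide e)) - Real.cos (φ (nextSide e)) * Real.cos (φ e))) := by ring
  rw [h2, ← h1]
  unfold Triangulation.rightAltitude Triangulation.edgeAltitude Triangulation.fanAngle
  rw [← he, nextSide_nextSide, prevSide_nextSide, T.vertex_nextSide_glue, hd]

section Apex

variable {r : V → ℝ}

lemma cos_apexAngle (hr : ∀ i, 0 < r i) (h : ∀ f, 0 < T.heightSq r f) (d : T.Face × Fin 3) :
    Real.cos (T.apexAngle r d) =
      gramEntry (r (T.vertex d)) (r (T.vertex (nextSide d))) (T.length d) /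
        (r (T.vertex d) * r (T.vertex (nextSide d))) :=
  cos_triAngle (hr _) (hr _) (T.edgeMinor_pos (h _))

lemma sin_apexAngle (hr : ∀ i, 0 < r i) (d : T.Face × Fin 3) :
    Real.sin (T.apexAngle r d) = Real.sqrt (T.edgeMinor r d) /
        (r (T.vertex d) * r (T.vertex (nextSide d))) :=
  sin_triAngle (hr _) (hr _)

lemma sin_apexAngle_pos (hr : ∀ i, 0 < r i) (h : ∀ f, 0 < T.heightSq r f) (d : T.Face × Fin 3) :
    0 < Real.sin (T.apexAngle r d) := by
  rw [T.sin_apexAngle hr]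
  have := hr (T.vertex d)
  have := hr (T.vertex (nextSide d))
  have := Real.sqrt_pos.2 (T.edgeMinor_pos (d := d) (h _))
  positivity

lemma fanDet_apexAngle (hr : ∀ i, 0 < r i) (h : ∀ f, 0 < T.heightSq r f) (d : T.Face × Fin 3) :
    T.fanDet (T.apexAngle r) d = T.pyramidDet r d /
      (r (T.vertex d) * r (T.vertex (nextSide d)) * r (T.vertex (prevSide d))) ^ 2 := by
  unfold fanDet
  rw [T.cos_apexAngle hr h, T.cos_apexAngle hr h, T.cos_apexAngle hr h, nextSide_nextSide,
    nextSide_prevSide]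
  have := hr (T.vertex d)
  have := hr (T.vertex (nextSide d))
  have := hr (T.vertex (prevSide d))
  unfold pyramidDet gramDet
  field_simp
  ring

lemma fanDet_apexAngle_pos (hr : ∀ i, 0 < r i) (h : ∀ f, 0 < T.heightSq r f)
    (d : T.Face × Fin 3) : 0 < T.fanDet (T.apexAngle r) d := by
  rw [T.fanDet_apexAngle hr h]
  have := hr (T.vertex d)
  have := hr (T.vertex (nextSide d))
  have := hr (T.vertex (prevSide d))
  have := T.pyramidDet_pos (d := d) (h _)
  positivity

lemma apexAngle_glue (r : V → ℝ) (d : T.Face × Fin 3) :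
    T.apexAngle r (T.glue d) = T.apexAngle r d := by
  unfold apexAngle
  rw [T.vertex_glue, T.vertex_nextSide_glue, T.length_glue, triAngle_comm]

/-- The altitude of the dual polyhedron over an edge is proportional to the signed distance of the
foot of the altitude of the pyramid from the edge. -/
lemma leftAltitude_apexAngle (hr : ∀ i, 0 < r i) (h : ∀ f, 0 < T.heightSq r f)
    (d : T.Face × Fin 3) :
    T.leftAltitude (T.apexAngle r) (fun i => 1 / r i) d =
      T.sideFootArea r d / (Real.sqrt (T.pyramidDet r d) * Real.sqrt (T.edgeMinor r d)) := by
  rw [T.leftAltitude_eq _ (T.sin_apexAngle_pos hr h) (T.fanDet_apexAngle_pos hr h d),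
    T.fanDet_apexAngle hr h, T.cos_apexAngle hr h, T.cos_apexAngle hr h, T.cos_apexAngle hr h,
    T.sin_apexAngle hr, nextSide_nextSide, nextSide_prevSide]
  have hx := hr (T.vertex d)
  have hy := hr (T.vertex (nextSide d))
  have hz := hr (T.vertex (prevSide d))
  have hS := T.edgeMinor_pos (d := d) (h _)
  have h1 := Real.sqrt_pos.2 (T.pyramidDet_pos (d := d) (h _))
  have h2 := Real.sqrt_pos.2 hS
  rw [Real.sqrt_div (T.pyramidDet_pos (d := d) (h _)).le, Real.sqrt_sq (by positivity), div_pow,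
    Real.sq_sqrt hS.le]
  have h3 : T.sideFootArea r d = T.edgeMinor r d -
      (gramEntry (r (T.vertex (nextSide d))) (r (T.vertex (prevSide d))) (T.length (nextSide d)) *
        r (T.vertex d) ^ 2 -
      gramEntry (r (T.vertex d)) (r (T.vertex (nextSide d))) (T.length d) *
        gramEntry (r (T.vertex (prevSide d))) (r (T.vertex d)) (T.length (prevSide d))) -
      (gramEntry (r (T.vertex (prevSide d))) (r (T.vertex d)) (T.length (prevSide d)) *
        r (T.vertex (nextSide d)) ^ 2 -
      gramEntry (r (T.vertex (nextSide d))) (r (T.vertex (prevSide d))) (T.length (nextSide d)) *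
      gramEntry (r (T.vertex d)) (r (T.vertex (nextSide d))) (T.length d)) := rfl
  rw [h3]
  field_simp
  ring

/-- The dual edge length of the dual polyhedron. -/
lemma dualLength_apexAngle (hr : ∀ i, 0 < r i) (h : ∀ f, 0 < T.heightSq r f)
    (d : T.Face × Fin 3) :
    T.dualLength (T.apexAngle r) (fun i => 1 / r i) d =
      T.length d / Real.sqrt (T.edgeMinor r d) *
        (T.footDist r d / Real.sqrt (T.heightSq r d.1) +
          T.footDist r (T.glue d) / Real.sqrt (T.heightSq r (T.glue d).1)) := by
  have hd : ∀ d, T.leftAltitude (T.apexAngle r) (fun i => 1 / r i) d =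
      T.length d / Real.sqrt (T.edgeMinor r d) *
        (T.footDist r d / Real.sqrt (T.heightSq r d.1)) := by
    intro d
    rw [T.leftAltitude_apexAngle hr h, (T.pyramid_formulas r d).2.1, T.pyramidDet_eq,
      Real.sqrt_mul (h _).le]
    have h1 := Real.sqrt_pos.2 (T.baseAreaSq_pos d)
    have h2 := Real.sqrt_pos.2 (T.edgeMinor_pos (d := d) (h _))
    have h3 := Real.sqrt_pos.2 (h d.1)
    field_simp
  rw [Triangulation.dualLength, T.rightAltitude_eq _ (T.apexAngle_glue r) (T.sin_apexAngle_pos hr h)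
    (T.fanDet_apexAngle_pos hr h _), hd, hd, T.edgeMinor_glue, T.length_glue]
  ring

lemma div_sqrt_add_div_sqrt_nonneg {s s' H H' c D : ℝ} (hc : 0 < c) (hH : 0 < H) (hH' : 0 < H')
    (h1 : D = c ^ 2 * (s ^ 2 + H)) (h2 : D = c ^ 2 * (s' ^ 2 + H')) (h : 0 ≤ s + s') :
    0 ≤ s / Real.sqrt H + s' / Real.sqrt H' := by
  have hc2 : c ^ 2 ≠ 0 := (pow_pos hc 2).ne'
  have h3 : s ^ 2 + H = s' ^ 2 + H' := mul_left_cancel₀ hc2 (h1.symm.trans h2)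
  have a1 := Real.sqrt_pos.2 hH
  have a2 := Real.sqrt_pos.2 hH'
  have b1 := Real.sq_sqrt hH.le
  have b2 := Real.sq_sqrt hH'.le
  rcases le_or_gt 0 s with hs | hs <;> rcases le_or_gt 0 s' with hs' | hs'
  · positivity
  · have : Real.sqrt H ≤ Real.sqrt H' := Real.sqrt_le_sqrt (by nlinarith)
    rw [div_add_div _ _ a1.ne' a2.ne']
    exact div_nonneg (by nlinarith) (by positivity)
  · have : Real.sqrt H' ≤ Real.sqrt H := Real.sqrt_le_sqrt (by nlinarith)
    rw [div_add_div _ _ a1.ne' a2.ne']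
    exact div_nonneg (by nlinarith) (by positivity)
  · linarith

lemma dualLength_nonneg (hr : ∀ i, 0 < r i) (h : ∀ f, 0 < T.heightSq r f)
    (hc : T.PowerConcave r) (d : T.Face × Fin 3) :
    0 ≤ T.dualLength (T.apexAngle r) (fun i => 1 / r i) d := by
  rw [T.dualLength_apexAngle hr h]
  refine mul_nonneg (div_nonneg (T.length_pos d).le (Real.sqrt_nonneg _)) ?_
  have h1 := (T.pyramid_formulas r d).2.2
  have h2 := (T.pyramid_formulas r (T.glue d)).2.2
  rw [T.edgeMinor_glue, T.length_glue] at h2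
  exact div_sqrt_add_div_sqrt_nonneg (T.length_pos d) (h _) (h _) h1 h2 (hc d)

lemma isConvexPolyhedron_dual (hP : T.IsConvexPolytope r) :
    T.IsConvexPolyhedron (T.apexAngle r) (fun i => 1 / r i) := by
  obtain ⟨h1, h2, h3⟩ := T.isConvexPolytope_iff.1 hP
  exact ⟨T.isSimplicialFan_apexAngle hP.1 hP.2.1, T.dualLength_nonneg h1 h2 h3⟩

end Apex

end GeodesicTriangulation
/-- Two vectors of the plane that are orthogonal to the same unit vector are proportional. -/
lemma exists_eq_smul_of_inner_eq_zero {n e w : E2} (hn : ‖n‖ = 1) (he : e ≠ 0)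
    (h1 : inner ℝ n e = 0) (h2 : inner ℝ n w = 0) : ∃ c : ℝ, w = c • e := by
  have hi : ∀ u v : E2, inner ℝ u v = u 0 * v 0 + u 1 * v 1 := by
    intro u v
    simp [PiLp.inner_apply, Fin.sum_univ_two, mul_comm]
  have hn1 : n 0 ^ 2 + n 1 ^ 2 = 1 := by
    have h := EuclideanSpace.norm_sq_eq n
    rw [hn, Fin.sum_univ_two] at h
    simpa using h.symm
  have he1 : 0 < e 0 ^ 2 + e 1 ^ 2 := by
    have h := EuclideanSpace.norm_sq_eq e
    rw [Fin.sum_univ_two] at h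
    have h3 := norm_pos_iff.2 he
    simp only [Real.norm_eq_abs, sq_abs] at h
    rw [← h]; positivity
  rw [hi] at h1 h2
  have hdet : e 0 * w 1 - e 1 * w 0 = 0 := by
    have h3 : n 0 * (e 0 * w 1 - e 1 * w 0) = 0 := by linear_combination w 1 * h1 - e 1 * h2
    have h4 : n 1 * (e 0 * w 1 - e 1 * w 0) = 0 := by linear_combination e 0 * h2 - w 0 * h1
    linear_combination n 0 * h3 + n 1 * h4 - (e 0 * w 1 - e 1 * w 0) * hn1
  refine ⟨(w 0 * e 0 + w 1 * e 1) / (e 0 ^ 2 + e 1 ^ 2), ?_⟩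
  ext i
  fin_cases i
  · simp only [Fin.zero_eta, PiLp.smul_apply, smul_eq_mul]
    field_simp
    linear_combination - e 1 * hdet
  · simp only [Fin.mk_one, PiLp.smul_apply, smul_eq_mul]
    field_simp
    linear_combination e 0 * hdet

namespace GeodesicTriangulation

variable {M : Type*} [MetricSpace M] {V : Finset M} (T : GeodesicTriangulation M V)

/-- Two straight curves from vertices to vertices coincide, including the parametrization, if they
agree near interior points up to an affine change of the parameter. -/
lemma IsStraightCurve.eq_of_eventually {γ γ' : ℝ → M}
    (h : IsStraightCurve V γ) (h' : IsStraightCurve V γ') (h0 : γ 0 ∈ V) (h0' : γ' 0 ∈ V)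
    {t t' c : ℝ} (ht : t ∈ Set.Ioo (0 : ℝ) 1) (ht' : t' ∈ Set.Ioo (0 : ℝ) 1) (hc : 0 < c)
    (he : ∀ᶠ s in nhds 0, γ' (t' + s) = γ (t + c * s)) :
    c = 1 ∧ ∀ s ∈ Set.Icc (0 : ℝ) 1, γ' s = γ s := by
  set b := t - c * t' with hb
  -- the parameter interval of the reparametrization of `γ` is `(α, β)`
  set α := -b / c with hα
  set β := (1 - b) / c with hβ
  have hα1 : c * α + b = 0 := by rw [hα]; field_simp; ring
  have hβ1 : c * β + b = 1 := by rw [hβ]; field_simp; ring_nf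
  have hmono : ∀ {x y : ℝ}, c * x + b < c * y + b ↔ x < y := by
    intro x y
    constructor
    · intro hxy; exact lt_of_mul_lt_mul_left (by linarith) hc.le
    · intro hxy; linarith [mul_lt_mul_of_pos_left hxy hc]
  have hαt : α < t' := by rw [← hmono, hα1, hb]; linarith [ht.1]
  have htβ : t' < β := by rw [← hmono, hβ1, hb]; linarith [ht.2]
  set p := max 0 α with hp
  set q := min 1 β with hq
  have hpt : p < t' := max_lt ht'.1 hαt
  have htq : t' < q := lt_min ht'.2 htβ
  have hcont : ContinuousOn (fun s => γ (c * s + b)) (Set.Icc p q) := by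
    refine h.continuousOn.comp (by fun_prop) fun s hs => ⟨?_, ?_⟩
    · have : α ≤ s := (le_max_right _ _).trans hs.1
      nlinarith
    · have : s ≤ β := hs.2.trans (min_le_right _ _)
      nlinarith
  have hcont' : ContinuousOn γ' (Set.Icc p q) := h'.continuousOn.mono
    (Set.Icc_subset_Icc (le_max_left _ _) (min_le_left _ _))
  have hmemIoo : ∀ s ∈ Set.Ioo α β, c * s + b ∈ Set.Ioo (0 : ℝ) 1 := fun s hs =>
    ⟨by rw [← hα1]; exact hmono.2 hs.1, by rw [← hβ1]; exact hmono.2 hs.2⟩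
  have hev : γ' =ᶠ[nhds t'] fun s => γ (c * s + b) := by
    have h1 : Filter.Tendsto (fun s => s - t') (nhds t') (nhds 0) := by
      have : ContinuousAt (fun s : ℝ => s - t') t' := by fun_prop
      simpa [ContinuousAt] using this
    filter_upwards [h1.eventually he] with s hs
    rw [add_sub_cancel] at hs
    rw [hs]; congr 1; rw [hb]; ring
  have hioo := eq_of_straightAt (a := p) (b := q)
    (fun s hs => h'.straightAt s ⟨(le_max_left _ _).trans_lt hs.1, hs.2.trans_le (min_le_left _ _)⟩)
    (fun s hs => (h.straightAt (c * s + b) (hmemIoo s ⟨(le_max_right _ _).trans_lt hs.1,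
      hs.2.trans_le (min_le_right _ _)⟩)).comp_affine) ⟨hpt, htq⟩ hev
  have hicc : Set.EqOn γ' (fun s => γ (c * s + b)) (Set.Icc p q) := by
    refine Set.EqOn.of_subset_closure (s := Set.Ioo p q) hioo hcont' hcont
      Set.Ioo_subset_Icc_self ?_
    rw [closure_Ioo (hpt.trans htq).ne]
  have hp' := hicc ⟨le_rfl, (hpt.trans htq).le⟩
  have hq' := hicc ⟨(hpt.trans htq).le, le_rfl⟩
  have hα0 : α = 0 := by
    rcases lt_trichotomy α 0 with h1 | h1 | h1
    · rw [hp, max_eq_left h1.le] at hp'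
      exact absurd (hp'.subst (motive := (· ∈ V)) h0')
        (h.notMem _ (hmemIoo 0 ⟨h1, ht'.1.trans htβ⟩))
    · exact h1
    · rw [hp, max_eq_right h1.le] at hp'
      simp only [hα1] at hp'
      exact absurd (hp' ▸ h0) (h'.notMem α ⟨h1, hαt.trans ht'.2⟩)
  have hβ0 : β = 1 := by
    rcases lt_trichotomy β 1 with h1 | h1 | h1
    · rw [hq, min_eq_right h1.le] at hq'
      simp only [hβ1] at hq'
      exact absurd (hq' ▸ h.end_mem) (h'.notMem β ⟨ht'.1.trans htβ, h1⟩)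
    · exact h1
    · rw [hq, min_eq_left h1.le] at hq'
      exact absurd (hq'.subst (motive := (· ∈ V)) h'.end_mem)
        (h.notMem _ (hmemIoo 1 ⟨hαt.trans ht'.2, h1⟩))
  rw [hα0, mul_zero, zero_add] at hα1
  rw [hβ0, mul_one, hα1, add_zero] at hβ1
  refine ⟨hβ1, fun s hs => ?_⟩
  have h5 := hicc (x := s) (by rwa [hp, hq, hα0, hβ0, max_self, min_self])
  simpa [hβ1, hα1] using h5

/-! ### The edges at which the power function is not smooth -/

/-- The vector along an edge. -/
noncomputable def edgeVec (d : T.Face × Fin 3) : E2 := T.corner d.1 (d.2 + 1) - T.corner d.1 d.2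

lemma norm_edgeVec (d : T.Face × Fin 3) : ‖T.edgeVec d‖ = T.length d := by
  rw [length, dist_comm, dist_eq_norm, edgeVec]

lemma edgeVec_ne_zero (d : T.Face × Fin 3) : T.edgeVec d ≠ 0 := by
  rw [← norm_pos_iff, norm_edgeVec]; exact T.length_pos d

/-- Near an interior point of a triangle, the second difference of the power function is that of
the squared norm. -/
lemma exists_flatDisc_interior_second_diff (r : V → ℝ) {f : T.Face} {x : E2}
    (hx : ∀ k, 0 < T.bary f k x) :
    ∃ ρ, ∃ Φ : E2 → M, IsFlatDisc (T.chart f x) ρ Φ ∧ ∀ u, ‖u‖ < ρ →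
      T.power r (Φ u) + T.power r (Φ (-u)) = 2 * T.power r (Φ 0) + 2 * ‖u‖ ^ 2 := by
  obtain ⟨ρ, Φ, hΦ, h⟩ := T.exists_flatDisc_interior_power r hx
  refine ⟨ρ, Φ, hΦ, fun u hu => ?_⟩
  rw [h u hu, h (-u) (by rwa [norm_neg]), h 0 (by simpa using hΦ.pos)]
  simp only [facePower_eq_foot, dist_eq_norm]
  set w := x - T.foot r f
  have e1 : x + u - T.foot r f = w + u := add_sub_right_comm _ _ _
  have e2 : x + -u - T.foot r f = w - u := by rw [sub_eq_add_neg w, ← add_sub_right_comm]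
  rw [e1, e2, add_zero, norm_add_sq_real w u, norm_sub_sq_real w u]
  ring

/-- The power function near an interior point of an edge. -/
lemma exists_flatDisc_side_second_diff {r : V → ℝ} (hr : T.PowerConcave r) (d : T.Face × Fin 3)
    {t : ℝ} (ht : t ∈ Set.Ioo (0 : ℝ) 1) :
    ∃ ρ, ∃ Φ : E2 → M, ∃ n : E2, IsFlatDisc (T.edgeCurve d t) ρ Φ ∧ ‖n‖ = 1 ∧
      inner ℝ n (T.edgeVec d) = 0 ∧
      (∀ s : ℝ, ‖s • T.edgeVec d‖ < ρ → Φ (s • T.edgeVec d) = T.edgeCurve d (t + s)) ∧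
      (∀ u, ‖u‖ < ρ → T.power r (Φ u) + T.power r (Φ (-u)) = 2 * T.power r (Φ 0) + 2 * ‖u‖ ^ 2 -
        2 * (T.footDist r d + T.footDist r (T.glue d)) * |inner ℝ n u|) ∧
      ∀ ε : ℝ, 0 ≤ ε → ε < ρ →
        T.power r (Φ (ε • n)) = T.power r (Φ 0) + ε ^ 2 - 2 * ε * T.footDist r d ∧
        T.power r (Φ (-(ε • n))) = T.power r (Φ 0) + ε ^ 2 - 2 * ε * T.footDist r (T.glue d) := by
  obtain ⟨ρ, Φ, hΦ, h⟩ := T.exists_flatDisc_side_power hr d ht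
  set g := T.baryGrad d.1 (d.2 + 2) with hg
  set x := T.sidePoint d t with hx
  set a := T.foot r d.1 with ha
  set σ := T.footDist r d + T.footDist r (T.glue d) with hσ
  have hg0 : 0 < ‖g‖ := norm_pos_iff.2 (T.baryGrad_ne_zero _ _)
  obtain ⟨n, hn⟩ : ∃ n : E2, n = ‖g‖⁻¹ • g := ⟨_, rfl⟩
  have hb0 : T.bary d.1 (d.2 + 2) x = 0 := T.bary_sidePoint_two d t
  have hnu : ∀ u, inner ℝ n u = inner ℝ g u / ‖g‖ := by
    intro u; rw [hn, real_inner_smul_left]; ring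
  have hn1 : ‖n‖ = 1 := by
    rw [hn, norm_smul, norm_inv, norm_norm, inv_mul_cancel₀ hg0.ne']
  have hs : T.footDist r d = inner ℝ n (a - x) := by
    rw [hnu, hg, ← bary_sub, hb0, sub_zero]; rfl
  have hval : ∀ u, ‖u‖ < ρ → T.power r (Φ u) =
      ‖x - a‖ ^ 2 + T.heightSq r d.1 + 2 * inner ℝ (x - a) u + ‖u‖ ^ 2 +
        min 0 (2 * σ * inner ℝ n u) := by
    intro u hu
    have h1 := T.facePower_sub_unfold r d (x + u)
    rw [(h u hu).2, ← hσ, T.bary_add, hb0, zero_add, ← hg] at *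
    have h2 : T.facePower r (T.glue d).1 ((T.unfold d).symm (x + u)) =
        T.facePower r d.1 (x + u) + 2 * σ * inner ℝ n u := by
      rw [hnu]
      have h3 : -2 * σ / ‖g‖ * inner ℝ g u = -(2 * σ * (inner ℝ g u / ‖g‖)) := by ring
      linarith
    rw [h2]
    nth_rewrite 1 [← add_zero (T.facePower r d.1 (x + u))]
    rw [min_add_add_left, facePower_eq_foot, dist_eq_norm, ← ha,
      show x + u - a = (x - a) + u by abel, norm_add_sq_real]
    ring
  have hv0 : T.power r (Φ 0) = ‖x - a‖ ^ 2 + T.heightSq r d.1 := by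
    rw [hval 0 (by simpa using hΦ.pos)]; simp
  refine ⟨ρ, Φ, n, hΦ, hn1, ?_, fun s hs' => ?_, fun u hu => ?_, fun ε hε0 hερ => ⟨?_, ?_⟩⟩
  · rw [hnu, hg, edgeVec, ← bary_sub, ← T.sidePoint_one, ← T.sidePoint_zero, bary_sidePoint_two,
      bary_sidePoint_two, sub_zero, zero_div]
  · have e : x + s • T.edgeVec d = T.sidePoint d (t + s) := by
      rw [hx, sidePoint_eq, sidePoint_eq, edgeVec]; module
    rw [(h _ hs').1 (by rw [e, bary_sidePoint_two]), e]; rfl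
  · rw [hval u hu, hval (-u) (by rwa [norm_neg]), hv0, norm_neg, inner_neg_right, inner_neg_right]
    have h3 : min 0 (2 * σ * inner ℝ n u) + min 0 (2 * σ * -inner ℝ n u) =
        -(2 * σ * |inner ℝ n u|) := by
      have hσ0 : 0 ≤ 2 * σ := mul_nonneg zero_le_two (hr d)
      rcases le_total 0 (inner ℝ n u) with h4 | h4
      · rw [abs_of_nonneg h4, min_eq_left (mul_nonneg hσ0 h4), min_eq_right (by nlinarith)]; ring
      · rw [abs_of_nonpos h4, min_eq_right (by nlinarith), min_eq_left (by nlinarith)]; ring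
    linarith
  · have e1 : ‖ε • n‖ = ε := by rw [norm_smul, hn1, mul_one, Real.norm_of_nonneg hε0]
    have e2 : inner ℝ (x - a) n = - T.footDist r d := by
      rw [hs, ← neg_sub a x, inner_neg_left, real_inner_comm]
    rw [hval _ (by rwa [e1]), hv0, e1, real_inner_smul_right, real_inner_smul_right, e2,
      real_inner_self_eq_norm_sq, hn1, min_eq_left]
    · ring
    · have := hr d
      rw [one_pow, mul_one]; exact mul_nonneg (mul_nonneg zero_le_two this) hε0
  · have e1 : ‖-(ε • n)‖ = ε := by
      rw [norm_neg, norm_smul, hn1, mul_one, Real.norm_of_nonneg hε0]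
    have e2 : inner ℝ (x - a) n = - T.footDist r d := by
      rw [hs, ← neg_sub a x, inner_neg_left, real_inner_comm]
    rw [hval _ (by rwa [e1]), hv0, e1, inner_neg_right, inner_neg_right, real_inner_smul_right,
      real_inner_smul_right, e2, real_inner_self_eq_norm_sq, hn1, min_eq_right]
    · rw [hσ]; ring
    · have h4 : 0 ≤ 2 * σ * ε := mul_nonneg (mul_nonneg zero_le_two (hr d)) hε0
      linarith

lemma edgeCurve_glue (d : T.Face × Fin 3) {t : ℝ} (ht : t ∈ Set.Icc (0 : ℝ) 1) :
    T.edgeCurve (T.glue d) (1 - t) = T.edgeCurve d t :=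
  (T.chart_sidePoint d ht).symm

lemma edgeCurve_zero (d : T.Face × Fin 3) : T.edgeCurve d 0 = T.vertex d := by
  rw [edgeCurve, sidePoint_zero, T.chart_corner]

lemma edgeCurve_one (d : T.Face × Fin 3) : T.edgeCurve d 1 = T.vertex (nextSide d) := by
  rw [edgeCurve, sidePoint_one]; exact T.chart_corner (nextSide d)

/-- The relation between an edge of `T` and an edge of `T'` that are the same curve, with the same
(unordered) pair of feet of altitudes. -/
structure SameEdge (T T' : GeodesicTriangulation M V) (r : V → ℝ) (d : T.Face × Fin 3)
    (d' : T'.Face × Fin 3) : Prop where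
  curve : ∀ s ∈ Set.Icc (0 : ℝ) 1, T'.edgeCurve d' s = T.edgeCurve d s
  length : T'.length d' = T.length d
  foot : (T'.footDist r d' = T.footDist r d ∧
      T'.footDist r (T'.glue d') = T.footDist r (T.glue d)) ∨
    (T'.footDist r d' = T.footDist r (T.glue d) ∧ T'.footDist r (T'.glue d') = T.footDist r d)

lemma exists_sameEdge_of_eventually {T' : GeodesicTriangulation M V} {r : V → ℝ}
    {d : T.Face × Fin 3} {d' : T'.Face × Fin 3} {t t' c : ℝ} (ht : t ∈ Set.Ioo (0 : ℝ) 1)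
    (ht' : t' ∈ Set.Ioo (0 : ℝ) 1) (hc0 : c ≠ 0) (hlen : T'.length d' = |c| * T.length d)
    (hfoot : (T'.footDist r d' = T.footDist r d ∧
        T'.footDist r (T'.glue d') = T.footDist r (T.glue d)) ∨
      (T'.footDist r d' = T.footDist r (T.glue d) ∧
        T'.footDist r (T'.glue d') = T.footDist r d))
    (hev : ∀ᶠ s in nhds (0 : ℝ), T'.edgeCurve d' (t' + s) = T.edgeCurve d (t + c * s)) :
    ∃ d', T.SameEdge T' r d d' := by
  have h00 : T.edgeCurve d 0 ∈ V := by rw [edgeCurve_zero]; exact Subtype.coe_prop _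
  have h00' : ∀ d', T'.edgeCurve d' 0 ∈ V := fun d' => by
    rw [edgeCurve_zero]; exact Subtype.coe_prop _
  rcases lt_or_gt_of_ne hc0 with hcneg | hcpos
  · have hev' : ∀ᶠ s in nhds (0 : ℝ), T'.edgeCurve (T'.glue d') (1 - t' + s) =
        T.edgeCurve d (t + (-c) * s) := by
      have h9 : Filter.Tendsto (fun s : ℝ => -s) (nhds 0) (nhds 0) := by
        simpa using (continuous_neg.tendsto (0 : ℝ))
      have h10 : ∀ᶠ s in nhds (0 : ℝ), t' - s ∈ Set.Icc (0 : ℝ) 1 := by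
        have : ContinuousAt (fun s : ℝ => t' - s) 0 := by fun_prop
        refine this.preimage_mem_nhds ?_
        rw [sub_zero]
        exact Icc_mem_nhds ht'.1 ht'.2
      filter_upwards [h9.eventually hev, h10] with s hs hs'
      rw [show 1 - t' + s = 1 - (t' - s) by ring, T'.edgeCurve_glue d' hs', sub_eq_add_neg, hs]
      congr 1; ring
    obtain ⟨hc1, heq⟩ := (T.isStraightCurve_edgeCurve d).eq_of_eventually
      (T'.isStraightCurve_edgeCurve (T'.glue d')) h00 (h00' _) ht
      ⟨by linarith [ht'.2], by linarith [ht'.1]⟩ (by linarith) hev'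
    refine ⟨T'.glue d', heq, ?_, ?_⟩
    · rw [T'.length_glue, hlen, abs_of_neg hcneg, hc1, one_mul]
    · rw [T'.glue_glue]; exact hfoot.symm.imp And.symm And.symm
  · obtain ⟨hc1, heq⟩ := (T.isStraightCurve_edgeCurve d).eq_of_eventually
      (T'.isStraightCurve_edgeCurve d') h00 (h00' _) ht ht' hcpos hev
    exact ⟨d', heq, by rw [hlen, hc1, abs_one, one_mul], hfoot⟩

/-- An edge at which the power function is not smooth is an edge of every triangulation that
defines the same power function. -/
lemma exists_sameEdge {r : V → ℝ} (hr : T.PowerConcave r) {T' : GeodesicTriangulation M V}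
    (hr' : T'.PowerConcave r) (hp : T'.power r = T.power r) {d : T.Face × Fin 3}
    (hd : 0 < T.footDist r d + T.footDist r (T.glue d)) : ∃ d', T.SameEdge T' r d d' := by
  have ht : (1 / 2 : ℝ) ∈ Set.Ioo (0 : ℝ) 1 := ⟨by norm_num, by norm_num⟩
  obtain ⟨ρ, Φ, n, hΦ, hn, hne, hcurve, hdiff, hval⟩ := T.exists_flatDisc_side_second_diff hr d ht
  set σ := T.footDist r d + T.footDist r (T.glue d) with hσ
  have hV : T.edgeCurve d (1 / 2) ∉ V := T.chart_sidePoint_notMem d ht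
  obtain ⟨f', x', hx', hxp⟩ := T'.exists_rep (T.edgeCurve d (1 / 2))
  rcases T'.interior_or_side hx' (by rwa [hxp]) with hint | ⟨k, t', ht', hxt⟩
  · exfalso
    obtain ⟨ρ', Φ', hΦ', hdiff'⟩ := T'.exists_flatDisc_interior_second_diff r hint
    rw [hxp] at hΦ'
    obtain ⟨L, hL⟩ := hΦ'.exists_linearIsometry hΦ
    have hρ := hΦ.pos
    have hρ' := hΦ'.pos
    set ε := min ρ ρ' / 2 with hε
    have hε0 : 0 < ε := by positivity
    have hε1 : ε < ρ := by have := min_le_left ρ ρ'; linarith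
    have hε2 : ε < ρ' := by have := min_le_right ρ ρ'; linarith
    have hnε : ‖ε • n‖ = ε := by rw [norm_smul, hn, mul_one, Real.norm_of_nonneg hε0.le]
    have h1 := hdiff (ε • n) (by rwa [hnε])
    have h2 := hdiff' (L (ε • n)) (by rwa [LinearIsometryEquiv.norm_map, hnε])
    rw [← map_neg, ← hL _ (by rwa [hnε]) (by rwa [hnε]),
      ← hL _ (by rwa [norm_neg, hnε]) (by rwa [norm_neg, hnε]), hp, hΦ'.map_zero, ← hΦ.map_zero,
      h1, LinearIsometryEquiv.norm_map, real_inner_smul_right, real_inner_self_eq_norm_sq, hn,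
      one_pow, mul_one, abs_of_pos hε0] at h2
    have : 0 < σ * ε := mul_pos hd hε0
    linarith
  · obtain ⟨d', hpt⟩ : ∃ d', T'.edgeCurve d' t' = T.edgeCurve d (1 / 2) :=
      ⟨(f', k), by rw [← hxp, hxt]; rfl⟩
    obtain ⟨ρ', Φ', n', hΦ', hn', hne', hcurve', hdiff', hval'⟩ :=
      T'.exists_flatDisc_side_second_diff hr' d' ht'
    rw [hpt] at hΦ'
    obtain ⟨L, hL⟩ := hΦ.exists_linearIsometry hΦ'
    have hρ := hΦ.pos
    have hρ' := hΦ'.pos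
    set ε := min ρ ρ' / 2 with hε
    have hε0 : 0 < ε := by positivity
    have hε1 : ε < ρ := by have := min_le_left ρ ρ'; linarith
    have hε2 : ε < ρ' := by have := min_le_right ρ ρ'; linarith
    set σ' := T'.footDist r d' + T'.footDist r (T'.glue d') with hσ'
    have hΦ0 : Φ' 0 = Φ 0 := by rw [hΦ'.map_zero, hΦ.map_zero]
    have hsd : ∀ u, ‖u‖ = ε → σ' * |inner ℝ n' u| = σ * |inner ℝ n (L u)| := by
      intro u hu
      have h1 := hdiff' u (by rwa [hu])
      have h2 := hdiff (L u) (by rwa [LinearIsometryEquiv.norm_map, hu])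
      rw [hL u (by rwa [hu]) (by rwa [hu]), hL (-u) (by rwa [norm_neg, hu])
        (by rwa [norm_neg, hu]), map_neg, hp, h2, hΦ0, LinearIsometryEquiv.norm_map] at h1
      linarith
    have h3 := hsd (ε • n') (by rw [norm_smul, hn', mul_one, Real.norm_of_nonneg hε0.le])
    have h4 := hsd (L.symm (ε • n)) (by
      rw [LinearIsometryEquiv.norm_map, norm_smul, hn, mul_one, Real.norm_of_nonneg hε0.le])
    have h5 : inner ℝ n' (L.symm (ε • n)) = ε * inner ℝ n (L n') := by
      rw [← LinearIsometryEquiv.inner_map_map L, LinearIsometryEquiv.apply_symm_apply,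
        real_inner_smul_right, real_inner_comm]
    rw [map_smul, real_inner_smul_right, real_inner_smul_right, real_inner_self_eq_norm_sq, hn',
      one_pow, mul_one, abs_mul, abs_of_pos hε0] at h3
    rw [h5, LinearIsometryEquiv.apply_symm_apply, real_inner_smul_right,
      real_inner_self_eq_norm_sq, hn, one_pow, mul_one, abs_mul, abs_of_pos hε0] at h4
    set m := |inner ℝ n (L n')| with hm
    have h6 : σ' = σ * m := by
      apply mul_right_cancel₀ hε0.ne'; linarith
    have h7 : σ' * m = σ := by
      apply mul_right_cancel₀ hε0.ne'; linarith
    have hm0 : 0 ≤ m := abs_nonneg _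
    have hm1 : m = 1 := by
      have h8 : σ * (m ^ 2 - 1) = 0 := by linear_combination h7 - m * h6
      rcases mul_eq_zero.1 h8 with h9 | h9
      · exact absurd h9 hd.ne'
      · nlinarith
    have hLn : L n' = n ∨ L n' = -n := by
      have h8 : ‖L n'‖ = 1 := by rw [LinearIsometryEquiv.norm_map, hn']
      rcases abs_eq (zero_le_one (α := ℝ)) |>.1 (hm.symm.trans hm1) with h9 | h9
      · left
        have := norm_sub_sq_real (L n') n
        rw [real_inner_comm, h9, h8, hn] at this
        rw [← sub_eq_zero, ← norm_eq_zero]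
        nlinarith
      · right
        have := norm_add_sq_real (L n') n
        rw [real_inner_comm, h9, h8, hn] at this
        rw [← add_eq_zero_iff_eq_neg, ← norm_eq_zero]
        nlinarith
    -- the two feet
    have hfoot : (T'.footDist r d' = T.footDist r d ∧
          T'.footDist r (T'.glue d') = T.footDist r (T.glue d)) ∨
        (T'.footDist r d' = T.footDist r (T.glue d) ∧
          T'.footDist r (T'.glue d') = T.footDist r d) := by
      obtain ⟨v1, v2⟩ := hval ε hε0.le hε1
      obtain ⟨v1', v2'⟩ := hval' ε hε0.le hε2
      have hn1 : ‖ε • n'‖ = ε := by rw [norm_smul, hn', mul_one, Real.norm_of_nonneg hε0.le]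
      rw [hL _ (by rwa [hn1]) (by rwa [hn1]), map_smul, hp, hΦ0] at v1'
      rw [hL _ (by rwa [norm_neg, hn1]) (by rwa [norm_neg, hn1]), map_neg, map_smul, hp,
        hΦ0] at v2'
      rcases hLn with h8 | h8
      · rw [h8] at v1' v2'
        left
        constructor
        · apply mul_left_cancel₀ hε0.ne'; linarith
        · apply mul_left_cancel₀ hε0.ne'; linarith
      · rw [h8, smul_neg] at v1' v2'
        rw [neg_neg] at v2'
        right
        constructor
        · apply mul_left_cancel₀ hε0.ne'; linarith
        · apply mul_left_cancel₀ hε0.ne'; linarith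
    have hLe : inner ℝ n (L (T'.edgeVec d')) = 0 := by
      rw [← LinearIsometryEquiv.inner_map_map L] at hne'
      rcases hLn with h8 | h8
      · rwa [h8] at hne'
      · rw [h8, inner_neg_left] at hne'; linarith
    obtain ⟨c, hc⟩ := exists_eq_smul_of_inner_eq_zero hn (T.edgeVec_ne_zero d) hne hLe
    have hc0 : c ≠ 0 := by
      rintro rfl
      rw [zero_smul] at hc
      exact T'.edgeVec_ne_zero d' (by simpa using hc)
    have hlen : T'.length d' = |c| * T.length d := by
      rw [← norm_edgeVec, ← norm_edgeVec, ← LinearIsometryEquiv.norm_map L, hc, norm_smul,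
        Real.norm_eq_abs]
    have hev : ∀ᶠ s in nhds (0 : ℝ), T'.edgeCurve d' (t' + s) = T.edgeCurve d (1 / 2 + c * s) := by
      have hz : ∀ (w : E2) {a : ℝ}, 0 < a → ∀ᶠ s : ℝ in nhds 0, ‖s • w‖ < a := by
        intro w a ha
        have : ContinuousAt (fun s : ℝ => ‖s • w‖) 0 := by fun_prop
        refine this.eventually_lt continuousAt_const ?_
        simpa using ha
      filter_upwards [hz (T'.edgeVec d') hρ, hz (T'.edgeVec d') hρ'] with s hs1 hs2
      rw [← hcurve' s hs2, hL _ hs1 hs2, map_smul, hc, smul_smul, mul_comm s c]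
      refine hcurve (c * s) ?_
      rw [mul_comm, ← smul_smul, ← hc, ← map_smul, LinearIsometryEquiv.norm_map]
      exact hs1
    exact T.exists_sameEdge_of_eventually ht ht' hc0 hlen hfoot hev

lemma SameEdge.vertex_eq {T' : GeodesicTriangulation M V} {r : V → ℝ} {d : T.Face × Fin 3}
    {d' : T'.Face × Fin 3} (h : T.SameEdge T' r d d') :
    T'.vertex d' = T.vertex d ∧ T'.vertex (nextSide d') = T.vertex (nextSide d) := by
  constructor
  · apply Subtype.ext
    rw [← edgeCurve_zero, ← edgeCurve_zero, h.curve 0 ⟨le_rfl, zero_le_one⟩]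
  · apply Subtype.ext
    rw [← edgeCurve_one, ← edgeCurve_one, h.curve 1 ⟨zero_le_one, le_rfl⟩]

lemma eq_of_edgeCurve_eq {d₁ d₂ : T.Face × Fin 3}
    (h : ∀ s ∈ Set.Icc (0 : ℝ) 1, T.edgeCurve d₁ s = T.edgeCurve d₂ s) : d₁ = d₂ := by
  refine T.eq_of_edgeCurve_eventuallyEq (t := 1 / 2) ⟨by norm_num, by norm_num⟩ ?_
  filter_upwards [Icc_mem_nhds (show (0 : ℝ) < 1 / 2 by norm_num)
    (show (1 / 2 : ℝ) < 1 by norm_num)] with s hs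
  exact h s hs

/-- A sum over oriented edges that ignores the edges at which the power function is smooth depends
only on the power function. -/
lemma sum_edges_eq {r : V → ℝ} (hr : T.PowerConcave r) {T' : GeodesicTriangulation M V}
    (hr' : T'.PowerConcave r) (hp : T'.power r = T.power r) (Q : V → V → ℝ → ℝ → ℝ → ℝ)
    (hsymm : ∀ i j l s s', Q i j l s s' = Q i j l s' s)
    (hT : ∀ d, T.footDist r d + T.footDist r (T.glue d) = 0 →
      Q (T.vertex d) (T.vertex (nextSide d)) (T.length d) (T.footDist r d)
        (T.footDist r (T.glue d)) = 0)
    (hT' : ∀ d, T'.footDist r d + T'.footDist r (T'.glue d) = 0 →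
      Q (T'.vertex d) (T'.vertex (nextSide d)) (T'.length d) (T'.footDist r d)
        (T'.footDist r (T'.glue d)) = 0) :
    ∑ d, Q (T.vertex d) (T.vertex (nextSide d)) (T.length d) (T.footDist r d)
        (T.footDist r (T.glue d)) =
      ∑ d, Q (T'.vertex d) (T'.vertex (nextSide d)) (T'.length d) (T'.footDist r d)
        (T'.footDist r (T'.glue d)) := by
  classical
  have hpos : ∀ d, T.footDist r d + T.footDist r (T.glue d) ≠ 0 →
      0 < T.footDist r d + T.footDist r (T.glue d) := fun d h => lt_of_le_of_ne (hr d) h.symm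
  have hpos' : ∀ d, T'.footDist r d + T'.footDist r (T'.glue d) ≠ 0 →
      0 < T'.footDist r d + T'.footDist r (T'.glue d) := fun d h => lt_of_le_of_ne (hr' d) h.symm
  rw [← Finset.sum_filter_of_ne (p := fun d => 0 < T.footDist r d + T.footDist r (T.glue d))
      (fun d _ hd => hpos d fun h => hd (hT d h)),
    ← Finset.sum_filter_of_ne (p := fun d => 0 < T'.footDist r d + T'.footDist r (T'.glue d))
      (fun d _ hd => hpos' d fun h => hd (hT' d h))]
  have hex : ∀ d, 0 < T.footDist r d + T.footDist r (T.glue d) → ∃ d', T.SameEdge T' r d d' :=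
    fun d hd => T.exists_sameEdge hr hr' hp hd
  refine Finset.sum_bij (fun d hd => (hex d (Finset.mem_filter.1 hd).2).choose) ?_ ?_ ?_ ?_
  · intro d hd
    have h := (hex d (Finset.mem_filter.1 hd).2).choose_spec
    have h1 := (Finset.mem_filter.1 hd).2
    refine Finset.mem_filter.2 ⟨Finset.mem_univ _, ?_⟩
    rcases h.foot with ⟨h2, h3⟩ | ⟨h2, h3⟩ <;> rw [h2, h3] <;> linarith
  · intro d₁ hd₁ d₂ hd₂ heq
    have h1 := (hex d₁ (Finset.mem_filter.1 hd₁).2).choose_spec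
    have h2 := (hex d₂ (Finset.mem_filter.1 hd₂).2).choose_spec
    refine T.eq_of_edgeCurve_eq fun s hs => ?_
    rw [← h1.curve s hs, ← h2.curve s hs]
    exact congrArg (fun e => T'.edgeCurve e s) heq
  · intro d' hd'
    obtain ⟨d, hd⟩ := T'.exists_sameEdge hr' hr hp.symm (Finset.mem_filter.1 hd').2
    have hdpos : 0 < T.footDist r d + T.footDist r (T.glue d) := by
      have h1 := (Finset.mem_filter.1 hd').2
      rcases hd.foot with ⟨h2, h3⟩ | ⟨h2, h3⟩ <;> rw [h2, h3] <;> linarith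
    refine ⟨d, Finset.mem_filter.2 ⟨Finset.mem_univ _, hdpos⟩, ?_⟩
    have h := (hex d hdpos).choose_spec
    refine T'.eq_of_edgeCurve_eq fun s hs => ?_
    rw [h.curve s hs, hd.curve s hs]
  · intro d hd
    have h := (hex d (Finset.mem_filter.1 hd).2).choose_spec
    obtain ⟨h1, h2⟩ := h.vertex_eq
    rw [h1, h2, h.length]
    rcases h.foot with ⟨h3, h4⟩ | ⟨h3, h4⟩
    · rw [h3, h4]
    · rw [h3, h4]; exact hsymm _ _ _ _ _

end GeodesicTriangulation
/-! ### The area of an elliptic sector -/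

/-- The circular sector with angle `ω` and radius `ε` in the plane, for `0 < ω < π`. -/
def sector (ω ε : ℝ) : Set (ℝ × ℝ) := {p | 0 < p.2 ∧
  0 < p.1 * Real.sin ω - p.2 * Real.cos ω ∧ p.1 ^ 2 + p.2 ^ 2 < ε ^ 2}

lemma measurableSet_sector (ω ε : ℝ) : MeasurableSet (sector ω ε) := by
  have h1 : IsOpen {p : ℝ × ℝ | 0 < p.2} := isOpen_lt continuous_const continuous_snd
  have h2 : IsOpen {p : ℝ × ℝ | 0 < p.1 * Real.sin ω - p.2 * Real.cos ω} :=
    isOpen_lt continuous_const (by fun_prop)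
  have h3 : IsOpen {p : ℝ × ℝ | p.1 ^ 2 + p.2 ^ 2 < ε ^ 2} :=
    isOpen_lt (by fun_prop) continuous_const
  exact (h1.inter (h2.inter h3)).measurableSet

open MeasureTheory in
lemma volume_sector {ω ε : ℝ} (hω : 0 < ω) (hω' : ω < Real.pi) (hε : 0 < ε) :
    volume (sector ω ε) = ENNReal.ofReal (ω * ε ^ 2 / 2) := by
  set S := sector ω ε with hS
  have hSm : MeasurableSet S := measurableSet_sector ω ε
  rw [← lintegral_indicator_one hSm, ← lintegral_comp_polarCoord_symm]
  have hmem : ∀ p ∈ polarCoord.target,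
      (polarCoord.symm p ∈ S ↔ p ∈ Set.Ioo 0 ε ×ˢ Set.Ioo 0 ω) := by
    rintro ⟨s, θ⟩ hp
    rw [polarCoord_target] at hp
    obtain ⟨hs, hθ1, hθ2⟩ := hp
    simp only [Set.mem_Ioi] at hs
    simp only at hθ1 hθ2
    have e1 : s * Real.cos θ * Real.sin ω - s * Real.sin θ * Real.cos ω =
        s * Real.sin (ω - θ) := by rw [Real.sin_sub]; ring
    have e2 : (s * Real.cos θ) ^ 2 + (s * Real.sin θ) ^ 2 = s ^ 2 := by
      rw [mul_pow, mul_pow, ← mul_add, Real.cos_sq_add_sin_sq, mul_one]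
    simp only [polarCoord_symm_apply, hS, sector, Set.mem_ofPred_eq, Set.mem_prod, Set.mem_Ioo, e1, e2]
    rw [pow_lt_pow_iff_left₀ hs.le hε.le two_ne_zero]
    constructor
    · rintro ⟨h1, h2, h3⟩
      have h4 : 0 < Real.sin θ := pos_of_mul_pos_right h1 hs.le
      have h5 : 0 < Real.sin (ω - θ) := pos_of_mul_pos_right h2 hs.le
      have h6 : 0 < θ := by
        by_contra! h
        have := Real.sin_nonpos_of_nonpos_of_neg_pi_le h hθ1.le
        linarith
      refine ⟨⟨hs, h3⟩, h6, ?_⟩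
      by_contra! h
      have := Real.sin_nonpos_of_nonpos_of_neg_pi_le (sub_nonpos.2 h) (by linarith)
      linarith
    · rintro ⟨⟨-, h3⟩, h1, h2⟩
      exact ⟨mul_pos hs (Real.sin_pos_of_pos_of_lt_pi h1 hθ2),
        mul_pos hs (Real.sin_pos_of_pos_of_lt_pi (by linarith) (by linarith)), h3⟩
  have hsub : Set.Ioo 0 ε ×ˢ Set.Ioo 0 ω ⊆ polarCoord.target := by
    rw [polarCoord_target]
    rintro ⟨s, θ⟩ ⟨⟨h1, h2⟩, h3, h4⟩
    simp only at h1 h2 h3 h4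
    exact ⟨h1, by linarith, by linarith⟩
  have h1 : ∫⁻ p in polarCoord.target, ENNReal.ofReal p.1 • S.indicator 1 (polarCoord.symm p) =
      ∫⁻ p in polarCoord.target, (Set.Ioo 0 ε ×ˢ Set.Ioo 0 ω).indicator
        (fun p : ℝ × ℝ => ENNReal.ofReal p.1) p := by
    refine setLIntegral_congr_fun polarCoord.open_target.measurableSet fun p hp => ?_
    by_cases h : p ∈ Set.Ioo 0 ε ×ˢ Set.Ioo 0 ω
    · rw [Set.indicator_of_mem ((hmem p hp).2 h), Set.indicator_of_mem h]; simp
    · rw [Set.indicator_of_notMem (mt (hmem p hp).1 h), Set.indicator_of_notMem h]; simp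
  have hprod : (volume : Measure (ℝ × ℝ)).restrict (Set.Ioo 0 ε ×ˢ Set.Ioo 0 ω) =
      (volume.restrict (Set.Ioo 0 ε)).prod (volume.restrict (Set.Ioo 0 ω)) := by
    rw [Measure.prod_restrict]; rfl
  rw [h1, setLIntegral_indicator (measurableSet_Ioo.prod measurableSet_Ioo),
    Set.inter_eq_left.2 hsub, hprod]
  have h2 := lintegral_prod_mul (μ := volume.restrict (Set.Ioo (0 : ℝ) ε))
    (ν := volume.restrict (Set.Ioo (0 : ℝ) ω)) (f := fun s => ENNReal.ofReal s) (g := fun _ => 1)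
    (by fun_prop) (by fun_prop)
  simp only [mul_one, lintegral_const, Measure.restrict_apply_univ, Real.volume_Ioo, sub_zero,
    one_mul] at h2
  rw [h2, ← ofReal_integral_eq_lintegral_ofReal, ← integral_Ioc_eq_integral_Ioo,
    ← intervalIntegral.integral_of_le hε.le, integral_id, ← ENNReal.ofReal_mul
    (by rw [zero_pow two_ne_zero, sub_zero]; positivity)]
  · congr 1; ring
  · exact (continuous_id.integrableOn_Icc (a := (0 : ℝ)) (b := ε)).mono_set Set.Ioo_subset_Icc_self
  · exact (ae_restrict_iff' measurableSet_Ioo).2 (Filter.Eventually.of_forall fun x hx => hx.1.le)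

/-- The linear map of the plane with given rows. -/
noncomputable def rowMap (a b : E2) : E2 →ₗ[ℝ] E2 :=
  Matrix.toLin (EuclideanSpace.basisFun (Fin 2) ℝ).toBasis
    (EuclideanSpace.basisFun (Fin 2) ℝ).toBasis !![a 0, a 1; b 0, b 1]

lemma det_rowMap (a b : E2) : LinearMap.det (rowMap a b) = a 0 * b 1 - a 1 * b 0 := by
  rw [rowMap, LinearMap.det_toLin, Matrix.det_fin_two_of]

lemma inner_eq_coord (u v : E2) : inner ℝ u v = u 0 * v 0 + u 1 * v 1 := by
  simp [PiLp.inner_apply, Fin.sum_univ_two, mul_comm]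

lemma rowMap_apply (a b v : E2) : rowMap a b v 0 = inner ℝ a v ∧ rowMap a b v 1 = inner ℝ b v := by
  rw [inner_eq_coord, inner_eq_coord]
  constructor <;> simp [rowMap, Matrix.toLin_apply, Matrix.mulVec, dotProduct, Fin.sum_univ_two,
    EuclideanSpace.basisFun_apply]

open MeasureTheory in
/-- The area of the part of the cone spanned by `e₁` and `e₂` where the quadratic form
`‖y‖ ^ 2 - κ ⟪w, y⟫ ^ 2`, which has the values `q₁`, `q₂` and `q₁₂` on the basis, is less than
`ε ^ 2`.  Here `g₁`, `g₂` is the dual basis. -/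
lemma volume_elliptic_sector {e₁ e₂ g₁ g₂ w : E2} {κ q₁ q₂ q₁₂ Δ ω ε : ℝ}
    (h11 : inner ℝ g₁ e₁ = 1) (h12 : inner ℝ g₁ e₂ = 0) (h21 : inner ℝ g₂ e₁ = 0)
    (h22 : inner ℝ g₂ e₂ = 1) (hΔ : ‖e₁‖ ^ 2 * ‖e₂‖ ^ 2 - inner ℝ e₁ e₂ ^ 2 = Δ)
    (hq1 : ‖e₁‖ ^ 2 - κ * inner ℝ w e₁ ^ 2 = q₁) (hq2 : ‖e₂‖ ^ 2 - κ * inner ℝ w e₂ ^ 2 = q₂)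
    (hq12 : inner ℝ e₁ e₂ - κ * (inner ℝ w e₁ * inner ℝ w e₂) = q₁₂)
    (h1 : 0 < q₁) (h2 : 0 < q₂) (hω : 0 < ω) (hω' : ω < Real.pi)
    (hcos : q₁₂ = Real.sqrt q₁ * Real.sqrt q₂ * Real.cos ω) (hε : 0 < ε) :
    volume {y : E2 | 0 < inner ℝ g₁ y ∧ 0 < inner ℝ g₂ y ∧
      ‖y‖ ^ 2 - κ * inner ℝ w y ^ 2 < ε ^ 2} =
      ENNReal.ofReal (Real.sqrt Δ / (Real.sqrt q₁ * Real.sqrt q₂ * Real.sin ω) *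
        (ω * ε ^ 2 / 2)) := by
  have s1 := Real.sqrt_pos.2 h1
  have s2 := Real.sqrt_pos.2 h2
  have hs := Real.sin_pos_of_pos_of_lt_pi hω hω'
  set S := sector ω ε with hS
  have hSm : MeasurableSet S := measurableSet_sector ω ε
  -- a linear map that takes the quadratic form to the squared norm
  set a : E2 := Real.sqrt q₁ • g₁ + (Real.sqrt q₂ * Real.cos ω) • g₂ with ha
  set b : E2 := (Real.sqrt q₂ * Real.sin ω) • g₂ with hb
  have hF := (volume_preserving_finTwoArrow ℝ).comp (PiLp.volume_preserving_ofLp (Fin 2))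
  set F : E2 → ℝ × ℝ := MeasurableEquiv.finTwoArrow ∘ (WithLp.ofLp) with hFdef
  have hFv : ∀ v : E2, F v = (v 0, v 1) := fun v => rfl
  rw [inner_eq_coord] at h11 h12 h21 h22
  have hdual : (g₁ 0 * g₂ 1 - g₁ 1 * g₂ 0) * (e₁ 0 * e₂ 1 - e₁ 1 * e₂ 0) = 1 := by
    have : (g₁ 0 * g₂ 1 - g₁ 1 * g₂ 0) * (e₁ 0 * e₂ 1 - e₁ 1 * e₂ 0) =
      (g₁ 0 * e₁ 0 + g₁ 1 * e₁ 1) * (g₂ 0 * e₂ 0 + g₂ 1 * e₂ 1) -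
      (g₁ 0 * e₂ 0 + g₁ 1 * e₂ 1) * (g₂ 0 * e₁ 0 + g₂ 1 * e₁ 1) := by ring
    rw [this, h11, h22, h12, h21]; norm_num
  set D := e₁ 0 * e₂ 1 - e₁ 1 * e₂ 0 with hD
  have hD0 : D ≠ 0 := right_ne_zero_of_mul_eq_one hdual
  have hg : g₁ 0 * g₂ 1 - g₁ 1 * g₂ 0 = D⁻¹ := eq_inv_of_mul_eq_one_left hdual
  have hΔD : Real.sqrt Δ = |D| := by
    rw [← Real.sqrt_sq_eq_abs, ← hΔ, ← real_inner_self_eq_norm_sq, ← real_inner_self_eq_norm_sq,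
      inner_eq_coord, inner_eq_coord, inner_eq_coord]
    congr 1; rw [hD]; ring
  have hdet : LinearMap.det (rowMap a b) = Real.sqrt q₁ * Real.sqrt q₂ * Real.sin ω * D⁻¹ := by
    rw [det_rowMap, ← hg, ha, hb]
    simp only [PiLp.add_apply, PiLp.smul_apply, smul_eq_mul]
    ring
  -- coordinates with respect to `e₁`, `e₂`
  have hexp : ∀ y : E2, y = inner ℝ g₁ y • e₁ + inner ℝ g₂ y • e₂ := by
    intro y
    have k1 : D * g₁ 0 = e₂ 1 := by rw [hD]; linear_combination e₂ 1 * h11 - e₁ 1 * h12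
    have k2 : D * g₁ 1 = -e₂ 0 := by rw [hD]; linear_combination e₁ 0 * h12 - e₂ 0 * h11
    have k3 : D * g₂ 0 = -e₁ 1 := by rw [hD]; linear_combination e₂ 1 * h21 - e₁ 1 * h22
    have k4 : D * g₂ 1 = e₁ 0 := by rw [hD]; linear_combination e₁ 0 * h22 - e₂ 0 * h21
    have c0 : D * y 0 = D * (inner ℝ g₁ y • e₁ + inner ℝ g₂ y • e₂ : E2) 0 := by
      simp only [PiLp.add_apply, PiLp.smul_apply, smul_eq_mul, inner_eq_coord]
      linear_combination hD * y 0 - e₁ 0 * y 0 * k1 - e₁ 0 * y 1 * k2 - e₂ 0 * y 0 * k3 -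
        e₂ 0 * y 1 * k4
    have c1 : D * y 1 = D * (inner ℝ g₁ y • e₁ + inner ℝ g₂ y • e₂ : E2) 1 := by
      simp only [PiLp.add_apply, PiLp.smul_apply, smul_eq_mul, inner_eq_coord]
      linear_combination hD * y 1 - e₁ 1 * y 0 * k1 - e₁ 1 * y 1 * k2 - e₂ 1 * y 0 * k3 -
        e₂ 1 * y 1 * k4
    ext i
    fin_cases i
    · exact mul_left_cancel₀ hD0 c0
    · exact mul_left_cancel₀ hD0 c1
  have hset : {y : E2 | 0 < inner ℝ g₁ y ∧ 0 < inner ℝ g₂ y ∧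
      ‖y‖ ^ 2 - κ * inner ℝ w y ^ 2 < ε ^ 2} = rowMap a b ⁻¹' (F ⁻¹' S) := by
    ext y
    obtain ⟨s, hs'⟩ : ∃ s : ℝ, s = inner ℝ g₁ y := ⟨_, rfl⟩
    obtain ⟨t, ht'⟩ : ∃ t : ℝ, t = inner ℝ g₂ y := ⟨_, rfl⟩
    have hy := hexp y
    rw [← hs', ← ht'] at hy
    have hQ : ‖y‖ ^ 2 - κ * inner ℝ w y ^ 2 = q₁ * s ^ 2 + 2 * s * t * q₁₂ + q₂ * t ^ 2 := by
      rw [hy, norm_add_sq_real, inner_add_right, real_inner_smul_left, real_inner_smul_right,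
        real_inner_smul_right, real_inner_smul_right, norm_smul, norm_smul, mul_pow, mul_pow,
        Real.norm_eq_abs, Real.norm_eq_abs, sq_abs, sq_abs, ← hq1, ← hq2, ← hq12]
      ring
    have ha' : inner ℝ a y = Real.sqrt q₁ * s + Real.sqrt q₂ * Real.cos ω * t := by
      rw [ha, inner_add_left, real_inner_smul_left, real_inner_smul_left, hs', ht']
    have hb' : inner ℝ b y = Real.sqrt q₂ * Real.sin ω * t := by
      rw [hb, real_inner_smul_left, ht']
    simp only [Set.mem_ofPred_eq, Set.mem_preimage, hFv, (rowMap_apply a b y).1,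
      (rowMap_apply a b y).2, hS, sector, ha', hb', hQ, ← hs', ← ht']
    have e1 : (Real.sqrt q₁ * s + Real.sqrt q₂ * Real.cos ω * t) * Real.sin ω -
        Real.sqrt q₂ * Real.sin ω * t * Real.cos ω = Real.sqrt q₁ * Real.sin ω * s := by ring
    have e2 : (Real.sqrt q₁ * s + Real.sqrt q₂ * Real.cos ω * t) ^ 2 +
        (Real.sqrt q₂ * Real.sin ω * t) ^ 2 = q₁ * s ^ 2 + 2 * s * t * q₁₂ + q₂ * t ^ 2 := by
      rw [hcos, mul_pow _ t, mul_pow, Real.sin_sq, add_sq, mul_pow, mul_pow _ t, mul_pow,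
        Real.sq_sqrt h1.le, Real.sq_sqrt h2.le]
      ring
    rw [e1, e2, mul_pos_iff_of_pos_left (mul_pos s2 hs), mul_pos_iff_of_pos_left (mul_pos s1 hs)]
    tauto
  have hdet0 : LinearMap.det (rowMap a b) ≠ 0 := by
    rw [hdet]; positivity
  rw [hset, Measure.addHaar_preimage_linearMap _ hdet0, hF.measure_preimage hSm.nullMeasurableSet,
    hS, volume_sector hω hω' hε, ← ENNReal.ofReal_mul (abs_nonneg _), hdet, hΔD, mul_inv, inv_inv,
    abs_mul, abs_of_pos (inv_pos.2 (mul_pos (mul_pos s1 s2) hs))]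
  congr 1
  field_simp

namespace GeodesicTriangulation

variable {M : Type*} [MetricSpace M] {V : Finset M} (T : GeodesicTriangulation M V)

/-! ### Comparison of the areas of the triangles of two triangulations -/

/-- The interior of a triangle. -/
def cell (f : T.Face) : Set E2 := {x | ∀ k, 0 < T.bary f k x}

lemma cell_subset_face (f : T.Face) : T.cell f ⊆ T.face f := fun _ hx =>
  T.mem_face_iff.2 fun k => (hx k).le

lemma isOpen_cell (f : T.Face) : IsOpen (T.cell f) := by
  have : T.cell f = ⋂ k, {x | 0 < T.bary f k x} := by ext x; simp [cell]
  rw [this]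
  exact isOpen_iInter_of_finite fun k => isOpen_lt continuous_const (T.continuous_bary f k)

/-- The image of the interior of a triangle in the surface. -/
def openCell (f : T.Face) : Set M := T.chart f '' T.cell f

lemma isOpen_openCell (f : T.Face) : IsOpen (T.openCell f) := by
  rw [Metric.isOpen_iff]
  rintro _ ⟨x, hx, rfl⟩
  obtain ⟨ρ, Φ, hΦ, h⟩ := T.exists_flatDisc_interior hx
  refine ⟨ρ, hΦ.pos, fun q hq => ?_⟩
  rw [Metric.mem_ball, dist_comm] at hq
  obtain ⟨u, hu, rfl⟩ := hΦ.surj q hq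
  exact ⟨x + u, (h u hu).1, (h u hu).2.symm⟩

lemma injOn_chart_cell (f : T.Face) : Set.InjOn (T.chart f) (T.cell f) := fun _ hx _ hy h =>
  (T.eq_of_chart_eq_of_interior hx (T.cell_subset_face f hy) h).2.symm

lemma eq_of_mem_openCell {f g : T.Face} {p : M} (hf : p ∈ T.openCell f) (hg : p ∈ T.openCell g) :
    g = f := by
  obtain ⟨x, hx, rfl⟩ := hf
  obtain ⟨y, hy, h⟩ := hg
  exact (T.eq_of_chart_eq_of_interior hx (T.cell_subset_face g hy) h.symm).1

/-- Two flat charts of the surface around the same point that is interior to two triangles differ by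
an isometry of the plane. -/
lemma exists_transition {T' : GeodesicTriangulation M V} {f : T.Face} {f' : T'.Face} {x x' : E2}
    (hx : x ∈ T.cell f) (hx' : x' ∈ T'.cell f') (h : T.chart f x = T'.chart f' x') :
    ∃ L : E2 ≃ₗᵢ[ℝ] E2, ∃ ε > 0, ∀ u, ‖u‖ < ε → x + u ∈ T.cell f ∧ x' + L u ∈ T'.cell f' ∧
      T.chart f (x + u) = T'.chart f' (x' + L u) := by
  obtain ⟨ρ, Φ, hΦ, h1⟩ := T.exists_flatDisc_interior hx
  obtain ⟨ρ', Φ', hΦ', h1'⟩ := T'.exists_flatDisc_interior hx'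
  rw [← h] at hΦ'
  obtain ⟨L, hL⟩ := hΦ'.exists_linearIsometry hΦ
  refine ⟨L, min ρ ρ', lt_min hΦ.pos hΦ'.pos, fun u hu => ?_⟩
  have hu1 := hu.trans_le (min_le_left _ _)
  have hu2 := hu.trans_le (min_le_right _ _)
  have hu3 : ‖L u‖ < ρ' := by rwa [LinearIsometryEquiv.norm_map]
  exact ⟨(h1 u hu1).1, (h1' _ hu3).1, by rw [← (h1 u hu1).2, hL u hu2 hu1, (h1' _ hu3).2]⟩

/-- The squared height of a pyramid over a point of the surface is determined by the power
function. -/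
lemma heightSq_le_of_chart_eq {T' : GeodesicTriangulation M V} {r : V → ℝ}
    (hp : T'.power r = T.power r) {f : T.Face} {f' : T'.Face} {x x' : E2}
    (hx : x ∈ T.cell f) (hx' : x' ∈ T'.cell f') (h : T.chart f x = T'.chart f' x') :
    T'.heightSq r f' ≤ T.heightSq r f := by
  obtain ⟨L, ε, hε, hL⟩ := T.exists_transition hx hx' h
  set w := x - T.foot r f with hw
  set w' := x' - T'.foot r f' with hw'
  have key : ∀ u, ‖u‖ < ε → ‖w + u‖ ^ 2 + T.heightSq r f = ‖w' + L u‖ ^ 2 + T'.heightSq r f' := by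
    intro u hu
    obtain ⟨h1, h2, h3⟩ := hL u hu
    have h4 := T.power_chart r (T.cell_subset_face f h1)
    have h5 := T'.power_chart r (T'.cell_subset_face f' h2)
    rw [h3, ← hp, h5, facePower_eq_foot, facePower_eq_foot, dist_eq_norm, dist_eq_norm] at h4
    rw [hw, hw', sub_add_eq_add_sub, sub_add_eq_add_sub]
    exact h4.symm
  have h0 := key 0 (by simpa using hε)
  rw [add_zero, map_zero, add_zero] at h0
  -- the gradients at the given point have the same norm
  have hle : ‖w‖ ≤ ‖w'‖ := by
    obtain ⟨s, hs, hsw⟩ : ∃ s : ℝ, 0 < s ∧ ‖s • w‖ < ε := by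
      refine ⟨ε / (2 * (‖w‖ + 1)), by positivity, ?_⟩
      rw [norm_smul, Real.norm_of_nonneg (by positivity), div_mul_eq_mul_div, div_lt_iff₀
        (by positivity)]
      nlinarith [norm_nonneg w]
    have h1 := key _ hsw
    rw [norm_add_sq_real, norm_add_sq_real, map_smul, real_inner_smul_right,
      real_inner_smul_right, real_inner_self_eq_norm_sq, norm_smul s, norm_smul s,
      LinearIsometryEquiv.norm_map] at h1
    have h2 : s * ‖w‖ ^ 2 = s * inner ℝ w' (L w) := by linarith
    have h3 := mul_left_cancel₀ hs.ne' h2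
    have h4 := real_inner_le_norm w' (L w)
    rw [LinearIsometryEquiv.norm_map, ← h3] at h4
    by_contra! hlt
    nlinarith [norm_nonneg w']
  have := norm_nonneg w
  nlinarith

lemma heightSq_eq_of_chart_eq {T' : GeodesicTriangulation M V} {r : V → ℝ}
    (hp : T'.power r = T.power r) {f : T.Face} {f' : T'.Face} {x x' : E2}
    (hx : x ∈ T.cell f) (hx' : x' ∈ T'.cell f') (h : T.chart f x = T'.chart f' x') :
    T'.heightSq r f' = T.heightSq r f :=
  le_antisymm (T.heightSq_le_of_chart_eq hp hx hx' h)
    (T'.heightSq_le_of_chart_eq hp.symm hx' hx h.symm)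

/-- The part of a triangle of `T` that is covered by the interior of a triangle of `T'` and lies in
the given region. -/
def overlap (T T' : GeodesicTriangulation M V) (f : T.Face) (f' : T'.Face) (S : Set M) : Set E2 :=
  {x | x ∈ T.cell f ∧ T.chart f x ∈ T'.openCell f' ∧ T.chart f x ∈ S}

lemma isOpen_cell_inter_preimage (f : T.Face) {S : Set M} (hS : IsOpen S) :
    IsOpen {x | x ∈ T.cell f ∧ T.chart f x ∈ S} :=
  ((T.continuousOn_chart f).mono (T.cell_subset_face f)).isOpen_inter_preimage (T.isOpen_cell f) hS

lemma isOpen_overlap (T' : GeodesicTriangulation M V) (f : T.Face) (f' : T'.Face) {S : Set M}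
    (hS : IsOpen S) : IsOpen (T.overlap T' f f' S) := by
  exact T.isOpen_cell_inter_preimage f ((T'.isOpen_openCell f').inter hS)

open MeasureTheory in
/-- The transition between two triangles is a local isometry, hence preserves areas. -/
lemma volume_overlap_comm (T' : GeodesicTriangulation M V) (f : T.Face) (f' : T'.Face) {S : Set M}
    (hS : IsOpen S) : volume (T'.overlap T f' f S) = volume (T.overlap T' f f' S) := by
  classical
  have hex : ∀ x ∈ T.overlap T' f f' S, ∃ x' ∈ T'.cell f', T'.chart f' x' = T.chart f x :=
    fun x hx => hx.2.1
  choose! τ hτ hτc using hex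
  have himg : τ '' T.overlap T' f f' S = T'.overlap T f' f S := by
    ext y
    constructor
    · rintro ⟨x, hx, rfl⟩
      exact ⟨hτ x hx, ⟨x, hx.1, (hτc x hx).symm⟩, by rw [hτc x hx]; exact hx.2.2⟩
    · rintro ⟨hy, ⟨x, hx, hxy⟩, hyS⟩
      have hxo : x ∈ T.overlap T' f f' S := ⟨hx, ⟨y, hy, hxy.symm⟩, by rw [hxy]; exact hyS⟩
      exact ⟨x, hxo, T'.injOn_chart_cell f' (hτ x hxo) hy ((hτc x hxo).trans hxy)⟩
  have hinj : Set.InjOn τ (T.overlap T' f f' S) := fun x hx y hy h =>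
    T.injOn_chart_cell f hx.1 hy.1 (by rw [← hτc x hx, ← hτc y hy, h])
  have hder : ∀ x ∈ T.overlap T' f f' S, ∃ L : E2 ≃ₗᵢ[ℝ] E2,
      HasFDerivWithinAt τ (L.toContinuousLinearEquiv : E2 →L[ℝ] E2) (T.overlap T' f f' S) x := by
    intro x hx
    obtain ⟨L, ε, hε, hL⟩ := T.exists_transition hx.1 (hτ x hx) (hτc x hx).symm
    refine ⟨L, ?_⟩
    have h1 : HasFDerivAt (fun y => τ x + L (y - x))
        (L.toContinuousLinearEquiv : E2 →L[ℝ] E2) x := by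
      have h3 : HasFDerivAt (fun y => y - x) (ContinuousLinearMap.id ℝ E2) x :=
        (hasFDerivAt_id x).sub_const x
      have h2 := HasFDerivAt.comp (f := fun y => y - x) x
        ((L.toContinuousLinearEquiv : E2 →L[ℝ] E2).hasFDerivAt) h3
      exact h2.const_add (τ x)
    refine h1.hasFDerivWithinAt.congr_of_eventuallyEq ?_ (by simp)
    filter_upwards [self_mem_nhdsWithin, nhdsWithin_le_nhds (Metric.ball_mem_nhds x hε)] with y hy
      hyε
    have h3 := hL (y - x) (by rwa [← dist_eq_norm])
    rw [add_sub_cancel] at h3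
    exact T'.injOn_chart_cell f' (hτ y hy) h3.2.1 (by rw [hτc y hy, h3.2.2])
  choose! L hL using hder
  rw [← himg, ← lintegral_abs_det_fderiv_eq_addHaar_image volume
    (T.isOpen_overlap T' f f' hS).measurableSet hL hinj]
  have hdet : ∀ x, |((L x).toContinuousLinearEquiv : E2 →L[ℝ] E2).det| = 1 := by
    intro x
    have h1 := LinearMap.normDet_eq_abs_det (L x).toLinearIsometry.toLinearMap
    rw [LinearIsometry.normDet_eq_one] at h1
    exact h1.symm
  simp [hdet]

/-- The interiors of the triangles are dense, and the complement is locally contained in a line. -/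
lemma exists_normal {p : M} (hp : p ∉ V) {ρ : ℝ} {Φ : E2 → M} (hΦ : IsFlatDisc p ρ Φ) :
    ∃ n : E2, n ≠ 0 ∧ ∃ ε > 0, ∀ u, ‖u‖ < ε → inner ℝ n u ≠ 0 → ∃ f, Φ u ∈ T.openCell f := by
  obtain ⟨f, x, hx, rfl⟩ := T.exists_rep p
  rcases T.interior_or_side hx hp with hint | ⟨k, t, ht, rfl⟩
  · obtain ⟨ρ', Φ', hΦ', h⟩ := T.exists_flatDisc_interior hint
    obtain ⟨L, hL⟩ := hΦ'.exists_linearIsometry hΦ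
    refine ⟨EuclideanSpace.single 0 1, by simp, min ρ ρ', lt_min hΦ.pos hΦ'.pos, fun u hu _ => ?_⟩
    have hu1 := hu.trans_le (min_le_left _ _)
    have hu2 := hu.trans_le (min_le_right _ _)
    have h3 := h (L u) (by rwa [LinearIsometryEquiv.norm_map])
    exact ⟨f, x + L u, h3.1, by rw [hL u hu2 hu1, h3.2]⟩
  · set d : T.Face × Fin 3 := (f, k) with hd
    obtain ⟨ρ', Φ', hΦ', h⟩ := T.exists_flatDisc_side d ht
    obtain ⟨L, hL⟩ := hΦ'.exists_linearIsometry hΦ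
    obtain ⟨ε₁, hε₁, h1⟩ := T.exists_ball_bary_pos d.1 d.2 (x := T.sidePoint d t)
      (by rw [bary_sidePoint_zero]; linarith [ht.2])
    obtain ⟨ε₂, hε₂, h2⟩ := T.exists_ball_bary_pos d.1 (d.2 + 1) (x := T.sidePoint d t)
      (by rw [bary_sidePoint_one]; exact ht.1)
    have hb := T.bary_sidePoint_zero (T.glue d) (1 - t)
    have hb' := T.bary_sidePoint_one (T.glue d) (1 - t)
    rw [← T.unfold_symm_sidePoint] at hb hb'
    obtain ⟨ε₃, hε₃, h3⟩ := T.exists_ball_bary_pos (T.glue d).1 (T.glue d).2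
      (x := (T.unfold d).symm (T.sidePoint d t)) (by rw [hb]; linarith [ht.1])
    obtain ⟨ε₄, hε₄, h4⟩ := T.exists_ball_bary_pos (T.glue d).1 ((T.glue d).2 + 1)
      (x := (T.unfold d).symm (T.sidePoint d t)) (by rw [hb']; linarith [ht.2])
    obtain ⟨κ, hκ, hbary⟩ := T.exists_bary_unfold d
    have hg := T.baryGrad_ne_zero d.1 (d.2 + 2)
    set g := T.baryGrad d.1 (d.2 + 2) with hg'
    refine ⟨L.symm g, by simpa using hg, min ρ (min ρ' (min (min ε₁ ε₂) (min ε₃ ε₄))),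
      by have := hΦ.pos; have := hΦ'.pos; positivity, fun u hu hne => ?_⟩
    simp only [lt_min_iff] at hu
    obtain ⟨hu1, hu2, ⟨hu3, hu4⟩, hu5, hu6⟩ := hu
    have hLu : ‖L u‖ = ‖u‖ := LinearIsometryEquiv.norm_map _ _
    have hne' : inner ℝ g (L u) ≠ 0 := by
      rwa [← LinearIsometryEquiv.inner_map_map L, LinearIsometryEquiv.apply_symm_apply] at hne
    have hbu : T.bary d.1 (d.2 + 2) (T.sidePoint d t + L u) = inner ℝ g (L u) := by
      rw [T.bary_add, bary_sidePoint_two, zero_add]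
    rw [hL u hu2 hu1]
    rcases lt_or_gt_of_ne hne' with hneg | hpos
    · refine ⟨(T.glue d).1, (T.unfold d).symm (T.sidePoint d t + L u), ?_,
        ((h (L u) (by rwa [hLu])).2 (by rw [hbu]; exact hneg.le)).2.symm⟩
      have hsub : (T.unfold d).symm (T.sidePoint d t + L u) =
          (T.unfold d).symm (T.sidePoint d t) + (T.unfold d).symm.linearIsometryEquiv (L u) := by
        have := (T.unfold d).symm.map_vadd (T.sidePoint d t) (L u)
        rw [vadd_eq_add, vadd_eq_add] at this
        rw [add_comm, this, add_comm]
      change ∀ l, 0 < T.bary (T.glue d).1 l _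
      rw [fin3_forall (T.glue d).2]
      refine ⟨?_, ?_, ?_⟩
      · rw [hsub]; exact h3 _ (by rwa [LinearIsometryEquiv.norm_map, hLu])
      · rw [hsub]; exact h4 _ (by rwa [LinearIsometryEquiv.norm_map, hLu])
      · rw [hbary, hbu]; nlinarith
    · refine ⟨d.1, T.sidePoint d t + L u, ?_,
        ((h (L u) (by rwa [hLu])).1 (by rw [hbu]; exact hpos.le)).2.symm⟩
      change ∀ l, 0 < T.bary d.1 l _
      rw [fin3_forall d.2]
      exact ⟨h1 _ (by rwa [hLu]), h2 _ (by rwa [hLu]), by rwa [hbu]⟩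

open MeasureTheory in
/-- Almost every point of a triangle is interior to a triangle of the other triangulation. -/
lemma volume_not_openCell (T' : GeodesicTriangulation M V) (f : T.Face) :
    volume {x | x ∈ T.cell f ∧ ∀ f', T.chart f x ∉ T'.openCell f'} = 0 := by
  refine measure_null_of_locally_null _ fun x hx => ?_
  obtain ⟨ρ, Φ, hΦ, h⟩ := T.exists_flatDisc_interior hx.1
  obtain ⟨n, hn, ε, hε, hu⟩ := T'.exists_normal (T.chart_interior_notMem hx.1) hΦ
  refine ⟨{x | x ∈ T.cell f ∧ ∀ f', T.chart f x ∉ T'.openCell f'} ∩ Metric.ball x (min ε ρ),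
    Filter.inter_mem self_mem_nhdsWithin
      (nhdsWithin_le_nhds (Metric.ball_mem_nhds x (lt_min hε hΦ.pos))), ?_⟩
  let l : E2 →ₗ[ℝ] ℝ := (innerSL ℝ n).toLinearMap
  have hl : LinearMap.ker l ≠ ⊤ := by
    intro h
    have h1 : n ∈ LinearMap.ker l := by rw [h]; trivial
    have h2 : inner ℝ n n = 0 := h1
    exact hn (inner_self_eq_zero.1 h2)
  have hnull := Measure.addHaar_submodule (volume : Measure E2) _ hl
  have hnull' : volume ((fun y => -x + y) ⁻¹' (LinearMap.ker l : Set E2)) = 0 := by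
    rw [measure_preimage_add, hnull]
  refine measure_mono_null ?_ hnull'
  rintro y ⟨⟨hy, hy'⟩, hyb⟩
  rw [Metric.mem_ball, dist_eq_norm] at hyb
  by_contra hne
  obtain ⟨f', hf'⟩ := hu (y - x) (hyb.trans_le (min_le_left _ _)) (fun h0 => hne (by
    change inner ℝ n (-x + y) = 0
    rwa [neg_add_eq_sub]))
  have h3 := (h (y - x) (hyb.trans_le (min_le_right _ _))).2
  rw [add_sub_cancel] at h3
  exact hy' f' (h3 ▸ hf')

open MeasureTheory in
lemma volume_cell_inter_eq_sum (T' : GeodesicTriangulation M V) (f : T.Face) {S : Set M}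
    (hS : IsOpen S) : volume {x | x ∈ T.cell f ∧ T.chart f x ∈ S} =
      ∑ f', volume (T.overlap T' f f' S) := by
  rw [← measure_biUnion_finset]
  · refine measure_congr ?_
    have h0 := T.volume_not_openCell T' f
    refine Filter.EventuallyLE.antisymm ?_ ?_
    · have : ∀ᵐ x, x ∉ {x | x ∈ T.cell f ∧ ∀ f', T.chart f x ∉ T'.openCell f'} :=
        measure_eq_zero_iff_ae_notMem.1 h0
      filter_upwards [this] with x hx hxS
      simp only [not_and, not_forall, not_not] at hx
      obtain ⟨f', hf'⟩ := hx hxS.1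
      exact Set.mem_biUnion (Finset.mem_coe.2 (Finset.mem_univ f')) ⟨hxS.1, hf', hxS.2⟩
    · refine Filter.Eventually.of_forall fun x hx => ?_
      obtain ⟨f', -, hf'⟩ := Set.mem_iUnion₂.1 hx
      exact ⟨hf'.1, hf'.2.2⟩
  · intro f₁ _ f₂ _ hne
    refine Set.disjoint_left.2 fun x h1 h2 => hne ?_
    exact T'.eq_of_mem_openCell h2.2.1 h1.2.1
  · intro f' _
    exact (T.isOpen_overlap T' f f' hS).measurableSet

open MeasureTheory in
/-- The area of an open part of the surface, weighted with the heights of the pyramids, depends only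
on the power function. -/
lemma sum_height_mul_volume_eq {T' : GeodesicTriangulation M V} {r : V → ℝ}
    (hp : T'.power r = T.power r) {S : Set M} (hS : IsOpen S) :
    ∑ f, ENNReal.ofReal (Real.sqrt (T.heightSq r f)) *
        volume {x | x ∈ T.cell f ∧ T.chart f x ∈ S} =
      ∑ f, ENNReal.ofReal (Real.sqrt (T'.heightSq r f)) *
        volume {x | x ∈ T'.cell f ∧ T'.chart f x ∈ S} := by
  simp_rw [T.volume_cell_inter_eq_sum T' _ hS, T'.volume_cell_inter_eq_sum T _ hS, Finset.mul_sum]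
  rw [Finset.sum_comm]
  refine Finset.sum_congr rfl fun f' _ => Finset.sum_congr rfl fun f _ => ?_
  rw [T.volume_overlap_comm T' f f' hS]
  rcases (T.overlap T' f f' S).eq_empty_or_nonempty with h | ⟨x, hx⟩
  · rw [h, measure_empty, mul_zero, mul_zero]
  · obtain ⟨x', hx', h⟩ := hx.2.1
    rw [T.heightSq_eq_of_chart_eq hp hx.1 hx' h.symm]

lemma nonempty_cell (f : T.Face) : (T.cell f).Nonempty := by
  refine ⟨∑ k, (1 / 3 : ℝ) • T.corner f k, fun k => ?_⟩
  have h1 : ∑ k : Fin 3, (1 / 3 : ℝ) • T.corner f k =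
      Finset.univ.affineCombination ℝ (T.corner f) (fun _ => (1 / 3 : ℝ)) := by
    rw [Finset.affineCombination_eq_linear_combination _ _ _ (by simp)]
  rw [h1]
  have h2 := (T.basis f).coord_apply_combination_of_mem (s := Finset.univ) (i := k)
    (Finset.mem_univ k) (w := fun _ => (1 / 3 : ℝ)) (by simp)
  have h3 : T.bary f k (Finset.univ.affineCombination ℝ (T.corner f) (fun _ => (1 / 3 : ℝ))) =
    1 / 3 := h2
  rw [h3]; norm_num

open MeasureTheory in
lemma heightSq_pos_of_power_eq {T' : GeodesicTriangulation M V} {r : V → ℝ}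
    (hp : T'.power r = T.power r) (h : ∀ f, 0 < T.heightSq r f) (f' : T'.Face) :
    0 < T'.heightSq r f' := by
  have h0 := (T'.isOpen_cell f').measure_pos volume (T'.nonempty_cell f')
  have h1 := T'.volume_not_openCell T f'
  obtain ⟨x', hx', hx⟩ : ∃ x' ∈ T'.cell f', ∃ f, T'.chart f' x' ∈ T.openCell f := by
    by_contra! hcon
    refine h0.ne' (measure_mono_null (fun x hx => ?_) h1)
    exact ⟨hx, hcon x hx⟩
  obtain ⟨f, x, hx, hxx⟩ := hx
  rw [T.heightSq_eq_of_chart_eq hp hx hx' hxx]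
  exact h f

/-! ### The total angle at a radial edge -/

/-- A radius within which the vertices are separated from each other in all triangles, and the
distance from a vertex is the distance from a corner. -/
def IsVertexRadius (ρ : ℝ) : Prop :=
  (∀ f k l x, dist x (T.corner f k) < ρ → dist x (T.corner f l) < ρ → k = l) ∧
    (∀ f k x, x ∈ T.face f → dist x (T.corner f k) < ρ →
      dist (T.vertex (f, k) : M) (T.chart f x) = dist x (T.corner f k)) ∧
    (∀ (i : V) f x, x ∈ T.face f → dist (i : M) (T.chart f x) < ρ →
      ∃ k, T.vertex (f, k) = i ∧ dist x (T.corner f k) = dist (i : M) (T.chart f x))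

variable {T} in
lemma IsVertexRadius.mono {ρ ρ' : ℝ} (h : T.IsVertexRadius ρ) (hρ : ρ' ≤ ρ) :
    T.IsVertexRadius ρ' :=
  ⟨fun f k l x h1 h2 => h.1 f k l x (h1.trans_le hρ) (h2.trans_le hρ),
    fun f k x hx h1 => h.2.1 f k x hx (h1.trans_le hρ),
    fun i f x hx h1 => h.2.2 i f x hx (h1.trans_le hρ)⟩

/-- The squared distance of a point of the boundary of the generalized polytope from the axis
through the apex and the vertex `i`. -/
noncomputable def axisDistSq (r : V → ℝ) (i : V) (p : M) : ℝ :=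
  dist (i : M) p ^ 2 -
    (r i ^ 2)⁻¹ * ((dist (i : M) p ^ 2 + r i ^ 2 - T.power r p) / 2) ^ 2

lemma isOpen_axis_nhd (r : V → ℝ) (i : V) (ρ ε : ℝ) :
    IsOpen {p | dist (i : M) p < ρ ∧ T.axisDistSq r i p < ε ^ 2} := by
  have h := T.continuous_power r
  have o1 : IsOpen {p : M | dist (i : M) p < ρ} := isOpen_lt (by fun_prop) continuous_const
  have o2 : IsOpen {p : M | T.axisDistSq r i p < ε ^ 2} :=
    isOpen_lt (by unfold axisDistSq; fun_prop) continuous_const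
  exact o1.inter o2

/-- The position of the foot of the altitude relative to the corner `d`. -/
lemma corner_frame (r : V → ℝ) (d : T.Face × Fin 3) :
    ‖T.corner d.1 (d.2 + 1) - T.corner d.1 d.2‖ = T.length d ∧
    ‖T.corner d.1 (d.2 + 2) - T.corner d.1 d.2‖ = T.length (prevSide d) ∧
    inner ℝ (T.corner d.1 (d.2 + 1) - T.corner d.1 d.2)
      (T.corner d.1 (d.2 + 2) - T.corner d.1 d.2) =
        (T.length d ^ 2 + T.length (prevSide d) ^ 2 - T.length (nextSide d) ^ 2) / 2 ∧
    inner ℝ (T.foot r d.1 - T.corner d.1 d.2) (T.corner d.1 (d.2 + 1) - T.corner d.1 d.2) =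
      (r (T.vertex d) ^ 2 + T.length d ^ 2 - r (T.vertex (nextSide d)) ^ 2) / 2 ∧
    inner ℝ (T.foot r d.1 - T.corner d.1 d.2) (T.corner d.1 (d.2 + 2) - T.corner d.1 d.2) =
      (r (T.vertex d) ^ 2 + T.length (prevSide d) ^ 2 - r (T.vertex (prevSide d)) ^ 2) / 2 := by
  obtain ⟨f, k⟩ := d
  have hk2 : k - 1 = k + 2 := by revert k; decide
  have hk3 : k + 2 + 1 = k := by revert k; decide
  have hk4 : k + 1 + 1 = k + 2 := by revert k; decide
  set e := T.corner f (k + 1) - T.corner f k with he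
  set e₂ := T.corner f (k + 2) - T.corner f k with he₂
  set w := T.foot r f - T.corner f k with hw
  have hc : ‖e‖ = T.length (f, k) := by rw [length, dist_comm, dist_eq_norm]
  have hb : ‖e₂‖ = T.length (prevSide (f, k)) := by
    simp only [length, prevSide, hk2, hk3]; rw [dist_eq_norm]
  have ha : ‖e₂ - e‖ = T.length (nextSide (f, k)) := by
    simp only [length, nextSide, hk4]; rw [dist_comm, dist_eq_norm, he, he₂]; congr 1; abel
  have hx := T.dist_corner_foot r (f, k)
  have hy := T.dist_corner_foot r (nextSide (f, k))
  have hz := T.dist_corner_foot r (prevSide (f, k))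
  have hy' : T.foot r (nextSide (f, k)).1 - T.corner (nextSide (f, k)).1 (nextSide (f, k)).2 =
      w - e := by simp only [nextSide, hw, he]; abel
  have hz' : T.foot r (prevSide (f, k)).1 - T.corner (prevSide (f, k)).1 (prevSide (f, k)).2 =
      w - e₂ := by simp only [prevSide, hk2, hw, he₂]; abel
  rw [hy', norm_sub_sq_real] at hy
  rw [hz', norm_sub_sq_real] at hz
  change ‖w‖ ^ 2 + T.heightSq r f = _ at hx
  change _ + T.heightSq r f = _ at hy
  change _ + T.heightSq r f = _ at hz
  have ha2 := norm_sub_sq_real e₂ e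
  rw [ha, real_inner_comm] at ha2
  refine ⟨hc, hb, ?_, ?_, ?_⟩
  · rw [← hc, ← hb, ha2]; ring
  · rw [← hx, ← hy, ← hc]; ring
  · rw [← hx, ← hz, ← hb]; ring

lemma abs_cornerCofactor_lt {r : V → ℝ} (hr : ∀ i, 0 < r i) {d : T.Face × Fin 3}
    (h : 0 < T.heightSq r d.1) :
    |T.cornerCofactor r d| < Real.sqrt (T.edgeMinor r d * T.edgeMinor r (prevSide d)) := by
  rw [Real.lt_sqrt (abs_nonneg _), sq_abs]
  have h1 := T.edgeMinor_mul_sub_sq r d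
  have := mul_pos (pow_pos (hr (T.vertex d)) 2) (T.pyramidDet_pos h)
  linarith

/-- The cosine and the sine of the dihedral angle at a side edge. -/
lemma radialDihedral_spec {r : V → ℝ} (hr : ∀ i, 0 < r i) {d : T.Face × Fin 3}
    (h : 0 < T.heightSq r d.1) :
    0 < T.radialDihedral r d ∧ T.radialDihedral r d < Real.pi ∧
    Real.sqrt (T.edgeMinor r d) * Real.sqrt (T.edgeMinor r (prevSide d)) *
      Real.cos (T.radialDihedral r d) = T.cornerCofactor r d ∧
    Real.sqrt (T.edgeMinor r d) * Real.sqrt (T.edgeMinor r (prevSide d)) *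
      Real.sin (T.radialDihedral r d) = r (T.vertex d) * Real.sqrt (T.pyramidDet r d) := by
  have hS := T.edgeMinor_pos h
  have hS' : 0 < T.edgeMinor r (prevSide d) := T.edgeMinor_pos (d := prevSide d) h
  have hlt := abs_lt.1 (T.abs_cornerCofactor_lt hr h)
  have hpos : 0 < Real.sqrt (T.edgeMinor r d * T.edgeMinor r (prevSide d)) :=
    Real.sqrt_pos.2 (mul_pos hS hS')
  have h1 : -1 < T.cornerCofactor r d / Real.sqrt (T.edgeMinor r d * T.edgeMinor r (prevSide d)) := by
    rw [lt_div_iff₀ hpos]; linarith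
  have h2 : T.cornerCofactor r d / Real.sqrt (T.edgeMinor r d * T.edgeMinor r (prevSide d)) < 1 := by
    rw [div_lt_iff₀ hpos]; linarith
  rw [T.radialDihedral_eq hr h, ← Real.sqrt_mul hS.le, Real.cos_arccos h1.le h2.le]
  refine ⟨Real.arccos_pos.2 h2, ?_, ?_, ?_⟩
  · refine lt_of_le_of_ne (Real.arccos_le_pi _) fun h3 => ?_
    rw [Real.arccos_eq_pi] at h3; linarith
  · field_simp
  · rw [Real.sin_arccos]
    rw [← Real.sqrt_mul (mul_pos hS hS').le, ← Real.sqrt_sq (hr (T.vertex d)).le,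
      ← Real.sqrt_mul (sq_nonneg _), ← edgeMinor_mul_sub_sq]
    congr 1
    rw [div_pow, Real.sq_sqrt (mul_pos hS hS').le]
    field_simp

open MeasureTheory in
/-- The region around a corner of a triangle that is cut out by a cylinder around the axis through
the apex and the corner. Its area, weighted with the height of the pyramid, is proportional to the
dihedral angle at the axis. -/
lemma height_mul_volume_corner {r : V → ℝ} (hr : ∀ i, 0 < r i) {d : T.Face × Fin 3}
    (h : 0 < T.heightSq r d.1) {ε : ℝ} (hε : 0 < ε) :
    ENNReal.ofReal (Real.sqrt (T.heightSq r d.1)) *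
      volume {x | 0 < T.bary d.1 (d.2 + 1) x ∧ 0 < T.bary d.1 (d.2 + 2) x ∧
        ‖x - T.corner d.1 d.2‖ ^ 2 - (r (T.vertex d) ^ 2)⁻¹ *
          inner ℝ (T.foot r d.1 - T.corner d.1 d.2) (x - T.corner d.1 d.2) ^ 2 < ε ^ 2} =
      ENNReal.ofReal (r (T.vertex d) * ε ^ 2 / 2 * T.radialDihedral r d) := by
  obtain ⟨hω, hω', hcos, hsin⟩ := T.radialDihedral_spec hr h
  obtain ⟨hc, hb, he12, hw1, hw2⟩ := T.corner_frame r d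
  have hS := T.edgeMinor_pos h
  have hS' : 0 < T.edgeMinor r (prevSide d) := T.edgeMinor_pos (d := prevSide d) h
  have hx := hr (T.vertex d)
  have hx0 := hx.ne'
  set c := T.corner d.1 d.2 with hcdef
  set x₀ := r (T.vertex d) with hx₀
  have hk : ¬ (d.2 + 1 = d.2) ∧ ¬ (d.2 + 2 = d.2) ∧ ¬ (d.2 + 1 = d.2 + 2) ∧
      ¬ (d.2 + 2 = d.2 + 1) := by
    generalize d.2 = k; revert k; decide
  obtain ⟨k1, k2, k3, k4⟩ := hk
  have hset : {x | 0 < T.bary d.1 (d.2 + 1) x ∧ 0 < T.bary d.1 (d.2 + 2) x ∧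
        ‖x - c‖ ^ 2 - (x₀ ^ 2)⁻¹ * inner ℝ (T.foot r d.1 - c) (x - c) ^ 2 < ε ^ 2} =
      (fun x => -c + x) ⁻¹' {y : E2 | 0 < inner ℝ (T.baryGrad d.1 (d.2 + 1)) y ∧
        0 < inner ℝ (T.baryGrad d.1 (d.2 + 2)) y ∧
        ‖y‖ ^ 2 - (x₀ ^ 2)⁻¹ * inner ℝ (T.foot r d.1 - c) y ^ 2 < ε ^ 2} := by
    ext x
    simp only [Set.mem_ofPred_eq, Set.mem_preimage, neg_add_eq_sub, ← bary_sub, hcdef, bary_corner,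
      if_neg k1, if_neg k2, sub_zero]
  rw [hset, measure_preimage_add, volume_elliptic_sector (e₁ := T.corner d.1 (d.2 + 1) - c)
    (e₂ := T.corner d.1 (d.2 + 2) - c) (q₁ := T.edgeMinor r d / x₀ ^ 2)
    (q₂ := T.edgeMinor r (prevSide d) / x₀ ^ 2) (q₁₂ := T.cornerCofactor r d / x₀ ^ 2)
    (Δ := T.baseAreaSq d) (ω := T.radialDihedral r d) _ _ _ _ _ _ _ _ (by positivity)
    (by positivity) hω hω' _ hε, ← ENNReal.ofReal_mul (Real.sqrt_nonneg _)]
  · congr 1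
    have e1 : Real.sqrt (T.edgeMinor r d / x₀ ^ 2) *
        Real.sqrt (T.edgeMinor r (prevSide d) / x₀ ^ 2) * Real.sin (T.radialDihedral r d) =
        Real.sqrt (T.heightSq r d.1) * Real.sqrt (T.baseAreaSq d) / x₀ := by
      rw [Real.sqrt_div hS.le, Real.sqrt_div hS'.le, Real.sqrt_sq hx.le, ← Real.sqrt_mul h.le,
        ← T.pyramidDet_eq, div_mul_div_comm, div_mul_eq_mul_div, hsin]
      field_simp
    rw [e1]
    have h1 := Real.sqrt_pos.2 h
    have h2 := Real.sqrt_pos.2 (T.baseAreaSq_pos d)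
    field_simp
  · rw [hcdef, ← bary_sub, bary_corner, bary_corner, if_pos rfl, if_neg k1, sub_zero]
  · rw [hcdef, ← bary_sub, bary_corner, bary_corner, if_neg k3, if_neg k1, sub_zero]
  · rw [hcdef, ← bary_sub, bary_corner, bary_corner, if_neg k4, if_neg k2, sub_zero]
  · rw [hcdef, ← bary_sub, bary_corner, bary_corner, if_pos rfl, if_neg k2, sub_zero]
  · rw [hc, hb, he12]; unfold baseAreaSq areaSq; ring
  · rw [hc, hw1]
    unfold edgeMinor gramMinor gramEntry
    rw [← hx₀]
    field_simp
    ring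
  · rw [hb, hw2]
    unfold edgeMinor gramMinor gramEntry
    rw [nextSide_prevSide, ← hx₀]
    field_simp
    ring
  · rw [he12, hw1, hw2]
    unfold cornerCofactor gramCofactor gramEntry
    rw [← hx₀]
    field_simp
    ring
  · rw [Real.sqrt_div hS.le, Real.sqrt_div hS'.le, Real.sqrt_sq hx.le, ← hcos]
    field_simp

open MeasureTheory in
/-- The weighted area of a small region around a vertex, cut out by a cylinder around the axis. -/
lemma sum_height_mul_volume_axis_nhd {r : V → ℝ} (hr : ∀ i, 0 < r i) (h : ∀ f, 0 < T.heightSq r f)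
    (i : V) {ρ : ℝ} (hρ : 0 < ρ) (hρT : T.IsVertexRadius ρ) :
    ∃ ε₀ > 0, ∀ ε, 0 < ε → ε < ε₀ →
      ∑ f, ENNReal.ofReal (Real.sqrt (T.heightSq r f)) * volume {x | x ∈ T.cell f ∧ T.chart f x ∈
        {p | dist (i : M) p < ρ ∧ T.axisDistSq r i p < ε ^ 2}} =
      ENNReal.ofReal (r i * ε ^ 2 / 2 * (2 * Real.pi - T.curvature r i)) := by
  classical
  have hi := hr i
  obtain ⟨c₀, hc0, hc⟩ := exists_pos_forall_le (fun f => T.heightSq r f / r i ^ 2)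
    (fun f => div_pos (h f) (pow_pos hi 2))
  have hball : ∀ d : T.Face × Fin 3, ∃ δ > 0, ∀ u, ‖u‖ < δ →
      0 < T.bary d.1 d.2 (T.corner d.1 d.2 + u) := fun d =>
    T.exists_ball_bary_pos d.1 d.2 (by rw [bary_corner, if_pos rfl]; exact one_pos)
  choose δ hδ0 hδ using hball
  obtain ⟨δ₀, hδ₀, hδle⟩ := exists_pos_forall_le δ hδ0
  set η := min ρ δ₀ with hη
  have hη0 : 0 < η := lt_min hρ hδ₀
  refine ⟨η * Real.sqrt c₀, by positivity, fun ε hε hε' => ?_⟩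
  set C : T.Face × Fin 3 → Set E2 := fun d => {x | 0 < T.bary d.1 (d.2 + 1) x ∧
    0 < T.bary d.1 (d.2 + 2) x ∧ ‖x - T.corner d.1 d.2‖ ^ 2 - (r (T.vertex d) ^ 2)⁻¹ *
          inner ℝ (T.foot r d.1 - T.corner d.1 d.2) (x - T.corner d.1 d.2) ^ 2 < ε ^ 2} with hC
  -- The height is positive, so the axis is transversal to the triangles, and a thin cylinder around
  -- it meets them in small sets only.
  have hsmall : ∀ d, T.vertex d = i → ∀ x ∈ C d, ‖x - T.corner d.1 d.2‖ < η := by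
    rintro d hd x ⟨-, -, hx⟩
    rw [hd] at hx
    set y := x - T.corner d.1 d.2
    set w := T.foot r d.1 - T.corner d.1 d.2 with hw
    have h1 : ‖w‖ ^ 2 + T.heightSq r d.1 = r i ^ 2 := by rw [← hd]; exact T.dist_corner_foot r d
    have h2 : inner ℝ w y ^ 2 ≤ ‖w‖ ^ 2 * ‖y‖ ^ 2 := by
      rw [← mul_pow, ← sq_abs]
      exact pow_le_pow_left₀ (abs_nonneg _) (abs_real_inner_le_norm w y) 2
    have h3 : T.heightSq r d.1 / r i ^ 2 * ‖y‖ ^ 2 ≤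
        ‖y‖ ^ 2 - (r i ^ 2)⁻¹ * inner ℝ w y ^ 2 := by
      have h4 : T.heightSq r d.1 / r i ^ 2 * ‖y‖ ^ 2 =
          ‖y‖ ^ 2 - (r i ^ 2)⁻¹ * (‖w‖ ^ 2 * ‖y‖ ^ 2) := by
        have h5 : T.heightSq r d.1 = r i ^ 2 - ‖w‖ ^ 2 := by linarith
        rw [h5]
        field_simp
      rw [h4]
      have : 0 ≤ (r i ^ 2)⁻¹ := by positivity
      nlinarith
    have h5 : c₀ * ‖y‖ ^ 2 ≤ T.heightSq r d.1 / r i ^ 2 * ‖y‖ ^ 2 :=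
      mul_le_mul_of_nonneg_right (hc d.1) (sq_nonneg _)
    have h6 : ε ^ 2 < η ^ 2 * c₀ := by
      rw [← Real.sq_sqrt hc0.le, ← mul_pow]
      exact pow_lt_pow_left₀ hε' hε.le two_ne_zero
    have h7 : ‖y‖ ^ 2 < η ^ 2 := by
      by_contra! hcon
      nlinarith
    exact lt_of_pow_lt_pow_left₀ 2 hη0.le h7
  have haxis : ∀ f k x, T.vertex (f, k) = i → x ∈ T.face f →
      dist x (T.corner f k) = dist (i : M) (T.chart f x) →
      T.axisDistSq r i (T.chart f x) = ‖x - T.corner f k‖ ^ 2 - (r (T.vertex (f, k)) ^ 2)⁻¹ *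
          inner ℝ (T.foot r f - T.corner f k) (x - T.corner f k) ^ 2 := by
    intro f k x hv hx hd
    have h1 := T.dist_corner_foot r (f, k)
    have h2 := norm_sub_sq_real (x - T.corner f k) (T.foot r f - T.corner f k)
    rw [sub_sub_sub_cancel_right, real_inner_comm] at h2
    unfold axisDistSq
    rw [← hd, T.power_chart r hx, facePower_eq_foot, dist_eq_norm, dist_eq_norm, h2, hv]
    rw [hv] at h1
    rw [← h1]
    ring
  have hcell : ∀ f, {x | x ∈ T.cell f ∧ T.chart f x ∈
        {p | dist (i : M) p < ρ ∧ T.axisDistSq r i p < ε ^ 2}} =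
      ⋃ k ∈ Finset.univ.filter (fun k => T.vertex (f, k) = i), C (f, k) := by
    intro f
    ext x
    simp only [Set.mem_iUnion, Finset.mem_filter, Finset.mem_univ, true_and, exists_prop]
    constructor
    · rintro ⟨hx, hxρ, hxε⟩
      obtain ⟨k, hk, hd⟩ := hρT.2.2 i f x (T.cell_subset_face f hx) hxρ
      refine ⟨k, hk, hx _, hx _, ?_⟩
      rw [haxis f k x hk (T.cell_subset_face f hx) hd] at hxε
      exact hxε
    · rintro ⟨k, hk, hx⟩
      have hxs := hsmall (f, k) hk x hx
      have hxcell : x ∈ T.cell f := by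
        change ∀ l, 0 < T.bary f l x
        rw [fin3_forall k]
        refine ⟨?_, hx.1, hx.2.1⟩
        have := hδ (f, k) (x - T.corner f k) (hxs.trans_le ((min_le_right _ _).trans (hδle _)))
        rwa [add_sub_cancel] at this
      have hxρ : dist x (T.corner f k) < ρ := by
        rw [dist_eq_norm]; exact hxs.trans_le (min_le_left _ _)
      have hd := hρT.2.1 f k x (T.cell_subset_face f hxcell) hxρ
      rw [hk] at hd
      refine ⟨hxcell, ?_, ?_⟩
      · rw [hd]; exact hxρ
      · rw [haxis f k x hk (T.cell_subset_face f hxcell) hd.symm]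
        exact hx.2.2
  have hvol : ∀ f, volume {x | x ∈ T.cell f ∧ T.chart f x ∈
        {p | dist (i : M) p < ρ ∧ T.axisDistSq r i p < ε ^ 2}} =
      ∑ k with T.vertex (f, k) = i, volume (C (f, k)) := by
    intro f
    rw [hcell f, measure_biUnion_finset]
    · intro k hk l hl hkl
      refine Set.disjoint_left.2 fun x h1 h2 => hkl ?_
      have h1' := hsmall (f, k) (Finset.mem_filter.1 hk).2 x h1
      have h2' := hsmall (f, l) (Finset.mem_filter.1 hl).2 x h2
      refine hρT.1 f k l x ?_ ?_
      · rw [dist_eq_norm]; exact h1'.trans_le (min_le_left _ _)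
      · rw [dist_eq_norm]; exact h2'.trans_le (min_le_left _ _)
    · intro k _
      have o1 : IsOpen {x | 0 < T.bary f (k + 1) x} :=
        isOpen_lt continuous_const (T.continuous_bary f _)
      have o2 : IsOpen {x | 0 < T.bary f (k + 2) x} :=
        isOpen_lt continuous_const (T.continuous_bary f _)
      have o3 : IsOpen {x : E2 | ‖x - T.corner f k‖ ^ 2 - (r (T.vertex (f, k)) ^ 2)⁻¹ *
          inner ℝ (T.foot r f - T.corner f k) (x - T.corner f k) ^ 2 < ε ^ 2} :=
        isOpen_lt (by fun_prop) continuous_const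
      exact (o1.inter (o2.inter o3)).measurableSet
  have hterm : ∀ f, ENNReal.ofReal (Real.sqrt (T.heightSq r f)) * volume {x | x ∈ T.cell f ∧
        T.chart f x ∈ {p | dist (i : M) p < ρ ∧ T.axisDistSq r i p < ε ^ 2}} =
      ENNReal.ofReal (∑ k : Fin 3, if T.vertex (f, k) = i then
        r i * ε ^ 2 / 2 * T.radialDihedral r (f, k) else 0) := by
    intro f
    rw [hvol f, Finset.mul_sum, Finset.sum_filter, ENNReal.ofReal_sum_of_nonneg]
    · refine Finset.sum_congr rfl fun k _ => ?_
      by_cases hk : T.vertex (f, k) = i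
      · rw [if_pos hk, if_pos hk]
        have := T.height_mul_volume_corner hr (d := (f, k)) (h f) hε
        rw [← hk]
        exact this
      · rw [if_neg hk, if_neg hk, ENNReal.ofReal_zero]
    · intro k _
      split_ifs
      · have := (T.radialDihedral_spec hr (d := (f, k)) (h f)).1
        positivity
      · exact le_rfl
  simp_rw [hterm]
  rw [← ENNReal.ofReal_sum_of_nonneg]
  · congr 1
    rw [curvature, sub_sub_cancel, Finset.sum_filter, Finset.mul_sum, ← Fintype.sum_prod_type']
    refine Finset.sum_congr rfl fun d _ => ?_
    split_ifs <;> simp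
  · intro f _
    refine Finset.sum_nonneg fun k _ => ?_
    split_ifs
    · have := (T.radialDihedral_spec hr (d := (f, k)) (h f)).1
      positivity
    · exact le_rfl

/-- The curvatures are determined by the power function. -/
lemma curvature_eq_of_power_eq {T' : GeodesicTriangulation M V} {r : V → ℝ}
    (hr : ∀ i, 0 < r i) (h : ∀ f, 0 < T.heightSq r f) (hp : T'.power r = T.power r) :
    T'.curvature r = T.curvature r := by
  have h' := T.heightSq_pos_of_power_eq hp h
  funext i
  obtain ⟨ρ₁, hρ₁, h1⟩ := T.exists_vertex_nhd
  obtain ⟨ρ₂, hρ₂, h2⟩ := T'.exists_vertex_nhd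
  set ρ := min ρ₁ ρ₂ with hρ
  have hρ0 : 0 < ρ := lt_min hρ₁ hρ₂
  have hT : T.IsVertexRadius ρ := IsVertexRadius.mono h1 (min_le_left _ _)
  have hT' : T'.IsVertexRadius ρ := IsVertexRadius.mono h2 (min_le_right _ _)
  obtain ⟨ε₁, hε₁, e1⟩ := T.sum_height_mul_volume_axis_nhd hr h i hρ0 hT
  obtain ⟨ε₂, hε₂, e2⟩ := T'.sum_height_mul_volume_axis_nhd hr h' i hρ0 hT'
  set ε := min ε₁ ε₂ / 2 with hε
  have hε0 : 0 < ε := by positivity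
  have a1 := e1 ε hε0 (by have := min_le_left ε₁ ε₂; linarith)
  have a2 := e2 ε hε0 (by have := min_le_right ε₁ ε₂; linarith)
  have hax : ∀ p, T'.axisDistSq r i p = T.axisDistSq r i p := by
    intro p; unfold axisDistSq; rw [hp]
  simp_rw [hax] at a2
  rw [← T.sum_height_mul_volume_eq hp (T.isOpen_axis_nhd r i ρ ε), a1] at a2
  have hi := hr i
  have hnn : ∀ (T : GeodesicTriangulation M V), (∀ f, 0 < T.heightSq r f) →
      0 ≤ 2 * Real.pi - T.curvature r i := by
    intro T h
    rw [curvature, sub_sub_cancel]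
    exact Finset.sum_nonneg fun d _ => (T.radialDihedral_spec hr (h _)).1.le
  have h3 := (ENNReal.ofReal_eq_ofReal_iff (mul_nonneg (by positivity) (hnn T h))
    (mul_nonneg (by positivity) (hnn T' h'))).1 a2
  have h4 := mul_left_cancel₀ (by positivity) h3
  linarith

/-! ### Invariance under a change of the triangulation -/

open Classical in
/-- The matrix of the derivative of the face areas of the polyhedron `(T, φ, h)`. -/
noncomputable def areaJacobian (φ : T.Face × Fin 3 → ℝ) (h : V → ℝ) : Matrix V V ℝ := fun i j =>
  ∑ d with T.vertex d = i, T.dualLength φ h d * T.edgeAltitude φ (Pi.single j 1) d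

variable {T' : GeodesicTriangulation M V} {r : V → ℝ}

/-- The total scalar curvature is determined by the power function. -/
lemma totalScalarCurvature_eq_of_power_eq (hr : ∀ i, 0 < r i) (h : ∀ f, 0 < T.heightSq r f)
    (hc : T.PowerConcave r) (hc' : T'.PowerConcave r) (hp : T'.power r = T.power r) :
    T'.totalScalarCurvature r = T.totalScalarCurvature r := by
  have h' := T.heightSq_pos_of_power_eq hp h
  have hform : ∀ (T : GeodesicTriangulation M V), (∀ f, 0 < T.heightSq r f) → ∀ d,
      T.length d * (Real.pi - T.boundaryDihedral r d) =
        T.length d * (Real.pi -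
          (Real.arccos (T.footDist r d * T.length d /
            Real.sqrt (gramMinor (r (T.vertex d)) (r (T.vertex (nextSide d))) (T.length d))) +
          Real.arccos (T.footDist r (T.glue d) * T.length d /
            Real.sqrt (gramMinor (r (T.vertex d)) (r (T.vertex (nextSide d))) (T.length d))))) := by
    intro T h d
    rw [boundaryDihedral, T.baseDihedral_eq_footDist hr (h _), T.baseDihedral_eq_footDist hr (h _),
      edgeMinor_glue, length_glue]
    rfl
  have hflat : ∀ (T : GeodesicTriangulation M V), ∀ d,
      T.footDist r d + T.footDist r (T.glue d) = 0 → T.length d * (Real.pi -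
          (Real.arccos (T.footDist r d * T.length d /
            Real.sqrt (gramMinor (r (T.vertex d)) (r (T.vertex (nextSide d))) (T.length d))) +
          Real.arccos (T.footDist r (T.glue d) * T.length d /
            Real.sqrt (gramMinor (r (T.vertex d)) (r (T.vertex (nextSide d))) (T.length d))))) =
        0 := by
    intro T d hd
    rw [eq_neg_of_add_eq_zero_right hd, neg_mul, neg_div, Real.arccos_neg]
    ring
  unfold totalScalarCurvature
  rw [T.curvature_eq_of_power_eq hr h hp, Finset.sum_congr rfl fun d _ => hform T h d,
    Finset.sum_congr rfl fun d _ => hform T' h' d]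
  rw [T.sum_edges_eq hc hc' hp (fun i j l s s' => l * (Real.pi -
    (Real.arccos (s * l / Real.sqrt (gramMinor (r i) (r j) l)) +
      Real.arccos (s' * l / Real.sqrt (gramMinor (r i) (r j) l)))))
      (fun i j l s s' => by rw [add_comm]) (hflat T) (hflat T')]

/-- The matrix of the derivative of the face areas of the dual polyhedron is determined by the power
function. -/
lemma areaJacobian_eq_of_power_eq (hr : ∀ i, 0 < r i) (h : ∀ f, 0 < T.heightSq r f)
    (hc : T.PowerConcave r) (hc' : T'.PowerConcave r) (hp : T'.power r = T.power r) :
    T'.areaJacobian (T'.apexAngle r) (fun i => 1 / r i) =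
      T.areaJacobian (T.apexAngle r) (fun i => 1 / r i) := by
  classical
  have h' := T.heightSq_pos_of_power_eq hp h
  ext i j
  let v : V → ℝ := Pi.single j 1
  let Q : V → V → ℝ → ℝ → ℝ → ℝ := fun p q l s s' => if p = i then
    l / Real.sqrt (gramMinor (r p) (r q) l) *
      (s / Real.sqrt (gramMinor (r p) (r q) l / l ^ 2 - s ^ 2) +
        s' / Real.sqrt (gramMinor (r p) (r q) l / l ^ 2 - s' ^ 2)) *
      ((v q - v p * (gramEntry (r p) (r q) l / (r p * r q))) /
        (Real.sqrt (gramMinor (r p) (r q) l) / (r p * r q))) else 0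
  have hform : ∀ (T : GeodesicTriangulation M V), (∀ f, 0 < T.heightSq r f) → ∀ d,
      (if T.vertex d = i then T.dualLength (T.apexAngle r) (fun i => 1 / r i) d *
        T.edgeAltitude (T.apexAngle r) v d else 0) =
      Q (T.vertex d) (T.vertex (nextSide d)) (T.length d) (T.footDist r d)
        (T.footDist r (T.glue d)) := by
    intro T h d
    have hl := (pow_pos (T.length_pos d) 2).ne'
    have e1 : T.edgeMinor r d / T.length d ^ 2 - T.footDist r d ^ 2 = T.heightSq r d.1 := by
      rw [(T.pyramid_formulas r d).2.2, mul_div_cancel_left₀ _ hl]; ring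
    have e2 : T.edgeMinor r d / T.length d ^ 2 - T.footDist r (T.glue d) ^ 2 =
        T.heightSq r (T.glue d).1 := by
      rw [← T.edgeMinor_glue, (T.pyramid_formulas r (T.glue d)).2.2, T.length_glue,
        mul_div_cancel_left₀ _ hl]
      ring
    change _ = if _ then T.length d / Real.sqrt (T.edgeMinor r d) *
      (T.footDist r d / Real.sqrt (T.edgeMinor r d / T.length d ^ 2 - T.footDist r d ^ 2) +
        T.footDist r (T.glue d) /
          Real.sqrt (T.edgeMinor r d / T.length d ^ 2 - T.footDist r (T.glue d) ^ 2)) *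
      ((v (T.vertex (nextSide d)) - v (T.vertex d) * _) / (Real.sqrt (T.edgeMinor r d) / _)) else 0
    rw [e1, e2, ← T.dualLength_apexAngle hr h, ← T.cos_apexAngle hr h, ← T.sin_apexAngle hr]
    rfl
  have hflat : ∀ (T : GeodesicTriangulation M V), ∀ d,
      T.footDist r d + T.footDist r (T.glue d) = 0 →
      Q (T.vertex d) (T.vertex (nextSide d)) (T.length d) (T.footDist r d)
        (T.footDist r (T.glue d)) = 0 := by
    intro T d hd
    simp only [Q]
    rw [eq_neg_of_add_eq_zero_right hd, neg_sq, neg_div, add_neg_cancel, mul_zero, zero_mul,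
      ite_self]
  unfold areaJacobian
  rw [Finset.sum_filter, Finset.sum_filter, Finset.sum_congr rfl fun d _ => hform T h d,
    Finset.sum_congr rfl fun d _ => hform T' h' d]
  refine (T.sum_edges_eq hc hc' hp Q (fun p q l s s' => ?_) (hflat T) (hflat T')).symm
  simp only [Q]
  rw [add_comm (s / _)]

/-! ### Face areas and volume of a polyhedron -/

section Polyhedron

variable {φ : T.Face × Fin 3 → ℝ}

lemma edgeAltitude_add (φ : T.Face × Fin 3 → ℝ) (u v : V → ℝ) (d : T.Face × Fin 3) :
    T.edgeAltitude φ (u + v) d = T.edgeAltitude φ u d + T.edgeAltitude φ v d := by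
  simp only [Triangulation.edgeAltitude, Pi.add_apply]; ring

lemma edgeAltitude_smul (φ : T.Face × Fin 3 → ℝ) (c : ℝ) (v : V → ℝ) (d : T.Face × Fin 3) :
    T.edgeAltitude φ (c • v) d = c * T.edgeAltitude φ v d := by
  simp only [Triangulation.edgeAltitude, Pi.smul_apply, smul_eq_mul]; ring

lemma edgeAltitude_glue (hφ : ∀ d, φ (T.glue d) = φ d) (v : V → ℝ) (d : T.Face × Fin 3) :
    T.edgeAltitude φ v (T.glue d) = T.edgeAltitudeRev φ v d := by
  simp only [Triangulation.edgeAltitude, Triangulation.edgeAltitudeRev, T.vertex_glue,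
    T.vertex_nextSide_glue, hφ]

lemma dualLength_glue (hφ : ∀ d, φ (T.glue d) = φ d) (hs : ∀ d, 0 < Real.sin (φ d))
    (hG : ∀ d, 0 < T.fanDet φ d) (h : V → ℝ) (d : T.Face × Fin 3) :
    T.dualLength φ h (T.glue d) = T.dualLength φ h d := by
  unfold Triangulation.dualLength
  rw [T.rightAltitude_eq h hφ hs (hG _), T.rightAltitude_eq h hφ hs (hG _), T.glue_glue, add_comm]

open Classical in
lemma areaJacobian_mulVec (h v : V → ℝ) (i : V) : (T.areaJacobian φ h).mulVec v i =
    ∑ d, if T.vertex d = i then T.dualLength φ h d * T.edgeAltitude φ v d else 0 := by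
  classical
  rw [← Finset.sum_filter]
  let L : T.Face × Fin 3 → (V → ℝ) →ₗ[ℝ] ℝ := fun d =>
    { toFun := fun v => T.edgeAltitude φ v d
      map_add' := fun u v => T.edgeAltitude_add φ u v d
      map_smul' := fun c v => T.edgeAltitude_smul φ c v d }
  have hL : ∀ d, T.edgeAltitude φ v d = ∑ j, T.edgeAltitude φ (Pi.single j 1) d * v j := by
    intro d
    have := (L d).pi_apply_eq_sum_univ v
    refine this.trans (Finset.sum_congr rfl fun j _ => ?_)
    rw [smul_eq_mul, mul_comm]
    have e : (fun k => if j = k then (1 : ℝ) else 0) = Pi.single j 1 := by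
      ext k; simp [Pi.single_apply, eq_comm]
    rw [e]
    rfl
  simp_rw [hL]
  unfold areaJacobian Matrix.mulVec dotProduct
  simp_rw [Finset.mul_sum, Finset.sum_mul]
  rw [Finset.sum_comm]
  refine Finset.sum_congr rfl fun d _ => Finset.sum_congr rfl fun j _ => ?_
  convert mul_assoc _ _ _ using 3

/-- The derivative of the face areas is a symmetric function of the two vectors of support numbers,
because each corner of the triangulation contributes a symmetric function. -/
lemma areaJacobian_mulVec_comm (hφ : ∀ d, φ (T.glue d) = φ d) (h v : V → ℝ) :
    (T.areaJacobian φ h).mulVec v = (T.areaJacobian φ v).mulVec h := by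
  classical
  have key : ∀ (h v : V → ℝ) (i : V), (T.areaJacobian φ h).mulVec v i =
      ∑ d, if T.vertex d = i then
        (T.edgeAltitudeRev φ h (prevSide d) -
          T.edgeAltitude φ h d * Real.cos (T.fanAngle φ d)) / Real.sin (T.fanAngle φ d) *
            T.edgeAltitude φ v d +
        (T.edgeAltitude φ h d -
          T.edgeAltitudeRev φ h (prevSide d) * Real.cos (T.fanAngle φ d)) /
            Real.sin (T.fanAngle φ d) * T.edgeAltitudeRev φ v (prevSide d) else 0 := by
    intro h v i
    rw [T.areaJacobian_mulVec]
    have e1 : ∀ d, (if T.vertex d = i then T.dualLength φ h d * T.edgeAltitude φ v d else 0) =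
        (if T.vertex d = i then T.leftAltitude φ h d * T.edgeAltitude φ v d else 0) +
        (if T.vertex d = i then T.rightAltitude φ h d * T.edgeAltitude φ v d else 0) := by
      intro d
      unfold Triangulation.dualLength
      split_ifs <;> ring
    rw [Finset.sum_congr rfl fun d _ => e1 d, Finset.sum_add_distrib,
      ← Equiv.sum_comp (T.glue * prevPerm T.Face) (fun d => if T.vertex d = i then
        T.rightAltitude φ h d * T.edgeAltitude φ v d else 0), ← Finset.sum_add_distrib]
    refine Finset.sum_congr rfl fun d _ => ?_
    have e2 : (T.glue * prevPerm T.Face) d = T.glue (prevSide d) := rfl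
    rw [e2, T.vertex_glue, nextSide_prevSide]
    unfold Triangulation.leftAltitude Triangulation.rightAltitude
    rw [T.glue_glue, nextSide_prevSide, T.edgeAltitude_glue hφ, T.edgeAltitude_glue hφ]
    split_ifs <;> ring
  funext i
  rw [key, key]
  refine Finset.sum_congr rfl fun d _ => ?_
  split_ifs <;> ring

lemma faceArea_eq (h : V → ℝ) (i : V) :
    T.faceArea φ h i = 1 / 2 * (T.areaJacobian φ h).mulVec h i := by
  rw [T.areaJacobian_mulVec, ← Finset.sum_filter, Triangulation.faceArea]
  congr 1
  refine Finset.sum_congr (by congr) fun d _ => mul_comm _ _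

lemma sum_mul_areaJacobian_mulVec_comm (hφ : ∀ d, φ (T.glue d) = φ d)
    (hs : ∀ d, 0 < Real.sin (φ d)) (hG : ∀ d, 0 < T.fanDet φ d) (h u v : V → ℝ) :
    ∑ i, u i * (T.areaJacobian φ h).mulVec v i = ∑ i, v i * (T.areaJacobian φ h).mulVec u i := by
  classical
  have key : ∀ u v : V → ℝ, ∑ i, u i * (T.areaJacobian φ h).mulVec v i =
      1 / 2 * ∑ d, T.dualLength φ h d * (u (T.vertex d) * T.edgeAltitude φ v d +
        u (T.vertex (nextSide d)) * T.edgeAltitudeRev φ v d) := by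
    intro u v
    have e1 : ∑ i, u i * (T.areaJacobian φ h).mulVec v i =
        ∑ d, T.dualLength φ h d * (u (T.vertex d) * T.edgeAltitude φ v d) := by
      simp_rw [T.areaJacobian_mulVec, Finset.mul_sum]
      rw [Finset.sum_comm]
      refine Finset.sum_congr rfl fun d _ => ?_
      simp_rw [mul_ite, mul_zero]
      rw [Finset.sum_ite_eq]
      simp only [Finset.mem_univ, if_true]
      ring
    have e2 : ∑ d, T.dualLength φ h d * (u (T.vertex d) * T.edgeAltitude φ v d) =
        ∑ d, T.dualLength φ h d * (u (T.vertex (nextSide d)) * T.edgeAltitudeRev φ v d) := by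
      rw [← Equiv.sum_comp T.glue]
      refine Finset.sum_congr rfl fun d _ => ?_
      rw [T.dualLength_glue hφ hs hG, T.edgeAltitude_glue hφ, T.vertex_glue]
    simp_rw [mul_add]
    rw [Finset.sum_add_distrib, e1, ← e2]
    ring
  rw [key, key]
  congr 1
  refine Finset.sum_congr rfl fun d _ => ?_
  unfold Triangulation.edgeAltitude Triangulation.edgeAltitudeRev
  ring

end Polyhedron

end GeodesicTriangulation
/-! ### Derivatives of the angles of a pyramid -/

section Arccos

variable {E : Type*} [NormedAddCommGroup E] [NormedSpace ℝ E]

/-- The derivative of an angle of a spherical triangle in terms of the Gram matrix: `N` is a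
cofactor, `S` and `Q` are the corresponding diagonal minors, and `K ^ 2` is a multiple of the
determinant. -/
lemma hasFDerivAt_arccos_div_sqrt {N S Q : E → ℝ} {N' S' Q' : E →L[ℝ] ℝ} {x : E} {K : ℝ}
    (hN : HasFDerivAt N N' x) (hS : HasFDerivAt S S' x) (hQ : HasFDerivAt Q Q' x)
    (hS0 : 0 < S x) (hQ0 : 0 < Q x) (hK : 0 < K) (h : S x * Q x - N x ^ 2 = K ^ 2) :
    HasFDerivAt (fun y => Real.arccos (N y / Real.sqrt (S y * Q y)))
      (-(1 / K) • (N' - (N x / 2) • ((1 / S x) • S' + (1 / Q x) • Q'))) x := by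
  have hD0 : 0 < S x * Q x := mul_pos hS0 hQ0
  have hD := Real.sqrt_pos.2 hD0
  have hDsq := Real.sq_sqrt hD0.le
  obtain ⟨D, hDdef⟩ : ∃ D, D = Real.sqrt (S x * Q x) := ⟨_, rfl⟩
  rw [← hDdef] at hD hDsq
  have h1 : 1 - (N x / D) ^ 2 = (K / D) ^ 2 := by
    rw [div_pow, div_pow, hDsq, ← h]; field_simp
  have hKD : 0 < K / D := div_pos hK hD
  have h2 : N x / D ≠ -1 := by
    intro h3; rw [h3] at h1; nlinarith [pow_pos hKD 2]
  have h3 : N x / D ≠ 1 := by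
    intro h3; rw [h3] at h1; nlinarith [pow_pos hKD 2]
  have hsq := (hS.fun_mul hQ).sqrt hD0.ne'
  have hinv : HasFDerivAt (fun y => (Real.sqrt (S y * Q y))⁻¹) _ x :=
    (hasDerivAt_inv (by rw [← hDdef]; exact hD.ne')).comp_hasFDerivAt x hsq
  have hdiv : HasFDerivAt (fun y => N y / Real.sqrt (S y * Q y)) _ x := hN.fun_mul hinv
  have harc := Real.hasDerivAt_arccos h2 h3
  rw [h1, Real.sqrt_sq hKD.le, hDdef] at harc
  refine (harc.comp_hasFDerivAt x hdiv).congr_fderiv (ContinuousLinearMap.ext fun v => ?_)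
  simp only [← hDdef, smul_apply, sub_apply, add_apply, smul_eq_mul]
  have hS0' := hS0.ne'
  have hQ0' := hQ0.ne'
  have hD' := hD.ne'
  have hK' := hK.ne'
  have hD4 : D ^ 4 = (S x * Q x) ^ 2 := by rw [← hDsq]; ring
  field_simp
  simp only [hDsq]
  ring

end Arccos

lemma hasFDerivAt_gramEntry {ι : Type*} [Fintype ι] (r : ι → ℝ) (i j : ι) (c : ℝ) :
    HasFDerivAt (fun r : ι → ℝ => gramEntry (r i) (r j) c)
      (r i • ContinuousLinearMap.proj (R := ℝ) (φ := fun _ : ι => ℝ) i +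
        r j • ContinuousLinearMap.proj (R := ℝ) (φ := fun _ : ι => ℝ) j) r := by
  unfold gramEntry
  have hi : HasFDerivAt (fun r : ι → ℝ => r i)
      (ContinuousLinearMap.proj (R := ℝ) (φ := fun _ : ι => ℝ) i) r := hasFDerivAt_apply i r
  have hj : HasFDerivAt (fun r : ι → ℝ => r j)
      (ContinuousLinearMap.proj (R := ℝ) (φ := fun _ : ι => ℝ) j) r := hasFDerivAt_apply j r
  have h := ((((hi.pow 2).fun_add (hj.pow 2)).sub_const (c ^ 2)).mul_const (1 / 2))
  simp only [mul_one_div] at h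
  refine h.congr_fderiv (ContinuousLinearMap.ext fun v => ?_)
  simp
  ring

namespace GeodesicTriangulation

variable {M : Type*} [MetricSpace M] {V : Finset M} (T : GeodesicTriangulation M V)

/-- The derivative of `edgeMinor` with respect to the radii. -/
noncomputable def edgeMinorDeriv (r : V → ℝ) (d : T.Face × Fin 3) : (V → ℝ) →L[ℝ] ℝ :=
  (2 * r (T.vertex d) * (r (T.vertex (nextSide d)) ^ 2 -
    gramEntry (r (T.vertex d)) (r (T.vertex (nextSide d))) (T.length d))) •
      ContinuousLinearMap.proj (T.vertex d) +
  (2 * r (T.vertex (nextSide d)) * (r (T.vertex d) ^ 2 -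
    gramEntry (r (T.vertex d)) (r (T.vertex (nextSide d))) (T.length d))) •
      ContinuousLinearMap.proj (T.vertex (nextSide d))

/-- The derivative of `cornerCofactor` with respect to the radii. -/
noncomputable def cornerCofactorDeriv (r : V → ℝ) (d : T.Face × Fin 3) : (V → ℝ) →L[ℝ] ℝ :=
  (r (T.vertex d) * (2 * gramEntry (r (T.vertex (nextSide d))) (r (T.vertex (prevSide d)))
      (T.length (nextSide d)) -
    gramEntry (r (T.vertex d)) (r (T.vertex (nextSide d))) (T.length d) -
    gramEntry (r (T.vertex (prevSide d))) (r (T.vertex d)) (T.length (prevSide d)))) •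
      ContinuousLinearMap.proj (T.vertex d) +
  (r (T.vertex (nextSide d)) * (r (T.vertex d) ^ 2 -
    gramEntry (r (T.vertex (prevSide d))) (r (T.vertex d)) (T.length (prevSide d)))) •
      ContinuousLinearMap.proj (T.vertex (nextSide d)) +
  (r (T.vertex (prevSide d)) * (r (T.vertex d) ^ 2 -
    gramEntry (r (T.vertex d)) (r (T.vertex (nextSide d))) (T.length d))) •
      ContinuousLinearMap.proj (T.vertex (prevSide d))

lemma hasFDerivAt_edgeMinor (r : V → ℝ) (d : T.Face × Fin 3) :
    HasFDerivAt (fun r => T.edgeMinor r d) (T.edgeMinorDeriv r d) r := by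
  unfold edgeMinor gramMinor
  have hi := hasFDerivAt_apply (𝕜 := ℝ) (F' := fun _ : V => ℝ) (T.vertex d) r
  have hj := hasFDerivAt_apply (𝕜 := ℝ) (F' := fun _ : V => ℝ) (T.vertex (nextSide d)) r
  refine (((hi.pow 2).fun_mul (hj.pow 2)).fun_sub
    ((hasFDerivAt_gramEntry r _ _ _).pow 2)).congr_fderiv (ContinuousLinearMap.ext fun v => ?_)
  simp [edgeMinorDeriv]
  ring

lemma hasFDerivAt_cornerCofactor (r : V → ℝ) (d : T.Face × Fin 3) :
    HasFDerivAt (fun r => T.cornerCofactor r d) (T.cornerCofactorDeriv r d) r := by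
  unfold cornerCofactor gramCofactor
  have hi := hasFDerivAt_apply (𝕜 := ℝ) (F' := fun _ : V => ℝ) (T.vertex d) r
  refine (((hasFDerivAt_gramEntry r _ _ _).fun_mul (hi.pow 2)).fun_sub
    ((hasFDerivAt_gramEntry r _ _ _).fun_mul (hasFDerivAt_gramEntry r _ _ _))).congr_fderiv
      (ContinuousLinearMap.ext fun v => ?_)
  simp [cornerCofactorDeriv]
  ring

lemma sideFootArea_eq (r : V → ℝ) (d : T.Face × Fin 3) : T.sideFootArea r d =
    T.edgeMinor r d - T.cornerCofactor r d - T.cornerCofactor r (nextSide d) := by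
  unfold sideFootArea footArea edgeMinor cornerCofactor
  rw [nextSide_nextSide, prevSide_nextSide]

lemma hasFDerivAt_sideFootArea (r : V → ℝ) (d : T.Face × Fin 3) :
    HasFDerivAt (fun r => T.sideFootArea r d) (T.edgeMinorDeriv r d - T.cornerCofactorDeriv r d -
      T.cornerCofactorDeriv r (nextSide d)) r := by
  simp_rw [sideFootArea_eq]
  exact ((T.hasFDerivAt_edgeMinor r d).fun_sub (T.hasFDerivAt_cornerCofactor r d)).fun_sub
    (T.hasFDerivAt_cornerCofactor r _)

/-- The pyramids persist under small changes of the radii. -/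
lemma eventually_heightSq_pos {r : V → ℝ} (hr : ∀ i, 0 < r i) (h : ∀ f, 0 < T.heightSq r f) :
    ∀ᶠ r' in nhds r, (∀ i, 0 < r' i) ∧ ∀ f, 0 < T.heightSq r' f := by
  have hc : ∀ f, Continuous fun r => T.heightSq r f := by
    intro f
    have e : (fun r => T.heightSq r f) =
        fun r => T.pyramidDet r (f, 0) / T.baseAreaSq (f, 0) := by
      funext r
      rw [T.pyramidDet_eq, mul_div_cancel_right₀ _ (T.baseAreaSq_pos _).ne']
    rw [e]
    refine Continuous.div_const ?_ _
    unfold pyramidDet gramDet gramEntry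
    fun_prop
  refine Filter.Eventually.and ?_ ?_
  · exact Filter.eventually_all.2 fun i =>
      (continuous_apply i).continuousAt.eventually_const_lt (hr i)
  · exact Filter.eventually_all.2 fun f => (hc f).continuousAt.eventually_const_lt (h f)

variable {r : V → ℝ}

lemma hasFDerivAt_radialDihedral (hr : ∀ i, 0 < r i) (h : ∀ f, 0 < T.heightSq r f)
    (d : T.Face × Fin 3) :
    HasFDerivAt (fun r => T.radialDihedral r d)
      (-(1 / (r (T.vertex d) * Real.sqrt (T.pyramidDet r d))) • (T.cornerCofactorDeriv r d -
        (T.cornerCofactor r d / 2) • ((1 / T.edgeMinor r d) • T.edgeMinorDeriv r d +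
          (1 / T.edgeMinor r (prevSide d)) • T.edgeMinorDeriv r (prevSide d)))) r := by
  have hW := T.pyramidDet_pos (d := d) (h _)
  have h1 := hasFDerivAt_arccos_div_sqrt (T.hasFDerivAt_cornerCofactor r d)
    (T.hasFDerivAt_edgeMinor r d) (T.hasFDerivAt_edgeMinor r (prevSide d))
    (T.edgeMinor_pos (h _)) (T.edgeMinor_pos (h _))
    (mul_pos (hr (T.vertex d)) (Real.sqrt_pos.2 hW))
    (by rw [mul_pow, Real.sq_sqrt hW.le, edgeMinor_mul_sub_sq])
  refine h1.congr_of_eventuallyEq ?_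
  filter_upwards [T.eventually_heightSq_pos hr h] with r' hr'
  exact T.radialDihedral_eq hr'.1 (hr'.2 _)

lemma hasFDerivAt_baseDihedral (hr : ∀ i, 0 < r i) (h : ∀ f, 0 < T.heightSq r f)
    (d : T.Face × Fin 3) :
    HasFDerivAt (fun r => T.baseDihedral r d)
      (-(1 / (T.length d * Real.sqrt (T.pyramidDet r d))) • (T.edgeMinorDeriv r d -
        T.cornerCofactorDeriv r d - T.cornerCofactorDeriv r (nextSide d) -
        (T.sideFootArea r d / 2) • ((1 / T.edgeMinor r d) • T.edgeMinorDeriv r d))) r := by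
  have hW := T.pyramidDet_pos (d := d) (h _)
  have h0 : T.baseAreaSq d * T.edgeMinor r d - T.sideFootArea r d ^ 2 =
    T.length d ^ 2 * T.pyramidDet r d := areaSq_mul_sub_sq _ _ _ _ _ _
  have h1 := hasFDerivAt_arccos_div_sqrt (T.hasFDerivAt_sideFootArea r d)
    (T.hasFDerivAt_edgeMinor r d) (hasFDerivAt_const (T.baseAreaSq d) r)
    (T.edgeMinor_pos (h _)) (T.baseAreaSq_pos _)
    (mul_pos (T.length_pos d) (Real.sqrt_pos.2 hW))
    (by rw [mul_pow, Real.sq_sqrt hW.le, ← h0]; ring)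
  rw [smul_zero, add_zero] at h1
  refine h1.congr_of_eventuallyEq ?_
  filter_upwards [T.eventually_heightSq_pos hr h] with r' hr'
  exact T.baseDihedral_eq hr'.1 (hr'.2 _)

/-! ### Derivatives for a fixed triangulation -/

section Polyhedron

variable {φ : T.Face × Fin 3 → ℝ}

lemma hasFDerivAt_edgeAltitude (h : V → ℝ) (d : T.Face × Fin 3) :
    ∃ L : (V → ℝ) →L[ℝ] ℝ, (∀ v, L v = T.edgeAltitude φ v d) ∧
      HasFDerivAt (fun h => T.edgeAltitude φ h d) L h := by
  let L : (V → ℝ) →ₗ[ℝ] ℝ :=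
    { toFun := fun v => T.edgeAltitude φ v d
      map_add' := fun u v => T.edgeAltitude_add φ u v d
      map_smul' := fun c v => T.edgeAltitude_smul φ c v d }
  exact ⟨LinearMap.toContinuousLinearMap L, fun v => rfl,
    (LinearMap.toContinuousLinearMap L).hasFDerivAt⟩

lemma hasFDerivAt_dualLength (h : V → ℝ) (d : T.Face × Fin 3) :
    ∃ L : (V → ℝ) →L[ℝ] ℝ, (∀ v, L v = T.dualLength φ v d) ∧
      HasFDerivAt (fun h => T.dualLength φ h d) L h := by
  let L : (V → ℝ) →ₗ[ℝ] ℝ :=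
    { toFun := fun v => T.dualLength φ v d
      map_add' := fun u v => by
        simp only [Triangulation.dualLength, Triangulation.leftAltitude,
          Triangulation.rightAltitude, Triangulation.edgeAltitude, Triangulation.edgeAltitudeRev,
          Pi.add_apply]
        ring
      map_smul' := fun c v => by
        simp only [Triangulation.dualLength, Triangulation.leftAltitude,
          Triangulation.rightAltitude, Triangulation.edgeAltitude, Triangulation.edgeAltitudeRev,
          Pi.smul_apply, smul_eq_mul, RingHom.id_apply]
        ring }
  exact ⟨LinearMap.toContinuousLinearMap L, fun v => rfl,
    (LinearMap.toContinuousLinearMap L).hasFDerivAt⟩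

lemma hasJacobianWithinAt_faceArea (hφ : ∀ d, φ (T.glue d) = φ d) (h : V → ℝ) :
    HasJacobianWithinAt (T.faceArea φ) (T.areaJacobian φ h) Set.univ h := by
  classical
  unfold HasJacobianWithinAt
  rw [hasFDerivWithinAt_univ, hasFDerivAt_pi']
  intro i
  choose Le hLe hde using fun d => T.hasFDerivAt_edgeAltitude (φ := φ) h d
  choose Ll hLl hdl using fun d => T.hasFDerivAt_dualLength (φ := φ) h d
  have h1 := (HasFDerivAt.fun_sum (u := Finset.univ.filter fun d => T.vertex d = i)
    fun d _ => (hde d).fun_mul (hdl d)).const_mul (1 / 2)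
  have h2 : (fun h => T.faceArea φ h i) = fun h => 1 / 2 * ∑ d with T.vertex d = i,
      T.edgeAltitude φ h d * T.dualLength φ h d := by
    funext h
    rw [Triangulation.faceArea]
    congr
  rw [h2]
  refine h1.congr_fderiv (ContinuousLinearMap.ext fun v => ?_)
  have h3 : (T.areaJacobian φ h).mulVec v i =
      1 / 2 * ((T.areaJacobian φ h).mulVec v i + (T.areaJacobian φ v).mulVec h i) := by
    rw [T.areaJacobian_mulVec_comm hφ v h]; ring
  change _ = (T.areaJacobian φ h).mulVec v i
  rw [h3, T.areaJacobian_mulVec, T.areaJacobian_mulVec, ← Finset.sum_add_distrib,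
    smul_apply, smul_eq_mul, sum_apply, Finset.sum_filter]
  congr 1
  refine Finset.sum_congr rfl fun d _ => ?_
  split_ifs
  · rw [add_apply, smul_apply, smul_apply, smul_eq_mul, smul_eq_mul, hLe, hLl]; ring
  · rw [add_zero]

/-- The gradient of the volume of a polyhedron consists of the areas of its faces. -/
lemma hasFDerivAt_vol (hφ : ∀ d, φ (T.glue d) = φ d) (hs : ∀ d, 0 < Real.sin (φ d))
    (hG : ∀ d, 0 < T.fanDet φ d) (h : V → ℝ) :
    HasFDerivAt (T.vol φ) (∑ i, T.faceArea φ h i •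
      (ContinuousLinearMap.proj i : (V → ℝ) →L[ℝ] ℝ)) h := by
  have hF := T.hasJacobianWithinAt_faceArea hφ h
  unfold HasJacobianWithinAt at hF
  rw [hasFDerivWithinAt_univ, hasFDerivAt_pi'] at hF
  have h1 := (HasFDerivAt.fun_sum (u := Finset.univ) fun i (_ : i ∈ Finset.univ) =>
    (hasFDerivAt_apply (𝕜 := ℝ) (F' := fun _ : V => ℝ) i h).fun_mul (hF i)).const_mul (1 / 3)
  refine h1.congr_fderiv (ContinuousLinearMap.ext fun v => ?_)
  have h2 : (1 / 3 : ℝ) * ∑ i, (h i * (T.areaJacobian φ h).mulVec v i + T.faceArea φ h i * v i) =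
      ∑ i, T.faceArea φ h i * v i := by
    rw [Finset.sum_add_distrib, T.sum_mul_areaJacobian_mulVec_comm hφ hs hG h h v]
    have h3 : ∑ i, v i * (T.areaJacobian φ h).mulVec h i = 2 * ∑ i, T.faceArea φ h i * v i := by
      rw [Finset.mul_sum]
      refine Finset.sum_congr rfl fun i _ => ?_
      rw [T.faceArea_eq]; ring
    rw [h3]; ring
  simpa [sum_apply] using h2

lemma hasHessianWithinAt_vol (hφ : ∀ d, φ (T.glue d) = φ d) (hs : ∀ d, 0 < Real.sin (φ d))
    (hG : ∀ d, 0 < T.fanDet φ d) (h : V → ℝ) :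
    HasHessianWithinAt (T.vol φ) (T.areaJacobian φ h) Set.univ h :=
  ⟨T.faceArea φ, fun y _ => (T.hasFDerivAt_vol hφ hs hG y).hasFDerivWithinAt,
    T.hasJacobianWithinAt_faceArea hφ h⟩

end Polyhedron

variable {r : V → ℝ}

/-- The derivative of a dihedral angle at a side edge of a pyramid, in terms of the dual
polyhedron. -/
lemma radialDihedral_deriv_apply (hr : ∀ i, 0 < r i) (h : ∀ f, 0 < T.heightSq r f)
    (d : T.Face × Fin 3) (v : V → ℝ) :
    1 / (r (T.vertex d) * Real.sqrt (T.pyramidDet r d)) * (T.cornerCofactorDeriv r d v -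
        (T.cornerCofactor r d / 2) * ((1 / T.edgeMinor r d) * T.edgeMinorDeriv r d v +
          (1 / T.edgeMinor r (prevSide d)) * T.edgeMinorDeriv r (prevSide d) v)) =
      T.leftAltitude (T.apexAngle r) (fun i => 1 / r i) d * T.edgeAltitude (T.apexAngle r) v d +
      T.leftAltitude (T.apexAngle r) (fun i => 1 / r i) (prevSide d) *
        T.edgeAltitudeRev (T.apexAngle r) v (prevSide d) := by
  have hx := hr (T.vertex d)
  have hy := hr (T.vertex (nextSide d))
  have hz := hr (T.vertex (prevSide d))
  have hW := Real.sqrt_pos.2 (T.pyramidDet_pos (d := d) (h _))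
  have hS := T.edgeMinor_pos (d := d) (h _)
  have hS' := T.edgeMinor_pos (d := prevSide d) (h _)
  have hSs := Real.sqrt_pos.2 hS
  have hSs' := Real.sqrt_pos.2 hS'
  rw [T.leftAltitude_apexAngle hr h, T.leftAltitude_apexAngle hr h, T.pyramidDet_prevSide]
  unfold Triangulation.edgeAltitude Triangulation.edgeAltitudeRev
  rw [T.cos_apexAngle hr h, T.cos_apexAngle hr h, T.sin_apexAngle hr, T.sin_apexAngle hr,
    nextSide_prevSide]
  have e1 : T.sideFootArea r d /
      (Real.sqrt (T.pyramidDet r d) * Real.sqrt (T.edgeMinor r d)) *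
      ((v (T.vertex (nextSide d)) - v (T.vertex d) *
        (gramEntry (r (T.vertex d)) (r (T.vertex (nextSide d))) (T.length d) /
          (r (T.vertex d) * r (T.vertex (nextSide d))))) /
        (Real.sqrt (T.edgeMinor r d) / (r (T.vertex d) * r (T.vertex (nextSide d))))) =
      T.sideFootArea r d / (Real.sqrt (T.pyramidDet r d) * T.edgeMinor r d) *
        (r (T.vertex d) * r (T.vertex (nextSide d)) * v (T.vertex (nextSide d)) -
          v (T.vertex d) *
            gramEntry (r (T.vertex d)) (r (T.vertex (nextSide d))) (T.length d)) := by
    rw [← Real.sq_sqrt hS.le, Real.sqrt_sq hSs.le]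
    field_simp
  have e2 : T.sideFootArea r (prevSide d) /
      (Real.sqrt (T.pyramidDet r d) * Real.sqrt (T.edgeMinor r (prevSide d))) *
      ((v (T.vertex (prevSide d)) - v (T.vertex d) *
        (gramEntry (r (T.vertex (prevSide d))) (r (T.vertex d)) (T.length (prevSide d)) /
          (r (T.vertex (prevSide d)) * r (T.vertex d)))) /
        (Real.sqrt (T.edgeMinor r (prevSide d)) / (r (T.vertex (prevSide d)) * r (T.vertex d)))) =
      T.sideFootArea r (prevSide d) /
        (Real.sqrt (T.pyramidDet r d) * T.edgeMinor r (prevSide d)) *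
        (r (T.vertex d) * r (T.vertex (prevSide d)) * v (T.vertex (prevSide d)) -
          v (T.vertex d) *
            gramEntry (r (T.vertex (prevSide d))) (r (T.vertex d)) (T.length (prevSide d))) := by
    rw [← Real.sq_sqrt hS'.le, Real.sqrt_sq hSs'.le]
    field_simp
  rw [e1, e2]
  simp only [edgeMinorDeriv, cornerCofactorDeriv, add_apply, smul_apply, smul_eq_mul,
    ContinuousLinearMap.proj_apply, nextSide_prevSide]
  field_simp
  unfold sideFootArea footArea cornerCofactor edgeMinor gramCofactor gramMinor
  rw [prevSide_prevSide, nextSide_prevSide]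
  generalize gramEntry (r (T.vertex d)) (r (T.vertex (nextSide d))) (T.length d) = g₁
  generalize gramEntry (r (T.vertex (nextSide d))) (r (T.vertex (prevSide d)))
    (T.length (nextSide d)) = g₂
  generalize gramEntry (r (T.vertex (prevSide d))) (r (T.vertex d)) (T.length (prevSide d)) = g₃
  ring

end GeodesicTriangulation
namespace GeodesicTriangulation

variable {M : Type*} [MetricSpace M] {V : Finset M} (T : GeodesicTriangulation M V) {r : V → ℝ}

/-- The derivative of the curvatures of a polytope is the derivative of the areas of the faces of
the dual polyhedron. -/
lemma hasFDerivAt_curvature (hr : ∀ i, 0 < r i) (h : ∀ f, 0 < T.heightSq r f) :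
    HasFDerivAt (fun r => T.curvature r) (LinearMap.toContinuousLinearMap
      (T.areaJacobian (T.apexAngle r) (fun i => 1 / r i)).mulVecLin) r := by
  classical
  rw [hasFDerivAt_pi']
  intro i
  have h1 := (HasFDerivAt.fun_sum (u := Finset.univ.filter fun d => T.vertex d = i)
    fun d _ => T.hasFDerivAt_radialDihedral hr h d).const_sub (2 * Real.pi)
  have h2 : (fun r => T.curvature r i) = fun r => 2 * Real.pi - ∑ d with T.vertex d = i,
      T.radialDihedral r d := by
    funext r
    rw [curvature]
  rw [h2]
  refine h1.congr_fderiv (ContinuousLinearMap.ext fun v => ?_)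
  change _ = (T.areaJacobian (T.apexAngle r) (fun i => 1 / r i)).mulVec v i
  have h3 : ∀ d, (if T.vertex d = i then T.dualLength (T.apexAngle r) (fun i => 1 / r i) d *
        T.edgeAltitude (T.apexAngle r) v d else 0) =
      (if T.vertex d = i then T.leftAltitude (T.apexAngle r) (fun i => 1 / r i) d *
        T.edgeAltitude (T.apexAngle r) v d else 0) +
      (if T.vertex d = i then T.leftAltitude (T.apexAngle r) (fun i => 1 / r i) (T.glue d) *
        T.edgeAltitude (T.apexAngle r) v d else 0) := by
    intro d
    rw [← T.rightAltitude_eq (fun i => 1 / r i) (T.apexAngle_glue r) (T.sin_apexAngle_pos hr h)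
      (T.fanDet_apexAngle_pos hr h _), Triangulation.dualLength]
    split_ifs <;> ring
  rw [T.areaJacobian_mulVec, Finset.sum_congr rfl fun d _ => h3 d, Finset.sum_add_distrib,
    ← Equiv.sum_comp (T.glue * prevPerm T.Face) (fun d => if T.vertex d = i then
        T.leftAltitude (T.apexAngle r) (fun i => 1 / r i) (T.glue d) *
        T.edgeAltitude (T.apexAngle r) v d else 0), ← Finset.sum_add_distrib,
    neg_apply, sum_apply, ← Finset.sum_neg_distrib, Finset.sum_filter]
  refine Finset.sum_congr rfl fun d _ => ?_
  have e2 : (T.glue * prevPerm T.Face) d = T.glue (prevSide d) := rfl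
  rw [e2, T.vertex_glue, nextSide_prevSide, T.glue_glue, T.edgeAltitude_glue (T.apexAngle_glue r)]
  split_ifs
  · rw [← T.radialDihedral_deriv_apply hr h d v]
    simp only [smul_apply, sub_apply, add_apply, smul_eq_mul, neg_mul, neg_neg]
  · rw [add_zero]

/-- Schläfli's formula for the pyramids of a polytope. -/
lemma schlafli_formula (hr : ∀ i, 0 < r i) (h : ∀ f, 0 < T.heightSq r f) (v : V → ℝ) :
    ∑ d, r (T.vertex d) * (1 / (r (T.vertex d) * Real.sqrt (T.pyramidDet r d)) *
      (T.cornerCofactorDeriv r d v -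
        (T.cornerCofactor r d / 2) * ((1 / T.edgeMinor r d) * T.edgeMinorDeriv r d v +
          (1 / T.edgeMinor r (prevSide d)) * T.edgeMinorDeriv r (prevSide d) v))) +
    ∑ d, T.length d * (1 / (T.length d * Real.sqrt (T.pyramidDet r d)) *
      (T.edgeMinorDeriv r d v - T.cornerCofactorDeriv r d v -
        T.cornerCofactorDeriv r (nextSide d) v -
        (T.sideFootArea r d / 2) * ((1 / T.edgeMinor r d) * T.edgeMinorDeriv r d v))) = 0 := by
  have hshift : ∀ F : T.Face × Fin 3 → ℝ, ∑ d, F (prevSide d) = ∑ d, F d := fun F =>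
    Equiv.sum_comp (prevPerm T.Face) F
  -- The derivative of the total area of the base vanishes.
  have hbase : ∀ d, (1 / 2 * T.edgeMinorDeriv r d v - T.cornerCofactorDeriv r d v) +
      (1 / 2 * T.edgeMinorDeriv r (prevSide d) v - T.cornerCofactorDeriv r (prevSide d) v) +
      (1 / 2 * T.edgeMinorDeriv r (nextSide d) v - T.cornerCofactorDeriv r (nextSide d) v) = 0 := by
    intro d
    simp only [edgeMinorDeriv, cornerCofactorDeriv, add_apply, smul_apply, smul_eq_mul,
      ContinuousLinearMap.proj_apply, nextSide_prevSide, prevSide_nextSide, nextSide_nextSide,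
      prevSide_prevSide]
    ring
  have e1 : ∀ d, r (T.vertex d) * (1 / (r (T.vertex d) * Real.sqrt (T.pyramidDet r d)) *
      (T.cornerCofactorDeriv r d v -
        (T.cornerCofactor r d / 2) * ((1 / T.edgeMinor r d) * T.edgeMinorDeriv r d v +
          (1 / T.edgeMinor r (prevSide d)) * T.edgeMinorDeriv r (prevSide d) v))) =
      1 / Real.sqrt (T.pyramidDet r d) * (T.cornerCofactorDeriv r d v -
        (T.cornerCofactor r d / 2) * ((1 / T.edgeMinor r d) * T.edgeMinorDeriv r d v)) -
      1 / Real.sqrt (T.pyramidDet r (prevSide d)) *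
        (T.cornerCofactor r (nextSide (prevSide d)) / 2 *
          ((1 / T.edgeMinor r (prevSide d)) * T.edgeMinorDeriv r (prevSide d) v)) := by
    intro d
    rw [nextSide_prevSide, T.pyramidDet_prevSide]
    have := (hr (T.vertex d)).ne'
    have := (Real.sqrt_pos.2 (T.pyramidDet_pos (d := d) (h _))).ne'
    have := (T.edgeMinor_pos (d := d) (h _)).ne'
    have := (T.edgeMinor_pos (d := prevSide d) (h _)).ne'
    field_simp
    ring
  have e2 : ∀ d, T.length d * (1 / (T.length d * Real.sqrt (T.pyramidDet r d)) *
      (T.edgeMinorDeriv r d v - T.cornerCofactorDeriv r d v -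
        T.cornerCofactorDeriv r (nextSide d) v -
        (T.sideFootArea r d / 2) * ((1 / T.edgeMinor r d) * T.edgeMinorDeriv r d v))) =
      1 / Real.sqrt (T.pyramidDet r d) * (1 / 2 * T.edgeMinorDeriv r d v -
        T.cornerCofactorDeriv r d v) -
      1 / Real.sqrt (T.pyramidDet r d) * T.cornerCofactorDeriv r (nextSide d) v +
      1 / Real.sqrt (T.pyramidDet r d) * ((T.cornerCofactor r d +
        T.cornerCofactor r (nextSide d)) / 2 *
          ((1 / T.edgeMinor r d) * T.edgeMinorDeriv r d v)) := by
    intro d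
    rw [T.sideFootArea_eq]
    have := (T.length_pos d).ne'
    have := (Real.sqrt_pos.2 (T.pyramidDet_pos (d := d) (h _))).ne'
    have := (T.edgeMinor_pos (d := d) (h _)).ne'
    field_simp
    ring
  have e3 := hshift fun d => 1 / Real.sqrt (T.pyramidDet r d) *
    (T.cornerCofactor r (nextSide d) / 2 *
          ((1 / T.edgeMinor r d) * T.edgeMinorDeriv r d v))
  have e4 := hshift fun d => 1 / Real.sqrt (T.pyramidDet r d) *
    T.cornerCofactorDeriv r (nextSide d) v
  have e5 := hshift fun d => 1 / Real.sqrt (T.pyramidDet r d) *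
    (1 / 2 * T.edgeMinorDeriv r d v - T.cornerCofactorDeriv r d v)
  have e6 := hshift fun d => 1 / Real.sqrt (T.pyramidDet r (nextSide d)) *
    (1 / 2 * T.edgeMinorDeriv r (nextSide d) v - T.cornerCofactorDeriv r (nextSide d) v)
  have e7 : ∑ d, 1 / Real.sqrt (T.pyramidDet r d) *
      (1 / 2 * T.edgeMinorDeriv r d v - T.cornerCofactorDeriv r d v) = 0 := by
    have : 3 * ∑ d, 1 / Real.sqrt (T.pyramidDet r d) *
        (1 / 2 * T.edgeMinorDeriv r d v - T.cornerCofactorDeriv r d v) =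
        ∑ d, (1 / Real.sqrt (T.pyramidDet r d) *
          (1 / 2 * T.edgeMinorDeriv r d v - T.cornerCofactorDeriv r d v) +
        1 / Real.sqrt (T.pyramidDet r (prevSide d)) *
          (1 / 2 * T.edgeMinorDeriv r (prevSide d) v - T.cornerCofactorDeriv r (prevSide d) v) +
        1 / Real.sqrt (T.pyramidDet r (nextSide d)) *
          (1 / 2 * T.edgeMinorDeriv r (nextSide d) v - T.cornerCofactorDeriv r (nextSide d) v)) := by
      rw [Finset.sum_add_distrib, Finset.sum_add_distrib, e5, ← e6]
      simp only [nextSide_prevSide]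
      ring
    have h0 : ∑ d, (1 / Real.sqrt (T.pyramidDet r d) *
          (1 / 2 * T.edgeMinorDeriv r d v - T.cornerCofactorDeriv r d v) +
        1 / Real.sqrt (T.pyramidDet r (prevSide d)) *
          (1 / 2 * T.edgeMinorDeriv r (prevSide d) v - T.cornerCofactorDeriv r (prevSide d) v) +
        1 / Real.sqrt (T.pyramidDet r (nextSide d)) *
          (1 / 2 * T.edgeMinorDeriv r (nextSide d) v - T.cornerCofactorDeriv r (nextSide d) v)) =
        0 := by
      refine Finset.sum_eq_zero fun d _ => ?_
      rw [T.pyramidDet_prevSide, T.pyramidDet_nextSide, ← mul_add, ← mul_add, hbase, mul_zero]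
    linarith
  rw [Finset.sum_congr rfl fun d _ => e1 d, Finset.sum_congr rfl fun d _ => e2 d]
  rw [Finset.sum_sub_distrib, e3, Finset.sum_add_distrib, Finset.sum_sub_distrib, e7, ← e4]
  simp only [nextSide_prevSide, T.pyramidDet_prevSide]
  rw [zero_sub, ← Finset.sum_sub_distrib, ← Finset.sum_neg_distrib, ← Finset.sum_add_distrib,
    ← Finset.sum_add_distrib]
  refine Finset.sum_eq_zero fun d _ => ?_
  ring

lemma totalScalarCurvature_eq (r : V → ℝ) : T.totalScalarCurvature r =
    ∑ i, r i * T.curvature r i + ∑ d, T.length d * (Real.pi / 2 - T.baseDihedral r d) := by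
  unfold totalScalarCurvature boundaryDihedral
  congr 1
  have h1 : ∑ d, T.length d * (Real.pi - (T.baseDihedral r d + T.baseDihedral r (T.glue d))) =
      ∑ d, T.length d * (Real.pi / 2 - T.baseDihedral r d) +
        ∑ d, T.length (T.glue d) * (Real.pi / 2 - T.baseDihedral r (T.glue d)) := by
    rw [← Finset.sum_add_distrib]
    refine Finset.sum_congr rfl fun d _ => ?_
    rw [T.length_glue]; ring
  rw [h1, Equiv.sum_comp T.glue fun d => T.length d * (Real.pi / 2 - T.baseDihedral r d)]
  ring

/-- The gradient of the total scalar curvature consists of the curvatures. -/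
lemma hasFDerivAt_totalScalarCurvature (hr : ∀ i, 0 < r i) (h : ∀ f, 0 < T.heightSq r f) :
    HasFDerivAt T.totalScalarCurvature (∑ i, T.curvature r i •
      (ContinuousLinearMap.proj i : (V → ℝ) →L[ℝ] ℝ)) r := by
  classical
  simp_rw [funext T.totalScalarCurvature_eq]
  have h0 : ∀ u r : V → ℝ, ∑ i, u i * T.curvature r i =
      2 * Real.pi * ∑ i, u i - ∑ d, u (T.vertex d) * T.radialDihedral r d := by
    intro u r
    have : ∑ d, u (T.vertex d) * T.radialDihedral r d =
        ∑ i, u i * ∑ d with T.vertex d = i, T.radialDihedral r d := by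
      simp_rw [Finset.mul_sum, Finset.sum_filter]
      rw [Finset.sum_comm]
      refine Finset.sum_congr rfl fun d _ => ?_
      rw [Finset.sum_ite_eq]
      simp
    rw [this, Finset.mul_sum, ← Finset.sum_sub_distrib]
    refine Finset.sum_congr rfl fun i _ => ?_
    rw [curvature, mul_sub, mul_comm]
  simp_rw [h0]
  have hproj := fun i : V => hasFDerivAt_apply (𝕜 := ℝ) (F' := fun _ : V => ℝ) i r
  have h1 := ((HasFDerivAt.fun_sum (u := Finset.univ) fun i (_ : i ∈ Finset.univ) =>
    hproj i).const_mul (2 * Real.pi)).fun_sub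
      (HasFDerivAt.fun_sum (u := Finset.univ) fun d (_ : d ∈ Finset.univ) =>
        (hproj (T.vertex d)).fun_mul (T.hasFDerivAt_radialDihedral hr h d))
  have h2 := HasFDerivAt.fun_sum (u := Finset.univ) fun d (_ : d ∈ Finset.univ) =>
    ((T.hasFDerivAt_baseDihedral hr h d).const_sub (Real.pi / 2)).const_mul (T.length d)
  refine (h1.fun_add h2).congr_fderiv (ContinuousLinearMap.ext fun v => ?_)
  have h3 := T.schlafli_formula hr h v
  simp only [add_apply, sub_apply, sum_apply, smul_apply, smul_eq_mul, neg_mul, neg_apply,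
    ContinuousLinearMap.proj_apply, neg_neg]
  rw [Finset.sum_congr rfl fun i _ => mul_comm (T.curvature r i) (v i), h0,
    Finset.sum_add_distrib, Finset.sum_congr rfl fun d _ => mul_comm (T.radialDihedral r d) _]
  simp only [mul_neg, Finset.sum_neg_distrib]
  linarith

end GeodesicTriangulation
namespace GeodesicTriangulation

variable {M : Type*} [MetricSpace M] {V : Finset M} (T : GeodesicTriangulation M V) {r : V → ℝ}

/-! ### Derivatives along the space of polytopes -/

variable {T} in
lemma IsConvexPolytope.power_eq {T' : GeodesicTriangulation M V} (h : T.IsConvexPolytope r)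
    (h' : T'.IsConvexPolytope r) : T'.power r = T.power r :=
  T.power_eq_power_of_mem_closure (T.isConvexPolytope_iff.1 h).2.2 T'
    (subset_closure (T'.isConvexPolytope_iff.1 h').2.2)

variable {T} in
lemma IsConvexPolytope.curvature_eq (h : T.IsConvexPolytope r) :
    GenPolytope.curvature M V r = T.curvature r := by
  have hr : r ∈ polytopeSpace M V := ⟨T, h⟩
  obtain ⟨h1, h2, -⟩ := T.isConvexPolytope_iff.1 h
  rw [← T.curvature_eq_of_power_eq h1 h2 (h.power_eq (Classical.choose_spec hr))]
  funext i
  rw [GenPolytope.curvature, dif_pos hr]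

variable {T} in
lemma IsConvexPolytope.totalScalarCurvature_eq (h : T.IsConvexPolytope r) :
    GenPolytope.totalScalarCurvature M V r = T.totalScalarCurvature r := by
  have hr : r ∈ polytopeSpace M V := ⟨T, h⟩
  have hc := Classical.choose_spec hr
  obtain ⟨h1, h2, h3⟩ := T.isConvexPolytope_iff.1 h
  rw [GenPolytope.totalScalarCurvature, dif_pos hr]
  exact T.totalScalarCurvature_eq_of_power_eq h1 h2 h3
    ((isConvexPolytope_iff _).1 hc).2.2 (h.power_eq hc)

lemma continuous_footDist (d : T.Face × Fin 3) : Continuous fun r => T.footDist r d := by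
  have e : (fun r => T.footDist r d) =
      fun r => T.sideFootArea r d / (Real.sqrt (T.baseAreaSq d) * T.length d) := by
    funext r
    rw [(T.pyramid_formulas r d).2.1, mul_assoc, mul_div_cancel_right₀]
    exact (mul_pos (Real.sqrt_pos.2 (T.baseAreaSq_pos d)) (T.length_pos d)).ne'
  rw [e]
  refine Continuous.div_const ?_ _
  unfold sideFootArea footArea gramMinor gramCofactor gramEntry
  fun_prop

/-- Within the space of polytopes, the set that belongs to a triangulation is closed. -/
lemma IsConvexPolytope.of_mem_closure {T T' : GeodesicTriangulation M V}
    (h : T.IsConvexPolytope r) (h' : r ∈ closure {r' | T'.IsConvexPolytope r'}) :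
    T'.IsConvexPolytope r := by
  obtain ⟨h1, h2, h3⟩ := T.isConvexPolytope_iff.1 h
  have hsub : {r' | T'.IsConvexPolytope r'} ⊆ {r' | T'.PowerConcave r'} :=
    fun r' hr' => (T'.isConvexPolytope_iff.1 hr').2.2
  have hcl := closure_mono hsub h'
  have hclosed : IsClosed {r' | T'.PowerConcave r'} := by
    have : {r' | T'.PowerConcave r'} =
        ⋂ d, {r' : V → ℝ | 0 ≤ T'.footDist r' d + T'.footDist r' (T'.glue d)} := by
      ext r'; simp only [PowerConcave, Set.mem_iInter, Set.mem_ofPred_eq]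
    rw [this]
    exact isClosed_iInter fun d => isClosed_le continuous_const
      ((T'.continuous_footDist d).add (T'.continuous_footDist _))
  have hp := T.power_eq_power_of_mem_closure h3 T' hcl
  rw [hclosed.closure_eq] at hcl
  exact T'.isConvexPolytope_iff.2 ⟨h1, T.heightSq_pos_of_power_eq hp h2, hcl⟩

lemma length_le_of_hasPyramids (h : T.HasPyramids r) (d : T.Face × Fin 3) :
    T.length d ≤ r (T.vertex d) + r (T.vertex (nextSide d)) := by
  obtain ⟨a, P, -, h1, h2⟩ := h d.1
  have h3 := h1 d.2
  have h4 := h2 d.2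
  have h5 := h2 (d.2 + 1)
  change _ = T.length d at h3
  change _ = r (T.vertex d) at h4
  change _ = r (T.vertex (nextSide d)) at h5
  rw [← h3, ← h4, ← h5]
  exact dist_triangle_left _ _ _

/-- Near a given polytope, finitely many triangulations suffice. -/
lemma exists_finite_cover (T : GeodesicTriangulation M V) (r : V → ℝ) :
    ∃ (ι : Type) (_ : Finite ι) (S : ι → GeodesicTriangulation M V),
      ∀ᶠ r' in nhds r, r' ∈ polytopeSpace M V → ∃ i, (S i).IsConvexPolytope r' := by
  obtain ⟨ι, hι, S, hS⟩ := T.exists_finite_shapes (2 * (‖r‖ + 1))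
  refine ⟨ι, hι, S, ?_⟩
  filter_upwards [Metric.ball_mem_nhds r one_pos] with r' hr' ⟨T', hT'⟩
  have hb : ∀ i, r' i ≤ ‖r‖ + 1 := by
    intro i
    have h1 : ‖r' - r‖ < 1 := by rwa [← dist_eq_norm]
    have h2 := norm_add_le (r' - r) r
    rw [sub_add_cancel] at h2
    have h3 := (le_abs_self _).trans (norm_le_pi_norm r' i)
    linarith
  obtain ⟨i, hi⟩ := hS T' fun d => by
    have := T'.length_le_of_hasPyramids hT'.2.1 d
    have := hb (T'.vertex d)
    have := hb (T'.vertex (nextSide d))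
    linarith
  exact ⟨i, hi.isConvexPolytope hT'⟩

/-- A function on the space of polytopes is differentiable if all triangulations that belong to a
given polytope define the same derivative there. -/
lemma IsConvexPolytope.hasFDerivWithinAt {T : GeodesicTriangulation M V}
    (hr : T.IsConvexPolytope r) {E : Type*} [NormedAddCommGroup E] [NormedSpace ℝ E]
    {F : (V → ℝ) → E} {G : GeodesicTriangulation M V → (V → ℝ) → E} {L : (V → ℝ) →L[ℝ] E}
    (hF : ∀ (T' : GeodesicTriangulation M V) y, T'.IsConvexPolytope y → F y = G T' y)
    (hG : ∀ T' : GeodesicTriangulation M V, T'.IsConvexPolytope r → HasFDerivAt (G T') L r) :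
    HasFDerivWithinAt F L (polytopeSpace M V) r := by
  classical
  -- A piece whose closure does not contain the point imposes no condition on the derivative; the
  -- other pieces contain the point.
  obtain ⟨ι, hι, S, hS⟩ := T.exists_finite_cover r
  have hpiece : ∀ i, HasFDerivWithinAt F L {r' | (S i).IsConvexPolytope r'} r := by
    intro i
    by_cases hi : r ∈ closure {r' | (S i).IsConvexPolytope r'}
    · have hc := hr.of_mem_closure hi
      exact (hG (S i) hc).hasFDerivWithinAt.congr (fun y hy => hF (S i) y hy) (hF (S i) r hc)
    · exact HasFDerivWithinAt.of_notMem_closure hi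
  have := Fintype.ofFinite ι
  have hunion : ∀ s : Finset ι,
      HasFDerivWithinAt F L (⋃ i ∈ s, {r' | (S i).IsConvexPolytope r'}) r := by
    intro s
    induction s using Finset.induction_on with
    | empty =>
      refine HasFDerivWithinAt.of_notMem_closure ?_
      simp
    | insert i s _ ih =>
      rw [Finset.set_biUnion_insert]
      exact (hpiece i).union ih
  refine (hunion Finset.univ).mono_of_mem_nhdsWithin ?_
  rw [mem_nhdsWithin_iff_eventually]
  filter_upwards [hS] with r' h1 h2
  obtain ⟨i, hi⟩ := h1 h2
  exact Set.mem_biUnion (Finset.mem_univ i) hi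

variable {T} in
lemma IsConvexPolytope.hasJacobianWithinAt_curvature (h : T.IsConvexPolytope r) :
    HasJacobianWithinAt (GenPolytope.curvature M V)
      (T.areaJacobian (T.apexAngle r) (fun i => 1 / r i)) (polytopeSpace M V) r := by
  obtain ⟨h1, h2, h3⟩ := T.isConvexPolytope_iff.1 h
  refine h.hasFDerivWithinAt (G := fun T' => T'.curvature) (fun T' y hy => hy.curvature_eq)
    fun T' hT' => ?_
  obtain ⟨-, h5, h6⟩ := T'.isConvexPolytope_iff.1 hT'
  rw [← T.areaJacobian_eq_of_power_eq h1 h2 h3 h6 (h.power_eq hT')]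
  exact T'.hasFDerivAt_curvature h1 h5

variable {T} in
lemma IsConvexPolytope.hasFDerivWithinAt_totalScalarCurvature (h : T.IsConvexPolytope r) :
    HasFDerivWithinAt (GenPolytope.totalScalarCurvature M V)
      (∑ i, GenPolytope.curvature M V r i • (ContinuousLinearMap.proj i : (V → ℝ) →L[ℝ] ℝ))
      (polytopeSpace M V) r := by
  refine h.hasFDerivWithinAt (G := fun T' => T'.totalScalarCurvature)
    (fun T' y hy => hy.totalScalarCurvature_eq) fun T' hT' => ?_
  rw [hT'.curvature_eq]
  obtain ⟨h4, h5, -⟩ := T'.isConvexPolytope_iff.1 hT'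
  exact T'.hasFDerivAt_totalScalarCurvature h4 h5

end GeodesicTriangulation
end GenPolytope

theorem mainTheorem4 {M : Type*} [MetricSpace M] {V : Finset M}
    (T : GenPolytope.GeodesicTriangulation M V) (r : V → ℝ) (hP : T.IsConvexPolytope r) :
    GenPolytope.curvature M V r = T.curvature r ∧
    GenPolytope.totalScalarCurvature M V r = T.totalScalarCurvature r ∧
    T.IsConvexPolyhedron (T.apexAngle r) (fun i => 1 / r i) ∧
    ∃ A : Matrix V V ℝ,
      (GenPolytope.HasHessianWithinAt (GenPolytope.totalScalarCurvature M V) A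
          (GenPolytope.polytopeSpace M V) r ∧
        GenPolytope.HasHessianWithinAt (T.vol (T.apexAngle r)) A Set.univ (fun i => 1 / r i)) ∧
      (GenPolytope.HasJacobianWithinAt (GenPolytope.curvature M V) A
          (GenPolytope.polytopeSpace M V) r ∧
        GenPolytope.HasJacobianWithinAt (T.faceArea (T.apexAngle r)) A Set.univ
          (fun i => 1 / r i)) := by
  obtain ⟨h1, h2, -⟩ := T.isConvexPolytope_iff.1 hP
  have hφ := T.apexAngle_glue r
  refine ⟨hP.curvature_eq, hP.totalScalarCurvature_eq, T.isConvexPolyhedron_dual hP,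
    T.areaJacobian (T.apexAngle r) (fun i => 1 / r i), ⟨⟨GenPolytope.curvature M V, ?_,
      hP.hasJacobianWithinAt_curvature⟩, ?_⟩, hP.hasJacobianWithinAt_curvature,
      T.hasJacobianWithinAt_faceArea hφ _⟩
  · rintro y ⟨T', hT'⟩
    exact hT'.hasFDerivWithinAt_totalScalarCurvature
  · exact T.hasHessianWithinAt_vol hφ (T.sin_apexAngle_pos h1 h2) (T.fanDet_apexAngle_pos h1 h2) _
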